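/- **Setting.** Let $T<\infty$, let $(\Omega,\mathcal F,\mathbb P)$ be a probability space with a filtration $\mathbb F=(\mathcal F_s)_{0\le s\le T}$ satisfying the usual conditions and an $\mathbb F$-Brownian motion $W$ on $[0,T]$. The market price started from $p>0$ at time $t$ is the geometric Brownian motion $dP_s=P_s(b\,ds+\sigma\,dW_s)$, i.e. $P_s=p\exp\big((b-\sigma^2/2)(s-t)+\sigma(W_s-W_t)\big)$, with $b\in\mathbb R$, $\sigma>0$. Let $f:\mathbb R\times[0,T]\to[0,\infty]$ be Borel with - $f(0,\theta)=1$ and $f(\cdot,\theta)$ nondecreasing for all $\theta\in[0,T]$; - $f(e,0)=0$ for $e<0$ and $f(e,0)=\infty$ for $e>0$; - $\sup_{e<0,\,\theta\in[0,T]}f(e,\theta)<1<\inf_{e>0,\,\theta\in[0,T]}f(e,\theta)$; - $f$ is continuous on $(\mathbb R\setminus\{0\})\times(0,T]$ and $C^1$ on $(-\infty,0)\times[0,T]$, with $\partial f/\partial\theta$ bounded on $(-\infty,0)\times[0,T]$. Let $U:[0,\infty)\to\mathbb R$ be nondecreasing and concave with $U(0)=0$ and $0\le U(x)\le Kx^\gamma$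 for all $x\ge0$, for some $K\ge0$, $\gamma\in[0,1)$. For $(z,\theta)=(x,y,p,\theta)\in\mathbb R\times[0,\infty)\times(0,\infty)\times[0,T]$ put $L(z,\theta)=x+yp\,f(-y,\theta)$. Let $\bar{\mathcal S}$ be the set of such $(z,\theta)$ with $L(z,\theta)\ge0$, and $\partial_L\mathcal S$ the set of those with $L(z,\theta)=0$. **Strategies.** A strategy $\alpha=(\tau_n,\zeta_n)_{n\ge1}$ consists of a finite or infinite nondecreasing sequence of stopping times $\tau_n\le T$ and of $\mathcal F_{\tau_n}$-measurable real trade sizes $\zeta_n$. Given $(t,z,\theta)\in[0,T]\times\bar{\mathcal S}$ with $z=(x,y,p)$, put $\tau_0=t-\theta$ and require $\tau_n\ge t$ for $n\ge1$. The state $(Z_s,\Theta_s)=(X_s,Y_s,P_s,\Theta_s)$ is given for $s\in[t,T]$ by $$Y_s=y+\sum_{n\ge1:\,\tau_n\le s}\zeta_n,\qquad X_s=x-\sum_{n\ge1:\,\tau_n\le s}\zeta_nP_{\tau_n}f(\zeta_n,\tau_n-\tau_{n-1}),\qquad \Theta_s=\inf\{s-\tau_n:\ n\ge0,\ \tau_n\le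 s\},$$ without any fixed transaction fee. The strategy is *admissible* if, almost surely, the cash never becomes $-\infty$ and the state belongs to $\bar{\mathcal S}$ after each trade (trades at the same time being performed one after the other) and at each time $s\in[t,T]$. Let $\mathcal A_\ell(t,z,\theta)$ be the set of admissible strategies with $Y_T=0$ a.s., and $$v(t,z,\theta)=\sup_{\alpha\in\mathcal A_\ell(t,z,\theta)}\mathbb E[U(X_T)]\in[0,\infty].$$ Let $\mathcal A^b_\ell(t,z,\theta)$ be the set of $\alpha\in\mathcal A_\ell(t,z,\theta)$ such that the number $N$ of trading times $\tau_n\le T$, $n\ge1$, is a.s. finite and $\tau_n<\tau_{n+1}$ a.s. for $0\le n\le N-1$. Let $\mathcal A^b_{\ell_+}(t,z,\theta)$ be the set of $\alpha\in\mathcal A^b_\ell(t,z,\theta)$ such that, a.s., $(Z_s,\Theta_s)\in\bar{\mathcal S}\setminus\partial_L\mathcal S$ for all $s\in[t,T)$. **Theorem.** (1) For all $(t,z,\theta)\in[0,T)\times\bar{\mathcal S}$, $$v(t,z,\theta)=\sup_{\alpha\in\mathcal A^b_\ell(t,z,\theta)}\mathbb E[U(X_T)].$$ (2) Assume moreover that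 $f(e,\theta)>0$ for all $e<0$ and $\theta\in(0,T]$. Then for all $(t,z,\theta)\in[0,T)\times(\bar{\mathcal S}\setminus\partial_L\mathcal S)$ with $\theta<T$, $$v(t,z,\theta)=\sup_{\alpha\in\mathcal A^b_{\ell_+}(t,z,\theta)}\mathbb E[U(X_T)].$$ -/

import Mathlib

open MeasureTheory ProbabilityTheory Set
open scoped NNReal ENNReal

noncomputable section

namespace Liquidation

/-- The data of the illiquid market, without any hypothesis on them: horizon `T`, drift `b`,
volatility `σ`, temporary price impact function `f`, utility `U`, probability measure `prob`,
filtration `F` and driving process `W`.  Only the values of `f` on `ℝ × [0,T]`, of `U` on `[0,∞)`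
and of `F`, `W` on `[0,T]` matter (a filtration on `[0,T]` is extended by `F s = F T`, `s ≥ T`). -/
structure Market (Ω : Type*) [MeasurableSpace Ω] where
  T : ℝ≥0
  b : ℝ
  σ : ℝ
  f : ℝ → ℝ → ℝ≥0∞
  U : ℝ → ℝ
  prob : Measure Ω
  F : Filtration ℝ≥0 (inferInstance : MeasurableSpace Ω)
  W : ℝ≥0 → Ω → ℝ

/-- A state `(z,θ) = (x,y,p,θ)`: cash, number of shares, market price, time since last trade. -/
structure State where
  cash : ℝ
  shares : ℝ
  price : ℝ
  lag : ℝ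

/-- The real time of a trading time; only used at finite trading times. -/
def clock (a : WithTop ℝ≥0) : ℝ≥0 := a.untopD 0

namespace Market

variable {Ω : Type*} [MeasurableSpace Ω] (M : Market Ω)

/-! ### Standing assumptions -/

/-- The usual conditions: the filtration is right-continuous and contains the null sets. -/
structure UsualConditions : Prop where
  rightCont : M.F.IsRightContinuous
  complete : ∀ A : Set Ω, M.prob A = 0 → MeasurableSet[M.F 0] A

/-- `W` is, on `[0,T]`, a one dimensional Brownian motion with respect to the filtration `F`. -/
structure IsBrownianMotion : Prop where
  start : ∀ᵐ ω ∂M.prob, M.W 0 ω = 0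
  adapted : ∀ s ≤ M.T, Measurable[M.F s] (M.W s)
  increments_law : ∀ s u : ℝ≥0, s ≤ u → u ≤ M.T →
    M.prob.map (fun ω => M.W u ω - M.W s ω) = gaussianReal 0 (u - s)
  increments_indep : ∀ s u : ℝ≥0, s ≤ u → u ≤ M.T →
    Indep (MeasurableSpace.comap (fun ω => M.W u ω - M.W s ω) inferInstance) (M.F s) M.prob
  continuous_paths : ∀ᵐ ω ∂M.prob, ContinuousOn (fun s => M.W s ω) (Icc 0 M.T)

/-- `f` is a Borel function on `ℝ × [0,T]`. -/
def BorelImpact : Prop :=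
  Measurable (fun q : ℝ × Icc (0 : ℝ) (M.T : ℝ) => M.f q.1 q.2)

/-- No trade has no impact, and the impact is nondecreasing in the order size. -/
structure H1f : Prop where
  zero : ∀ θ ∈ Icc (0 : ℝ) M.T, M.f 0 θ = 1
  mono : ∀ θ ∈ Icc (0 : ℝ) M.T, Monotone (fun e => M.f e θ)

/-- Immediate sales yield nothing and immediate purchases are infinitely expensive. -/
structure H2f : Prop where
  sale : ∀ e < 0, M.f e 0 = 0
  purchase : ∀ e > 0, M.f e 0 = ∞

/-- Bid-ask spread: `κ_b < 1 < κ_a`. -/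
structure H3f : Prop where
  bid : (⨆ e ∈ Iio (0 : ℝ), ⨆ θ ∈ Icc (0 : ℝ) M.T, M.f e θ) < 1
  ask : 1 < ⨅ e ∈ Ioi (0 : ℝ), ⨅ θ ∈ Icc (0 : ℝ) M.T, M.f e θ

/-- Regularity of the impact function (whose values are finite for `e < 0` as soon as the bid
spread is positive, so that `toReal` loses nothing there). -/
structure Hcf : Prop where
  cont : ContinuousOn (fun q : ℝ × ℝ => M.f q.1 q.2) ({0}ᶜ ×ˢ Ioc (0 : ℝ) M.T)
  smooth : ContDiffOn ℝ 1 (fun q : ℝ × ℝ => (M.f q.1 q.2).toReal) (Iio 0 ×ˢ Icc (0 : ℝ) M.T)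
  bounded : ∃ C : ℝ, ∀ e < 0, ∀ θ ∈ Icc (0 : ℝ) M.T,
    |derivWithin (fun θ' => (M.f e θ').toReal) (Icc (0 : ℝ) M.T) θ| ≤ C

/-- `U` is a utility function on `[0,∞)` with power growth of exponent `γ < 1`. -/
structure HU : Prop where
  mono : MonotoneOn M.U (Ici 0)
  concave : ConcaveOn ℝ (Ici 0) M.U
  zero : M.U 0 = 0
  growth : ∃ K γ : ℝ, 0 ≤ K ∧ 0 ≤ γ ∧ γ < 1 ∧ ∀ x, 0 ≤ x → 0 ≤ M.U x ∧ M.U x ≤ K * x ^ γ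

/-! ### Liquidation value and solvency region -/

/-- The liquidation function `L(x,y,p,θ) = x + y p f(-y,θ)`. -/
def liq (q : State) : ℝ := q.cash + q.shares * q.price * (M.f (-q.shares) q.lag).toReal

/-- The domain `ℝ × ℝ₊ × (0,∞) × [0,T]` of the liquidation function. -/
def domain : Set State :=
  {q | 0 ≤ q.shares ∧ 0 < q.price ∧ q.lag ∈ Icc (0 : ℝ) M.T}

/-- The solvency region `S`. -/
def region : Set State := {q | q ∈ M.domain ∧ 0 < q.shares ∧ 0 < M.liq q}

/-- The part `∂_y S` of the boundary. -/
def boundaryY : Set State :=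
  {q | q ∈ M.domain ∧ q.shares = 0 ∧ q.cash = M.liq q ∧ 0 ≤ M.liq q}

/-- The part `∂_L S` of the boundary. -/
def boundaryL : Set State := {q | q ∈ M.domain ∧ M.liq q = 0}

/-- The closed solvency region `S ∪ ∂_y S ∪ ∂_L S`. -/
def closedRegion : Set State := M.region ∪ (M.boundaryY ∪ M.boundaryL)

theorem mem_closedRegion_iff (q : State) :
    q ∈ M.closedRegion ↔ q ∈ M.domain ∧ 0 ≤ M.liq q := by
  constructor
  · rintro (⟨h, _, h'⟩ | ⟨h, _, _, h'⟩ | ⟨h, h'⟩)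
    · exact ⟨h, h'.le⟩
    · exact ⟨h, h'⟩
    · exact ⟨h, h'.ge⟩
  · rintro ⟨h, h'⟩
    rcases h'.eq_or_lt with h0 | h0
    · exact Or.inr (Or.inr ⟨h, h0.symm⟩)
    · rcases h.1.eq_or_lt with hy | hy
      · refine Or.inr (Or.inl ⟨h, hy.symm, ?_, h'⟩)
        simp [liq, ← hy]
      · exact Or.inl ⟨h, hy, h0⟩

/-! ### Trading strategies and controlled state process -/

/-- A trading strategy (impulse control), with a finite or infinite number of trades: `τ n` is the
time of the trade number `n + 1`, equal to `⊤` when there are at most `n` trades, and `ζ n` is its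
size (a purchase if positive, a sale if negative). -/
structure Strategy where
  τ : ℕ → Ω → WithTop ℝ≥0
  ζ : ℕ → Ω → ℝ
  stopping : ∀ n, IsStoppingTime M.F (τ n)
  mono : ∀ n ω, τ n ω ≤ τ (n + 1) ω
  horizon : ∀ n ω, τ n ω ≤ (M.T : WithTop ℝ≥0) ∨ τ n ω = ⊤
  size_measurable : ∀ n, Measurable[(stopping n).measurableSpace] (ζ n)

/-- Market price at time `s`: the geometric Brownian motion `dP = P (b ds + σ dW)` with value `p`
at time `t`. -/
def price (t : ℝ≥0) (p : ℝ) (s : ℝ≥0) (ω : Ω) : ℝ :=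
  p * Real.exp ((M.b - M.σ ^ 2 / 2) * ((s : ℝ) - t) + M.σ * (M.W s ω - M.W t ω))

namespace Strategy

variable {M} (α : M.Strategy) (t : ℝ≥0) (q : State)

/-- The trading time preceding the trade `τ n`; before the first one, it is `t - θ`. -/
def prevTime (ω : Ω) : ℕ → ℝ
  | 0 => (t : ℝ) - q.lag
  | n + 1 => (clock (α.τ n ω) : ℝ)

/-- The lag `Θ` just before the trade `τ n`, that is the time elapsed since the previous trade. -/
def lagBefore (n : ℕ) (ω : Ω) : ℝ := (clock (α.τ n ω) : ℝ) - α.prevTime t q ω n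

/-- The unit impact `f(ζ, Θ)` of the trade `τ n`. -/
def impact (n : ℕ) (ω : Ω) : ℝ≥0∞ := M.f (α.ζ n ω) (α.lagBefore t q n ω)

/-- The cash paid at the trade `τ n`: `ζ P f(ζ, Θ)`, when the impact is finite. -/
def cost (n : ℕ) (ω : Ω) : ℝ :=
  α.ζ n ω * M.price t q.price (clock (α.τ n ω)) ω * (α.impact t q n ω).toReal

/-- The state immediately after the trade `τ n` (trades at the same time being performed one after
the other). -/
def stateAfter (n : ℕ) (ω : Ω) : State where
  cash := q.cash - ∑ k ∈ Finset.range (n + 1), α.cost t q k ω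
  shares := q.shares + ∑ k ∈ Finset.range (n + 1), α.ζ k ω
  price := M.price t q.price (clock (α.τ n ω)) ω
  lag := 0

open Classical in
/-- The controlled state `(Z_s, Θ_s)` at time `s`, all trades of time at most `s` included.
The lag is `inf {s - τ_n : τ_n ≤ s}`, the initial time `t - θ` being one of the `τ_n`. -/
def state (s : ℝ≥0) (ω : Ω) : State where
  cash := q.cash - ∑' k, if α.τ k ω ≤ (s : WithTop ℝ≥0) then α.cost t q k ω else 0
  shares := q.shares + ∑' k, if α.τ k ω ≤ (s : WithTop ℝ≥0) then α.ζ k ω else 0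
  price := M.price t q.price s ω
  lag := sInf ({(s : ℝ) - ((t : ℝ) - q.lag)} ∪
    {d : ℝ | ∃ k, α.τ k ω ≤ (s : WithTop ℝ≥0) ∧ d = (s : ℝ) - clock (α.τ k ω)})

/-- Admissible strategies from the state `q` at time `t`: the trading times are not before `t`,
the cash never becomes `-∞` (no trade at an infinite price), and the state stays in the closed
solvency region, both after each trade and at each time of `[t,T]`. -/
def Admissible : Prop :=
  (∀ n ω, (t : WithTop ℝ≥0) ≤ α.τ n ω) ∧
  ∀ᵐ ω ∂M.prob,
    (∀ n, α.τ n ω ≤ (M.T : WithTop ℝ≥0) →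
      α.impact t q n ω ≠ ∞ ∧ α.stateAfter t q n ω ∈ M.closedRegion) ∧
    ∀ s : ℝ≥0, t ≤ s → s ≤ M.T → α.state t q s ω ∈ M.closedRegion

/-- Admissible strategies holding no share at the horizon. -/
def Liquidating : Prop :=
  α.Admissible t q ∧ ∀ᵐ ω ∂M.prob, (α.state t q M.T ω).shares = 0

/-- The number `N_s` of trades up to time `s`. -/
def tradeCount (s : ℝ≥0) (ω : Ω) : ℕ∞ := {k : ℕ | α.τ k ω ≤ (s : WithTop ℝ≥0)}.encard

/-- Liquidating strategies with almost surely finitely many trading times, which are almost surely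
strictly increasing (from the initial time `t - θ` of the last trade on). -/
def FiniteLiquidating : Prop :=
  α.Liquidating t q ∧ (∀ᵐ ω ∂M.prob, α.tradeCount M.T ω < ⊤) ∧
  ∀ᵐ ω ∂M.prob, ∀ n, α.τ n ω ≤ (M.T : WithTop ℝ≥0) →
    α.prevTime t q ω n < clock (α.τ n ω)

/-- Those among them that keep a positive liquidation value on `[t,T)`. -/
def PositiveFiniteLiquidating : Prop :=
  α.FiniteLiquidating t q ∧ ∀ᵐ ω ∂M.prob, ∀ s : ℝ≥0, t ≤ s → s < M.T →
    α.state t q s ω ∈ M.closedRegion \ M.boundaryL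

/-- The expected utility `E[U(X_T)]` of the terminal cash, in `[0,∞]`; it is only used for
liquidating strategies, for which `X_T ≥ 0` and `U(X_T) ≥ 0`. -/
def expectedUtility : ℝ≥0∞ :=
  ∫⁻ ω, ENNReal.ofReal (M.U (α.state t q M.T ω).cash) ∂M.prob

end Strategy

/-- The value function `v` of the liquidation problem. -/
def value (t : ℝ≥0) (q : State) : ℝ≥0∞ :=
  ⨆ α ∈ {α : M.Strategy | α.Liquidating t q}, α.expectedUtility t q

/-- The optimal expected utility over finite strictly increasing liquidating strategies. -/
def valueFinite (t : ℝ≥0) (q : State) : ℝ≥0∞ :=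
  ⨆ α ∈ {α : M.Strategy | α.FiniteLiquidating t q}, α.expectedUtility t q

/-- The same with a positive liquidation value before the horizon. -/
def valuePositive (t : ℝ≥0) (q : State) : ℝ≥0∞ :=
  ⨆ α ∈ {α : M.Strategy | α.PositiveFiniteLiquidating t q}, α.expectedUtility t q

end Market

end Liquidation

end

/-! ### Elementary facts, and criteria for a bounded strategy to be liquidating. -/

noncomputable section

namespace Liquidation

namespace Market

variable {Ω : Type*} [MeasurableSpace Ω] {M : Market Ω}

/-! First assertion: a liquidating strategy is approximated by finite ones. Along times `r n`
increasing to `T`, one keeps its first `n + 1` trades before `r n`, deletes those made at the same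
instant as the preceding trade, sells at `r n` the most profitable of finitely many fractions of the
position (`bestSale`), and sells the rest at `T`. Deletion is harmless: at zero lag a purchase is
impossible and a sale yields nothing, so the cash is unchanged and the shares can only increase. If
finitely many trades take place before `T`, only the trade at `T` has to be anticipated, which the
continuity of `f` permits. If there are infinitely many, the bid-ask spread bounds the volume
traded, hence the costs are summable (`summable_cost_of_spread`) and the cash converges. Fatou's
lemma and the concavity of `U` conclude (`Strategy.Liquidating.expectedUtility_le`).

Second assertion: it remains to turn such a finite strategy, coded as a valid `Schedule`, into one
of positive liquidation value, at a small loss. By monotonicity of `f`, scaling a trade by `l < 1`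
multiplies its cost by at most `l` (`scaled_cost`); when the initial cash is nonnegative, scaling
all the trades leaves positive cash after each of them (`Schedule.scale_compare`). A debt cannot be
scaled: the strategy may wait until its liquidation value vanishes, or repay the debt leaving
exactly nothing. Two events of `F t` are treated separately.

Where a trade takes place at `t`, it is postponed to a slightly later time at which the same sale
leaves more than `l` times as much cash. Such times exist because the Brownian oscillations, of
order `√s`, beat the drift and the effect of the lag, of order `s`
(`ContVersion.frequently_cash_gt`). The later trades are scaled down.

Where no trade takes place at `t`, with large probability none takes place before some `u > t`
either. The law of the price at `u` is almost unchanged, in total variation, when the price is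
multiplied by `1 + ε` (`exists_gaussian_shift`). With the higher price, the strategy can be imitated
on a grid, with finitely many order sizes, from a cash lowered by `δ`
(`Schedule.eventually_shadow`). The dynamic programming value of this discretized model at the true
price is therefore almost as large. An optimal policy of the model, played with the true cash,
always holds `δ` more than the model, hence positive cash (`Follow.exists_positive`). A watch sells
everything if the liquidation value falls to `δ / 2` before the first trade; on a fine grid this
rarely spoils a successful path of the model (`Follow.idle_nonneg`). The two constructions are glued
together, and the scaling and the truncation of the utility are removed
(`Schedule.payoff_le_of_scaled`). -/

theorem price_pos {p : ℝ} (hp : 0 < p) (t s : ℝ≥0) (ω : Ω) : 0 < M.price t p s ω :=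
  mul_pos hp (Real.exp_pos _)

theorem impact_le_one_of_nonpos (h1 : M.H1f) {e θ : ℝ} (he : e ≤ 0) (hθ : θ ∈ Icc (0 : ℝ) M.T) :
    M.f e θ ≤ 1 :=
  (h1.mono θ hθ he).trans_eq (h1.zero θ hθ)

theorem one_le_impact_of_nonneg (h1 : M.H1f) {e θ : ℝ} (he : 0 ≤ e) (hθ : θ ∈ Icc (0 : ℝ) M.T) :
    1 ≤ M.f e θ :=
  (h1.zero θ hθ).symm.le.trans (h1.mono θ hθ he)

theorem cash_le_liq {r : State} (hy : 0 ≤ r.shares) (hp : 0 < r.price) : r.cash ≤ M.liq r := by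
  have : 0 ≤ r.shares * r.price * (M.f (-r.shares) r.lag).toReal := by positivity
  unfold liq
  linarith

theorem mem_closedRegion_of_cash_nonneg {r : State} (hx : 0 ≤ r.cash) (hy : 0 ≤ r.shares)
    (hp : 0 < r.price) (hl : r.lag ∈ Icc (0 : ℝ) M.T) : r ∈ M.closedRegion :=
  (M.mem_closedRegion_iff r).2 ⟨⟨hy, hp, hl⟩, hx.trans (cash_le_liq hy hp)⟩

/-- Just after a trade a sale yields nothing, so solvency after a trade amounts to nonnegative cash.
-/
theorem liq_of_lag_zero (h2 : M.H2f) {r : State} (hy : 0 ≤ r.shares)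
    (hl : r.lag = 0) : M.liq r = r.cash := by
  rcases hy.eq_or_lt with hy | hy
  · simp [liq, ← hy]
  · simp [liq, hl, h2.sale (-r.shares) (by linarith)]

namespace Strategy

variable (α : M.Strategy) (t : ℝ≥0) (q : State)

theorem monotone_τ (ω : Ω) : Monotone (fun n => α.τ n ω) :=
  monotone_nat_of_le_succ (fun n => α.mono n ω)

variable {α t q}

theorem state_cash_eq {s : ℝ≥0} {ω : Ω} {J : ℕ} (h : ∀ k, α.τ k ω ≤ (s : WithTop ℝ≥0) ↔ k < J) :
    (α.state t q s ω).cash = q.cash - ∑ k ∈ Finset.range J, α.cost t q k ω := by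
  simp only [state]
  rw [tsum_eq_sum (s := Finset.range J)]
  · congr 1
    refine Finset.sum_congr rfl fun k hk => ?_
    rw [if_pos ((h k).2 (Finset.mem_range.1 hk))]
  · intro k hk
    rw [if_neg]
    rw [h k]
    simpa using hk

theorem state_shares_eq {s : ℝ≥0} {ω : Ω} {J : ℕ} (h : ∀ k, α.τ k ω ≤ (s : WithTop ℝ≥0) ↔ k < J) :
    (α.state t q s ω).shares = q.shares + ∑ k ∈ Finset.range J, α.ζ k ω := by
  simp only [state]
  rw [tsum_eq_sum (s := Finset.range J)]
  · congr 1
    refine Finset.sum_congr rfl fun k hk => ?_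
    rw [if_pos ((h k).2 (Finset.mem_range.1 hk))]
  · intro k hk
    rw [if_neg]
    rw [h k]
    simpa using hk

/-- Trading times are nondecreasing, so the trades made by time `s` have for indices an initial
segment, finite because some trade never takes place. This turns the infinite sums of `state` into
finite ones. -/
theorem exists_trade_count {ω : Ω} {n : ℕ} (hn : α.τ n ω = ⊤) (s : ℝ≥0) :
    ∃ J, ∀ k, α.τ k ω ≤ (s : WithTop ℝ≥0) ↔ k < J := by
  obtain ⟨J, hJ, hmin⟩ := WellFounded.has_min (r := (· < ·)) wellFounded_lt
    {J | ¬ α.τ J ω ≤ (s : WithTop ℝ≥0)}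
    ⟨n, by rw [mem_ofPred_eq, hn]; exact WithTop.not_top_le_coe s⟩
  refine ⟨J, fun k => ⟨fun hk => ?_, fun hk => not_not.1 fun h => hmin k h hk⟩⟩
  by_contra! hlt
  exact hJ (le_trans (α.monotone_τ ω hlt) hk)

theorem clock_le {a : WithTop ℝ≥0} {s : ℝ≥0} (h : a ≤ (s : WithTop ℝ≥0)) : clock a ≤ s := by
  induction a with
  | top => exact absurd h (WithTop.not_top_le_coe s)
  | coe a => exact WithTop.coe_le_coe.1 h

theorem le_clock {a : WithTop ℝ≥0} {s : ℝ≥0} (h' : a ≠ ⊤) (h : (s : WithTop ℝ≥0) ≤ a) :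
    s ≤ clock a := by
  induction a with
  | top => simp at h'
  | coe a => exact WithTop.coe_le_coe.1 h

theorem coe_clock {a : WithTop ℝ≥0} (h' : a ≠ ⊤) : ((clock a : ℝ≥0) : WithTop ℝ≥0) = a := by
  induction a with
  | top => simp at h'
  | coe a => rfl

theorem state_lag_of_no_trade {s : ℝ≥0} {ω : Ω} (h : ∀ k, ¬ α.τ k ω ≤ (s : WithTop ℝ≥0)) :
    (α.state t q s ω).lag = (s : ℝ) - ((t : ℝ) - q.lag) := by
  have : {d : ℝ | ∃ k, α.τ k ω ≤ (s : WithTop ℝ≥0) ∧ d = (s : ℝ) - clock (α.τ k ω)} = ∅ :=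
    eq_empty_of_forall_notMem fun d ⟨k, hk, _⟩ => h k hk
  simp only [state, this, union_empty, csInf_singleton]

/-- Once a trade has been made the lag is at most `s - τ k ≤ T`: the bound on the lag constrains a
strategy only before its first trade. -/
theorem state_lag_mem {s : ℝ≥0} {ω : Ω} {k : ℕ} (hk : α.τ k ω ≤ (s : WithTop ℝ≥0))
    (hs : s ≤ M.T) (hts : t ≤ s) (hq : 0 ≤ q.lag) :
    (α.state t q s ω).lag ∈ Icc (0 : ℝ) M.T := by
  have hs' : (t : ℝ) ≤ s := by exact_mod_cast hts
  have hlb : ∀ d ∈ ({(s : ℝ) - ((t : ℝ) - q.lag)} ∪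
      {d : ℝ | ∃ k, α.τ k ω ≤ (s : WithTop ℝ≥0) ∧ d = (s : ℝ) - clock (α.τ k ω)} : Set ℝ), 0 ≤ d := by
    rintro d (rfl | ⟨j, hj, rfl⟩)
    · linarith
    · have : (clock (α.τ j ω) : ℝ) ≤ s := by exact_mod_cast clock_le hj
      linarith
  refine ⟨Real.sInf_nonneg hlb, ?_⟩
  refine (csInf_le ⟨0, hlb⟩ (Or.inr ⟨k, hk, rfl⟩)).trans ?_
  have h1 : (0 : ℝ) ≤ clock (α.τ k ω) := NNReal.coe_nonneg _
  have h2 : (s : ℝ) ≤ M.T := by exact_mod_cast hs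
  linarith

/-- A strategy with at most `n` trades, whose trading times increase strictly and which keeps
nonnegative cash and shares after each trade, is a finite liquidating strategy. -/
theorem finiteLiquidating_of_bounded {n : ℕ} (hq : q ∈ M.domain) (hfrom : ∀ k ω, (t : WithTop ℝ≥0) ≤ α.τ k ω)
    (hn : ∀ k ω, n ≤ k → α.τ k ω = ⊤)
    (hstrict : ∀ k ω, α.τ k ω ≠ ⊤ → α.prevTime t q ω k < clock (α.τ k ω))
    (htrade : ∀ᵐ ω ∂M.prob, ∀ k, α.τ k ω ≠ ⊤ → α.impact t q k ω ≠ ∞ ∧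
      0 ≤ q.cash - ∑ i ∈ Finset.range (k + 1), α.cost t q i ω ∧
      0 ≤ q.shares + ∑ i ∈ Finset.range (k + 1), α.ζ i ω)
    (hpre : ∀ᵐ ω ∂M.prob, ∀ s : ℝ≥0, t ≤ s → s ≤ M.T → (∀ k, ¬ α.τ k ω ≤ (s : WithTop ℝ≥0)) →
      (⟨q.cash, q.shares, M.price t q.price s ω, s - (t - q.lag)⟩ : State) ∈ M.closedRegion)
    (hend : ∀ᵐ ω ∂M.prob, (α.state t q M.T ω).shares = 0) : α.FiniteLiquidating t q := by
  have hT0 : (0 : ℝ) ∈ Icc (0 : ℝ) M.T := ⟨le_rfl, NNReal.coe_nonneg _⟩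
  refine ⟨⟨⟨fun k ω => hfrom k ω, ?_⟩, hend⟩, ?_, ?_⟩
  · filter_upwards [htrade, hpre] with ω h1 h2
    refine ⟨fun k hk => ?_, fun s hts hsT => ?_⟩
    · have hk' : α.τ k ω ≠ ⊤ := ne_top_of_le_ne_top WithTop.coe_ne_top hk
      obtain ⟨ha, hb, hc⟩ := h1 k hk'
      exact ⟨ha, mem_closedRegion_of_cash_nonneg hb hc (price_pos hq.2.1 _ _ _) hT0⟩
    -- Before the first trade the cash may be negative and solvency is the assumption `hpre`;
    -- afterwards the holdings are those following the last trade, and nonnegative cash suffices.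
    · by_cases hno : ∀ k, ¬ α.τ k ω ≤ (s : WithTop ℝ≥0)
      · have h0 : ∀ k, α.τ k ω ≤ (s : WithTop ℝ≥0) ↔ k < 0 := fun k => ⟨fun h => absurd h (hno k), fun h => absurd h (Nat.not_lt_zero k)⟩
        have hst := h2 s hts hsT hno
        have : α.state t q s ω = ⟨q.cash, q.shares, M.price t q.price s ω, s - (t - q.lag)⟩ := by
          have e1 := state_cash_eq (t := t) (q := q) h0
          have e2 := state_shares_eq (t := t) (q := q) h0
          have e3 := state_lag_of_no_trade (t := t) (q := q) hno
          have e4 : (α.state t q s ω).price = M.price t q.price s ω := rfl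
          simp only [Finset.range_zero, Finset.sum_empty, sub_zero, add_zero] at e1 e2
          rw [← e1, ← e2, ← e3, ← e4]
        rwa [this]
      · push Not at hno
        obtain ⟨k₀, hk₀⟩ := hno
        obtain ⟨J, hJ⟩ := exists_trade_count (hn n ω le_rfl) s
        have hk₀J := (hJ k₀).1 hk₀
        obtain ⟨i, rfl⟩ : ∃ i, J = i + 1 := ⟨J - 1, by omega⟩
        have hi := (hJ i).2 (by omega)
        obtain ⟨-, hb, hc⟩ := h1 i (ne_top_of_le_ne_top WithTop.coe_ne_top hi)
        refine mem_closedRegion_of_cash_nonneg ?_ ?_ (price_pos hq.2.1 _ _ _)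
          (state_lag_mem hi hsT hts hq.2.2.1)
        · rw [state_cash_eq hJ]; exact hb
        · rw [state_shares_eq hJ]; exact hc
  · refine Filter.Eventually.of_forall fun ω => ?_
    have : {k : ℕ | α.τ k ω ≤ (M.T : WithTop ℝ≥0)} ⊆ Iio n := by
      intro k hk
      by_contra hlt
      have := hn k ω (by simpa using hlt)
      rw [mem_ofPred_eq, this] at hk
      exact WithTop.not_top_le_coe _ hk
    exact (encard_le_encard this).trans_lt (Set.finite_Iio n).encard_lt_top
  · exact Filter.Eventually.of_forall fun ω k hk =>
      hstrict k ω (ne_top_of_le_ne_top WithTop.coe_ne_top hk)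

/-- Such a strategy keeps a positive liquidation value as soon as the cash is positive after each
trade before the horizon and the liquidation value is positive before the first trade. -/
theorem positiveFiniteLiquidating_of_bounded {n : ℕ}
    (hα : α.FiniteLiquidating t q)
    (hn : ∀ k ω, n ≤ k → α.τ k ω = ⊤)
    (htrade : ∀ᵐ ω ∂M.prob, ∀ k, α.τ k ω < (M.T : WithTop ℝ≥0) →
      0 < q.cash - ∑ i ∈ Finset.range (k + 1), α.cost t q i ω)
    (hpre : ∀ᵐ ω ∂M.prob, ∀ s : ℝ≥0, t ≤ s → s < M.T → (∀ k, ¬ α.τ k ω ≤ (s : WithTop ℝ≥0)) →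
      0 < M.liq ⟨q.cash, q.shares, M.price t q.price s ω, s - (t - q.lag)⟩) :
    α.PositiveFiniteLiquidating t q := by
  refine ⟨hα, ?_⟩
  filter_upwards [htrade, hpre, hα.1.1.2] with ω h1 h2 h3 s hts hsT
  refine ⟨h3.2 s hts hsT.le, fun hb => ?_⟩
  suffices 0 < M.liq (α.state t q s ω) from this.ne' hb.2
  by_cases hno : ∀ k, ¬ α.τ k ω ≤ (s : WithTop ℝ≥0)
  · have h0 : ∀ k, α.τ k ω ≤ (s : WithTop ℝ≥0) ↔ k < 0 := fun k => ⟨fun h => absurd h (hno k), fun h => absurd h (Nat.not_lt_zero k)⟩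
    have hst := h2 s hts hsT hno
    have : α.state t q s ω = ⟨q.cash, q.shares, M.price t q.price s ω, s - (t - q.lag)⟩ := by
      have e1 := state_cash_eq (t := t) (q := q) h0
      have e2 := state_shares_eq (t := t) (q := q) h0
      have e3 := state_lag_of_no_trade (t := t) (q := q) hno
      have e4 : (α.state t q s ω).price = M.price t q.price s ω := rfl
      simp only [Finset.range_zero, Finset.sum_empty, sub_zero, add_zero] at e1 e2
      rw [← e1, ← e2, ← e3, ← e4]
    rwa [this]
  · push Not at hno
    obtain ⟨k₀, hk₀⟩ := hno
    obtain ⟨J, hJ⟩ := exists_trade_count (hn n ω le_rfl) s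
    have hk₀J := (hJ k₀).1 hk₀
    obtain ⟨i, rfl⟩ : ∃ i, J = i + 1 := ⟨J - 1, by omega⟩
    have hi := (hJ i).2 (by omega)
    have hc := h1 i (hi.trans_lt (by exact_mod_cast hsT))
    have hd := ((M.mem_closedRegion_iff _).1 (h3.2 s hts hsT.le)).1
    refine lt_of_lt_of_le ?_ (cash_le_liq hd.1 hd.2.1)
    rw [state_cash_eq hJ]
    exact hc

end Strategy

end Market

end Liquidation

/-! ### Schedules: finite lists of trades, some of them skipped, and their compression into
strategies. -/

namespace Liquidation

namespace Market

variable {Ω : Type*} [MeasurableSpace Ω] {M : Market Ω}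

/-- Measurability of `ξ` with respect to the σ-algebra of events prior to `ρ`. -/
def StopMeas (M : Market Ω) (ρ : Ω → WithTop ℝ≥0) (ξ : Ω → ℝ) : Prop :=
  ∀ A : Set ℝ, MeasurableSet A → MeasurableSet[⨆ s, M.F s] (ξ ⁻¹' A) ∧
    ∀ s : ℝ≥0, MeasurableSet[M.F s] (ξ ⁻¹' A ∩ {ω | ρ ω ≤ (s : WithTop ℝ≥0)})

/-- `StopMeas` is membership in the stopped σ-algebra written out, so that it makes sense without a
proof that `ρ` is a stopping time. -/
theorem stopMeas_of_measurable {ρ : Ω → WithTop ℝ≥0} (hρ : IsStoppingTime M.F ρ) {ξ : Ω → ℝ}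
    (h : Measurable[hρ.measurableSpace] ξ) : StopMeas M ρ ξ := fun _ hA => h hA

theorem StopMeas.measurable {ρ : Ω → WithTop ℝ≥0} (hρ : IsStoppingTime M.F ρ) {ξ : Ω → ℝ}
    (h : StopMeas M ρ ξ) : Measurable[hρ.measurableSpace] ξ := fun _ hA => h _ hA

theorem stopMeas_const {r : ℝ≥0} {ξ : Ω → ℝ} (h : Measurable[M.F r] ξ) :
    StopMeas M (fun _ => (r : WithTop ℝ≥0)) ξ := by
  refine stopMeas_of_measurable (isStoppingTime_const M.F r) ?_
  rwa [IsStoppingTime.measurableSpace_const]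

theorem StopMeas.measurable_ite {ρ : Ω → WithTop ℝ≥0} (hρ : IsStoppingTime M.F ρ) {ξ : Ω → ℝ}
    (h : StopMeas M ρ ξ) (s : ℝ≥0) [∀ ω, Decidable (ρ ω ≤ (s : WithTop ℝ≥0))] :
    Measurable[M.F s] (fun ω => if ρ ω ≤ (s : WithTop ℝ≥0) then ξ ω else 0) := by
  intro A hA
  have : (fun ω => if ρ ω ≤ (s : WithTop ℝ≥0) then ξ ω else 0) ⁻¹' A =
      (ξ ⁻¹' A ∩ {ω | ρ ω ≤ (s : WithTop ℝ≥0)}) ∪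
        ({ω | ρ ω ≤ (s : WithTop ℝ≥0)}ᶜ ∩ (fun _ => (0 : ℝ)) ⁻¹' A) := by
    ext ω
    simp only [mem_preimage, mem_union, mem_inter_iff, mem_compl_iff, mem_ofPred_eq]
    by_cases hω : ρ ω ≤ (s : WithTop ℝ≥0)
    · rw [if_pos hω]; tauto
    · rw [if_neg hω]; tauto
  rw [this]
  exact ((h A hA).2 s).union ((hρ s).compl.inter (@measurable_const _ _ _ (M.F s) 0 A hA))

/-- A finite list of trades, some of which may be skipped (trading time `⊤`), with strictly
increasing trading times. -/
structure Schedule (M : Market Ω) (t : ℝ≥0) (q : State) where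
  n : ℕ
  ρ : ℕ → Ω → WithTop ℝ≥0
  ξ : ℕ → Ω → ℝ
  stopping : ∀ k, IsStoppingTime M.F (ρ k)
  size_meas : ∀ k, StopMeas M (ρ k) (ξ k)
  start : ∀ k ω, (t : WithTop ℝ≥0) ≤ ρ k ω
  horizon : ∀ k ω, ρ k ω ≤ (M.T : WithTop ℝ≥0) ∨ ρ k ω = ⊤
  bounded : ∀ k ω, n ≤ k → ρ k ω = ⊤
  strict : ∀ i k ω, i < k → ρ i ω ≠ ⊤ → ρ k ω ≠ ⊤ → ρ i ω < ρ k ω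
  first : ∀ k ω, ρ k ω ≠ ⊤ → (t : ℝ) - q.lag < clock (ρ k ω)

namespace Schedule

variable {t : ℝ≥0} {q : State} (S : M.Schedule t q)

open Classical in
/-- The time of the last trade before the trade number `k`. -/
def lastTime (ω : Ω) : ℕ → ℝ
  | 0 => (t : ℝ) - q.lag
  | k + 1 => if S.ρ k ω ≠ ⊤ then (clock (S.ρ k ω) : ℝ) else lastTime ω k

def impact (k : ℕ) (ω : Ω) : ℝ≥0∞ := M.f (S.ξ k ω) (clock (S.ρ k ω) - S.lastTime ω k)

def cost (k : ℕ) (ω : Ω) : ℝ :=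
  S.ξ k ω * M.price t q.price (clock (S.ρ k ω)) ω * (S.impact k ω).toReal

open Classical in
/-- The cash before the trade number `k`. -/
def cashAt (k : ℕ) (ω : Ω) : ℝ :=
  q.cash - ∑ i ∈ Finset.range k, if S.ρ i ω ≠ ⊤ then S.cost i ω else 0

open Classical in
/-- The number of shares before the trade number `k`. -/
def sharesAt (k : ℕ) (ω : Ω) : ℝ :=
  q.shares + ∑ i ∈ Finset.range k, if S.ρ i ω ≠ ⊤ then S.ξ i ω else 0

open Classical in
/-- The number of trades actually performed before the trade number `k`. -/
def performed (k : ℕ) (ω : Ω) : ℕ := ∑ i ∈ Finset.range k, if S.ρ i ω ≠ ⊤ then 1 else 0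

variable {S}

theorem performed_succ_of_ne {k : ℕ} {ω : Ω} (h : S.ρ k ω ≠ ⊤) :
    S.performed (k + 1) ω = S.performed k ω + 1 := by
  rw [performed, Finset.sum_range_succ, if_pos h, performed]

theorem performed_succ_of_eq {k : ℕ} {ω : Ω} (h : S.ρ k ω = ⊤) :
    S.performed (k + 1) ω = S.performed k ω := by
  rw [performed, Finset.sum_range_succ, if_neg (not_not.2 h), performed, add_zero]

theorem performed_mono (ω : Ω) : Monotone (fun k => S.performed k ω) := by
  refine monotone_nat_of_le_succ fun k => ?_
  by_cases h : S.ρ k ω = ⊤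
  · exact (performed_succ_of_eq h).ge
  · simp only [performed_succ_of_ne h, Nat.le_succ]

/-- `performed` grows by at most one at each index, and only at performed trades, so it takes every
intermediate value at one of them. -/
theorem exists_performed {ω : Ω} {j N : ℕ} (h : j < S.performed N ω) :
    ∃ k < N, S.ρ k ω ≠ ⊤ ∧ S.performed k ω = j := by
  induction N with
  | zero => simp [performed] at h
  | succ N ih =>
    by_cases hN : S.ρ N ω = ⊤
    · rw [performed_succ_of_eq hN] at h
      obtain ⟨k, hk, h'⟩ := ih h
      exact ⟨k, hk.trans N.lt_succ_self, h'⟩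
    · rw [performed_succ_of_ne hN] at h
      rcases (Nat.lt_succ_iff.1 h).lt_or_eq with h | h
      · obtain ⟨k, hk, h'⟩ := ih h
        exact ⟨k, hk.trans N.lt_succ_self, h'⟩
      · exact ⟨N, N.lt_succ_self, hN, h.symm⟩

theorem performed_injOn {ω : Ω} {k k' : ℕ} (hk : S.ρ k ω ≠ ⊤) (hk' : S.ρ k' ω ≠ ⊤)
    (h : S.performed k ω = S.performed k' ω) : k = k' := by
  by_contra hne
  rcases lt_or_gt_of_ne hne with hlt | hlt
  · have := performed_mono (S := S) ω (Nat.succ_le_of_lt hlt)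
    simp only [Nat.succ_eq_add_one, performed_succ_of_ne hk] at this
    omega
  · have := performed_mono (S := S) ω (Nat.succ_le_of_lt hlt)
    simp only [Nat.succ_eq_add_one, performed_succ_of_ne hk'] at this
    omega

variable (S)

open Classical in
/-- The number of the trade performed after exactly `j` other ones. -/
def sel (j : ℕ) (ω : Ω) : ℕ :=
  if h : ∃ k, S.ρ k ω ≠ ⊤ ∧ S.performed k ω = j then h.choose else S.n

variable {S}

theorem sel_performed {k : ℕ} {ω : Ω} (hk : S.ρ k ω ≠ ⊤) : S.sel (S.performed k ω) ω = k := by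
  have h : ∃ k', S.ρ k' ω ≠ ⊤ ∧ S.performed k' ω = S.performed k ω := ⟨k, hk, rfl⟩
  rw [sel, dif_pos h]
  exact performed_injOn h.choose_spec.1 hk h.choose_spec.2

theorem sel_spec {j : ℕ} {ω : Ω} (h : S.ρ (S.sel j ω) ω ≠ ⊤) : S.performed (S.sel j ω) ω = j := by
  by_cases h' : ∃ k, S.ρ k ω ≠ ⊤ ∧ S.performed k ω = j
  · obtain ⟨k, hk, rfl⟩ := h'
    rw [sel_performed hk]
  · exfalso
    rw [sel, dif_neg h'] at h
    exact h (S.bounded _ _ le_rfl)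

/-- The trade `sel j` is preceded by `j` performed trades, one of which has rank `k`; the strict
order of the trading times passes to the ranks. -/
theorem le_of_sel {j k : ℕ} {ω : Ω} (h : S.ρ (S.sel j ω) ω ≠ ⊤) (hk : k < j) :
    S.ρ (S.sel k ω) ω < S.ρ (S.sel j ω) ω ∧ S.ρ (S.sel k ω) ω ≠ ⊤ := by
  have h1 := sel_spec h
  obtain ⟨i, hi, hi', hi''⟩ := exists_performed (S := S) (ω := ω) (j := k) (N := S.sel j ω)
    (by omega)
  have := sel_performed hi'
  rw [hi''] at this
  rw [this]
  exact ⟨S.strict _ _ _ hi hi' h, hi'⟩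

theorem sum_performed {G : ℕ → ℝ} {ω : Ω} [∀ i, Decidable (S.ρ i ω ≠ ⊤)] (k : ℕ) :
    ∑ j ∈ Finset.range (S.performed k ω), G (S.sel j ω) =
      ∑ i ∈ Finset.range k, if S.ρ i ω ≠ ⊤ then G i else 0 := by
  induction k with
  | zero => simp [performed]
  | succ k ih =>
    rw [Finset.sum_range_succ (fun i => if S.ρ i ω ≠ ⊤ then G i else 0)]
    by_cases hk : S.ρ k ω = ⊤
    · rw [performed_succ_of_eq hk, ih, if_neg (not_not.2 hk), add_zero]
    · rw [performed_succ_of_ne hk, Finset.sum_range_succ, ih, if_pos hk, sel_performed hk]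

/-- The performed trades preceding a trade made by time `s` are also made by time `s`. Its rank can
thus be found by counting trades up to `s`, which is an `F s`-measurable operation; this is what
makes the compressed strategy adapted. -/
theorem sel_le_iff {j : ℕ} {s : ℝ≥0} {ω : Ω} {P : ℕ → Prop} [∀ i, Decidable (S.ρ i ω ≤ (s : WithTop ℝ≥0))] :
    (P (S.sel j ω) ∧ S.ρ (S.sel j ω) ω ≤ (s : WithTop ℝ≥0)) ↔ ∃ k, P k ∧ S.ρ k ω ≤ (s : WithTop ℝ≥0) ∧
      (∑ i ∈ Finset.range k, if S.ρ i ω ≤ (s : WithTop ℝ≥0) then 1 else 0) = j := by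
  have key : ∀ k, S.ρ k ω ≤ (s : WithTop ℝ≥0) →
      (∑ i ∈ Finset.range k, if S.ρ i ω ≤ (s : WithTop ℝ≥0) then 1 else 0) = S.performed k ω := by
    intro k hk
    refine Finset.sum_congr rfl fun i hi => ?_
    have hk' := ne_top_of_le_ne_top WithTop.coe_ne_top hk
    have : S.ρ i ω ≤ (s : WithTop ℝ≥0) ↔ S.ρ i ω ≠ ⊤ := by
      refine ⟨fun h => ne_top_of_le_ne_top WithTop.coe_ne_top h, fun h => ?_⟩
      exact (S.strict _ _ _ (Finset.mem_range.1 hi) h hk').le.trans hk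
    simp only [this]
  constructor
  · rintro ⟨hP, h⟩
    exact ⟨_, hP, h, by rw [key _ h, sel_spec (ne_top_of_le_ne_top WithTop.coe_ne_top h)]⟩
  · rintro ⟨k, hP, h, hk⟩
    rw [key _ h] at hk
    have := sel_performed (ne_top_of_le_ne_top WithTop.coe_ne_top h)
    rw [hk] at this
    rw [this]
    exact ⟨hP, h⟩

theorem measurableSet_count (s : ℝ≥0) (k j : ℕ) [∀ ω i, Decidable (S.ρ i ω ≤ (s : WithTop ℝ≥0))] :
    MeasurableSet[M.F s] {ω | (∑ i ∈ Finset.range k,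
      if S.ρ i ω ≤ (s : WithTop ℝ≥0) then 1 else 0) = j} := by
  have : Measurable[M.F s] (fun ω => ∑ i ∈ Finset.range k,
      if S.ρ i ω ≤ (s : WithTop ℝ≥0) then 1 else 0) := by
    refine @Finset.measurable_sum _ _ _ _ _ _ (M.F s) _ _ fun i _ => ?_
    exact Measurable.ite (S.stopping i s) measurable_const measurable_const
  exact this (measurableSet_singleton j)

theorem measurableSet_performed (k j : ℕ) :
    MeasurableSet[⨆ s, M.F s] {ω | S.performed k ω = j} := by
  have : Measurable[⨆ s, M.F s] (fun ω => S.performed k ω) := by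
    refine @Finset.measurable_sum _ _ _ _ _ _ (⨆ s, M.F s) _ _ fun i _ => ?_
    exact Measurable.ite (S.stopping i).measurableSet_eq_top'.compl measurable_const
      measurable_const
  exact this (measurableSet_singleton j)

variable (S)

/-- The trading strategy performing the trades of the schedule that are not skipped. -/
def compress : M.Strategy where
  τ j ω := S.ρ (S.sel j ω) ω
  ζ j ω := S.ξ (S.sel j ω) ω
  stopping j s := by
    classical
    have : {ω | S.ρ (S.sel j ω) ω ≤ (s : WithTop ℝ≥0)} = ⋃ k, {ω | S.ρ k ω ≤ (s : WithTop ℝ≥0)} ∩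
        {ω | (∑ i ∈ Finset.range k, if S.ρ i ω ≤ (s : WithTop ℝ≥0) then 1 else 0) = j} := by
      ext ω
      have := sel_le_iff (S := S) (j := j) (s := s) (ω := ω) (P := fun _ => True)
      simp only [true_and] at this
      simp only [mem_ofPred_eq, mem_iUnion, mem_inter_iff]
      exact this
    rw [this]
    exact MeasurableSet.iUnion fun k => (S.stopping k s).inter (measurableSet_count s k j)
  mono j ω := by
    by_cases h : S.ρ (S.sel (j + 1) ω) ω = ⊤
    · rw [h]; exact le_top
    · exact (le_of_sel h j.lt_succ_self).1.le
  horizon j ω := S.horizon _ _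
  size_measurable j := by
    classical
    intro A hA
    refine ⟨?_, fun s => ?_⟩
    -- Where there is no trade of rank `j`, `sel` has the default value `S.n`, whose trading time is
    -- `⊤`; the size read there plays no role but must be measurable.
    · have : (fun ω => S.ξ (S.sel j ω) ω) ⁻¹' A =
          (⋃ k, S.ξ k ⁻¹' A ∩ ({ω | S.ρ k ω = ⊤}ᶜ ∩ {ω | S.performed k ω = j})) ∪
          ((⋃ k, {ω | S.ρ k ω = ⊤}ᶜ ∩ {ω | S.performed k ω = j})ᶜ ∩ S.ξ S.n ⁻¹' A) := by
        ext ω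
        simp only [mem_preimage, mem_union, mem_iUnion, mem_inter_iff, mem_compl_iff, mem_ofPred_eq]
        by_cases h : ∃ k, ¬ S.ρ k ω = ⊤ ∧ S.performed k ω = j
        · obtain ⟨k, hk, rfl⟩ := h
          rw [sel_performed hk]
          constructor
          · intro h
            exact Or.inl ⟨k, h, hk, rfl⟩
          · rintro (⟨k', h1, h2, h3⟩ | ⟨h, -⟩)
            · rwa [← performed_injOn h2 hk h3]
            · exact absurd ⟨k, hk, rfl⟩ h
        · have : S.sel j ω = S.n := by rw [sel, dif_neg h]
          rw [this]
          constructor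
          · intro h'
            exact Or.inr ⟨h, h'⟩
          · rintro (⟨k', h1, h2⟩ | ⟨-, h'⟩)
            · exact absurd ⟨k', h2⟩ h
            · exact h'
      rw [this]
      have h1 : ∀ k, MeasurableSet[⨆ s, M.F s] ({ω | S.ρ k ω = ⊤}ᶜ ∩ {ω | S.performed k ω = j}) :=
        fun k => (S.stopping k).measurableSet_eq_top'.compl.inter (measurableSet_performed k j)
      exact (MeasurableSet.iUnion fun k => (S.size_meas k A hA).1.inter (h1 k)).union
        ((MeasurableSet.iUnion h1).compl.inter (S.size_meas _ A hA).1)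
    · have : (fun ω => S.ξ (S.sel j ω) ω) ⁻¹' A ∩ {ω | S.ρ (S.sel j ω) ω ≤ (s : WithTop ℝ≥0)} =
          ⋃ k, (S.ξ k ⁻¹' A ∩ {ω | S.ρ k ω ≤ (s : WithTop ℝ≥0)}) ∩
        {ω | (∑ i ∈ Finset.range k, if S.ρ i ω ≤ (s : WithTop ℝ≥0) then 1 else 0) = j} := by
        ext ω
        have := sel_le_iff (S := S) (j := j) (s := s) (ω := ω) (P := fun k => S.ξ k ω ∈ A)
        simp only [mem_ofPred_eq, mem_iUnion, mem_inter_iff, mem_preimage, and_assoc]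
        exact this
      rw [this]
      exact MeasurableSet.iUnion fun k => ((S.size_meas k A hA).2 s).inter (measurableSet_count s k j)

variable {S}

/-- The dictionary between a schedule and its compression is written at rank `performed k`: the
compressed trade before that rank is the last trade before `k` that was not skipped. -/
theorem compress_prevTime {k : ℕ} (ω : Ω) :
    S.compress.prevTime t q ω (S.performed k ω) = S.lastTime ω k := by
  induction k with
  | zero => simp [performed, Strategy.prevTime, lastTime]
  | succ k ih =>
    by_cases hk : S.ρ k ω = ⊤
    · rw [performed_succ_of_eq hk, ih, lastTime, if_neg (not_not.2 hk)]
    · rw [performed_succ_of_ne hk, lastTime, if_pos hk]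
      change ((clock (S.ρ (S.sel _ ω) ω) : ℝ≥0) : ℝ) = _
      rw [sel_performed hk]

theorem compress_impact {k : ℕ} {ω : Ω} (hk : S.ρ k ω ≠ ⊤) :
    S.compress.impact t q (S.performed k ω) ω = S.impact k ω := by
  rw [Strategy.impact, Strategy.lagBefore, compress_prevTime]
  change M.f (S.ξ (S.sel _ ω) ω) (clock (S.ρ (S.sel _ ω) ω) - _) = _
  rw [sel_performed hk, impact]

theorem compress_cost {k : ℕ} {ω : Ω} (hk : S.ρ k ω ≠ ⊤) :
    S.compress.cost t q (S.performed k ω) ω = S.cost k ω := by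
  rw [Strategy.cost, compress_impact hk]
  change S.ξ (S.sel _ ω) ω * M.price t q.price (clock (S.ρ (S.sel _ ω) ω)) ω * _ = _
  rw [sel_performed hk, cost]

theorem compress_cash (k : ℕ) (ω : Ω) :
    q.cash - ∑ j ∈ Finset.range (S.performed k ω), S.compress.cost t q j ω = S.cashAt k ω := by
  classical
  rw [cashAt]
  congr 1
  have := sum_performed (S := S) (G := fun i => S.cost i ω) (ω := ω) k
  convert! this using 1
  refine Finset.sum_congr rfl fun j hj => ?_
  obtain ⟨i, hi, hi', rfl⟩ := exists_performed (Finset.mem_range.1 hj)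
  rw [compress_cost hi', sel_performed hi']

theorem compress_shares (k : ℕ) (ω : Ω) :
    q.shares + ∑ j ∈ Finset.range (S.performed k ω), S.compress.ζ j ω = S.sharesAt k ω := by
  classical
  rw [sharesAt]
  congr 1
  have := sum_performed (S := S) (G := fun i => S.ξ i ω) (ω := ω) k
  convert! this using 1

theorem compress_τ_ne_top {j : ℕ} {ω : Ω} (h : S.compress.τ j ω ≠ ⊤) :
    ∃ k, S.ρ k ω ≠ ⊤ ∧ S.performed k ω = j ∧ S.compress.τ j ω = S.ρ k ω :=
  ⟨S.sel j ω, h, sel_spec h, rfl⟩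

theorem compress_bounded {j : ℕ} {ω : Ω} (h : S.n ≤ j) : S.compress.τ j ω = ⊤ := by
  by_contra hne
  obtain ⟨k, hk, rfl, -⟩ := compress_τ_ne_top hne
  have h1 : k < S.n := by
    by_contra hlt
    exact hk (S.bounded k ω (not_lt.1 hlt))
  have h2 : S.performed k ω ≤ k := by
    classical
    rw [performed]
    refine (Finset.sum_le_card_nsmul _ _ 1 fun i _ => ?_).trans (by simp)
    split_ifs <;> simp
  omega

theorem lastTime_lt {k : ℕ} {ω : Ω} (hk : S.ρ k ω ≠ ⊤) : S.lastTime ω k < clock (S.ρ k ω) := by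
  suffices ∀ i ≤ k, S.lastTime ω i < clock (S.ρ k ω) from this k le_rfl
  intro i
  induction i with
  | zero => intro _; exact S.first k ω hk
  | succ i ih =>
    intro hi
    rw [lastTime]
    split_ifs with h
    · have := S.strict i k ω hi h hk
      rw [← Strategy.coe_clock h, ← Strategy.coe_clock hk] at this
      exact_mod_cast WithTop.coe_lt_coe.1 this
    · exact ih (by omega)

theorem compress_strict {j : ℕ} {ω : Ω} (h : S.compress.τ j ω ≠ ⊤) :
    S.compress.prevTime t q ω j < clock (S.compress.τ j ω) := by
  obtain ⟨k, hk, rfl, h'⟩ := compress_τ_ne_top h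
  rw [compress_prevTime, h']
  exact lastTime_lt hk

end Schedule

end Market

end Liquidation

/-! ### Final liquidation at the horizon; valid and positive schedules. -/

namespace Liquidation

namespace Market

variable {Ω : Type*} [MeasurableSpace Ω] {M : Market Ω}

namespace Schedule

variable {t : ℝ≥0} {q : State} (S : M.Schedule t q)

open Classical in
theorem measurable_ite_ne_top {r : ℝ≥0} {ρ : Ω → WithTop ℝ≥0} {ξ : Ω → ℝ}
    (hρ : IsStoppingTime M.F ρ) (hξ : StopMeas M ρ ξ)
    (h : ∀ ω, ρ ω ≠ ⊤ → ρ ω ≤ (r : WithTop ℝ≥0)) :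
    Measurable[M.F r] (fun ω => if ρ ω ≠ ⊤ then ξ ω else 0) := by
  have h1 := hξ.measurable_ite hρ r
  have : (fun ω => if ρ ω ≠ ⊤ then ξ ω else 0) =
      fun ω => if ρ ω ≤ (r : WithTop ℝ≥0) then ξ ω else 0 := by
    funext ω
    by_cases hω : ρ ω ≠ ⊤
    · rw [if_pos hω, if_pos (h ω hω)]
    · rw [if_neg hω, if_neg fun h => hω (ne_top_of_le_ne_top WithTop.coe_ne_top h)]
  rwa [this]

theorem measurable_sharesAt {r : ℝ≥0} {k : ℕ}
    (h : ∀ i < k, ∀ ω, S.ρ i ω ≠ ⊤ → S.ρ i ω ≤ (r : WithTop ℝ≥0)) :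
    Measurable[M.F r] (S.sharesAt k) := by
  classical
  unfold sharesAt
  refine Measurable.const_add ?_ _
  refine @Finset.measurable_sum _ _ _ _ _ _ (M.F r) _ _ fun i hi => ?_
  exact measurable_ite_ne_top (S.stopping i) (S.size_meas i) (h i (Finset.mem_range.1 hi))

/-- The schedule `S`, all of whose trades take place before `r`, followed by a trade of size `η`
at `r`. -/
def snoc {r : ℝ≥0} {η : Ω → ℝ} (htr : t < r) (hrT : r ≤ M.T) (hq : 0 ≤ q.lag)
    (hlt : ∀ k ω, S.ρ k ω ≠ ⊤ → S.ρ k ω < (r : WithTop ℝ≥0)) (hη : Measurable[M.F r] η) :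
    M.Schedule t q where
  n := S.n + 1
  ρ k := if k = S.n then fun _ => (r : WithTop ℝ≥0) else S.ρ k
  ξ k := if k = S.n then η else S.ξ k
  stopping k := by
    split_ifs
    · exact isStoppingTime_const _ _
    · exact S.stopping k
  size_meas k := by
    split_ifs
    · exact stopMeas_const hη
    · exact S.size_meas k
  start k ω := by
    split_ifs
    · exact WithTop.coe_le_coe.2 htr.le
    · exact S.start k ω
  horizon k ω := by
    split_ifs
    · exact Or.inl (WithTop.coe_le_coe.2 hrT)
    · exact S.horizon k ω
  bounded k ω hk := by
    rw [if_neg (by omega)]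
    exact S.bounded k ω (by omega)
  strict i k ω hik h1 h2 := by
    split_ifs at h1 h2 ⊢ with hi hk hk
    · omega
    · exact absurd (S.bounded k ω (by omega)) h2
    · exact hlt i ω h1
    · exact S.strict i k ω hik h1 h2
  first k ω h := by
    split_ifs at h ⊢
    · have : (t : ℝ) < r := by exact_mod_cast htr
      change (t : ℝ) - q.lag < r
      linarith
    · exact S.first k ω h

section Snoc

variable {S} {r : ℝ≥0} {η : Ω → ℝ} {htr : t < r} {hrT : r ≤ M.T} {hq : 0 ≤ q.lag}
    {hlt : ∀ k ω, S.ρ k ω ≠ ⊤ → S.ρ k ω < (r : WithTop ℝ≥0)} {hη : Measurable[M.F r] η}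

theorem snoc_ρ_of_ne {k : ℕ} (hk : k ≠ S.n) : (S.snoc htr hrT hq hlt hη).ρ k = S.ρ k := if_neg hk

theorem snoc_ρ_self : (S.snoc htr hrT hq hlt hη).ρ S.n = fun _ => (r : WithTop ℝ≥0) :=
  if_pos rfl

theorem snoc_ξ_of_ne {k : ℕ} (hk : k ≠ S.n) : (S.snoc htr hrT hq hlt hη).ξ k = S.ξ k := if_neg hk

theorem snoc_ξ_self : (S.snoc htr hrT hq hlt hη).ξ S.n = η :=
  if_pos rfl

theorem snoc_lastTime {k : ℕ} (hk : k ≤ S.n) (ω : Ω) :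
    (S.snoc htr hrT hq hlt hη).lastTime ω k = S.lastTime ω k := by
  induction k with
  | zero => rfl
  | succ k ih => rw [lastTime, lastTime, snoc_ρ_of_ne (by omega), ih (by omega)]

theorem snoc_impact {k : ℕ} (hk : k < S.n) (ω : Ω) :
    (S.snoc htr hrT hq hlt hη).impact k ω = S.impact k ω := by
  rw [impact, impact, snoc_ρ_of_ne hk.ne, snoc_ξ_of_ne hk.ne, snoc_lastTime hk.le]

theorem snoc_cost {k : ℕ} (hk : k < S.n) (ω : Ω) :
    (S.snoc htr hrT hq hlt hη).cost k ω = S.cost k ω := by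
  rw [cost, cost, snoc_impact hk, snoc_ρ_of_ne hk.ne, snoc_ξ_of_ne hk.ne]

theorem snoc_cashAt {k : ℕ} (hk : k ≤ S.n) (ω : Ω) :
    (S.snoc htr hrT hq hlt hη).cashAt k ω = S.cashAt k ω := by
  rw [cashAt, cashAt]
  congr 1
  refine Finset.sum_congr rfl fun i hi => ?_
  have hi := Finset.mem_range.1 hi
  rw [snoc_cost (by omega), snoc_ρ_of_ne (by omega)]

theorem snoc_sharesAt {k : ℕ} (hk : k ≤ S.n) (ω : Ω) :
    (S.snoc htr hrT hq hlt hη).sharesAt k ω = S.sharesAt k ω := by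
  rw [sharesAt, sharesAt]
  congr 1
  refine Finset.sum_congr rfl fun i hi => ?_
  have hi := Finset.mem_range.1 hi
  rw [snoc_ξ_of_ne (by omega), snoc_ρ_of_ne (by omega)]

end Snoc

theorem cashAt_succ_of_ne {k : ℕ} {ω : Ω} (h : S.ρ k ω ≠ ⊤) :
    S.cashAt (k + 1) ω = S.cashAt k ω - S.cost k ω := by
  rw [cashAt, Finset.sum_range_succ, if_pos h, cashAt]
  ring

theorem cashAt_succ_of_eq {k : ℕ} {ω : Ω} (h : S.ρ k ω = ⊤) :
    S.cashAt (k + 1) ω = S.cashAt k ω := by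
  rw [cashAt, Finset.sum_range_succ, if_neg (not_not.2 h), cashAt, add_zero]

theorem sharesAt_succ_of_ne {k : ℕ} {ω : Ω} (h : S.ρ k ω ≠ ⊤) :
    S.sharesAt (k + 1) ω = S.sharesAt k ω + S.ξ k ω := by
  rw [sharesAt, Finset.sum_range_succ, if_pos h, sharesAt]
  ring

theorem sharesAt_succ_of_eq {k : ℕ} {ω : Ω} (h : S.ρ k ω = ⊤) :
    S.sharesAt (k + 1) ω = S.sharesAt k ω := by
  rw [sharesAt, Finset.sum_range_succ, if_neg (not_not.2 h), sharesAt, add_zero]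

/-- Either no trade is performed before the trade number `k`, or the quantities at `k` are those
after the last performed trade. -/
theorem at_cases (k : ℕ) (ω : Ω) :
    ((∀ i < k, S.ρ i ω = ⊤) ∧ S.lastTime ω k = t - q.lag ∧ S.cashAt k ω = q.cash ∧
      S.sharesAt k ω = q.shares) ∨
    ∃ i < k, S.ρ i ω ≠ ⊤ ∧ S.lastTime ω k = clock (S.ρ i ω) ∧ S.cashAt k ω = S.cashAt (i + 1) ω ∧
      S.sharesAt k ω = S.sharesAt (i + 1) ω := by
  induction k with
  | zero => left; simp [lastTime, cashAt, sharesAt]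
  | succ k ih =>
    by_cases h : S.ρ k ω = ⊤
    · rw [lastTime, if_neg (not_not.2 h), S.cashAt_succ_of_eq h, S.sharesAt_succ_of_eq h]
      rcases ih with ⟨h1, h2⟩ | ⟨i, hi, h2⟩
      · refine Or.inl ⟨fun i hi => ?_, h2⟩
        rcases (Nat.lt_succ_iff.1 hi).lt_or_eq with hi | rfl
        · exact h1 i hi
        · exact h
      · exact Or.inr ⟨i, by omega, h2⟩
    · right
      refine ⟨k, k.lt_succ_self, h, ?_, rfl, rfl⟩
      rw [lastTime, if_pos h]

/-- The validity of a schedule: finite impacts, nonnegative cash and shares after each trade, and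
admissible state before the first trade. -/
structure Valid : Prop where
  lt_horizon : ∀ k ω, S.ρ k ω ≠ ⊤ → S.ρ k ω < (M.T : WithTop ℝ≥0)
  trade : ∀ᵐ ω ∂M.prob, ∀ k, S.ρ k ω ≠ ⊤ →
    S.impact k ω ≠ ∞ ∧ 0 ≤ S.cashAt (k + 1) ω ∧ 0 ≤ S.sharesAt (k + 1) ω
  pre : ∀ᵐ ω ∂M.prob, ∀ s : ℝ≥0, t ≤ s → s ≤ M.T → (∀ k, ¬ S.ρ k ω ≤ (s : WithTop ℝ≥0)) →
    (⟨q.cash, q.shares, M.price t q.price s ω, s - (t - q.lag)⟩ : State) ∈ M.closedRegion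

/-- A valid schedule keeping a positive liquidation value before the horizon. -/
structure Positive : Prop extends S.Valid where
  trade_pos : ∀ᵐ ω ∂M.prob, ∀ k, S.ρ k ω ≠ ⊤ → 0 < S.cashAt (k + 1) ω
  pre_pos : ∀ᵐ ω ∂M.prob, ∀ s : ℝ≥0, t ≤ s → s < M.T → (∀ k, ¬ S.ρ k ω ≤ (s : WithTop ℝ≥0)) →
    0 < M.liq ⟨q.cash, q.shares, M.price t q.price s ω, s - (t - q.lag)⟩

/-- The expected utility of the cash held just before the horizon. -/
def payoff : ℝ≥0∞ := ∫⁻ ω, ENNReal.ofReal (M.U (max 0 (S.cashAt S.n ω))) ∂M.prob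

variable {S}

/-- All remaining shares are sold at `T`. The proceeds are nonnegative, so the cash does not
decrease. It ends up nonnegative: after a trade it already was, and without any trade its final
value is the liquidation value at `T`, which `pre` makes nonnegative. -/
theorem Valid.exists_finiteLiquidating (h : S.Valid) (h1 : M.H1f) (hU : M.HU) (hq : q ∈ M.domain)
    (htT : t < M.T) :
    ∃ α : M.Strategy, α.FiniteLiquidating t q ∧ S.payoff ≤ α.expectedUtility t q ∧
      (S.Positive → α.PositiveFiniteLiquidating t q) := by
  set D := S.snoc htT le_rfl hq.2.2.1 h.lt_horizon
    (η := fun ω => - S.sharesAt S.n ω)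
    (S.measurable_sharesAt fun i _ ω h' => (h.lt_horizon i ω h').le).neg with hD
  have hDn : D.n = S.n + 1 := rfl
  have htop : ∀ ω, D.ρ S.n ω = (M.T : WithTop ℝ≥0) := fun ω => by rw [hD, snoc_ρ_self]
  have htop' : ∀ ω, D.ρ S.n ω ≠ ⊤ := fun ω => by rw [htop]; exact WithTop.coe_ne_top
  have hshares : ∀ ω, D.sharesAt (S.n + 1) ω = 0 := fun ω => by
    rw [D.sharesAt_succ_of_ne (htop' ω), hD, snoc_sharesAt le_rfl, snoc_ξ_self]
    ring
  have hlast : ∀ᵐ ω ∂M.prob, D.impact S.n ω ≠ ∞ ∧ 0 ≤ S.sharesAt S.n ω ∧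
      0 ≤ D.cashAt (S.n + 1) ω ∧ S.cashAt S.n ω ≤ D.cashAt (S.n + 1) ω := by
    filter_upwards [h.trade, h.pre] with ω ht hp
    have hP := price_pos (M := M) hq.2.1 t (M.T) ω
    have himp : D.impact S.n ω = M.f (- S.sharesAt S.n ω) (M.T - S.lastTime ω S.n) := by
      rw [impact, htop, hD, snoc_ξ_self, snoc_lastTime le_rfl]; rfl
    have hcost : D.cost S.n ω = - S.sharesAt S.n ω * M.price t q.price M.T ω *
        (M.f (- S.sharesAt S.n ω) (M.T - S.lastTime ω S.n)).toReal := by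
      rw [cost, himp, htop, hD, snoc_ξ_self]; rfl
    rw [D.cashAt_succ_of_ne (htop' ω), hcost, hD, snoc_cashAt le_rfl, ← hD, himp]
    rcases S.at_cases S.n ω with ⟨hno, e1, e2, e3⟩ | ⟨i, hi, hi', e1, e2, e3⟩
    · have hst := hp M.T htT.le le_rfl fun k hk => by
        rcases lt_or_ge k S.n with hk' | hk'
        · rw [hno k hk'] at hk; exact WithTop.not_top_le_coe _ hk
        · rw [S.bounded k ω hk'] at hk; exact WithTop.not_top_le_coe _ hk
      rw [M.mem_closedRegion_iff] at hst
      obtain ⟨hd, hl⟩ := hst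
      rw [e1, e2, e3]
      have hs : 0 ≤ q.shares := hq.1
      refine ⟨ne_top_of_le_ne_top ENNReal.one_ne_top
        (impact_le_one_of_nonpos h1 (by linarith) hd.2.2), hs, ?_, ?_⟩
      · simp only [liq] at hl
        linarith
      · have : 0 ≤ q.shares * M.price t q.price M.T ω *
          (M.f (-q.shares) (M.T - (t - q.lag))).toReal := by positivity
        linarith
    · obtain ⟨-, hc, hs⟩ := ht i hi'
      rw [e1, e2, e3]
      have hi1 := Strategy.clock_le (h.lt_horizon i ω hi').le
      have hi2 := Strategy.le_clock hi' (S.start i ω)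
      have : (clock (S.ρ i ω) : ℝ) ≤ M.T := by exact_mod_cast hi1
      have h0 : (0 : ℝ) ≤ clock (S.ρ i ω) := NNReal.coe_nonneg _
      have hpr : 0 ≤ S.sharesAt (i + 1) ω * M.price t q.price M.T ω *
          (M.f (-S.sharesAt (i + 1) ω) (M.T - clock (S.ρ i ω))).toReal := by positivity
      refine ⟨ne_top_of_le_ne_top ENNReal.one_ne_top
        (impact_le_one_of_nonpos h1 (by linarith) ⟨by linarith, by linarith⟩), hs, ?_, ?_⟩ <;>
      linarith
  have hne : ∀ k ω, D.ρ k ω ≠ ⊤ → k ≤ S.n := fun k ω hk => by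
    by_contra hlt
    exact hk (D.bounded k ω (by omega))
  have hprep : ∀ ω, S.performed S.n ω + 1 = D.performed (S.n + 1) ω := fun ω => by
    rw [performed_succ_of_ne (htop' ω), performed, performed]
    congr 1
    refine Finset.sum_congr rfl fun i hi => ?_
    rw [hD, snoc_ρ_of_ne (Finset.mem_range.1 hi).ne]
  have hcount : ∀ ω k, D.compress.τ k ω ≤ (M.T : WithTop ℝ≥0) ↔ k < D.performed (S.n + 1) ω := by
    intro ω k
    constructor
    · intro hk
      obtain ⟨i, hi, rfl, -⟩ := compress_τ_ne_top (ne_top_of_le_ne_top WithTop.coe_ne_top hk)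
      have := performed_mono (S := D) ω (show i + 1 ≤ S.n + 1 by have := hne i ω hi; omega)
      simp only [performed_succ_of_ne hi] at this
      omega
    · intro hk
      obtain ⟨i, -, hi, rfl⟩ := exists_performed hk
      change D.ρ (D.sel _ ω) ω ≤ _
      rw [sel_performed hi]
      exact (D.horizon i ω).resolve_right hi
  have hfin : D.compress.FiniteLiquidating t q := by
    refine Strategy.finiteLiquidating_of_bounded (n := S.n + 1) hq (fun k ω => D.start _ _)
      (fun k ω hk => compress_bounded hk) (fun k ω hk => compress_strict hk) ?_ ?_ ?_
    · filter_upwards [hlast, h.trade] with ω hl ht k hk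
      obtain ⟨i, hi, rfl, -⟩ := compress_τ_ne_top hk
      rw [compress_impact hi, ← performed_succ_of_ne hi, compress_cash, compress_shares]
      rcases (hne i ω hi).eq_or_lt with rfl | hlt
      · exact ⟨hl.1, hl.2.2.1, (hshares ω).ge⟩
      · rw [hD, snoc_ρ_of_ne hlt.ne] at hi
        have := ht i hi
        rwa [hD, snoc_impact hlt, snoc_cashAt hlt, snoc_sharesAt hlt]
    · filter_upwards [h.pre] with ω hp s hts hsT hno
      refine hp s hts hsT fun k hk => ?_
      have hk' := ne_top_of_le_ne_top WithTop.coe_ne_top hk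
      have hkn : k < S.n := by
        by_contra hlt
        exact hk' (S.bounded k ω (not_lt.1 hlt))
      have hk'' : D.ρ k ω ≠ ⊤ := by rwa [hD, snoc_ρ_of_ne hkn.ne]
      apply hno (D.performed k ω)
      change D.ρ (D.sel _ ω) ω ≤ _
      rw [sel_performed hk'', hD, snoc_ρ_of_ne hkn.ne]
      exact hk
    · refine Filter.Eventually.of_forall fun ω => ?_
      rw [Strategy.state_shares_eq (hcount ω), compress_shares, hshares]
  refine ⟨D.compress, hfin, ?_, fun hpos => ?_⟩
  · refine lintegral_mono_ae ?_
    filter_upwards [hlast] with ω hl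
    rw [Strategy.state_cash_eq (hcount ω), compress_cash]
    refine ENNReal.ofReal_le_ofReal (hU.mono (mem_Ici.2 (le_max_left _ _)) (mem_Ici.2 hl.2.2.1)
      (max_le hl.2.2.1 hl.2.2.2))
  · refine Strategy.positiveFiniteLiquidating_of_bounded (n := S.n + 1) hfin
      (fun k ω hk => compress_bounded hk) ?_ ?_
    · filter_upwards [hpos.trade_pos] with ω ht k hk
      obtain ⟨i, hi, rfl, hi'⟩ := compress_τ_ne_top hk.ne_top
      rw [← performed_succ_of_ne hi, compress_cash]
      -- The added trade is made at `T`, where positivity is not required.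
      rcases (hne i ω hi).eq_or_lt with rfl | hlt
      · rw [hi', htop] at hk
        exact absurd hk (lt_irrefl _)
      · rw [hD, snoc_ρ_of_ne hlt.ne] at hi
        rw [hD, snoc_cashAt hlt]
        exact ht i hi
    · filter_upwards [hpos.pre_pos] with ω hp s hts hsT hno
      refine hp s hts hsT fun k hk => ?_
      have hk' := ne_top_of_le_ne_top WithTop.coe_ne_top hk
      have hkn : k < S.n := by
        by_contra hlt
        exact hk' (S.bounded k ω (not_lt.1 hlt))
      have hk'' : D.ρ k ω ≠ ⊤ := by rwa [hD, snoc_ρ_of_ne hkn.ne]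
      apply hno (D.performed k ω)
      change D.ρ (D.sel _ ω) ω ≤ _
      rw [sel_performed hk'', hD, snoc_ρ_of_ne hkn.ne]
      exact hk

theorem Valid.payoff_le_valueFinite (h : S.Valid) (h1 : M.H1f) (hU : M.HU) (hq : q ∈ M.domain)
    (htT : t < M.T) : S.payoff ≤ M.valueFinite t q := by
  obtain ⟨α, h2, h3, -⟩ := h.exists_finiteLiquidating h1 hU hq htT
  exact h3.trans (le_iSup₂_of_le α h2 le_rfl)

theorem Positive.payoff_le_valuePositive (h : S.Positive) (h1 : M.H1f) (hU : M.HU)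
    (hq : q ∈ M.domain) (htT : t < M.T) : S.payoff ≤ M.valuePositive t q := by
  obtain ⟨α, -, h3, h4⟩ := h.toValid.exists_finiteLiquidating h1 hU hq htT
  exact h3.trans (le_iSup₂_of_le α (h4 h) le_rfl)

end Schedule

end Market

end Liquidation

/-! ### A continuous version of the price, and its measurability at stopping times. -/

namespace Liquidation

namespace Market

variable {Ω : Type*} [MeasurableSpace Ω] {M : Market Ω}

/-- A version `B` of the driving Brownian motion all of whose paths are continuous. -/
structure ContVersion (M : Market Ω) (B : ℝ≥0 → Ω → ℝ) : Prop where
  cont : ∀ ω, Continuous fun s => B s ω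
  adapted : ∀ s, Measurable[M.F s] (B s)
  ae_eq : ∀ᵐ ω ∂M.prob, ∀ s ≤ M.T, B s ω = M.W s ω
  indep : ∀ s u : ℝ≥0, s ≤ u → u ≤ M.T → ∀ E : Set Ω, MeasurableSet[M.F s] E →
    ∀ A : Set ℝ, MeasurableSet A → M.prob (E ∩ (fun ω => B u ω - B s ω) ⁻¹' A) =
      M.prob E * gaussianReal 0 (u - s) A

/-- The paths are set to zero on a null set containing the discontinuous ones, which completeness
puts in `F 0` so that adaptedness survives, and frozen after `T`. -/
theorem exists_contVersion [IsProbabilityMeasure M.prob] (hF : M.UsualConditions)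
    (hW : M.IsBrownianMotion) : ∃ B, ContVersion M B := by
  classical
  obtain ⟨N, hN1, hN2, hN3⟩ := exists_measurable_superset_of_null
    (μ := M.prob) (s := {ω | ¬ ContinuousOn (fun s => M.W s ω) (Icc 0 M.T)}) hW.continuous_paths
  have hNF : ∀ s, MeasurableSet[M.F s] N := fun s => M.F.mono (zero_le : 0 ≤ s) _ (hF.complete N hN3)
  have hae : ∀ᵐ ω ∂M.prob, ω ∉ N := measure_eq_zero_iff_ae_notMem.1 hN3
  refine ⟨fun s ω => if ω ∈ N then 0 else M.W (min s M.T) ω, ?_, ?_, ?_, ?_⟩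
  · intro ω
    by_cases hω : ω ∈ N
    · simp only [hω, if_true]; exact continuous_const
    · simp only [hω, if_false]
      have h : ContinuousOn (fun s => M.W s ω) (Icc 0 M.T) := by
        by_contra h; exact hω (hN1 h)
      exact h.comp_continuous (continuous_id.min continuous_const)
        fun s => ⟨zero_le, min_le_right _ _⟩
  · intro s
    exact Measurable.ite (hNF s) measurable_const
      ((hW.adapted _ (min_le_right _ _)).mono (M.F.mono (min_le_left _ _)) le_rfl)
  · filter_upwards [hae] with ω hω s hs
    simp only [hω, if_false, min_eq_left hs]
  · intro s u hsu hu E hE A hA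
    have h1 : M.prob (E ∩ (fun ω => (if ω ∈ N then 0 else M.W (min u M.T) ω) -
        (if ω ∈ N then 0 else M.W (min s M.T) ω)) ⁻¹' A) =
        M.prob ((fun ω => M.W u ω - M.W s ω) ⁻¹' A ∩ E) := by
      refine measure_congr ?_
      filter_upwards [hae] with ω hω
      refine propext ?_
      change (ω ∈ E ∧ _ ∈ A) ↔ (_ ∈ A ∧ ω ∈ E)
      simp only [hω, if_false, min_eq_left hu, min_eq_left (hsu.trans hu)]
      exact and_comm
    rw [h1]
    have hm : Measurable fun ω => M.W u ω - M.W s ω :=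
      ((hW.adapted u hu).mono (M.F.le _) le_rfl).sub
        ((hW.adapted s (hsu.trans hu)).mono (M.F.le _) le_rfl)
    have h2 := (Indep_iff _ _ _).1 (hW.increments_indep s u hsu hu) _ E ⟨A, hA, rfl⟩ hE
    rw [h2, ← hW.increments_law s u hsu hu, Measure.map_apply hm hA, mul_comm]

/-- The impact function extended to all lags by projection on `[0,T]`. -/
def impactExt (M : Market Ω) (e θ : ℝ) : ℝ≥0∞ :=
  M.f e (projIcc (0 : ℝ) M.T (NNReal.coe_nonneg _) θ)

theorem impactExt_of_mem {e θ : ℝ} (h : θ ∈ Icc (0 : ℝ) M.T) : M.impactExt e θ = M.f e θ := by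
  rw [impactExt, projIcc_of_mem _ h]

/-- Measurability of `f` is assumed for lags in `[0,T]` only; the projection carries it to the whole
plane. -/
theorem measurable_impactExt (hf : M.BorelImpact) :
    Measurable (fun q : ℝ × ℝ => M.impactExt q.1 q.2) :=
  Measurable.comp (g := fun q : ℝ × Icc (0 : ℝ) (M.T : ℝ) => M.f q.1 q.2) hf
    (measurable_fst.prodMk ((continuous_projIcc (h := NNReal.coe_nonneg M.T)).measurable.comp measurable_snd))

/-- The geometric Brownian motion driven by `B`. -/
def gbm (M : Market Ω) (B : ℝ≥0 → Ω → ℝ) (t : ℝ≥0) (p : ℝ) (s : ℝ≥0) (ω : Ω) : ℝ :=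
  p * Real.exp ((M.b - M.σ ^ 2 / 2) * ((s : ℝ) - t) + M.σ * (B s ω - B t ω))

theorem gbm_pos {B : ℝ≥0 → Ω → ℝ} {p : ℝ} (hp : 0 < p) (t s : ℝ≥0) (ω : Ω) :
    0 < M.gbm B t p s ω := mul_pos hp (Real.exp_pos _)

namespace ContVersion

variable {B : ℝ≥0 → Ω → ℝ}

theorem continuous_gbm (hB : ContVersion M B) (t : ℝ≥0) (p : ℝ) (ω : Ω) : Continuous fun s => M.gbm B t p s ω := by
  have := hB.cont ω
  unfold gbm
  fun_prop

theorem measurable_gbm (hB : ContVersion M B) {t s r : ℝ≥0} (hts : t ≤ r) (hsr : s ≤ r) (p : ℝ) :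
    Measurable[M.F r] (M.gbm B t p s) := by
  have h1 : Measurable[M.F r] (B s) := (hB.adapted s).mono (M.F.mono hsr) le_rfl
  have h2 : Measurable[M.F r] (B t) := (hB.adapted t).mono (M.F.mono hts) le_rfl
  exact ((((h1.sub h2).const_mul _).const_add _).exp).const_mul _

theorem gbm_ae_eq (hB : ContVersion M B) {t : ℝ≥0} (ht : t ≤ M.T) (p : ℝ) :
    ∀ᵐ ω ∂M.prob, ∀ s ≤ M.T, M.gbm B t p s ω = M.price t p s ω := by
  filter_upwards [hB.ae_eq] with ω h s hs
  rw [gbm, price, h s hs, h t ht]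

theorem isStronglyProgressive (hB : ContVersion M B) : IsStronglyProgressive M.F B :=
  StronglyAdapted.isStronglyProgressive_of_continuous
    (fun s => (hB.adapted s).stronglyMeasurable) hB.cont

end ContVersion

theorem measurable_clock {ρ : Ω → WithTop ℝ≥0} (hρ : IsStoppingTime M.F ρ) :
    Measurable[hρ.measurableSpace] fun ω => clock (ρ ω) :=
  hρ.measurable.untopD 0

/-- Continuity of all paths gives progressive measurability. Where `ρ = ⊤`, `clock` is `0` by
convention and the process is read at time `0`. -/
theorem ContVersion.measurable_stopped {B : ℝ≥0 → Ω → ℝ} (hB : ContVersion M B)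
    {ρ : Ω → WithTop ℝ≥0} (hρ : IsStoppingTime M.F ρ) :
    Measurable[hρ.measurableSpace] fun ω => B (clock (ρ ω)) ω := by
  classical
  have h1 := measurable_stoppedValue hB.isStronglyProgressive hρ
  have h0 : Measurable[hρ.measurableSpace] (B 0) :=
    (hB.adapted 0).mono (hρ.le_measurableSpace_of_const_le fun ω => zero_le) le_rfl
  have : (fun ω => B (clock (ρ ω)) ω) =
      fun ω => if ρ ω = ⊤ then B 0 ω else stoppedValue B ρ ω := by
    funext ω
    split_ifs with h
    · rw [h]; rfl
    · rw [stoppedValue]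
      obtain ⟨a, ha⟩ := WithTop.ne_top_iff_exists.1 h
      rw [← ha]; rfl
  rw [this]
  exact Measurable.ite ((measurableSet_singleton ⊤).preimage hρ.measurable) h0 h1

theorem ContVersion.measurable_gbm_stopped {B : ℝ≥0 → Ω → ℝ} (hB : ContVersion M B)
    {ρ : Ω → WithTop ℝ≥0} (hρ : IsStoppingTime M.F ρ) {t : ℝ≥0} (p : ℝ)
    (ht : ∀ ω, (t : WithTop ℝ≥0) ≤ ρ ω) :
    Measurable[hρ.measurableSpace] fun ω => M.gbm B t p (clock (ρ ω)) ω := by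
  have h1 := hB.measurable_stopped hρ
  have h2 : Measurable[hρ.measurableSpace] (B t) :=
    (hB.adapted t).mono (hρ.le_measurableSpace_of_const_le ht) le_rfl
  have h3 : Measurable[hρ.measurableSpace] fun ω => ((clock (ρ ω) : ℝ≥0) : ℝ) :=
    measurable_coe_nnreal_real.comp (measurable_clock hρ)
  unfold gbm
  exact (((((h3.sub_const _).const_mul _).add ((h1.sub h2).const_mul _)).exp).const_mul _)

end Market

end Liquidation

/-! ### Summable costs, utilities along sequences, best partial sales. -/

namespace Liquidation

open Filter Topology

/-- Proportional transaction costs and converging prices make the costs of infinitely many trades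
summable, as long as cash and shares stay nonnegative. -/
theorem summable_cost_of_spread {x y ζ c P g : ℕ → ℝ} {S κb κa : ℝ}
    (hx : ∀ k, x (k + 1) = x k - c k) (hy : ∀ k, y (k + 1) = y k + ζ k)
    (hc : ∀ k, c k = ζ k * P k * g k) (hx0 : ∀ k, 0 ≤ x (k + 1)) (hy0 : ∀ k, 0 ≤ y (k + 1))
    (hP0 : ∀ k, 0 < P k) (hP : Tendsto P atTop (𝓝 S)) (hS : 0 < S) (hκb : κb < 1) (hκa : 1 < κa)
    (hg0 : ∀ k, 0 ≤ g k) (hb : ∀ k, ζ k < 0 → g k ≤ κb) (ha : ∀ k, 0 < ζ k → κa ≤ g k) :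
    Summable c := by
  -- Once the prices are close to `S`, every sale is made below `S (1 - δ)` and every purchase above
  -- `S (1 + δ)`.
  obtain ⟨δ, hδ, hδb, hδa⟩ : ∃ δ > 0, max κb 0 < 1 - δ ∧ 1 + δ < κa := by
    refine ⟨min ((1 - max κb 0) / 2) ((κa - 1) / 2), ?_, ?_, ?_⟩
    · have : max κb 0 < 1 := max_lt hκb one_pos
      exact lt_min (by linarith) (by linarith)
    · have : max κb 0 < 1 := max_lt hκb one_pos
      have := min_le_left ((1 - max κb 0) / 2) ((κa - 1) / 2)
      linarith
    · have := min_le_right ((1 - max κb 0) / 2) ((κa - 1) / 2)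
      linarith
  have h1 : ∀ᶠ k in atTop, P k * max κb 0 < S * (1 - δ) :=
    (hP.mul_const _).eventually_lt_const (by nlinarith)
  have h2 : ∀ᶠ k in atTop, S * (1 + δ) < P k * κa :=
    (hP.mul_const _).eventually_const_lt (by nlinarith)
  have h3 : ∀ᶠ k in atTop, P k < 2 * S := hP.eventually_lt_const (by linarith)
  obtain ⟨N₀, hN₀⟩ := eventually_atTop.1 (h1.and (h2.and h3))
  obtain ⟨N, hN1, hN⟩ : ∃ N, 1 ≤ N ∧ ∀ k ≥ N, P k * max κb 0 < S * (1 - δ) ∧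
      S * (1 + δ) < P k * κa ∧ P k < 2 * S :=
    ⟨max N₀ 1, le_max_right _ _, fun k hk => hN₀ k (le_of_max_le_left hk)⟩
  have hx0' : ∀ k ≥ 1, 0 ≤ x k := fun k hk => by
    obtain ⟨j, rfl⟩ : ∃ j, k = j + 1 := ⟨k - 1, by omega⟩
    exact hx0 j
  have hy0' : ∀ k ≥ 1, 0 ≤ y k := fun k hk => by
    obtain ⟨j, rfl⟩ : ∃ j, k = j + 1 := ⟨k - 1, by omega⟩
    exact hy0 j
  have hstep : ∀ k ≥ N, δ * S * |ζ k| ≤ (x k + y k * S) - (x (k + 1) + y (k + 1) * S) := by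
    intro k hk
    obtain ⟨hb1, ha1, -⟩ := hN k hk
    have hPk := hP0 k
    rw [hx, hy, hc]
    rcases lt_trichotomy (ζ k) 0 with h | h | h
    · rw [abs_of_neg h]
      have : P k * g k ≤ P k * max κb 0 :=
        mul_le_mul_of_nonneg_left ((hb k h).trans (le_max_left _ _)) hPk.le
      nlinarith
    · simp [h]
    · rw [abs_of_pos h]
      have : P k * κa ≤ P k * g k := mul_le_mul_of_nonneg_left (ha k h) hPk.le
      nlinarith
  have hsumζ : ∀ n, ∑ k ∈ Finset.range n, |ζ (k + N)| ≤ (x N + y N * S) / (δ * S) := by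
    intro n
    rw [le_div_iff₀ (by positivity), mul_comm, Finset.mul_sum]
    calc ∑ k ∈ Finset.range n, δ * S * |ζ (k + N)|
        ≤ ∑ k ∈ Finset.range n, ((x (k + N) + y (k + N) * S) -
          (x (k + 1 + N) + y (k + 1 + N) * S)) := by
          refine Finset.sum_le_sum fun k _ => ?_
          have := hstep (k + N) (by omega)
          rwa [show k + N + 1 = k + 1 + N by ring] at this
      _ = (x (0 + N) + y (0 + N) * S) - (x (n + N) + y (n + N) * S) :=
          Finset.sum_range_sub' (fun k => x (k + N) + y (k + N) * S) n
      _ ≤ x N + y N * S := by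
          have e1 := hx0' (n + N) (by omega)
          have e2 := mul_nonneg (hy0' (n + N) (by omega)) hS.le
          simp only [zero_add]
          linarith
  -- Only sales have negative cost, and then `|c| ≤ 2 S |ζ|`; since `|c| = c + 2 |c|` in that case,
  -- the constant is `4 S`. The sums of the costs themselves telescope.
  have hcabs : ∀ k ≥ N, |c k| ≤ c k + 4 * S * |ζ k| := by
    intro k hk
    obtain ⟨hb1, -, hP2⟩ := hN k hk
    have hPk := hP0 k
    rcases lt_or_ge (ζ k) 0 with h | h
    · have hg : g k ≤ 1 := (hb k h).trans hκb.le
      have hneg : c k ≤ 0 := by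
        rw [hc]
        exact mul_nonpos_of_nonpos_of_nonneg (mul_nonpos_of_nonpos_of_nonneg h.le hPk.le) (hg0 k)
      rw [abs_of_nonpos hneg, abs_of_neg h]
      have : P k * g k ≤ 2 * S := by nlinarith [hg0 k]
      have : -(ζ k) * (P k * g k) ≤ -(ζ k) * (2 * S) := mul_le_mul_of_nonneg_left this (by linarith)
      rw [hc]
      nlinarith
    · have hpos : 0 ≤ c k := by rw [hc]; exact mul_nonneg (mul_nonneg h hPk.le) (hg0 k)
      rw [abs_of_nonneg hpos]
      have := mul_nonneg hS.le (abs_nonneg (ζ k))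
      linarith
  refine (summable_nat_add_iff N).1 (Summable.of_abs ?_)
  refine summable_of_sum_range_le (c := x N + 4 * S * ((x N + y N * S) / (δ * S)))
    (fun k => abs_nonneg _) fun n => ?_
  calc ∑ k ∈ Finset.range n, |c (k + N)|
      ≤ ∑ k ∈ Finset.range n, ((x (k + N) - x (k + 1 + N)) + 4 * S * |ζ (k + N)|) := by
        refine Finset.sum_le_sum fun k _ => ?_
        have := hcabs (k + N) (by omega)
        have h' := hx (k + N)
        rw [show k + N + 1 = k + 1 + N by ring] at h'
        linarith
    _ = (x (0 + N) - x (n + N)) + 4 * S * ∑ k ∈ Finset.range n, |ζ (k + N)| := by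
        rw [Finset.sum_add_distrib, Finset.sum_range_sub' (fun k => x (k + N)), Finset.mul_sum]
    _ ≤ _ := by
        have e1 := hx0' (n + N) (by omega)
        have e2 := mul_le_mul_of_nonneg_left (hsumζ n) (by positivity : 0 ≤ 4 * S)
        simp only [zero_add]
        linarith

namespace Market

variable {Ω : Type*} [MeasurableSpace Ω] {M : Market Ω}

/-- Concavity between `0` and `x`, with `U 0 = 0`. Every loss of a factor on the cash is converted
in this way into the loss of the same factor on the utility. -/
theorem HU.mul_le (hU : M.HU) {l x : ℝ} (hl : l ∈ Icc (0 : ℝ) 1) (hx : 0 ≤ x) :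
    l * M.U x ≤ M.U (l * x) := by
  have := hU.concave.2 (mem_Ici.2 hx) (mem_Ici.2 le_rfl) hl.1 (sub_nonneg.2 hl.2) (by ring)
  simpa [hU.zero] using this

theorem HU.measurable (hU : M.HU) : Measurable fun x => M.U (max 0 x) :=
  Monotone.measurable fun _ _ h =>
    hU.mono (mem_Ici.2 (le_max_left _ _)) (mem_Ici.2 (le_max_left _ _)) (max_le_max le_rfl h)

/-- Comparison of utilities along a sequence of positions. -/
theorem HU.le_liminf (hU : M.HU) {X : ℝ} (hX : 0 ≤ X) {x : ℕ → ℝ}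
    (h : ∀ c, c < X → ∀ᶠ n in atTop, c ≤ x n) :
    ENNReal.ofReal (M.U X) ≤ liminf (fun n => ENNReal.ofReal (M.U (max 0 (x n)))) atTop := by
  -- For `l < 1` one has `l U(X) ≤ U(l X)`, and the level `l X`, below `X`, is eventually reached;
  -- this dispenses with the continuity of `U`.
  refine ENNReal.le_of_forall_lt_one_mul_le fun a ha => ?_
  obtain ⟨l, rfl⟩ : ∃ l : ℝ≥0, a = l := ⟨a.toNNReal, (ENNReal.coe_toNNReal ha.ne_top).symm⟩
  have hl1 : (l : ℝ) < 1 := by exact_mod_cast ha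
  have hl0 : (0 : ℝ) ≤ l := l.2
  refine le_liminf_of_le (by isBoundedDefault) ?_
  have key : ∀ᶠ n in atTop, (l : ℝ) * X ≤ max 0 (x n) := by
    rcases hX.eq_or_lt with rfl | hX
    · simp
    · filter_upwards [h (l * X) (by nlinarith)] with n hn
      exact hn.trans (le_max_right _ _)
  filter_upwards [key] with n hn
  rw [← ENNReal.ofReal_coe_nnreal, ← ENNReal.ofReal_mul hl0]
  refine ENNReal.ofReal_le_ofReal ((hU.mul_le ⟨hl0, hl1.le⟩ hX).trans ?_)
  exact hU.mono (mem_Ici.2 (by positivity)) (mem_Ici.2 (le_max_left _ _)) hn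

theorem H3f.exists_bid (h3 : M.H3f) : ∃ κ < (1 : ℝ), ∀ e < 0, ∀ θ ∈ Icc (0 : ℝ) M.T,
    (M.f e θ).toReal ≤ κ := by
  refine ⟨(⨆ e ∈ Iio (0 : ℝ), ⨆ θ ∈ Icc (0 : ℝ) M.T, M.f e θ).toReal, ?_, fun e he θ hθ => ?_⟩
  · rw [← ENNReal.toReal_one]
    exact (ENNReal.toReal_lt_toReal h3.bid.ne_top ENNReal.one_ne_top).2 h3.bid
  · refine ENNReal.toReal_mono h3.bid.ne_top ?_
    exact (le_iSup₂_of_le e he (le_iSup₂_of_le θ hθ le_rfl))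

/-- The infimum may be infinite, so a finite constant is taken strictly between `1` and it.
Finiteness of `f e θ` is required because `toReal` sends `∞` to `0`. -/
theorem H3f.exists_ask (h3 : M.H3f) : ∃ κ > (1 : ℝ), ∀ e > 0, ∀ θ ∈ Icc (0 : ℝ) M.T,
    M.f e θ ≠ ∞ → κ ≤ (M.f e θ).toReal := by
  obtain ⟨κ, h1, h2⟩ := ENNReal.lt_iff_exists_nnreal_btwn.1 h3.ask
  refine ⟨κ, by exact_mod_cast h1, fun e he θ hθ hfin => ?_⟩
  rw [← ENNReal.coe_toReal]
  refine ENNReal.toReal_mono hfin (h2.le.trans ?_)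
  exact (iInf₂_le_of_le e he (iInf₂_le_of_le θ hθ le_rfl))

/-- The proceeds, per unit of price, of the sale of `e` shares with lag `θ`. -/
def proceeds (M : Market Ω) (e θ : ℝ) : ℝ := e * (M.impactExt (-e) θ).toReal

theorem measurable_proceeds (hf : M.BorelImpact) :
    Measurable fun q : ℝ × ℝ => M.proceeds q.1 q.2 :=
  measurable_fst.mul ((measurable_impactExt hf).comp
    (measurable_fst.neg.prodMk measurable_snd)).ennreal_toReal

theorem proceeds_nonneg {e θ : ℝ} (he : 0 ≤ e) : 0 ≤ M.proceeds e θ :=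
  mul_nonneg he ENNReal.toReal_nonneg

theorem proceeds_zero (θ : ℝ) : M.proceeds 0 θ = 0 := zero_mul _

/-- Joint continuity of the impact function off `e = 0` and at positive lags. -/
theorem Hcf.tendsto (hc : M.Hcf) {ι : Type*} {l : Filter ι} {e θ : ι → ℝ} {e₀ θ₀ : ℝ}
    (he₀ : e₀ ≠ 0) (hθ₀ : θ₀ ∈ Ioc (0 : ℝ) M.T) (he : Tendsto e l (𝓝 e₀))
    (hθ : Tendsto θ l (𝓝 θ₀)) (hmem : ∀ᶠ i in l, θ i ∈ Ioc (0 : ℝ) M.T) :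
    Tendsto (fun i => M.f (e i) (θ i)) l (𝓝 (M.f e₀ θ₀)) := by
  have h := hc.cont (e₀, θ₀) ⟨he₀, hθ₀⟩
  refine Tendsto.comp (f := fun i => (e i, θ i)) (g := fun q : ℝ × ℝ => M.f q.1 q.2) h ?_
  refine tendsto_nhdsWithin_iff.2 ⟨he.prodMk_nhds hθ, ?_⟩
  filter_upwards [he.eventually_ne he₀, hmem] with i h1 h2
  exact ⟨h1, h2⟩

theorem Hcf.tendsto_proceeds (hc : M.Hcf) (h1 : M.H1f) {ι : Type*} {l : Filter ι} {e θ : ι → ℝ}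
    {e₀ θ₀ : ℝ} (he₀ : 0 < e₀) (hθ₀ : θ₀ ∈ Ioc (0 : ℝ) M.T) (he : Tendsto e l (𝓝 e₀))
    (hθ : Tendsto θ l (𝓝 θ₀)) (hmem : ∀ᶠ i in l, θ i ∈ Ioc (0 : ℝ) M.T) :
    Tendsto (fun i => M.proceeds (e i) (θ i)) l (𝓝 (M.proceeds e₀ θ₀)) := by
  have h := hc.tendsto (e₀ := -e₀) (by linarith) hθ₀ he.neg hθ hmem
  have hfin : M.f (-e₀) θ₀ ≠ ∞ := ne_top_of_le_ne_top ENNReal.one_ne_top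
    (impact_le_one_of_nonpos h1 (by linarith) ⟨hθ₀.1.le, hθ₀.2⟩)
  have h' := he.mul ((ENNReal.tendsto_toReal hfin).comp h)
  rw [proceeds, impactExt_of_mem ⟨hθ₀.1.le, hθ₀.2⟩]
  refine h'.congr' ?_
  filter_upwards [hmem] with i hi
  rw [proceeds, impactExt_of_mem ⟨hi.1.le, hi.2⟩]
  rfl

/-- A sequence of fractions starting from `1`, dense in `[0,1]`. -/
def fraction : ℕ → ℝ
  | 0 => 1
  | j + 1 => max 0 (min 1 (TopologicalSpace.denseSeq ℝ j))

theorem fraction_mem (j : ℕ) : fraction j ∈ Icc (0 : ℝ) 1 := by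
  cases j with
  | zero => simp [fraction]
  | succ j => exact ⟨le_max_left _ _, max_le zero_le_one (min_le_left _ _)⟩

theorem exists_fraction_mem {a : ℝ} (ha : a ∈ Icc (0 : ℝ) 1) {V : Set ℝ} (hV : V ∈ 𝓝 a) :
    ∃ j, fraction j ∈ V := by
  have hcont : Continuous fun u : ℝ => max 0 (min 1 u) := by fun_prop
  have ha' : max 0 (min 1 a) = a := by rw [min_eq_right ha.2, max_eq_right ha.1]
  have := hcont.continuousAt (x := a)
  rw [ContinuousAt, ha'] at this
  obtain ⟨j, hj⟩ := (TopologicalSpace.denseRange_denseSeq ℝ).exists_mem_open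
    isOpen_interior ⟨a, mem_interior_iff_mem_nhds.2 (this hV)⟩
  have hj' := interior_subset hj
  exact ⟨j + 1, hj'⟩

/-- The best amount to sell among the first fractions of the position. -/
def bestSale (M : Market Ω) : ℕ → ℝ → ℝ → ℝ
  | 0, y, _ => y
  | m + 1, y, θ => if M.proceeds (bestSale M m y θ) θ < M.proceeds (fraction m * y) θ
      then fraction m * y else bestSale M m y θ

theorem measurable_bestSale (hf : M.BorelImpact) (m : ℕ) :
    Measurable fun q : ℝ × ℝ => M.bestSale m q.1 q.2 := by
  induction m with
  | zero => exact measurable_fst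
  | succ m ih =>
    have hφ := measurable_proceeds hf
    have h2 : Measurable fun q : ℝ × ℝ => fraction m * q.1 := measurable_fst.const_mul _
    refine Measurable.ite (measurableSet_lt ?_ ?_) h2 ih
    · exact hφ.comp (ih.prodMk measurable_snd)
    · exact hφ.comp (h2.prodMk measurable_snd)

theorem bestSale_mem (m : ℕ) {y : ℝ} (hy : 0 ≤ y) (θ : ℝ) : M.bestSale m y θ ∈ Icc 0 y := by
  induction m with
  | zero => exact ⟨hy, le_rfl⟩
  | succ m ih =>
    rw [bestSale]
    split_ifs
    · have := fraction_mem m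
      exact ⟨mul_nonneg this.1 hy, mul_le_of_le_one_left hy this.2⟩
    · exact ih

theorem proceeds_bestSale_mono (y θ : ℝ) : Monotone fun m => M.proceeds (M.bestSale m y θ) θ := by
  refine monotone_nat_of_le_succ fun m => ?_
  simp only [bestSale]
  split_ifs with h
  · exact h.le
  · exact le_rfl

/-- Every fraction of the dense sequence is dominated once `m` is large. Selling everything need not
be best, since `e f(-e,θ)` may decrease with `e`; a maximum over finitely many candidates is plainly
measurable. -/
theorem proceeds_fraction_le {m j : ℕ} (h : j < m) (y θ : ℝ) :
    M.proceeds (fraction j * y) θ ≤ M.proceeds (M.bestSale m y θ) θ := by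
  refine le_trans ?_ (proceeds_bestSale_mono y θ (Nat.succ_le_of_lt h))
  simp only [bestSale]
  split_ifs with h
  · exact le_rfl
  · exact not_lt.1 h

theorem proceeds_le_bestSale (m : ℕ) (y θ : ℝ) :
    M.proceeds y θ ≤ M.proceeds (M.bestSale m y θ) θ :=
  proceeds_bestSale_mono y θ (Nat.zero_le m)

theorem liq_eq_proceeds {r : State} (h : r.lag ∈ Icc (0 : ℝ) M.T) :
    M.liq r = r.cash + r.price * M.proceeds r.shares r.lag := by
  rw [liq, proceeds, impactExt_of_mem h]
  ring

end Market

end Liquidation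

/-! ### Trimming a strategy: its first trades before a date, without the simultaneous ones. -/

namespace Liquidation

open Filter Topology

namespace Market

variable {Ω : Type*} [MeasurableSpace Ω] {M : Market Ω}

namespace Schedule

variable {t : ℝ≥0} {q : State} {S : M.Schedule t q}

theorem start_le_clock {k : ℕ} {ω : Ω} (h : S.ρ k ω ≠ ⊤) : (t : ℝ) ≤ clock (S.ρ k ω) := by
  exact_mod_cast Strategy.le_clock h (S.start k ω)

theorem clock_le_horizon {k : ℕ} {ω : Ω} (h : S.ρ k ω ≠ ⊤) : clock (S.ρ k ω) ≤ M.T :=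
  Strategy.clock_le ((S.horizon k ω).resolve_right h)

/-- For the first trade, `pre` gives information only at times strictly before it; were its lag
larger than `T`, the lag would exceed `T` slightly earlier. For a later trade the lag is at most the
trading time itself. -/
theorem Valid.lag_mem (h : S.Valid) (hq : q ∈ M.domain) : ∀ᵐ ω ∂M.prob, ∀ k, S.ρ k ω ≠ ⊤ →
    clock (S.ρ k ω) - S.lastTime ω k ∈ Ioc (0 : ℝ) M.T := by
  filter_upwards [h.pre] with ω hp k hk
  refine ⟨sub_pos.2 (lastTime_lt hk), ?_⟩
  have hk1 := start_le_clock hk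
  have hk2 : (clock (S.ρ k ω) : ℝ) ≤ M.T := by exact_mod_cast clock_le_horizon hk
  rcases S.at_cases k ω with ⟨hno, e1, -, -⟩ | ⟨i, hi, hi', e1, -, -⟩
  · rw [e1]
    by_contra! hlt
    have hl := hq.2.2.2
    -- A time before the trade at which the lag has already passed `T`: midway between the trade and
    -- the moment `T + t - θ` when the lag equals `T`.
    set s : ℝ := (clock (S.ρ k ω) + max (t : ℝ) (M.T + t - q.lag)) / 2 with hs
    have hm1 := le_max_left (t : ℝ) (M.T + t - q.lag)
    have hm2 := le_max_right (t : ℝ) (M.T + t - q.lag)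
    have hm3 : max (t : ℝ) (M.T + t - q.lag) < clock (S.ρ k ω) :=
      max_lt (by linarith) (by linarith)
    have hs0 : (0 : ℝ) ≤ s := by have := NNReal.coe_nonneg t; linarith
    obtain ⟨s', hs'⟩ : ∃ s' : ℝ≥0, (s' : ℝ) = s := ⟨s.toNNReal, Real.coe_toNNReal s hs0⟩
    have hst : s' < clock (S.ρ k ω) := by
      rw [← NNReal.coe_lt_coe, hs']; linarith
    have := hp s' (by rw [← NNReal.coe_le_coe, hs']; linarith)
      (hst.le.trans (clock_le_horizon hk)) (fun i hi => by
        have hi' := ne_top_of_le_ne_top WithTop.coe_ne_top hi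
        have hki : k ≤ i := by
          by_contra! hik
          exact hi' (hno i hik)
        have hle : S.ρ k ω ≤ S.ρ i ω := by
          rcases hki.eq_or_lt with rfl | hki
          · exact le_rfl
          · exact (S.strict _ _ _ hki hk hi').le
        exact absurd (Strategy.clock_le (hle.trans hi)) (not_le.2 hst))
    have := ((M.mem_closedRegion_iff _).1 this).1.2.2.2
    change (s' : ℝ) - (t - q.lag) ≤ M.T at this
    linarith
  · rw [e1]
    have : (0 : ℝ) ≤ clock (S.ρ i ω) := NNReal.coe_nonneg _
    linarith

theorem measurable_lastTime (k : ℕ) : Measurable fun ω => S.lastTime ω k := by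
  induction k with
  | zero => exact measurable_const
  | succ k ih =>
    simp only [lastTime]
    refine Measurable.ite (S.stopping k).measurableSet_eq_top.compl ?_ ih
    exact measurable_coe_nnreal_real.comp
      ((measurable_clock (S.stopping k)).mono (S.stopping k).measurableSpace_le le_rfl)

/-- Almost surely the price can be replaced by its continuous version, which is measurable when
stopped. This measurability is what Fatou's lemma asks for. -/
theorem Valid.aemeasurable_cashAt (h : S.Valid) (hq : q ∈ M.domain) (hf : M.BorelImpact)
    (htT : t ≤ M.T) {B : ℝ≥0 → Ω → ℝ} (hB : ContVersion M B) (k : ℕ) :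
    AEMeasurable (S.cashAt k) M.prob := by
  classical
  refine AEMeasurable.const_sub ?_ _
  refine Finset.aemeasurable_fun_sum _ fun i _ => ?_
  have hξ : Measurable (S.ξ i) :=
    ((S.size_meas i).measurable (S.stopping i)).mono (S.stopping i).measurableSpace_le le_rfl
  have hc : Measurable fun ω => ((clock (S.ρ i ω) : ℝ≥0) : ℝ) := measurable_coe_nnreal_real.comp
    ((measurable_clock (S.stopping i)).mono (S.stopping i).measurableSpace_le le_rfl)
  refine ⟨fun ω => if S.ρ i ω ≠ ⊤ then S.ξ i ω * M.gbm B t q.price (clock (S.ρ i ω)) ω *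
    (M.impactExt (S.ξ i ω) (clock (S.ρ i ω) - S.lastTime ω i)).toReal else 0, ?_, ?_⟩
  · refine Measurable.ite (S.stopping i).measurableSet_eq_top.compl ?_ measurable_const
    refine (hξ.mul ?_).mul (((measurable_impactExt hf).comp
      (hξ.prodMk (hc.sub (measurable_lastTime i)))).ennreal_toReal)
    exact (hB.measurable_gbm_stopped (S.stopping i) q.price (S.start i)).mono
      (S.stopping i).measurableSpace_le le_rfl
  · filter_upwards [hB.gbm_ae_eq htT q.price, h.lag_mem hq] with ω h1 h2
    by_cases hk : S.ρ i ω = ⊤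
    · rw [if_neg (not_not.2 hk), if_neg (not_not.2 hk)]
    · rw [if_pos hk, if_pos hk, cost, impact, h1 _ (clock_le_horizon hk),
        impactExt_of_mem ⟨(h2 i hk).1.le, (h2 i hk).2⟩]

end Schedule

/-- A stopping time restricted to an event of its past is a stopping time. -/
theorem isStoppingTime_restrict {τ : Ω → WithTop ℝ≥0} (hτ : IsStoppingTime M.F τ) {A : Set Ω}
    (hA : MeasurableSet[hτ.measurableSpace] A) [∀ ω, Decidable (ω ∈ A)] :
    IsStoppingTime M.F fun ω => if ω ∈ A then τ ω else ⊤ := by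
  intro s
  have : {ω | (if ω ∈ A then τ ω else ⊤) ≤ (s : WithTop ℝ≥0)} =
      A ∩ {ω | τ ω ≤ (s : WithTop ℝ≥0)} := by
    ext ω
    simp only [mem_ofPred_eq, mem_inter_iff]
    by_cases hω : ω ∈ A
    · rw [if_pos hω]; tauto
    · rw [if_neg hω]
      exact ⟨fun h => absurd h (WithTop.not_top_le_coe s), fun h => absurd h.1 hω⟩
  rw [this]
  exact hA.2 s

theorem StopMeas.restrict {τ : Ω → WithTop ℝ≥0} (hτ : IsStoppingTime M.F τ) {A : Set Ω}
    (hA : MeasurableSet[hτ.measurableSpace] A) [∀ ω, Decidable (ω ∈ A)] {ξ : Ω → ℝ}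
    (hξ : StopMeas M τ ξ) : StopMeas M (fun ω => if ω ∈ A then τ ω else ⊤) ξ := by
  intro V hV
  refine ⟨(hξ V hV).1, fun s => ?_⟩
  have : ξ ⁻¹' V ∩ {ω | (if ω ∈ A then τ ω else ⊤) ≤ (s : WithTop ℝ≥0)} =
      (ξ ⁻¹' V ∩ A) ∩ {ω | τ ω ≤ (s : WithTop ℝ≥0)} := by
    ext ω
    simp only [mem_ofPred_eq, mem_inter_iff, mem_preimage]
    by_cases hω : ω ∈ A
    · rw [if_pos hω]; tauto
    · rw [if_neg hω]
      exact ⟨fun h => absurd h.2 (WithTop.not_top_le_coe s), fun h => absurd h.1.2 hω⟩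
  rw [this]
  exact ((hξ.measurable hτ hV).inter hA).2 s

namespace Strategy

variable (α : M.Strategy) (t : ℝ≥0) (q : State)

/-- The event that the trade number `k` takes place before `r`, and not at the time of the previous
one. -/
def keep (r : ℝ≥0) (k : ℕ) : Set Ω :=
  {ω | α.prevTime t q ω k < clock (α.τ k ω)} ∩ {ω | α.τ k ω < (r : WithTop ℝ≥0)}

variable {t q}

theorem measurable_clock_coe (k : ℕ) :
    Measurable[(α.stopping k).measurableSpace] fun ω => ((clock (α.τ k ω) : ℝ≥0) : ℝ) :=
  measurable_coe_nnreal_real.comp (measurable_clock (α.stopping k))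

theorem measurable_prevTime (k : ℕ) :
    Measurable[(α.stopping k).measurableSpace] fun ω => α.prevTime t q ω k := by
  cases k with
  | zero => exact measurable_const
  | succ k =>
    exact (α.measurable_clock_coe k).mono
      (IsStoppingTime.measurableSpace_mono _ _ fun ω => α.mono k ω) le_rfl

theorem measurableSet_keep (r : ℝ≥0) (k : ℕ) :
    MeasurableSet[(α.stopping k).measurableSpace] (α.keep t q r k) :=
  (measurableSet_lt (α.measurable_prevTime k) (α.measurable_clock_coe k)).inter
    ((α.stopping k).measurableSet_lt' r)

open Classical in
/-- The trading times of `α` before `r`, among its first `m` trades, without simultaneous trades. -/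
def keptTime (t : ℝ≥0) (q : State) (m : ℕ) (r : ℝ≥0) (k : ℕ) (ω : Ω) : WithTop ℝ≥0 :=
  if k < m then (if ω ∈ α.keep t q r k then α.τ k ω else ⊤) else ⊤

variable {α}

theorem keptTime_ne_top {m k : ℕ} {r : ℝ≥0} {ω : Ω} (h : α.keptTime t q m r k ω ≠ ⊤) :
    k < m ∧ ω ∈ α.keep t q r k ∧ α.keptTime t q m r k ω = α.τ k ω := by
  unfold keptTime at h ⊢
  by_cases hk : k < m
  · by_cases hω : ω ∈ α.keep t q r k
    · rw [if_pos hk, if_pos hω]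
      exact ⟨hk, hω, rfl⟩
    · rw [if_pos hk, if_neg hω] at h
      exact absurd rfl h
  · rw [if_neg hk] at h
    exact absurd rfl h

theorem clock_lt_clock {a b : WithTop ℝ≥0} (hb : b ≠ ⊤) (h : clock a < clock b) (ha : a ≠ ⊤) :
    a < b := by
  rw [← coe_clock ha, ← coe_clock hb]
  exact WithTop.coe_lt_coe.2 h

/-- The first `m` trades of a strategy before `r`, without the simultaneous ones. -/
def trim (α : M.Strategy) (hfrom : ∀ n ω, (t : WithTop ℝ≥0) ≤ α.τ n ω) (hq : 0 ≤ q.lag) (m : ℕ)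
    {r : ℝ≥0} (hrT : r ≤ M.T) : M.Schedule t q where
  n := m
  ρ := α.keptTime t q m r
  ξ := α.ζ
  stopping := fun k => by
    classical
    unfold keptTime
    by_cases hk : k < m
    · simp only [if_pos hk]
      exact isStoppingTime_restrict (α.stopping k) (α.measurableSet_keep r k)
    · simp only [if_neg hk]
      intro s
      convert! @MeasurableSet.empty _ (M.F s)
      exact eq_empty_of_forall_notMem fun ω h => WithTop.not_top_le_coe s h
  size_meas := fun k => by
    classical
    have h0 := stopMeas_of_measurable (α.stopping k) (α.size_measurable k)
    unfold keptTime
    by_cases hk : k < m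
    · simp only [if_pos hk]
      exact h0.restrict (α.stopping k) (α.measurableSet_keep r k)
    · simp only [if_neg hk]
      refine fun A hA => ⟨(h0 A hA).1, fun s => ?_⟩
      convert! @MeasurableSet.empty _ (M.F s)
      exact eq_empty_of_forall_notMem fun ω h => WithTop.not_top_le_coe s h.2
  start := fun k ω => by
    by_cases h : α.keptTime t q m r k ω = ⊤
    · rw [h]; exact le_top
    · rw [(keptTime_ne_top h).2.2]; exact hfrom k ω
  horizon := fun k ω => by
    by_cases h : α.keptTime t q m r k ω = ⊤
    · exact Or.inr h
    · obtain ⟨-, h1, h2⟩ := keptTime_ne_top h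
      rw [h2]
      exact Or.inl (h1.2.le.trans (WithTop.coe_le_coe.2 hrT))
  bounded := fun k ω hk => by
    by_contra h
    have := (keptTime_ne_top h).1
    omega
  -- Whether or not the trade `k - 1` is itself kept, `τ i ≤ τ (k - 1) < τ k`.
  strict := fun i k ω hik hi hk => by
    obtain ⟨-, hi1, hi2⟩ := keptTime_ne_top hi
    obtain ⟨-, hk1, hk2⟩ := keptTime_ne_top hk
    rw [hi2, hk2]
    obtain ⟨j, rfl⟩ : ∃ j, k = j + 1 := ⟨k - 1, by omega⟩
    have h1 : α.τ i ω ≤ α.τ j ω := α.monotone_τ ω (by omega)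
    have h2 : (clock (α.τ j ω) : ℝ) < clock (α.τ (j + 1) ω) := hk1.1
    have hk3 : α.τ (j + 1) ω ≠ ⊤ := hk1.2.ne_top
    have hj3 : α.τ j ω ≠ ⊤ := ne_top_of_le_ne_top hk3 (α.mono j ω)
    exact h1.trans_lt (clock_lt_clock hk3 (by exact_mod_cast h2) hj3)
  first := fun k ω hk => by
    obtain ⟨-, hk1, hk2⟩ := keptTime_ne_top hk
    rw [hk2]
    cases k with
    | zero => exact hk1.1
    | succ j =>
      have hk3 : α.τ (j + 1) ω ≠ ⊤ := hk1.2.ne_top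
      have hj3 : α.τ j ω ≠ ⊤ := ne_top_of_le_ne_top hk3 (α.mono j ω)
      have h2 : (clock (α.τ j ω) : ℝ) < clock (α.τ (j + 1) ω) := hk1.1
      have : (t : ℝ) ≤ clock (α.τ j ω) := by exact_mod_cast le_clock hj3 (hfrom j ω)
      linarith

theorem trim_lt {hfrom : ∀ n ω, (t : WithTop ℝ≥0) ≤ α.τ n ω} {hq : 0 ≤ q.lag} {m : ℕ} {r : ℝ≥0}
    {hrT : r ≤ M.T} (k : ℕ) (ω : Ω) (h : (α.trim hfrom hq m hrT).ρ k ω ≠ ⊤) :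
    (α.trim hfrom hq m hrT).ρ k ω < (r : WithTop ℝ≥0) := by
  obtain ⟨-, h1, h2⟩ := keptTime_ne_top h
  change α.keptTime t q m r k ω < _
  rw [h2]
  exact h1.2

end Strategy

theorem Schedule.measurable_lastTime_of_le {t : ℝ≥0} {q : State} (S : M.Schedule t q) {r : ℝ≥0}
    (h : ∀ k ω, S.ρ k ω ≠ ⊤ → S.ρ k ω ≤ (r : WithTop ℝ≥0)) (k : ℕ) :
    Measurable[M.F r] fun ω => S.lastTime ω k := by
  classical
  induction k with
  | zero => exact measurable_const
  | succ k ih =>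
    have h1 := Schedule.measurable_ite_ne_top (S.stopping k) (stopMeas_of_measurable (S.stopping k)
      (measurable_coe_nnreal_real.comp (measurable_clock (S.stopping k)))) (h k)
    have h2 : (fun ω => S.lastTime ω (k + 1)) = fun ω => if S.ρ k ω ≤ (r : WithTop ℝ≥0) then
        (if S.ρ k ω ≠ ⊤ then ((clock (S.ρ k ω) : ℝ≥0) : ℝ) else 0) else S.lastTime ω k := by
      funext ω
      rw [Schedule.lastTime]
      by_cases hk : S.ρ k ω = ⊤
      · rw [if_neg (not_not.2 hk), if_neg]
        rw [hk]
        exact WithTop.not_top_le_coe r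
      · rw [if_pos hk, if_pos (h k ω hk), if_pos hk]
    rw [h2]
    exact Measurable.ite (S.stopping k r) h1 ih

/-- The truncation of a strategy: its first `m` trades before `r`, without the simultaneous ones,
and the best partial sale at `r`. -/
def Strategy.truncate {t : ℝ≥0} {q : State} (α : M.Strategy)
    (hfrom : ∀ n ω, (t : WithTop ℝ≥0) ≤ α.τ n ω) (hq : 0 ≤ q.lag) (hf : M.BorelImpact) (m : ℕ)
    {r : ℝ≥0} (htr : t < r) (hrT : r ≤ M.T) : M.Schedule t q :=
  (α.trim hfrom hq m hrT).snoc htr hrT hq trim_lt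
    (η := fun ω => -M.bestSale m ((α.trim hfrom hq m hrT).sharesAt m ω)
      (r - (α.trim hfrom hq m hrT).lastTime ω m))
    (((measurable_bestSale hf m).comp (((α.trim hfrom hq m hrT).measurable_sharesAt
      fun i _ ω h => (trim_lt i ω h).le).prodMk
      (((α.trim hfrom hq m hrT).measurable_lastTime_of_le
        (fun i ω h => (trim_lt i ω h).le) m).const_sub _))).neg)

end Market

end Liquidation

/-! ### Pathwise study of the truncations. -/

namespace Liquidation

open Filter Topology

namespace Market

variable {Ω : Type*} [MeasurableSpace Ω] {M : Market Ω}

namespace Strategy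

variable (α : M.Strategy) (t : ℝ≥0) (q : State)

/-- The outcomes at which a strategy is admissible and the price path is continuous. -/
structure GoodAt (ω : Ω) : Prop where
  start : ∀ n, (t : WithTop ℝ≥0) ≤ α.τ n ω
  trade : ∀ n, α.τ n ω ≤ (M.T : WithTop ℝ≥0) →
      α.impact t q n ω ≠ ∞ ∧ α.stateAfter t q n ω ∈ M.closedRegion
  state : ∀ s : ℝ≥0, t ≤ s → s ≤ M.T → α.state t q s ω ∈ M.closedRegion
  path : ∃ g : ℝ≥0 → ℝ, Continuous g ∧ ∀ s ≤ M.T, M.price t q.price s ω = g s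

/-- The cash before the trade number `k`. -/
def cashBefore (k : ℕ) (ω : Ω) : ℝ := q.cash - ∑ i ∈ Finset.range k, α.cost t q i ω

/-- The shares before the trade number `k`. -/
def sharesBefore (k : ℕ) (ω : Ω) : ℝ := q.shares + ∑ i ∈ Finset.range k, α.ζ i ω

open Classical in
/-- The shares before the trade number `k`, ignoring the simultaneous trades. -/
def keptShares (k : ℕ) (ω : Ω) : ℝ :=
  q.shares + ∑ i ∈ Finset.range k, if α.prevTime t q ω i < clock (α.τ i ω) then α.ζ i ω else 0

variable {α t q} {ω : Ω}

theorem Admissible.ae_goodAt (h : α.Admissible t q) {B : ℝ≥0 → Ω → ℝ} (hB : ContVersion M B)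
    (ht : t ≤ M.T) : ∀ᵐ ω ∂M.prob, α.GoodAt t q ω := by
  filter_upwards [h.2, hB.gbm_ae_eq ht q.price] with ω h1 h2
  exact ⟨fun n => h.1 n ω, h1.1, h1.2, _, hB.continuous_gbm t q.price ω, fun s hs => (h2 s hs).symm⟩

theorem cashBefore_succ (k : ℕ) : α.cashBefore t q (k + 1) ω =
    α.cashBefore t q k ω - α.cost t q k ω := by
  rw [cashBefore, cashBefore, Finset.sum_range_succ]
  ring

theorem sharesBefore_succ (k : ℕ) : α.sharesBefore q (k + 1) ω =
    α.sharesBefore q k ω + α.ζ k ω := by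
  rw [sharesBefore, sharesBefore, Finset.sum_range_succ]
  ring

theorem GoodAt.prevTime_le (h : α.GoodAt t q ω) (hq : q ∈ M.domain) {k : ℕ} (hk : α.τ k ω ≠ ⊤) :
    α.prevTime t q ω k ≤ clock (α.τ k ω) := by
  cases k with
  | zero =>
    have h1 : (t : ℝ) ≤ clock (α.τ 0 ω) := by exact_mod_cast le_clock hk (h.start 0)
    have := hq.2.2.1
    change (t : ℝ) - q.lag ≤ _
    linarith
  | succ k =>
    change ((clock (α.τ k ω) : ℝ≥0) : ℝ) ≤ _
    have h1 : α.τ k ω ≤ ((clock (α.τ (k + 1) ω) : ℝ≥0) : WithTop ℝ≥0) := by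
      rw [coe_clock hk]; exact α.mono k ω
    exact_mod_cast clock_le h1

/-- At every time before `r` solvency bounds the lag by `T`; the bound extends to `r`, although the
state at `r` may already include trades. -/
theorem GoodAt.lag_le_of_no_trade (h : α.GoodAt t q ω) (hq : q ∈ M.domain) {r : ℝ≥0} (_ : t ≤ r)
    (hrT : r ≤ M.T) (hno : ∀ k, (r : WithTop ℝ≥0) ≤ α.τ k ω) : (r : ℝ) - (t - q.lag) ≤ M.T := by
  by_contra! hlt
  have hl := hq.2.2.2
  set s : ℝ := (r + max (t : ℝ) (M.T + t - q.lag)) / 2 with hs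
  have hm1 := le_max_left (t : ℝ) (M.T + t - q.lag)
  have hm2 := le_max_right (t : ℝ) (M.T + t - q.lag)
  have hm3 : max (t : ℝ) (M.T + t - q.lag) < r := max_lt (by linarith) (by linarith)
  have hs0 : (0 : ℝ) ≤ s := by have := NNReal.coe_nonneg t; linarith
  obtain ⟨s', hs'⟩ : ∃ s' : ℝ≥0, (s' : ℝ) = s := ⟨s.toNNReal, Real.coe_toNNReal s hs0⟩
  have hst : s' < r := by rw [← NNReal.coe_lt_coe, hs']; linarith
  have hno' : ∀ k, ¬ α.τ k ω ≤ (s' : WithTop ℝ≥0) := fun k hk =>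
    absurd (WithTop.coe_le_coe.1 ((hno k).trans hk)) (not_le.2 hst)
  have := ((M.mem_closedRegion_iff _).1 (h.state s'
    (by rw [← NNReal.coe_le_coe, hs']; linarith) (hst.le.trans hrT))).1.2.2.2
  rw [state_lag_of_no_trade hno'] at this
  linarith

theorem GoodAt.lagBefore_mem (h : α.GoodAt t q ω) (hq : q ∈ M.domain) {k : ℕ}
    (hk : α.τ k ω ≤ (M.T : WithTop ℝ≥0)) : α.lagBefore t q k ω ∈ Icc (0 : ℝ) M.T := by
  have hk' := ne_top_of_le_ne_top WithTop.coe_ne_top hk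
  refine ⟨sub_nonneg.2 (h.prevTime_le hq hk'), ?_⟩
  have hcT := clock_le hk
  cases k with
  | zero =>
    refine h.lag_le_of_no_trade hq (le_clock hk' (h.start 0)) hcT fun k => ?_
    rw [coe_clock hk']
    exact α.monotone_τ ω (Nat.zero_le k)
  | succ k =>
    have h1 : (0 : ℝ) ≤ clock (α.τ k ω) := NNReal.coe_nonneg _
    have h2 : (clock (α.τ (k + 1) ω) : ℝ) ≤ M.T := by exact_mod_cast hcT
    change (clock (α.τ (k + 1) ω) : ℝ) - clock (α.τ k ω) ≤ _
    linarith

/-- At zero lag a purchase has infinite impact, which admissibility excludes, and a sale yields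
nothing: a simultaneous trade merely gives shares away. -/
theorem GoodAt.dropped (h : α.GoodAt t q ω) (hq : q ∈ M.domain) (h2 : M.H2f) {k : ℕ}
    (hk : α.τ k ω ≤ (M.T : WithTop ℝ≥0)) (hd : ¬ α.prevTime t q ω k < clock (α.τ k ω)) :
    α.ζ k ω ≤ 0 ∧ α.cost t q k ω = 0 ∧ α.prevTime t q ω k = clock (α.τ k ω) := by
  have hk' := ne_top_of_le_ne_top WithTop.coe_ne_top hk
  have he := le_antisymm (h.prevTime_le hq hk') (not_lt.1 hd)
  have hl : α.lagBefore t q k ω = 0 := by rw [lagBefore, he, sub_self]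
  have himp := (h.trade k hk).1
  rw [impact, hl] at himp
  have hz : α.ζ k ω ≤ 0 := by
    by_contra! hpos
    exact himp (h2.purchase _ hpos)
  refine ⟨hz, ?_, he⟩
  rw [cost, impact, hl]
  rcases hz.lt_or_eq with hz | hz
  · rw [h2.sale _ hz]; simp
  · rw [hz]; simp

theorem GoodAt.nonneg_after (h : α.GoodAt t q ω) (h2 : M.H2f) {k : ℕ}
    (hk : α.τ k ω ≤ (M.T : WithTop ℝ≥0)) :
    0 ≤ α.cashBefore t q (k + 1) ω ∧ 0 ≤ α.sharesBefore q (k + 1) ω := by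
  obtain ⟨hd, hl⟩ := (M.mem_closedRegion_iff _).1 (h.trade k hk).2
  rw [liq_of_lag_zero h2 hd.1 rfl] at hl
  exact ⟨hl, hd.1⟩

theorem GoodAt.sharesBefore_le (h : α.GoodAt t q ω) (hq : q ∈ M.domain) (h2 : M.H2f) {K : ℕ}
    (hK : ∀ i < K, α.τ i ω ≤ (M.T : WithTop ℝ≥0)) :
    α.sharesBefore q K ω ≤ α.keptShares t q K ω := by
  refine add_le_add le_rfl (Finset.sum_le_sum fun i hi => ?_)
  split_ifs with hd
  · exact le_rfl
  · exact (h.dropped hq h2 (hK i (Finset.mem_range.1 hi)) hd).1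

theorem GoodAt.keptShares_nonneg (h : α.GoodAt t q ω) (hq : q ∈ M.domain) (h2 : M.H2f) {K : ℕ}
    (hK : ∀ i < K, α.τ i ω ≤ (M.T : WithTop ℝ≥0)) : 0 ≤ α.keptShares t q K ω := by
  refine le_trans ?_ (h.sharesBefore_le hq h2 hK)
  cases K with
  | zero => simpa [sharesBefore] using hq.1
  | succ K => exact (h.nonneg_after h2 (hK K K.lt_succ_self)).2

section Trim

variable {hfrom : ∀ n ω, (t : WithTop ℝ≥0) ≤ α.τ n ω} {hq0 : 0 ≤ q.lag} {m : ℕ} {r : ℝ≥0}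
    {hrT : r ≤ M.T} {K : ℕ}

theorem exists_count (α : M.Strategy) (ω : Ω) (m : ℕ) (r : ℝ≥0) : ∃ K ≤ m,
    ∀ i, (i < m ∧ α.τ i ω < (r : WithTop ℝ≥0)) ↔ i < K := by
  obtain ⟨K, hK, hmin⟩ := WellFounded.has_min (r := (· < ·)) wellFounded_lt
    {K | ¬ (K < m ∧ α.τ K ω < (r : WithTop ℝ≥0))} ⟨m, fun h => lt_irrefl _ h.1⟩
  have hKm : K ≤ m := not_lt.1 (hmin m fun h => lt_irrefl _ h.1)
  refine ⟨K, hKm, fun i => ⟨fun hi => ?_, fun hi => not_not.1 fun h => hmin i h hi⟩⟩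
  by_contra! hlt
  exact hK ⟨hlt.trans_lt hi.1, (α.monotone_τ ω hlt).trans_lt hi.2⟩

theorem trim_ρ_of_kept {k : ℕ} (hk : k < m ∧ α.τ k ω < (r : WithTop ℝ≥0))
    (hd : α.prevTime t q ω k < clock (α.τ k ω)) :
    (α.trim hfrom hq0 m hrT).ρ k ω = α.τ k ω := by
  change α.keptTime t q m r k ω = _
  rw [keptTime, if_pos hk.1, if_pos ⟨hd, hk.2⟩]

theorem trim_ρ_of_not {k : ℕ} (h : ¬ ((k < m ∧ α.τ k ω < (r : WithTop ℝ≥0)) ∧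
    α.prevTime t q ω k < clock (α.τ k ω))) : (α.trim hfrom hq0 m hrT).ρ k ω = ⊤ := by
  by_contra hne
  obtain ⟨h1, h2, -⟩ := keptTime_ne_top hne
  exact h ⟨⟨h1, h2.2⟩, h2.1⟩

/-- A deleted trade costs nothing and is made at the time of the previous one, so trimming alters
neither the cash nor the lags; only the shares change. -/
theorem GoodAt.trim_at (h : α.GoodAt t q ω) (hq : q ∈ M.domain) (h2 : M.H2f)
    (hK : ∀ i, (i < m ∧ α.τ i ω < (r : WithTop ℝ≥0)) ↔ i < K) {k : ℕ} (hk : k ≤ K) :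
    (α.trim hfrom hq0 m hrT).cashAt k ω = α.cashBefore t q k ω ∧
    (α.trim hfrom hq0 m hrT).sharesAt k ω = α.keptShares t q k ω ∧
    (α.trim hfrom hq0 m hrT).lastTime ω k = α.prevTime t q ω k := by
  induction k with
  | zero => simp [Schedule.cashAt, Schedule.sharesAt, Schedule.lastTime, cashBefore, keptShares,
      prevTime]
  | succ k ih =>
    obtain ⟨i1, i2, i3⟩ := ih (by omega)
    have hkm := (hK k).2 hk
    have hkT : α.τ k ω ≤ (M.T : WithTop ℝ≥0) := hkm.2.le.trans (WithTop.coe_le_coe.2 hrT)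
    rw [cashBefore_succ, keptShares, Finset.sum_range_succ, ← add_assoc]
    by_cases hd : α.prevTime t q ω k < clock (α.τ k ω)
    · have hρ := trim_ρ_of_kept (hfrom := hfrom) (hq0 := hq0) (hrT := hrT) hkm hd
      have hne : (α.trim hfrom hq0 m hrT).ρ k ω ≠ ⊤ := by rw [hρ]; exact hkm.2.ne_top
      rw [Schedule.cashAt_succ_of_ne _ hne, Schedule.sharesAt_succ_of_ne _ hne, i1, i2,
        Schedule.lastTime, if_pos hne, if_pos hd, hρ, Schedule.cost, Schedule.impact, i3, hρ]
      exact ⟨rfl, rfl, rfl⟩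
    · have hρ := trim_ρ_of_not (hfrom := hfrom) (hq0 := hq0) (hrT := hrT) (m := m) (r := r)
        (fun h => hd h.2)
      obtain ⟨d1, d2, d3⟩ := h.dropped hq h2 hkT hd
      rw [Schedule.cashAt_succ_of_eq _ hρ, Schedule.sharesAt_succ_of_eq _ hρ, i1, i2,
        Schedule.lastTime, if_neg (not_not.2 hρ), if_neg hd, d2, i3, d3]
      exact ⟨by ring, by rw [add_zero]; rfl, rfl⟩

theorem trim_const (hK : ∀ i, (i < m ∧ α.τ i ω < (r : WithTop ℝ≥0)) ↔ i < K) {k : ℕ} (hk : K ≤ k) :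
    (α.trim hfrom hq0 m hrT).cashAt k ω = (α.trim hfrom hq0 m hrT).cashAt K ω ∧
    (α.trim hfrom hq0 m hrT).sharesAt k ω = (α.trim hfrom hq0 m hrT).sharesAt K ω ∧
    (α.trim hfrom hq0 m hrT).lastTime ω k = (α.trim hfrom hq0 m hrT).lastTime ω K := by
  induction k, hk using Nat.le_induction with
  | base => exact ⟨rfl, rfl, rfl⟩
  | succ k hk ih =>
    have hρ := trim_ρ_of_not (α := α) (ω := ω) (hfrom := hfrom) (hq0 := hq0) (hrT := hrT) (m := m)
      (r := r) (k := k) (fun h => by have := (hK k).1 h.1; omega)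
    rw [Schedule.cashAt_succ_of_eq _ hρ, Schedule.sharesAt_succ_of_eq _ hρ,
      Schedule.lastTime, if_neg (not_not.2 hρ)]
    exact ih

variable {hf : M.BorelImpact} {htr : t < r}

/-- The lag at `r` when no other trade takes place there. -/
theorem GoodAt.lag_at_mem (h : α.GoodAt t q ω) (hq : q ∈ M.domain) (htr : t < r) (hrT : r ≤ M.T)
    (hKm : ∀ i < K, α.τ i ω < (r : WithTop ℝ≥0)) (hK : K ≠ 0 ∨ (r : WithTop ℝ≥0) ≤ α.τ 0 ω) :
    (r : ℝ) - α.prevTime t q ω K ∈ Ioc (0 : ℝ) M.T := by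
  have hr : (t : ℝ) < r := by exact_mod_cast htr
  have hrT' : (r : ℝ) ≤ M.T := by exact_mod_cast hrT
  cases K with
  | zero =>
    have := hq.2.2.1
    refine ⟨?_, h.lag_le_of_no_trade hq htr.le hrT fun k =>
      (hK.resolve_left (not_not.2 rfl)).trans (α.monotone_τ ω (Nat.zero_le k))⟩
    change 0 < (r : ℝ) - (t - q.lag)
    linarith
  | succ K =>
    have h1 := hKm K K.lt_succ_self
    have h2 : (clock (α.τ K ω) : ℝ) < r := by
      rw [← coe_clock h1.ne_top] at h1
      exact_mod_cast WithTop.coe_lt_coe.1 h1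
    have h3 : (0 : ℝ) ≤ clock (α.τ K ω) := NNReal.coe_nonneg _
    change (r : ℝ) - clock (α.τ K ω) ∈ _
    exact ⟨by linarith, by linarith⟩

theorem GoodAt.truncate_at (h : α.GoodAt t q ω) (hq : q ∈ M.domain) (h1 : M.H1f) (h2 : M.H2f)
    (hKm : K ≤ m) (hK : ∀ i, (i < m ∧ α.τ i ω < (r : WithTop ℝ≥0)) ↔ i < K)
    (hlag : (r : ℝ) - α.prevTime t q ω K ∈ Ioc (0 : ℝ) M.T) :
    (α.truncate hfrom hq0 hf m htr hrT).impact m ω ≠ ∞ ∧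
    (α.truncate hfrom hq0 hf m htr hrT).cashAt (m + 1) ω = α.cashBefore t q K ω +
      M.price t q.price r ω * M.proceeds (M.bestSale m (α.keptShares t q K ω)
        (r - α.prevTime t q ω K)) (r - α.prevTime t q ω K) ∧
    0 ≤ (α.truncate hfrom hq0 hf m htr hrT).sharesAt (m + 1) ω := by
  have hKT : ∀ i < K, α.τ i ω ≤ (M.T : WithTop ℝ≥0) := fun i hi =>
    ((hK i).2 hi).2.le.trans (WithTop.coe_le_coe.2 hrT)
  obtain ⟨c1, c2, c3⟩ := h.trim_at (hfrom := hfrom) (hq0 := hq0) (hrT := hrT) hq h2 hK le_rfl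
  obtain ⟨d1, d2, d3⟩ := trim_const (hfrom := hfrom) (hq0 := hq0) (hrT := hrT) hK hKm
  rw [c1] at d1; rw [c2] at d2; rw [c3] at d3
  set Y := α.keptShares t q K ω with hY
  set θ := (r : ℝ) - α.prevTime t q ω K with hθ
  have hmem := bestSale_mem (M := M) m (h.keptShares_nonneg hq h2 hKT) θ
  set S₀ := α.trim hfrom hq0 m hrT with hS₀
  have hS : α.truncate hfrom hq0 hf m htr hrT = S₀.snoc htr hrT hq0 trim_lt
    (η := fun ω => -M.bestSale m (S₀.sharesAt m ω) (r - S₀.lastTime ω m)) _ := rfl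
  set S := α.truncate hfrom hq0 hf m htr hrT with hSdef
  have hρ : S.ρ m ω = (r : WithTop ℝ≥0) := by
    have : S.ρ m = fun _ => (r : WithTop ℝ≥0) := if_pos rfl
    rw [this]
  have hξ : S.ξ m ω = -M.bestSale m Y θ := by
    have : S.ξ m = fun ω => -M.bestSale m (S₀.sharesAt m ω) (r - S₀.lastTime ω m) := if_pos rfl
    rw [this]
    simp only [d2, d3]
    rfl
  have hne : S.ρ m ω ≠ ⊤ := by rw [hρ]; exact WithTop.coe_ne_top
  have hlast : S.lastTime ω m = α.prevTime t q ω K := by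
    rw [← d3]; exact Schedule.snoc_lastTime (S := S₀) le_rfl ω
  have hcash : S.cashAt m ω = α.cashBefore t q K ω := by
    rw [← d1]; exact Schedule.snoc_cashAt (S := S₀) le_rfl ω
  have hsh : S.sharesAt m ω = Y := by
    rw [← d2]; exact Schedule.snoc_sharesAt (S := S₀) le_rfl ω
  have himp : S.impact m ω = M.f (-M.bestSale m Y θ) θ := by
    rw [Schedule.impact, hρ, hξ, hlast]; rfl
  refine ⟨?_, ?_, ?_⟩
  · rw [himp]
    exact ne_top_of_le_ne_top ENNReal.one_ne_top
      (impact_le_one_of_nonpos h1 (by linarith [hmem.1]) ⟨hlag.1.le, hlag.2⟩)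
  · rw [Schedule.cashAt_succ_of_ne _ hne, hcash, Schedule.cost, himp, hρ, hξ, proceeds,
      impactExt_of_mem ⟨hlag.1.le, hlag.2⟩]
    change _ - _ * M.price t q.price r ω * _ = _
    ring
  · rw [Schedule.sharesAt_succ_of_ne _ hne, hsh, hξ]
    linarith [hmem.2]

theorem state_of_no_trade {s : ℝ≥0} (h : ∀ k, ¬ α.τ k ω ≤ (s : WithTop ℝ≥0)) :
    α.state t q s ω = ⟨q.cash, q.shares, M.price t q.price s ω, s - (t - q.lag)⟩ := by
  have h0 : ∀ k, α.τ k ω ≤ (s : WithTop ℝ≥0) ↔ k < 0 :=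
    fun k => ⟨fun h' => absurd h' (h k), fun h' => absurd h' (Nat.not_lt_zero k)⟩
  have e1 := state_cash_eq (t := t) (q := q) h0
  have e2 := state_shares_eq (t := t) (q := q) h0
  have e3 := state_lag_of_no_trade (t := t) (q := q) h
  have e4 : (α.state t q s ω).price = M.price t q.price s ω := rfl
  simp only [Finset.range_zero, Finset.sum_empty, sub_zero, add_zero] at e1 e2
  rw [← e1, ← e2, ← e3, ← e4]

/-- The liquidation value at `r` is nonnegative when no trade takes place before. -/
theorem GoodAt.liq_nonneg_of_no_trade (h : α.GoodAt t q ω) (hq : q ∈ M.domain) (h1 : M.H1f)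
    (hc : M.Hcf) (htr : t < r) (hrT : r ≤ M.T) (hno : ∀ k, (r : WithTop ℝ≥0) ≤ α.τ k ω) :
    0 ≤ q.cash + M.price t q.price r ω * M.proceeds q.shares (r - (t - q.lag)) := by
  have hlag : (r : ℝ) - (t - q.lag) ∈ Ioc (0 : ℝ) M.T :=
    h.lag_at_mem (K := 0) hq htr hrT (fun i hi => absurd hi (Nat.not_lt_zero i)) (Or.inr (hno 0))
  -- The state of the strategy at `r` may include trades made at `r`, so solvency is used at earlier
  -- times and passed to the limit.
  obtain ⟨s, hsm, hs, hst⟩ := exists_seq_strictMono_tendsto' htr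
  obtain ⟨g, hg, hgp⟩ := h.path
  have hL : ∀ n, 0 ≤ q.cash + M.price t q.price (s n) ω * M.proceeds q.shares (s n - (t - q.lag)) ∧
      (s n : ℝ) - (t - q.lag) ∈ Icc (0 : ℝ) M.T := by
    intro n
    have hno' : ∀ k, ¬ α.τ k ω ≤ (s n : WithTop ℝ≥0) := fun k hk =>
      absurd (WithTop.coe_le_coe.1 ((hno k).trans hk)) (not_le.2 (hs n).2)
    have := (M.mem_closedRegion_iff _).1 (h.state (s n) (hs n).1.le ((hs n).2.le.trans hrT))
    rw [state_of_no_trade hno'] at this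
    refine ⟨?_, this.1.2.2⟩
    rw [liq_eq_proceeds this.1.2.2] at this
    exact this.2
  rcases hq.1.eq_or_lt with hy | hy
  · have := (hL 0).1
    rw [← hy, proceeds_zero, mul_zero] at this ⊢
    exact this
  · have hlim : Tendsto (fun n => q.cash + M.price t q.price (s n) ω *
        M.proceeds q.shares (s n - (t - q.lag))) atTop
        (𝓝 (q.cash + M.price t q.price r ω * M.proceeds q.shares (r - (t - q.lag)))) := by
      refine tendsto_const_nhds.add (Tendsto.mul ?_ ?_)
      · rw [hgp r hrT]
        simp only [hgp _ ((hs _).2.le.trans hrT)]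
        exact (hg.tendsto r).comp hst
      · have hst' : Tendsto (fun n => (s n : ℝ) - (t - q.lag)) atTop (𝓝 ((r : ℝ) - (t - q.lag))) :=
          ((NNReal.tendsto_coe.2 hst).sub_const _)
        refine hc.tendsto_proceeds h1 hy hlag tendsto_const_nhds hst' ?_
        filter_upwards [hst'.eventually_const_lt hlag.1] with n hn
        exact ⟨hn, (hL n).2.2⟩
    exact ge_of_tendsto' hlim fun n => (hL n).1

/-- After a trade the cash is nonnegative, and a sale adds to it. Before any trade there may be a
debt, but the best sale yields at least as much as the full sale, which repays it. -/
theorem GoodAt.truncate_cash_nonneg (h : α.GoodAt t q ω) (hq : q ∈ M.domain) (h1 : M.H1f)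
    (h2 : M.H2f) (hc : M.Hcf) (htr : t < r) (hrT : r ≤ M.T) (hKr : ∀ i < K, α.τ i ω < (r : WithTop ℝ≥0))
    (hK' : K ≠ 0 ∨ (r : WithTop ℝ≥0) ≤ α.τ 0 ω) (m : ℕ) :
    0 ≤ α.cashBefore t q K ω + M.price t q.price r ω * M.proceeds (M.bestSale m
      (α.keptShares t q K ω) (r - α.prevTime t q ω K)) (r - α.prevTime t q ω K) := by
  have hKT : ∀ i < K, α.τ i ω ≤ (M.T : WithTop ℝ≥0) := fun i hi =>
    (hKr i hi).le.trans (WithTop.coe_le_coe.2 hrT)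
  have hP := price_pos (M := M) hq.2.1 t r ω
  cases K with
  | zero =>
    have hno := hK'.resolve_left (not_not.2 rfl)
    have := h.liq_nonneg_of_no_trade hq h1 hc htr hrT fun k => hno.trans (α.monotone_τ ω k.zero_le)
    have hle := proceeds_le_bestSale (M := M) m q.shares (r - (t - q.lag))
    have e1 : α.cashBefore t q 0 ω = q.cash := by simp [cashBefore]
    have e2 : α.keptShares t q 0 ω = q.shares := by simp [keptShares]
    rw [e1, e2]
    change 0 ≤ _ + _ * M.proceeds (M.bestSale m q.shares (r - (t - q.lag))) (r - (t - q.lag))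
    nlinarith
  | succ K =>
    have h3 := (h.nonneg_after h2 (hKT K K.lt_succ_self)).1
    have h4 := proceeds_nonneg (M := M) (θ := r - α.prevTime t q ω (K + 1))
      (bestSale_mem (M := M) m (h.keptShares_nonneg hq h2 hKT) (r - α.prevTime t q ω (K + 1))).1
    positivity

theorem truncate_valid (hq : q ∈ M.closedRegion) (h1 : M.H1f) (h2 : M.H2f) (hc : M.Hcf)
    (hm : 0 < m) (hrT' : r < M.T) (hgood : ∀ᵐ ω ∂M.prob, α.GoodAt t q ω) :
    (α.truncate hfrom hq0 hf m htr hrT).Valid := by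
  have hq' := ((M.mem_closedRegion_iff q).1 hq).1
  set S₀ := α.trim hfrom hq0 m hrT with hS₀
  set S := α.truncate hfrom hq0 hf m htr hrT with hSdef
  have hρ : ∀ ω, S.ρ m ω = (r : WithTop ℝ≥0) := fun ω => by
    have : S.ρ m = fun _ => (r : WithTop ℝ≥0) := if_pos rfl
    rw [this]
  have hρ' : ∀ k, k ≠ m → S.ρ k = S₀.ρ k := fun k hk => if_neg hk
  have hK0 : ∀ {ω : Ω} {K : ℕ}, K ≤ m →
      (∀ i, (i < m ∧ α.τ i ω < (r : WithTop ℝ≥0)) ↔ i < K) → K ≠ 0 ∨ (r : WithTop ℝ≥0) ≤ α.τ 0 ω := by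
    intro ω K hKm hK
    by_cases h : K = 0
    · right
      by_contra! hlt
      have := (hK 0).1 ⟨hm, hlt⟩
      omega
    · exact Or.inl h
  refine ⟨fun k ω hk => ?_, ?_, ?_⟩
  · by_cases h : k = m
    · rw [h, hρ]; exact WithTop.coe_lt_coe.2 hrT'
    · rw [hρ' k h] at hk ⊢
      exact (trim_lt k ω hk).trans (WithTop.coe_lt_coe.2 hrT')
  · filter_upwards [hgood] with ω hω k hk
    obtain ⟨K, hKm, hK⟩ := exists_count α ω m r
    have hKr : ∀ i < K, α.τ i ω < (r : WithTop ℝ≥0) := fun i hi => ((hK i).2 hi).2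
    by_cases h : k = m
    · subst h
      have hlag := hω.lag_at_mem hq' htr hrT hKr (hK0 hKm hK)
      obtain ⟨a1, a2, a3⟩ := hω.truncate_at (hfrom := hfrom) (hq0 := hq0) (hf := hf) (htr := htr)
        (hrT := hrT) hq' h1 h2 hKm hK hlag
      refine ⟨a1, ?_, a3⟩
      rw [a2]
      exact hω.truncate_cash_nonneg hq' h1 h2 hc htr hrT hKr (hK0 hKm hK) k
    · rw [hρ' k h] at hk
      obtain ⟨hk1, hk2, hk3⟩ := keptTime_ne_top hk
      have hkK : k + 1 ≤ K := (hK k).1 ⟨hk1, hk2.2⟩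
      have hkT : α.τ k ω ≤ (M.T : WithTop ℝ≥0) := hk2.2.le.trans (WithTop.coe_le_coe.2 hrT)
      have e1 : S.impact k ω = S₀.impact k ω := Schedule.snoc_impact (S := S₀) hk1 ω
      have e2 : S.cashAt (k + 1) ω = S₀.cashAt (k + 1) ω := Schedule.snoc_cashAt (S := S₀) hk1 ω
      have e3 : S.sharesAt (k + 1) ω = S₀.sharesAt (k + 1) ω :=
        Schedule.snoc_sharesAt (S := S₀) hk1 ω
      obtain ⟨c1, c2, -⟩ := hω.trim_at (hfrom := hfrom) (hq0 := hq0) (hrT := hrT) hq' h2 hK hkK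
      obtain ⟨-, -, c3⟩ := hω.trim_at (hfrom := hfrom) (hq0 := hq0) (hrT := hrT) hq' h2 hK
        (k.le_succ.trans hkK)
      have himp : S₀.impact k ω = α.impact t q k ω := by
        rw [Schedule.impact, c3]
        change M.f (α.ζ k ω) (clock (α.keptTime t q m r k ω) - _) = _
        rw [hk3]
        rfl
      rw [e1, e2, e3, c1, c2, himp]
      exact ⟨(hω.trade k hkT).1, (hω.nonneg_after h2 hkT).1, hω.keptShares_nonneg hq' h2
        fun i hi => (hKr i (by omega)).le.trans (WithTop.coe_le_coe.2 hrT)⟩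
  · filter_upwards [hgood] with ω hω s hts hsT hno
    have hsr : s < r := by
      by_contra! hrs
      exact hno m (by rw [hρ]; exact WithTop.coe_le_coe.2 hrs)
    -- If the strategy trades by time `s` while no trade is kept, its first trade was deleted as
    -- simultaneous with the initial time `t - θ`. Then `θ = 0`, and solvency of `q` says that its
    -- cash is nonnegative.
    by_cases h0 : α.τ 0 ω ≤ (s : WithTop ℝ≥0)
    · have h0r : α.τ 0 ω < (r : WithTop ℝ≥0) := h0.trans_lt (WithTop.coe_lt_coe.2 hsr)
      have hd : ¬ α.prevTime t q ω 0 < clock (α.τ 0 ω) := fun hd => by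
        apply hno 0
        rw [hρ' 0 hm.ne]
        exact (trim_ρ_of_kept ⟨hm, h0r⟩ hd).trans_le h0
      have h3 : (t : ℝ) ≤ clock (α.τ 0 ω) := by exact_mod_cast le_clock h0r.ne_top (hω.start 0)
      have h4 : (clock (α.τ 0 ω) : ℝ) ≤ t - q.lag := not_lt.1 hd
      have hl0 : q.lag = 0 := le_antisymm (by linarith) hq'.2.2.1
      have hx : 0 ≤ q.cash := by
        have := ((M.mem_closedRegion_iff q).1 hq).2
        rwa [liq_of_lag_zero h2 hq'.1 hl0] at this
      refine mem_closedRegion_of_cash_nonneg hx hq'.1 (price_pos hq'.2.1 _ _ _) ?_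
      have h5 : (t : ℝ) ≤ s := by exact_mod_cast hts
      have h6 : (s : ℝ) ≤ M.T := by exact_mod_cast hsT
      have h7 := NNReal.coe_nonneg t
      change (s : ℝ) - (t - q.lag) ∈ _
      rw [hl0]
      exact ⟨by linarith, by linarith⟩
    · have hno' : ∀ k, ¬ α.τ k ω ≤ (s : WithTop ℝ≥0) := fun k hk =>
        h0 ((α.monotone_τ ω k.zero_le).trans hk)
      have := hω.state s hts hsT
      rwa [state_of_no_trade hno'] at this

end Trim

end Strategy

end Market

end Liquidation

/-! ### Convergence of the truncations and the first assertion. -/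

namespace Liquidation

open Filter Topology

namespace Market

variable {Ω : Type*} [MeasurableSpace Ω] {M : Market Ω}

namespace Strategy

variable {α : M.Strategy} {t : ℝ≥0} {q : State} {ω : Ω}

theorem GoodAt.tendsto_price (h : α.GoodAt t q ω) {r : ℕ → ℝ≥0} {s : ℝ≥0} (hr : ∀ n, r n ≤ M.T)
    (hs : s ≤ M.T) (hrs : Tendsto r atTop (𝓝 s)) :
    Tendsto (fun n => M.price t q.price (r n) ω) atTop (𝓝 (M.price t q.price s ω)) := by
  obtain ⟨g, hg, hgp⟩ := h.path
  rw [hgp s hs]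
  simp only [hgp _ (hr _)]
  exact (hg.tendsto s).comp hrs

/-- Lower bounds of the terminal cash of the truncations, when finitely many trades take place
before the horizon. -/
theorem GoodAt.eventually_le_of_finite (h : α.GoodAt t q ω) (hq : q ∈ M.domain) (h1 : M.H1f)
    (h2 : M.H2f) (hc : M.Hcf) {r : ℕ → ℝ≥0} (hr : ∀ n, r n < M.T)
    (hrT : Tendsto r atTop (𝓝 M.T)) {K : ℕ}
    (hK : ∀ i, α.τ i ω < (M.T : WithTop ℝ≥0) ↔ i < K) {c : ℝ}
    (hcX : c < (α.state t q M.T ω).cash) :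
    ∀ᶠ n in atTop, c ≤ α.cashBefore t q K ω + M.price t q.price (r n) ω *
      M.proceeds (M.bestSale (n + 1) (α.keptShares t q K ω) (r n - α.prevTime t q ω K))
        (r n - α.prevTime t q ω K) := by
  have hKT : ∀ i < K, α.τ i ω ≤ (M.T : WithTop ℝ≥0) := fun i hi => ((hK i).2 hi).le
  have hY := h.keptShares_nonneg hq h2 hKT
  set Y := α.keptShares t q K ω with hYdef
  -- Among the trades made at `T`, only the first can have a positive lag; the others cost nothing.
  have hX : (α.state t q M.T ω).cash = α.cashBefore t q K ω -
      if α.τ K ω = (M.T : WithTop ℝ≥0) then α.cost t q K ω else 0 := by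
    have : (α.state t q M.T ω).cash = α.cashBefore t q (K + 1) ω + α.cost t q K ω -
        if α.τ K ω = (M.T : WithTop ℝ≥0) then α.cost t q K ω else 0 := by
      simp only [Strategy.state, cashBefore]
      rw [tsum_eq_sum (s := Finset.range (K + 1)), Finset.sum_range_succ, Finset.sum_range_succ]
      · have e1 : ∑ i ∈ Finset.range K, (if α.τ i ω ≤ (M.T : WithTop ℝ≥0) then α.cost t q i ω else 0) =
            ∑ i ∈ Finset.range K, α.cost t q i ω :=
          Finset.sum_congr rfl fun i hi => if_pos (hKT i (Finset.mem_range.1 hi))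
        have e2 : (if α.τ K ω ≤ (M.T : WithTop ℝ≥0) then α.cost t q K ω else 0) =
            if α.τ K ω = (M.T : WithTop ℝ≥0) then α.cost t q K ω else 0 := by
          have hKn : ¬ α.τ K ω < (M.T : WithTop ℝ≥0) := fun h => lt_irrefl _ ((hK K).1 h)
          by_cases hle : α.τ K ω ≤ (M.T : WithTop ℝ≥0)
          · rw [if_pos hle, if_pos (le_antisymm hle (not_lt.1 hKn))]
          · rw [if_neg hle, if_neg fun he => hle he.le]
        rw [e1, e2]
        ring
      · intro k hk
        have hk' : K < k := by simpa using hk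
        split_ifs with hkT
        · refine (h.dropped hq h2 hkT ?_).2.1
          obtain ⟨j, rfl⟩ : ∃ j, k = j + 1 := ⟨k - 1, by omega⟩
          have hj : (M.T : WithTop ℝ≥0) ≤ α.τ j ω := by
            by_contra! hlt
            have := (hK j).1 hlt
            omega
          have hj' : α.τ j ω ≠ ⊤ := ne_top_of_le_ne_top WithTop.coe_ne_top ((α.mono j ω).trans hkT)
          have a1 := le_clock hj' hj
          have a2 := clock_le hkT
          change ¬ ((clock (α.τ j ω) : ℝ≥0) : ℝ) < _
          rw [not_lt]
          exact_mod_cast a2.trans a1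
        · rfl
    rw [this, cashBefore_succ]
    ring
  have hbest : ∀ n, 0 ≤ M.price t q.price (r n) ω * M.proceeds (M.bestSale (n + 1) Y
      (r n - α.prevTime t q ω K)) (r n - α.prevTime t q ω K) := fun n =>
    mul_nonneg (price_pos hq.2.1 _ _ _).le (proceeds_nonneg (bestSale_mem _ hY _).1)
  have htriv : c ≤ α.cashBefore t q K ω → ∀ᶠ n in atTop, c ≤ α.cashBefore t q K ω +
      M.price t q.price (r n) ω * M.proceeds (M.bestSale (n + 1) Y
        (r n - α.prevTime t q ω K)) (r n - α.prevTime t q ω K) := fun hle =>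
    Eventually.of_forall fun n => by have := hbest n; linarith
  rw [hX] at hcX
  by_cases hKeq : α.τ K ω = (M.T : WithTop ℝ≥0)
  swap
  · rw [if_neg hKeq] at hcX
    exact htriv (by linarith)
  rw [if_pos hKeq] at hcX
  by_cases hd : α.prevTime t q ω K < clock (α.τ K ω)
  swap
  · rw [(h.dropped hq h2 hKeq.le hd).2.1] at hcX
    exact htriv (by linarith)
  have hclock : clock (α.τ K ω) = M.T := by rw [hKeq]; rfl
  -- A purchase at `T` only lowers the cash, so doing nothing is good enough; only a sale has to be
  -- imitated.
  rcases le_or_gt 0 (α.ζ K ω) with hz | hz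
  · have : 0 ≤ α.cost t q K ω :=
      mul_nonneg (mul_nonneg hz (price_pos hq.2.1 _ _ _).le) ENNReal.toReal_nonneg
    exact htriv (by linarith)
  set e := -α.ζ K ω with he
  have he0 : 0 < e := by rw [he]; linarith
  have heY : e ≤ Y := by
    have := (h.nonneg_after h2 hKeq.le).2
    rw [sharesBefore_succ] at this
    have := h.sharesBefore_le hq h2 hKT
    linarith
  have hlag : (M.T : ℝ) - α.prevTime t q ω K ∈ Ioc (0 : ℝ) M.T := by
    have := (h.lagBefore_mem hq hKeq.le).2
    rw [lagBefore, hclock] at this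
    rw [hclock] at hd
    exact ⟨by linarith, this⟩
  set θ := (M.T : ℝ) - α.prevTime t q ω K with hθ
  have hcost : -α.cost t q K ω = M.price t q.price M.T ω * M.proceeds e θ := by
    rw [cost, impact, lagBefore, hclock, proceeds, impactExt_of_mem ⟨hlag.1.le, hlag.2⟩, he, neg_neg]
    ring
  have hY0 : 0 < Y := he0.trans_le heY
  -- The sale concerns a fraction `e / Y` of the shares kept. A nearby fraction of the dense
  -- sequence yields almost as much at `T`, hence also at `r n` for large `n`.
  obtain ⟨j, hj0, hj⟩ : ∃ j, 0 < fraction j ∧ c < α.cashBefore t q K ω +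
      M.price t q.price M.T ω * M.proceeds (fraction j * Y) θ := by
    have hlim : Tendsto (fun u : ℝ => α.cashBefore t q K ω + M.price t q.price M.T ω *
        M.proceeds (u * Y) θ) (𝓝 (e / Y)) (𝓝 (α.cashBefore t q K ω + M.price t q.price M.T ω *
        M.proceeds e θ)) := by
      refine tendsto_const_nhds.add (tendsto_const_nhds.mul ?_)
      refine hc.tendsto_proceeds h1 he0 hlag ?_ tendsto_const_nhds
        (Eventually.of_forall fun _ => hlag)
      have : Tendsto (fun u : ℝ => u * Y) (𝓝 (e / Y)) (𝓝 (e / Y * Y)) := tendsto_id.mul_const _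
      rwa [div_mul_cancel₀ _ hY0.ne'] at this
    have hev := (hlim.eventually_const_lt (show c < _ by linarith)).and
      (lt_mem_nhds (show 0 < e / Y by positivity))
    obtain ⟨j, hj⟩ := exists_fraction_mem ⟨by positivity, (div_le_one hY0).2 heY⟩ hev
    exact ⟨j, hj.2, hj.1⟩
  have hst : Tendsto (fun n => (r n : ℝ) - α.prevTime t q ω K) atTop (𝓝 θ) :=
    (NNReal.tendsto_coe.2 hrT).sub_const _
  have hlim : Tendsto (fun n => α.cashBefore t q K ω + M.price t q.price (r n) ω *
      M.proceeds (fraction j * Y) (r n - α.prevTime t q ω K)) atTop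
      (𝓝 (α.cashBefore t q K ω + M.price t q.price M.T ω * M.proceeds (fraction j * Y) θ)) := by
    refine tendsto_const_nhds.add (Tendsto.mul
      (h.tendsto_price (fun n => (hr n).le) le_rfl hrT) ?_)
    refine hc.tendsto_proceeds h1 (by positivity) hlag tendsto_const_nhds hst ?_
    filter_upwards [hst.eventually_const_lt hlag.1] with n hn
    have : (r n : ℝ) < M.T := by exact_mod_cast hr n
    exact ⟨hn, by have := hlag.2; rw [hθ] at this; linarith⟩
  filter_upwards [hlim.eventually_const_lt hj, eventually_ge_atTop j] with n hn hjn
  have hle := proceeds_fraction_le (M := M) (show j < n + 1 by omega) Y (r n - α.prevTime t q ω K)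
  have hP := price_pos (M := M) hq.2.1 t (r n) ω
  nlinarith

/-- Lower bounds of the terminal cash of the truncations, when infinitely many trades take place
before the horizon. -/
theorem GoodAt.eventually_le_of_infinite (h : α.GoodAt t q ω) (hq : q ∈ M.domain)
    (h2 : M.H2f) (h3 : M.H3f)
    (hinf : ∀ i, α.τ i ω < (M.T : WithTop ℝ≥0)) {c : ℝ}
    (hcX : c < (α.state t q M.T ω).cash) : ∀ᶠ k in atTop, c ≤ α.cashBefore t q k ω := by
  obtain ⟨κb, hκb, hb⟩ := h3.exists_bid
  obtain ⟨κa, hκa, ha⟩ := h3.exists_ask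
  have hT : ∀ k, α.τ k ω ≤ (M.T : WithTop ℝ≥0) := fun k => (hinf k).le
  have hmono : Monotone fun k => clock (α.τ k ω) := fun i j hij => by
    have := α.monotone_τ ω hij
    have h' : α.τ i ω ≤ ((clock (α.τ j ω) : ℝ≥0) : WithTop ℝ≥0) := by
      rw [coe_clock (hinf j).ne_top]; exact this
    exact clock_le h'
  have hbdd : BddAbove (range fun k => clock (α.τ k ω)) :=
    ⟨M.T, by rintro _ ⟨k, rfl⟩; exact clock_le (hT k)⟩
  have hlim := tendsto_atTop_ciSup hmono hbdd
  have hsT : (⨆ k, clock (α.τ k ω)) ≤ M.T := ciSup_le fun k => clock_le (hT k)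
  have hP := h.tendsto_price (fun k => clock_le (hT k)) hsT hlim
  -- Without summability the `tsum` in the terminal cash would be the default value `0`, unrelated
  -- to the cash after each trade.
  have hsum : Summable fun k => α.cost t q k ω := by
    refine summable_cost_of_spread (x := fun k => α.cashBefore t q k ω)
      (y := fun k => α.sharesBefore q k ω) (ζ := fun k => α.ζ k ω)
      (P := fun k => M.price t q.price (clock (α.τ k ω)) ω)
      (g := fun k => (α.impact t q k ω).toReal) (fun k => cashBefore_succ k)
      (fun k => sharesBefore_succ k) (fun k => rfl) (fun k => (h.nonneg_after h2 (hT k)).1)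
      (fun k => (h.nonneg_after h2 (hT k)).2) (fun k => price_pos hq.2.1 _ _ _) hP
      (price_pos hq.2.1 _ _ _) hκb hκa (fun k => ENNReal.toReal_nonneg) (fun k hk => ?_)
      (fun k hk => ?_)
    · exact hb _ hk _ (h.lagBefore_mem hq (hT k))
    · exact ha _ hk _ (h.lagBefore_mem hq (hT k)) (h.trade k (hT k)).1
  have hX : Tendsto (fun k => α.cashBefore t q k ω) atTop (𝓝 (α.state t q M.T ω).cash) := by
    have : (α.state t q M.T ω).cash = q.cash - ∑' k, α.cost t q k ω := by
      simp only [Strategy.state, if_pos (hT _)]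
    rw [this]
    exact hsum.hasSum.tendsto_sum_nat.const_sub _
  filter_upwards [hX.eventually_const_lt hcX] with k hk
  exact hk.le

end Strategy

/-- Every liquidating strategy is dominated by the truncations. -/
theorem Strategy.Liquidating.expectedUtility_le [IsProbabilityMeasure M.prob]
    (hF : M.UsualConditions) (hW : M.IsBrownianMotion) (hf : M.BorelImpact)
    (h1 : M.H1f) (h2 : M.H2f) (h3 : M.H3f) (hc : M.Hcf) (hU : M.HU) {t : ℝ≥0} {q : State}
    (htT : t < M.T) (hq : q ∈ M.closedRegion) {α : M.Strategy} (hα : α.Liquidating t q) :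
    α.expectedUtility t q ≤ ⨆ S ∈ {S : M.Schedule t q | S.Valid ∧ ∃ r < M.T, ∀ k ω, S.ρ k ω ≠ ⊤ →
      S.ρ k ω ≤ (r : WithTop ℝ≥0)}, S.payoff := by
  obtain ⟨B, hB⟩ := exists_contVersion hF hW
  have hq' := ((M.mem_closedRegion_iff q).1 hq).1
  have hgood := hα.1.ae_goodAt hB htT.le
  obtain ⟨r, hrm, hr, hrT⟩ := exists_seq_strictMono_tendsto' htT
  set S : ℕ → M.Schedule t q := fun n =>
    α.truncate hα.1.1 hq'.2.2.1 hf (n + 1) (hr n).1 (hr n).2.le with hS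
  have hvalid : ∀ n, (S n).Valid := fun n =>
    Strategy.truncate_valid hq h1 h2 hc n.succ_pos (hr n).2 hgood
  have hcash : ∀ᵐ ω ∂M.prob, ∀ c, c < (α.state t q M.T ω).cash → ∀ᶠ n in atTop,
      c ≤ (S n).cashAt (S n).n ω := by
    filter_upwards [hgood] with ω hω c hcX
    have hval : ∀ n K, K ≤ n + 1 → (∀ i, (i < n + 1 ∧ α.τ i ω < (r n : WithTop ℝ≥0)) ↔ i < K) →
        (S n).cashAt (S n).n ω = α.cashBefore t q K ω + M.price t q.price (r n) ω *
          M.proceeds (M.bestSale (n + 1) (α.keptShares t q K ω) (r n - α.prevTime t q ω K))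
          (r n - α.prevTime t q ω K) := by
      intro n K hKn hK
      refine (hω.truncate_at hq' h1 h2 hKn hK ?_).2.1
      refine hω.lag_at_mem hq' (hr n).1 (hr n).2.le (fun i hi => ((hK i).2 hi).2) ?_
      by_cases h0 : K = 0
      · right
        by_contra! hlt
        have := (hK 0).1 ⟨n.succ_pos, hlt⟩
        omega
      · exact Or.inl h0
    have hlt : ∀ i, α.τ i ω < (M.T : WithTop ℝ≥0) → ∀ᶠ n in atTop, α.τ i ω < (r n : WithTop ℝ≥0) := by
      intro i hi
      have h4 : clock (α.τ i ω) < M.T := by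
        rw [← Strategy.coe_clock hi.ne_top] at hi
        exact WithTop.coe_lt_coe.1 hi
      filter_upwards [hrT.eventually_const_lt h4] with n hn
      rw [← Strategy.coe_clock hi.ne_top]
      exact WithTop.coe_lt_coe.2 hn
    by_cases hinf : ∀ i, α.τ i ω < (M.T : WithTop ℝ≥0)
    · obtain ⟨k₀, hk₀⟩ := eventually_atTop.1 (hω.eventually_le_of_infinite hq' h2 h3 hinf hcX)
      -- For `n` large the truncation performs at least `k₀` trades, and its partial sale can only
      -- add cash.
      filter_upwards [hlt k₀ (hinf k₀), eventually_ge_atTop k₀] with n hn hkn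
      obtain ⟨K, hKn, hK⟩ := Strategy.exists_count α ω (n + 1) (r n)
      rw [hval n K hKn hK]
      have hkK := (hK k₀).1 ⟨by omega, hn⟩
      refine (hk₀ K hkK.le).trans (le_add_of_nonneg_right ?_)
      exact mul_nonneg (price_pos hq'.2.1 _ _ _).le (proceeds_nonneg (bestSale_mem _
        (hω.keptShares_nonneg hq' h2 fun i _ => (hinf i).le) _).1)
    · push Not at hinf
      obtain ⟨m, hm⟩ := hinf
      obtain ⟨K, hKm, hK⟩ := Strategy.exists_count α ω m M.T
      have hK' : ∀ i, α.τ i ω < (M.T : WithTop ℝ≥0) ↔ i < K := fun i => by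
        refine ⟨fun hi => (hK i).1 ⟨?_, hi⟩, fun hi => ((hK i).2 hi).2⟩
        by_contra! hmi
        exact absurd hi (not_lt.2 (hm.trans (α.monotone_τ ω hmi)))
      have hall : ∀ᶠ n in atTop, ∀ i ∈ Finset.range K, α.τ i ω < (r n : WithTop ℝ≥0) :=
        (eventually_all_finset _).2 fun i hi => hlt i ((hK' i).2 (Finset.mem_range.1 hi))
      filter_upwards [hω.eventually_le_of_finite hq' h1 h2 hc (fun n => (hr n).2) hrT hK' hcX, hall, eventually_ge_atTop K] with n hn hn' hKn
      rw [hval n K (by omega) fun i => ?_]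
      · exact hn
      · refine ⟨fun hi => (hK' i).1 (hi.2.trans (WithTop.coe_lt_coe.2 (hr n).2)), fun hi =>
          ⟨by omega, hn' i (Finset.mem_range.2 hi)⟩⟩
  have hX0 : ∀ᵐ ω ∂M.prob, 0 ≤ (α.state t q M.T ω).cash := by
    filter_upwards [hgood, hα.2] with ω h4 h5
    have := ((M.mem_closedRegion_iff _).1 (h4.state M.T htT.le le_rfl)).2
    rwa [liq, h5, zero_mul, zero_mul, add_zero] at this
  calc α.expectedUtility t q
      ≤ ∫⁻ ω, liminf (fun n => ENNReal.ofReal (M.U (max 0 ((S n).cashAt (S n).n ω)))) atTop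
          ∂M.prob := by
        refine lintegral_mono_ae ?_
        filter_upwards [hcash, hX0] with ω h4 h5
        exact hU.le_liminf h5 h4
    _ ≤ liminf (fun n => (S n).payoff) atTop := by
        refine lintegral_liminf_le' fun n => ?_
        exact (hU.measurable.comp_aemeasurable
          ((hvalid n).aemeasurable_cashAt hq' hf htT.le hB _)).ennreal_ofReal
    _ ≤ _ := by
        refine liminf_le_of_le (by isBoundedDefault) fun b hb => ?_
        obtain ⟨n, hn⟩ := hb.exists
        -- The bound `r n < T` on the trading times is recorded for the second assertion, where a
        -- grid must fit between the last trade and `T`.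
        refine hn.trans (le_iSup₂_of_le (S n) ⟨hvalid n, r n, (hr n).2, fun k ω hk => ?_⟩ le_rfl)
        by_cases hkn : k = n + 1
        · have : (S n).ρ (n + 1) = fun _ => (r n : WithTop ℝ≥0) := if_pos rfl
          rw [hkn, this]
        · have : (S n).ρ k = (α.trim hα.1.1 hq'.2.2.1 (n + 1) (hr n).2.le).ρ k := if_neg hkn
          rw [this] at hk ⊢
          exact (Strategy.trim_lt k ω hk).le

theorem value_eq_valueFinite [IsProbabilityMeasure M.prob]
    (hF : M.UsualConditions) (hW : M.IsBrownianMotion) (hf : M.BorelImpact)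
    (h1 : M.H1f) (h2 : M.H2f) (h3 : M.H3f) (hc : M.Hcf) (hU : M.HU) {t : ℝ≥0} {q : State}
    (htT : t < M.T) (hq : q ∈ M.closedRegion) : M.value t q = M.valueFinite t q := by
  refine le_antisymm (iSup₂_le fun α hα => ?_) (iSup₂_le fun α hα => le_iSup₂_of_le α hα.1 le_rfl)
  refine (hα.expectedUtility_le hF hW hf h1 h2 h3 hc hU htT hq).trans (iSup₂_le fun S hS => ?_)
  exact hS.1.payoff_le_valueFinite h1 hU ((M.mem_closedRegion_iff q).1 hq).1 htT

end Market

end Liquidation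

/-! ### Scaling: positivity when the initial cash is nonnegative. -/

namespace Liquidation

open Filter Topology

namespace Market

variable {Ω : Type*} [MeasurableSpace Ω] {M : Market Ω}

/-- Scaling down a trade scales its cost down at least proportionally. -/
theorem scaled_cost (h1 : M.H1f) {l ξ θ P : ℝ} (hl : l ∈ Icc (0 : ℝ) 1) (hθ : θ ∈ Icc (0 : ℝ) M.T)
    (hP : 0 < P) (hfin : M.f ξ θ ≠ ∞) :
    M.f (l * ξ) θ ≠ ∞ ∧ l * ξ * P * (M.f (l * ξ) θ).toReal ≤ l * (ξ * P * (M.f ξ θ).toReal) := by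
  have hl0 := hl.1
  rcases le_or_gt 0 ξ with hξ | hξ
  · have hle : M.f (l * ξ) θ ≤ M.f ξ θ := h1.mono θ hθ (mul_le_of_le_one_left hξ hl.2)
    refine ⟨ne_top_of_le_ne_top hfin hle, ?_⟩
    have h2 := ENNReal.toReal_mono hfin hle
    have h3 : 0 ≤ l * ξ * P := by positivity
    nlinarith
  · have hle : M.f ξ θ ≤ M.f (l * ξ) θ := h1.mono θ hθ (by nlinarith [hl.2])
    have hfin' : M.f (l * ξ) θ ≠ ∞ := ne_top_of_le_ne_top ENNReal.one_ne_top
      (impact_le_one_of_nonpos h1 (mul_nonpos_of_nonneg_of_nonpos hl0 hξ.le) hθ)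
    refine ⟨hfin', ?_⟩
    have h2 := ENNReal.toReal_mono hfin' hle
    have h3 : l * ξ * P ≤ 0 :=
      mul_nonpos_of_nonpos_of_nonneg (mul_nonpos_of_nonneg_of_nonpos hl0 hξ.le) hP.le
    nlinarith

namespace Schedule

variable {t : ℝ≥0} {q : State} (S : M.Schedule t q)

open Classical in
-- On the event that the trade `k` is made by `s`, an earlier trade is skipped exactly when it is
-- not made by `s`, because the times are strictly increasing.
theorem measurableSet_isFirst (k : ℕ) :
    MeasurableSet[(S.stopping k).measurableSpace] {ω | ∀ i < k, S.ρ i ω = ⊤} := by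
  constructor
  · have : {ω | ∀ i < k, S.ρ i ω = ⊤} = ⋂ i, ⋂ (_ : i < k), {ω | S.ρ i ω = ⊤} := by ext; simp
    rw [this]
    exact MeasurableSet.iInter fun i => MeasurableSet.iInter fun _ =>
      (S.stopping i).measurableSet_eq_top'
  · intro s
    have : {ω | ∀ i < k, S.ρ i ω = ⊤} ∩ {ω | S.ρ k ω ≤ (s : WithTop ℝ≥0)} =
        (⋂ i, ⋂ (_ : i < k), {ω | S.ρ i ω ≤ (s : WithTop ℝ≥0)}ᶜ) ∩
          {ω | S.ρ k ω ≤ (s : WithTop ℝ≥0)} := by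
      ext ω
      simp only [mem_inter_iff, mem_ofPred_eq, mem_iInter, mem_compl_iff]
      refine and_congr_left fun hk => forall₂_congr fun i hi => ⟨fun h h' => ?_, fun h => ?_⟩
      · rw [h] at h'
        exact WithTop.not_top_le_coe _ h'
      · by_contra hne
        exact h ((S.strict i k ω hi hne (ne_top_of_le_ne_top WithTop.coe_ne_top hk)).le.trans hk)
    rw [this]
    exact (MeasurableSet.iInter fun i => MeasurableSet.iInter fun _ => (S.stopping i s).compl).inter
      (S.stopping k s)

open Classical in
/-- The trades scaled by `l`, then by `l ^ 2`; a trade of size zero performed first is replaced by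
a small sale. -/
def scale (l : ℝ) : M.Schedule t q where
  n := S.n
  ρ := S.ρ
  ξ k ω := if ∀ i < k, S.ρ i ω = ⊤ then (if S.ξ k ω = 0 then -((1 - l) * q.shares) else l * S.ξ k ω)
    else l ^ 2 * S.ξ k ω
  stopping := S.stopping
  size_meas k := by
    have h := (S.size_meas k).measurable (S.stopping k)
    exact stopMeas_of_measurable (S.stopping k) (Measurable.ite (S.measurableSet_isFirst k)
      (Measurable.ite (h (measurableSet_singleton 0)) measurable_const (h.const_mul l))
      (h.const_mul _))
  start := S.start
  horizon := S.horizon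
  bounded := S.bounded
  strict := S.strict
  first := S.first

variable {S}

theorem scale_lastTime {l : ℝ} (k : ℕ) (ω : Ω) : (S.scale l).lastTime ω k = S.lastTime ω k := by
  induction k with
  | zero => rfl
  | succ k ih => rw [lastTime, lastTime, ih]; rfl

/-- The comparison of a schedule with its scaled version, from the first trade on. -/
theorem scale_compare (h1 : M.H1f) (hq : q ∈ M.domain) (hx : 0 ≤ q.cash)
    (hpos : q.cash = 0 → 0 < q.shares ∧ ∀ e < 0, ∀ θ ∈ Ioc (0 : ℝ) M.T, 0 < M.f e θ)
    {l : ℝ} (hl0 : 0 < l) (hl1 : l < 1) {ω : Ω}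
    (ht : ∀ k, S.ρ k ω ≠ ⊤ →
      S.impact k ω ≠ ∞ ∧ 0 ≤ S.cashAt (k + 1) ω ∧ 0 ≤ S.sharesAt (k + 1) ω)
    (hlag : ∀ k, S.ρ k ω ≠ ⊤ → clock (S.ρ k ω) - S.lastTime ω k ∈ Ioc (0 : ℝ) M.T) (k : ℕ) :
    (S.ρ k ω ≠ ⊤ → (S.scale l).impact k ω ≠ ∞) ∧
    (((∀ i < k, S.ρ i ω = ⊤) ∧ (S.scale l).cashAt k ω = q.cash ∧ S.cashAt k ω = q.cash ∧
      (S.scale l).sharesAt k ω = q.shares ∧ S.sharesAt k ω = q.shares) ∨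
    ((∃ i < k, S.ρ i ω ≠ ⊤) ∧ 0 < (S.scale l).cashAt k ω - l ^ 2 * S.cashAt k ω ∧
      0 ≤ (S.scale l).sharesAt k ω - l ^ 2 * S.sharesAt k ω)) := by
  classical
  have hy := hq.1
  have hfin : ∀ e ≤ 0, ∀ θ ∈ Ioc (0 : ℝ) M.T, M.f e θ ≠ ∞ := fun e he θ hθ =>
    ne_top_of_le_ne_top ENNReal.one_ne_top (impact_le_one_of_nonpos h1 he ⟨hθ.1.le, hθ.2⟩)
  have hle2 : l ^ 2 ∈ Icc (0 : ℝ) 1 := ⟨by positivity, by nlinarith⟩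
  have himp : ∀ k, S.ρ k ω ≠ ⊤ → (S.scale l).impact k ω ≠ ∞ := by
    intro k hk
    have hθ := hlag k hk
    have hf := (ht k hk).1
    rw [impact, scale_lastTime]
    rw [impact] at hf
    change M.f (if _ then _ else _) (clock (S.ρ k ω) - _) ≠ ∞
    split_ifs
    · exact hfin _ (by nlinarith) _ hθ
    · exact (scaled_cost h1 ⟨hl0.le, hl1.le⟩ ⟨hθ.1.le, hθ.2⟩ one_pos hf).1
    · exact (scaled_cost h1 hle2 ⟨hθ.1.le, hθ.2⟩ one_pos hf).1
  refine ⟨himp k, ?_⟩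
  -- The margins over `l ^ 2` times the original holdings are propagated. Later trades, scaled by `l
  -- ^ 2`, do not reduce them; the first one, scaled by `l` only, makes the margin in cash strict.
  induction k with
  | zero => left; simp [cashAt, sharesAt]
  | succ k ih =>
    by_cases hk : S.ρ k ω = ⊤
    · have hk' : (S.scale l).ρ k ω = ⊤ := hk
      rw [cashAt_succ_of_eq _ hk, cashAt_succ_of_eq _ hk', sharesAt_succ_of_eq _ hk,
        sharesAt_succ_of_eq _ hk']
      rcases ih with ⟨i1, i2⟩ | ⟨⟨i, hi, hi'⟩, i2⟩
      · refine Or.inl ⟨fun i hi => ?_, i2⟩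
        rcases (Nat.lt_succ_iff.1 hi).lt_or_eq with hi | rfl
        · exact i1 i hi
        · exact hk
      · exact Or.inr ⟨⟨i, by omega, hi'⟩, i2⟩
    · have hk' : (S.scale l).ρ k ω ≠ ⊤ := hk
      obtain ⟨hf, hx1, hy1⟩ := ht k hk
      have hθ := hlag k hk
      have hP := price_pos (M := M) hq.2.1 t (clock (S.ρ k ω)) ω
      rw [cashAt_succ_of_ne _ hk] at hx1
      rw [sharesAt_succ_of_ne _ hk] at hy1
      rw [cashAt_succ_of_ne _ hk, cashAt_succ_of_ne _ hk', sharesAt_succ_of_ne _ hk,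
        sharesAt_succ_of_ne _ hk']
      refine Or.inr ⟨⟨k, k.lt_succ_self, hk⟩, ?_⟩
      have hcost : S.cost k ω = S.ξ k ω * M.price t q.price (clock (S.ρ k ω)) ω *
        (M.f (S.ξ k ω) (clock (S.ρ k ω) - S.lastTime ω k)).toReal := rfl
      have hcost' : (S.scale l).cost k ω = (S.scale l).ξ k ω *
          M.price t q.price (clock (S.ρ k ω)) ω *
          (M.f ((S.scale l).ξ k ω) (clock (S.ρ k ω) - S.lastTime ω k)).toReal := by
        rw [cost, impact, scale_lastTime]; rfl
      have hξ : (S.scale l).ξ k ω = if ∀ i < k, S.ρ i ω = ⊤ then (if S.ξ k ω = 0 then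
        -((1 - l) * q.shares) else l * S.ξ k ω) else l ^ 2 * S.ξ k ω := rfl
      set P := M.price t q.price (clock (S.ρ k ω)) ω
      set θ := clock (S.ρ k ω) - S.lastTime ω k with hθdef
      have hθ' : θ ∈ Icc (0 : ℝ) M.T := ⟨hθ.1.le, hθ.2⟩
      rw [impact] at hf
      rcases ih with ⟨i1, i2, i3, i4, i5⟩ | ⟨⟨i, hi, hi'⟩, i2, i3⟩
      · rw [if_pos i1] at hξ
        rw [i2, i3, i4, i5]
        rw [i3] at hx1
        rw [i5] at hy1
        -- Starting without cash, a first trade of size zero would create no margin; a sale of `(1 -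
        -- l) y` shares replaces it.
        by_cases hz : S.ξ k ω = 0
        · rw [if_pos hz] at hξ
          rw [hcost', hcost, hξ, hz]
          have h5 : 0 ≤ (1 - l) * q.shares := mul_nonneg (by linarith) hy
          refine ⟨?_, by nlinarith⟩
          have h6 : 0 ≤ (1 - l) * q.shares * P * (M.f (-((1 - l) * q.shares)) θ).toReal := by
            positivity
          rcases hx.eq_or_lt with hx0 | hx0
          · obtain ⟨h7, h8⟩ := hpos hx0.symm
            have h9 : 0 < (1 - l) * q.shares := mul_pos (by linarith) h7
            have h10 : 0 < (M.f (-((1 - l) * q.shares)) θ).toReal :=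
              ENNReal.toReal_pos (h8 _ (by linarith) θ hθ).ne' (hfin _ (by linarith) θ hθ)
            have : 0 < (1 - l) * q.shares * P * (M.f (-((1 - l) * q.shares)) θ).toReal := by
              positivity
            rw [← hx0]
            linarith
          · have : 0 < (1 - l ^ 2) * q.cash := mul_pos (by nlinarith) hx0
            linarith
        · rw [if_neg hz] at hξ
          have hsc := (scaled_cost h1 ⟨hl0.le, hl1.le⟩ hθ' hP hf).2
          rw [← hcost] at hsc
          rw [hcost', hξ]
          have hll : 0 < l - l ^ 2 := by nlinarith
          have hyy := mul_nonneg hll.le hy1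
          have hyy' := mul_nonneg (sub_nonneg.2 hl1.le) hy
          refine ⟨?_, by linarith⟩
          have hxx := mul_nonneg hll.le hx1
          rcases hx.eq_or_lt with hx0 | hx0
          · obtain ⟨h7, h8⟩ := hpos hx0.symm
            -- Without cash the first trade cannot be a purchase, and positivity of `f` gives a sale
            -- positive proceeds.
            have hneg : S.cost k ω < 0 := by
              rcases lt_or_gt_of_ne hz with hz | hz
              · have : 0 < (M.f (S.ξ k ω) θ).toReal :=
                  ENNReal.toReal_pos (h8 _ hz θ hθ).ne' hf
                rw [hcost]
                exact mul_neg_of_neg_of_pos (mul_neg_of_neg_of_pos hz hP) this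
              · exfalso
                have h9 : 1 ≤ (M.f (S.ξ k ω) θ).toReal := by
                  rw [← ENNReal.toReal_one]
                  exact ENNReal.toReal_mono hf (one_le_impact_of_nonneg h1 hz.le hθ')
                have : 0 < S.cost k ω := by rw [hcost]; positivity
                linarith
            rw [← hx0] at hxx ⊢
            nlinarith
          · have := mul_pos (sub_pos.2 hl1) hx0
            linarith
      · rw [if_neg fun hno => hi' (hno i hi)] at hξ
        have hsc := (scaled_cost h1 hle2 hθ' hP hf).2
        rw [← hcost] at hsc
        rw [hcost', hξ]
        constructor <;> nlinarith

/-- When the initial cash is nonnegative, a valid schedule is nearly dominated by one keeping a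
positive liquidation value. -/
theorem Valid.scale_positive (h : S.Valid) (h1 : M.H1f) (h2 : M.H2f) (hq : q ∈ M.domain)
    (hL : 0 < M.liq q) (hx : 0 ≤ q.cash) (hfpos : ∀ e < 0, ∀ θ ∈ Ioc (0 : ℝ) M.T, 0 < M.f e θ)
    {l : ℝ} (hl0 : 0 < l) (hl1 : l < 1) : (S.scale l).Positive := by
  have hpos : q.cash = 0 → 0 < q.shares ∧ ∀ e < 0, ∀ θ ∈ Ioc (0 : ℝ) M.T, 0 < M.f e θ := by
    intro hx0
    refine ⟨hq.1.lt_of_ne fun hy => ?_, hfpos⟩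
    rw [liq, hx0, ← hy] at hL
    simp at hL
  have hcmp : ∀ᵐ ω ∂M.prob, ∀ k, S.ρ k ω ≠ ⊤ → (S.scale l).impact k ω ≠ ∞ ∧
      0 < (S.scale l).cashAt (k + 1) ω ∧ 0 ≤ (S.scale l).sharesAt (k + 1) ω := by
    filter_upwards [h.trade, h.lag_mem hq] with ω ht hlag k hk
    refine ⟨(scale_compare h1 hq hx hpos hl0 hl1 ht hlag k).1 hk, ?_⟩
    rcases (scale_compare h1 hq hx hpos hl0 hl1 ht hlag (k + 1)).2 with ⟨i1, -⟩ | ⟨-, i1, i2⟩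
    · exact absurd (i1 k k.lt_succ_self) hk
    · obtain ⟨-, j1, j2⟩ := ht k hk
      have : 0 ≤ l ^ 2 * S.cashAt (k + 1) ω := by positivity
      have : 0 ≤ l ^ 2 * S.sharesAt (k + 1) ω := by positivity
      constructor <;> linarith
  refine ⟨⟨h.lt_horizon, ?_, h.pre⟩, ?_, ?_⟩
  · filter_upwards [hcmp] with ω hω k hk
    exact ⟨(hω k hk).1, (hω k hk).2.1.le, (hω k hk).2.2⟩
  · filter_upwards [hcmp] with ω hω k hk
    exact (hω k hk).2.1
  · filter_upwards [h.pre] with ω hp s hts hsT hno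
    have hst := ((M.mem_closedRegion_iff _).1 (hp s hts hsT.le hno)).1
    rcases hx.eq_or_lt with hx0 | hx0
    · have hy := (hpos hx0.symm).1
      -- At zero lag the liquidation value is the cash, here zero; a positive value therefore forces
      -- a positive lag, and `f` is positive from then on.
      have hθ : 0 < q.lag := hq.2.2.1.lt_of_ne fun h0 => by
        rw [liq_of_lag_zero h2 hq.1 h0.symm, ← hx0] at hL
        exact lt_irrefl _ hL
      have hts' : (t : ℝ) ≤ s := by exact_mod_cast hts
      have hlag : (s : ℝ) - (t - q.lag) ∈ Ioc (0 : ℝ) M.T := ⟨by linarith, hst.2.2.2⟩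
      have hP := price_pos (M := M) hq.2.1 t s ω
      have : 0 < (M.f (-q.shares) (s - (t - q.lag))).toReal :=
        ENNReal.toReal_pos (hfpos _ (by linarith) _ hlag).ne' (ne_top_of_le_ne_top
          ENNReal.one_ne_top (impact_le_one_of_nonpos h1 (by linarith) hst.2.2))
      simp only [liq, ← hx0, zero_add]
      positivity
    · exact hx0.trans_le (cash_le_liq (r := ⟨q.cash, q.shares, M.price t q.price s ω, _⟩)
        hst.1 hst.2.1)

theorem Valid.payoff_le_valuePositive_of_cash_nonneg (h : S.Valid) (h1 : M.H1f) (h2 : M.H2f)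
    (hU : M.HU) (hq : q ∈ M.domain) (htT : t < M.T)
    (hL : 0 < M.liq q) (hx : 0 ≤ q.cash) (hfpos : ∀ e < 0, ∀ θ ∈ Ioc (0 : ℝ) M.T, 0 < M.f e θ) :
    S.payoff ≤ M.valuePositive t q := by
  have hpos : q.cash = 0 → 0 < q.shares ∧ ∀ e < 0, ∀ θ ∈ Ioc (0 : ℝ) M.T, 0 < M.f e θ := by
    intro hx0
    refine ⟨hq.1.lt_of_ne fun hy => ?_, hfpos⟩
    rw [liq, hx0, ← hy] at hL
    simp at hL
  refine ENNReal.le_of_forall_lt_one_mul_le fun a ha => ?_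
  obtain ⟨a, rfl⟩ : ∃ a' : ℝ≥0, a = a' := ⟨a.toNNReal, (ENNReal.coe_toNNReal ha.ne_top).symm⟩
  rcases eq_or_ne a 0 with rfl | ha0
  · simp
  have ha1 : (a : ℝ) < 1 := by exact_mod_cast ha
  have ha0' : (0 : ℝ) < a := by exact_mod_cast pos_iff_ne_zero.2 ha0
  -- The scaled schedule keeps at least the fraction `l ^ 2 = a` of the cash, hence of the utility
  -- by concavity.
  set l := Real.sqrt a with hldef
  have hl0 : 0 < l := Real.sqrt_pos.2 ha0'
  have hl1 : l < 1 := by rw [hldef, Real.sqrt_lt' one_pos]; simpa using ha1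
  have hl2 : l ^ 2 = a := Real.sq_sqrt ha0'.le
  refine le_trans ?_ ((h.scale_positive h1 h2 hq hL hx hfpos hl0 hl1).payoff_le_valuePositive
    h1 hU hq htT)
  rw [payoff, ← lintegral_const_mul' _ _ ENNReal.coe_ne_top]
  refine lintegral_mono_ae ?_
  filter_upwards [h.trade, h.lag_mem hq] with ω ht hlag
  rw [← ENNReal.ofReal_coe_nnreal, ← ENNReal.ofReal_mul ha0'.le]
  refine ENNReal.ofReal_le_ofReal ((hU.mul_le ⟨ha0'.le, ha1.le⟩ (le_max_left _ _)).trans ?_)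
  refine hU.mono (mem_Ici.2 (by positivity)) (mem_Ici.2 (le_max_left _ _)) ?_
  change _ ≤ max 0 ((S.scale l).cashAt S.n ω)
  have hc : ∀ c : ℝ, a * c ≤ (S.scale l).cashAt S.n ω → a * max 0 c ≤
      max 0 ((S.scale l).cashAt S.n ω) := fun c hc => by
    rcases le_total 0 c with h0 | h0
    · rw [max_eq_right h0]; exact hc.trans (le_max_right _ _)
    · rw [max_eq_left h0, mul_zero]; exact le_max_left _ _
  refine hc _ ?_
  rw [← hl2]
  rcases (scale_compare h1 hq hx hpos hl0 hl1 ht hlag S.n).2 with ⟨-, i1, i2, -⟩ | ⟨-, i1, -⟩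
  · rw [i1, i2]
    nlinarith
  · linarith

end Schedule

end Market

end Liquidation

/-! ### Finite-horizon dynamic programming with finitely many actions. -/

namespace Liquidation

open Filter Topology

section DynamicProgramming

variable {X : Type*} (γ : Measure ℝ) {m : ℕ}
  (ev : Fin (m + 1) → X → ℝ → X) (G : X → ℝ≥0∞)

/-- The value functions of a finite horizon control problem with finitely many actions. -/
def bellman : ℕ → X → ℝ≥0∞
  | 0 => G
  | k + 1 => fun s => ⨆ a, ∫⁻ w, bellman k (ev a s w) ∂γ

variable {γ ev G}

theorem bellman_le [IsProbabilityMeasure γ] {C : ℝ≥0∞} (hG : ∀ s, G s ≤ C) (k : ℕ) (s : X) :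
    bellman γ ev G k s ≤ C := by
  induction k generalizing s with
  | zero => exact hG s
  | succ k ih =>
    refine iSup_le fun a => (lintegral_mono fun w => ih (ev a s w)).trans ?_
    simp

variable [MeasurableSpace X]

theorem measurable_bellman_ev [SFinite γ] (hev : ∀ a, Measurable (Function.uncurry (ev a)))
    {k : ℕ} (hk : Measurable (bellman γ ev G k)) (a : Fin (m + 1)) :
    Measurable fun s => ∫⁻ w, bellman γ ev G k (ev a s w) ∂γ :=
  Measurable.lintegral_prod_right' (f := fun z : X × ℝ => bellman γ ev G k (ev a z.1 z.2))
    (hk.comp (hev a))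

theorem measurable_bellman [SFinite γ] (hev : ∀ a, Measurable (Function.uncurry (ev a)))
    (hG : Measurable G) (k : ℕ) : Measurable (bellman γ ev G k) := by
  induction k with
  | zero => exact hG
  | succ k ih => exact Measurable.iSup fun a => measurable_bellman_ev hev ih a

/-- Among finitely many actions, the smallest maximizer depends measurably on the state. -/
theorem exists_policy [SFinite γ] (hev : ∀ a, Measurable (Function.uncurry (ev a)))
    (hG : Measurable G) : ∃ π : ℕ → X → Fin (m + 1), (∀ k, Measurable (π k)) ∧
      ∀ k s, bellman γ ev G (k + 1) s = ∫⁻ w, bellman γ ev G k (ev (π k s) s w) ∂γ := by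
  classical
  suffices ∀ k, ∃ π : X → Fin (m + 1), Measurable π ∧
      ∀ s, bellman γ ev G (k + 1) s = ∫⁻ w, bellman γ ev G k (ev (π s) s w) ∂γ by
    choose π h1 h2 using this
    exact ⟨π, h1, h2⟩
  intro k
  set val : Fin (m + 1) → X → ℝ≥0∞ := fun a s => ∫⁻ w, bellman γ ev G k (ev a s w) ∂γ with hval
  have hm : ∀ a, Measurable (val a) := measurable_bellman_ev hev (measurable_bellman hev hG k)
  have hne : ∀ s, (Finset.univ.filter fun a => ∀ b, val b s ≤ val a s).Nonempty := by
    intro s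
    obtain ⟨a, -, ha⟩ := Finset.exists_max_image Finset.univ (fun a => val a s)
      Finset.univ_nonempty
    exact ⟨a, by simpa using fun b => ha b (Finset.mem_univ b)⟩
  refine ⟨fun s => (Finset.univ.filter fun a => ∀ b, val b s ≤ val a s).min' (hne s), ?_, ?_⟩
  · have hset : ∀ a, MeasurableSet {s | ∀ b, val b s ≤ val a s} := fun a => by
      have : {s | ∀ b, val b s ≤ val a s} = ⋂ b, {s | val b s ≤ val a s} := by ext; simp
      rw [this]
      exact MeasurableSet.iInter fun b => measurableSet_le (hm b) (hm a)
    refine measurable_to_countable' fun a => ?_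
    have : (fun s => (Finset.univ.filter fun a => ∀ b, val b s ≤ val a s).min' (hne s)) ⁻¹' {a} =
        {s | ∀ b, val b s ≤ val a s} ∩ ⋂ a', ⋂ (_ : a' < a), {s | ∀ b, val b s ≤ val a' s}ᶜ := by
      ext s
      simp only [mem_preimage, mem_singleton_iff, mem_inter_iff, mem_iInter, mem_compl_iff,
        mem_ofPred_eq]
      constructor
      · rintro rfl
        refine ⟨?_, fun a' ha' h => ?_⟩
        · have := Finset.min'_mem _ (hne s)
          exact (Finset.mem_filter.1 this).2
        · exact absurd (Finset.min'_le _ a' (Finset.mem_filter.2 ⟨Finset.mem_univ _, h⟩))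
            (not_le.2 ha')
      · rintro ⟨h1, h2⟩
        refine le_antisymm (Finset.min'_le _ a (Finset.mem_filter.2 ⟨Finset.mem_univ _, h1⟩)) ?_
        by_contra! hlt
        exact h2 _ hlt (Finset.mem_filter.1 (Finset.min'_mem _ (hne s))).2
    rw [this]
    exact (hset a).inter (MeasurableSet.iInter fun a' => MeasurableSet.iInter fun _ =>
      (hset a').compl)
  · intro s
    have h := (Finset.mem_filter.1 (Finset.min'_mem _ (hne s))).2
    exact le_antisymm (iSup_le fun b => h b) (le_iSup (fun a => val a s) _)

variable {Ω : Type*} [m0 : MeasurableSpace Ω] {μ : Measure Ω}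

/-- Integration of a function of a known quantity and of an independent one. -/
theorem setLIntegral_freeze [IsFiniteMeasure μ] [SigmaFinite γ] {𝓕 : ℕ → MeasurableSpace Ω}
    {j : ℕ} (h𝓕 : 𝓕 j ≤ m0) {Z : Ω → X} (hZ : Measurable[𝓕 j] Z) {ξ : Ω → ℝ} (hξ : Measurable ξ)
    (hind : ∀ E, MeasurableSet[𝓕 j] E → ∀ A, MeasurableSet A → μ (E ∩ ξ ⁻¹' A) = μ E * γ A)
    {F : X × ℝ → ℝ≥0∞} (hF : Measurable F) {E : Set Ω} (hE : MeasurableSet[𝓕 j] E) :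
    ∫⁻ ω in E, F (Z ω, ξ ω) ∂μ = ∫⁻ ω in E, ∫⁻ w, F (Z ω, w) ∂γ ∂μ := by
  have hZ' : Measurable Z := hZ.mono h𝓕 le_rfl
  -- Independence says that, under `μ` restricted to `E`, the pair `(Z, ξ)` has a product law;
  -- Fubini then integrates the noise out.
  have hprod : ((μ.restrict E).map Z).prod γ = (μ.restrict E).map fun ω => (Z ω, ξ ω) := by
    refine Measure.prod_eq fun A B hA hB => ?_
    rw [Measure.map_apply (hZ'.prodMk hξ) (hA.prod hB), Measure.map_apply hZ' hA,
      Measure.restrict_apply (hZ' hA), Measure.restrict_apply ((hZ'.prodMk hξ) (hA.prod hB)),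
      ← hind _ ((hZ hA).inter hE) B hB]
    congr 1
    ext ω
    simp only [mem_inter_iff, mem_preimage, mem_prod]
    tauto
  rw [← lintegral_map (f := F) hF (hZ'.prodMk hξ), ← hprod, lintegral_prod _ hF.aemeasurable,
    lintegral_map hF.lintegral_prod_right' hZ']

/-- A controlled process with independent noise. -/
structure Controlled (μ : Measure Ω) (γ : Measure ℝ) (ev : Fin (m + 1) → X → ℝ → X) (n : ℕ)
    (𝓕 : ℕ → MeasurableSpace Ω) (ξ : ℕ → Ω → ℝ) (a : ℕ → Ω → Fin (m + 1)) (s : ℕ → Ω → X) :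
    Prop where
  le : ∀ j, 𝓕 j ≤ m0
  mono : Monotone 𝓕
  action : ∀ j < n, Measurable[𝓕 j] (a j)
  init : Measurable[𝓕 0] (s 0)
  noise : ∀ j < n, Measurable[𝓕 (j + 1)] (ξ j)
  indep : ∀ j < n, ∀ E, MeasurableSet[𝓕 j] E → ∀ A, MeasurableSet A →
    μ (E ∩ ξ j ⁻¹' A) = μ E * γ A
  next : ∀ j ω, s (j + 1) ω = ev (a j ω) (s j ω) (ξ j ω)

namespace Controlled

variable {n : ℕ} {𝓕 : ℕ → MeasurableSpace Ω} {ξ : ℕ → Ω → ℝ} {a : ℕ → Ω → Fin (m + 1)}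
    {s : ℕ → Ω → X}

theorem measurable_state (h : Controlled μ γ ev n 𝓕 ξ a s)
    (hev : ∀ a, Measurable (Function.uncurry (ev a))) {j : ℕ} (hj : j ≤ n) :
    Measurable[𝓕 j] (s j) := by
  induction j with
  | zero => exact h.init
  | succ j ih =>
    have h1 : Measurable[𝓕 (j + 1)] (s j) := (ih (by omega)).mono (h.mono j.le_succ) le_rfl
    have h2 : Measurable[𝓕 (j + 1)] (a j) := (h.action j hj).mono (h.mono j.le_succ) le_rfl
    have h3 := h.noise j hj
    have hev' : Measurable fun z : Fin (m + 1) × (X × ℝ) => ev z.1 z.2.1 z.2.2 :=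
      measurable_from_prod_countable_right fun a => hev a
    have := hev'.comp (h2.prodMk (h1.prodMk h3))
    have he : s (j + 1) = fun ω => ev (a j ω) (s j ω) (ξ j ω) := funext fun ω => h.next j ω
    rw [he]
    exact this

theorem setLIntegral_bellman_succ [IsFiniteMeasure μ] [SigmaFinite γ]
    (h : Controlled μ γ ev n 𝓕 ξ a s)
    (hev : ∀ a, Measurable (Function.uncurry (ev a))) (hG : Measurable G) {j : ℕ} (hj : j < n)
    (k : ℕ) {E : Set Ω} (hE : MeasurableSet[𝓕 j] E) :
    ∫⁻ ω in E, bellman γ ev G k (s (j + 1) ω) ∂μ =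
      ∫⁻ ω in E, ∫⁻ w, bellman γ ev G k (ev (a j ω) (s j ω) w) ∂γ ∂μ := by
  have h1 := h.measurable_state hev hj.le
  have hev' : Measurable fun z : (Fin (m + 1) × X) × ℝ => ev z.1.1 z.1.2 z.2 := by
    have : Measurable fun z : Fin (m + 1) × (X × ℝ) => ev z.1 z.2.1 z.2.2 :=
      measurable_from_prod_countable_right fun a => hev a
    exact this.comp ((measurable_fst.fst).prodMk (measurable_fst.snd.prodMk measurable_snd))
  have := setLIntegral_freeze (γ := γ) (h.le j) ((h.action j hj).prodMk h1)
    ((h.noise j hj).mono (h.le _) le_rfl)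
    (h.indep j hj) ((measurable_bellman (γ := γ) (G := G) hev hG k).comp hev') hE
  simp only [Function.comp_apply] at this
  rw [← this]
  simp only [h.next]

/-- Along any control, the value with the remaining number of steps is a supermartingale: the action
played does no better than the supremum. -/
theorem setLIntegral_le [IsFiniteMeasure μ] [SigmaFinite γ] (h : Controlled μ γ ev n 𝓕 ξ a s)
    (hev : ∀ a, Measurable (Function.uncurry (ev a))) (hG : Measurable G) {E : Set Ω}
    (hE : MeasurableSet[𝓕 0] E) :
    ∫⁻ ω in E, G (s n ω) ∂μ ≤ ∫⁻ ω in E, bellman γ ev G n (s 0 ω) ∂μ := by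
  suffices ∀ j ≤ n, ∫⁻ ω in E, bellman γ ev G (n - j) (s j ω) ∂μ ≤
      ∫⁻ ω in E, bellman γ ev G n (s 0 ω) ∂μ by
    have := this n le_rfl
    rwa [Nat.sub_self] at this
  intro j
  induction j with
  | zero => intro _; exact le_rfl
  | succ j ih =>
    intro hj
    refine le_trans ?_ (ih (by omega))
    rw [h.setLIntegral_bellman_succ hev hG hj _ (h.mono j.zero_le _ hE),
      show n - j = (n - (j + 1)) + 1 by omega]
    exact lintegral_mono fun ω => le_iSup (fun b => ∫⁻ w, bellman γ ev G (n - (j + 1))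
      (ev b (s j ω) w) ∂γ) (a j ω)

/-- When every action attains the supremum, the same process is a martingale. -/
theorem setLIntegral_eq [IsFiniteMeasure μ] [SigmaFinite γ] (h : Controlled μ γ ev n 𝓕 ξ a s)
    (hev : ∀ a, Measurable (Function.uncurry (ev a))) (hG : Measurable G)
    {π : ℕ → X → Fin (m + 1)} (hπ : ∀ k s, bellman γ ev G (k + 1) s =
      ∫⁻ w, bellman γ ev G k (ev (π k s) s w) ∂γ)
    (ha : ∀ j < n, ∀ ω, a j ω = π (n - (j + 1)) (s j ω)) {E : Set Ω}
    (hE : MeasurableSet[𝓕 0] E) :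
    ∫⁻ ω in E, G (s n ω) ∂μ = ∫⁻ ω in E, bellman γ ev G n (s 0 ω) ∂μ := by
  suffices ∀ j ≤ n, ∫⁻ ω in E, bellman γ ev G (n - j) (s j ω) ∂μ =
      ∫⁻ ω in E, bellman γ ev G n (s 0 ω) ∂μ by
    have := this n le_rfl
    rwa [Nat.sub_self] at this
  intro j
  induction j with
  | zero => intro _; rfl
  | succ j ih =>
    intro hj
    rw [← ih (by omega)]
    rw [h.setLIntegral_bellman_succ hev hG hj (n - (j + 1)) (h.mono (Nat.zero_le j) _ hE),
      show n - j = (n - (j + 1)) + 1 by omega]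
    refine lintegral_congr fun ω => ?_
    rw [hπ, ha j hj]

end Controlled

end DynamicProgramming

end Liquidation

/-! ### Gaussian laws under small translations. -/

namespace Liquidation

open Filter Topology

/-- Continuity of Gaussian expectations with respect to the mean, uniformly over bounded
functions. -/
theorem exists_gaussian_shift {v : ℝ≥0} (hv : v ≠ 0) {η : ℝ} (hη : 0 < η) :
    ∃ δ > 0, ∀ a : ℝ, |a| < δ → ∀ g : ℝ → ℝ≥0∞, Measurable g → (∀ x, g x ≤ 1) →
      ∫⁻ x, g (x + a) ∂gaussianReal 0 v ≤ (∫⁻ x, g x ∂gaussianReal 0 v) + ENNReal.ofReal η := by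
  -- Scheffé's argument: the densities converge pointwise, and the positive part of `φ₀ - φ_a` is
  -- dominated by the fixed density `φ₀`.
  have hlim : Tendsto (fun a : ℝ => ∫⁻ x, (gaussianPDF 0 v x - gaussianPDF a v x)) (𝓝 0) (𝓝 0) := by
    have h0 : ∫⁻ _ : ℝ, (0 : ℝ≥0∞) = 0 := lintegral_zero
    rw [← h0]
    refine tendsto_lintegral_filter_of_dominated_convergence (gaussianPDF 0 v) ?_ ?_ ?_ ?_
    · exact Eventually.of_forall fun a => (measurable_gaussianPDF 0 v).sub (measurable_gaussianPDF a v)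
    · exact Eventually.of_forall fun a => Eventually.of_forall fun x => tsub_le_self
    · rw [lintegral_gaussianPDF_eq_one 0 hv]; exact ENNReal.one_ne_top
    · refine Eventually.of_forall fun x => ?_
      have hc : Tendsto (fun a : ℝ => gaussianPDF a v x) (𝓝 0) (𝓝 (gaussianPDF 0 v x)) := by
        unfold gaussianPDF
        refine ENNReal.tendsto_ofReal ?_
        have : Continuous fun a : ℝ => gaussianPDFReal a v x := by
          unfold gaussianPDFReal
          fun_prop
        exact this.tendsto 0
      have := ENNReal.Tendsto.sub (tendsto_const_nhds (x := gaussianPDF 0 v x)) hc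
        (Or.inl gaussianPDF_ne_top)
      rwa [tsub_self] at this
  have hev := hlim.eventually_lt_const (ENNReal.ofReal_pos.2 hη)
  obtain ⟨δ, hδ, hball⟩ := Metric.eventually_nhds_iff.1 hev
  refine ⟨δ, hδ, fun a ha g hg hg1 => ?_⟩
  have hsmall := hball (y := a) (by simpa using ha)
  have hshift : ∀ g : ℝ → ℝ≥0∞, Measurable g → ∫⁻ x, g (x + a) ∂gaussianReal 0 v =
      ∫⁻ x, gaussianPDF a v x * g x := by
    intro g hg
    have := gaussianReal_map_add_const (μ := 0) (v := v) a
    rw [← lintegral_map (f := g) hg (measurable_add_const a), this, zero_add,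
      gaussianReal_of_var_ne_zero _ hv,
      lintegral_withDensity_eq_lintegral_mul _ (measurable_gaussianPDF a v) hg]
    rfl
  have hbase : ∀ g : ℝ → ℝ≥0∞, Measurable g → ∫⁻ x, g x ∂gaussianReal 0 v =
      ∫⁻ x, gaussianPDF 0 v x * g x := by
    intro g hg
    rw [gaussianReal_of_var_ne_zero _ hv,
      lintegral_withDensity_eq_lintegral_mul _ (measurable_gaussianPDF 0 v) hg]
    rfl
  have hg' : Measurable fun x => 1 - g x := hg.const_sub 1
  have hmg : ∀ a, Measurable fun x => gaussianPDF a v x * g x := fun a =>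
    (measurable_gaussianPDF a v).mul hg
  have hmg' : ∀ a, Measurable fun x => gaussianPDF a v x * (1 - g x) := fun a =>
    (measurable_gaussianPDF a v).mul hg'
  -- The positive part of `φ₀ - φ_a` bounds integrals against `φ₀` by integrals against `φ_a`.
  -- Applied to `1 - g`, and since both laws have mass one, this gives the inequality in the other
  -- direction for `g`.
  have key : ∫⁻ x, gaussianPDF 0 v x * (1 - g x) ≤ (∫⁻ x, gaussianPDF a v x * (1 - g x)) +
      ENNReal.ofReal η := by
    calc ∫⁻ x, gaussianPDF 0 v x * (1 - g x)
        ≤ ∫⁻ x, (gaussianPDF a v x * (1 - g x) + (gaussianPDF 0 v x - gaussianPDF a v x)) := by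
          refine lintegral_mono fun x => ?_
          calc gaussianPDF 0 v x * (1 - g x)
              ≤ (gaussianPDF a v x + (gaussianPDF 0 v x - gaussianPDF a v x)) * (1 - g x) := by
                gcongr; exact le_add_tsub
            _ ≤ _ := by
                rw [add_mul]
                gcongr
                exact mul_le_of_le_one_right' tsub_le_self
      _ = (∫⁻ x, gaussianPDF a v x * (1 - g x)) +
          ∫⁻ x, (gaussianPDF 0 v x - gaussianPDF a v x) :=
          lintegral_add_left (hmg' a) _
      _ ≤ _ := by gcongr
  have hsum : ∀ a : ℝ, (∫⁻ x, gaussianPDF a v x * g x) + ∫⁻ x, gaussianPDF a v x * (1 - g x) = 1 := by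
    intro a
    rw [← lintegral_add_left (hmg a)]
    refine (lintegral_congr fun x => ?_).trans (lintegral_gaussianPDF_eq_one a hv)
    rw [← mul_add, add_tsub_cancel_of_le (hg1 x), mul_one]
  rw [hshift g hg, hbase g hg]
  have e0 := hsum 0
  have ea := hsum a
  have hfin : ∫⁻ x, gaussianPDF a v x * (1 - g x) ≠ ∞ := by
    intro h
    rw [h, add_top] at ea
    exact ENNReal.top_ne_one ea
  refine (ENNReal.add_le_add_iff_right hfin).1 ?_
  rw [ea, add_assoc, add_comm (ENNReal.ofReal η)]
  exact e0.symm.le.trans (add_le_add le_rfl key)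

end Liquidation

/-! ### Brownian oscillations just after the initial time. -/

namespace Liquidation

open Filter Topology

/-- By scaling, a centred Gaussian variable exceeds its standard deviation with a positive
probability that does not depend on the variance. -/
theorem exists_gaussian_quantile : ∃ c : ℝ≥0∞, c < 1 ∧ ∀ v : ℝ≥0,
    v ≠ 0 → gaussianReal 0 v (Iic (Real.sqrt v)) = c := by
  refine ⟨gaussianReal 0 1 (Iic 1), ?_, fun v hv => ?_⟩
  · have h1 : 0 < gaussianReal 0 1 (Ioi 1) := by
      refine pos_iff_ne_zero.2 fun h0 => ?_
      have := gaussianReal_absolutelyContinuous' 0 one_ne_zero h0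
      simp at this
    have h2 := prob_compl_eq_one_sub (μ := gaussianReal 0 1) (measurableSet_Ioi (a := (1 : ℝ)))
    rw [compl_Ioi] at h2
    rw [h2]
    exact ENNReal.sub_lt_self ENNReal.one_ne_top one_ne_zero h1.ne'
  · have hv' : (0 : ℝ) < v := by exact_mod_cast pos_iff_ne_zero.2 hv
    have h := gaussianReal_map_const_mul (μ := 0) (v := 1) (Real.sqrt v)
    have he : NNReal.mk (Real.sqrt v ^ 2) (sq_nonneg _) * 1 = v := by
      rw [mul_one]
      ext
      exact Real.sq_sqrt hv'.le
    rw [mul_zero, he] at h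
    rw [← h, Measure.map_apply (measurable_const_mul _) measurableSet_Iic]
    congr 1
    ext x
    simp only [mem_preimage, mem_Iic]
    exact mul_le_iff_le_one_right (Real.sqrt_pos.2 hv')

namespace Market

variable {Ω : Type*} [MeasurableSpace Ω] {M : Market Ω}

/-- The mean value inequality with the bound on `∂f/∂θ`. It holds down to lag `0`, and for all lags
because the projection on `[0,T]` is `1`-Lipschitz. -/
theorem Hcf.exists_lipschitz (hc : M.Hcf) : ∃ C : ℝ, 0 ≤ C ∧ ∀ e : ℝ, 0 ≤ e → ∀ a b : ℝ,
    |M.proceeds e a - M.proceeds e b| ≤ e * (C * |a - b|) := by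
  obtain ⟨C, hC⟩ := hc.bounded
  refine ⟨|C|, abs_nonneg C, fun e he a b => ?_⟩
  rcases he.eq_or_lt with rfl | he
  · simp [proceeds]
  have hT := NNReal.coe_nonneg M.T
  have hdiff : DifferentiableOn ℝ (fun θ => (M.f (-e) θ).toReal) (Icc (0 : ℝ) M.T) := by
    have h1 := hc.smooth.differentiableOn one_ne_zero
    refine DifferentiableOn.comp (g := fun q : ℝ × ℝ => (M.f q.1 q.2).toReal)
      (f := fun θ : ℝ => ((-e, θ) : ℝ × ℝ)) h1 (by fun_prop) fun θ hθ => ⟨?_, hθ⟩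
    exact mem_Iio.2 (by linarith)
  have key := Convex.norm_image_sub_le_of_norm_derivWithin_le (s := Icc (0 : ℝ) M.T) (C := |C|)
    hdiff (fun θ hθ => (hC (-e) (by linarith) θ hθ).trans (le_abs_self C)) (convex_Icc _ _)
    (projIcc (0 : ℝ) M.T hT b).2 (projIcc (0 : ℝ) M.T hT a).2
  rw [proceeds, proceeds, ← mul_sub, abs_mul, abs_of_pos he]
  refine mul_le_mul_of_nonneg_left (key.trans ?_) he.le
  refine mul_le_mul_of_nonneg_left ?_ (abs_nonneg C)
  rw [Real.norm_eq_abs, coe_projIcc, coe_projIcc]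
  have h1 := abs_max_sub_max_le_abs (min (M.T : ℝ) a) (min (M.T : ℝ) b) 0
  have h2 := abs_min_sub_min_le_max (M.T : ℝ) a M.T b
  rw [sub_self, abs_zero, max_eq_right (abs_nonneg _)] at h2
  rw [max_comm 0, max_comm 0]
  exact h1.trans h2

theorem Hcf.tendsto_proceeds_lag (hc : M.Hcf) {ι : Type*} {l : Filter ι} {e a : ℝ} {θ : ι → ℝ}
    (he : 0 ≤ e) (hθ : Tendsto θ l (𝓝 a)) :
    Tendsto (fun i => M.proceeds e (θ i)) l (𝓝 (M.proceeds e a)) := by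
  obtain ⟨C, -, hC⟩ := hc.exists_lipschitz
  rw [tendsto_iff_dist_tendsto_zero] at hθ ⊢
  refine squeeze_zero (fun _ => dist_nonneg) (fun i => hC e he (θ i) a) ?_
  have := (hθ.const_mul C).const_mul e
  simpa [Real.dist_eq] using this

/-- After the current time, the proceeds of a feasible sale are feasible again at arbitrarily small
times, with a positive remaining cash. -/
theorem ContVersion.frequently_cash_gt [IsProbabilityMeasure M.prob] (hF : M.UsualConditions)
    (hσ : 0 < M.σ) (hf : M.BorelImpact) (hc : M.Hcf) {B : ℝ≥0 → Ω → ℝ} (hB : ContVersion M B)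
    {t : ℝ≥0} {p x θ l : ℝ} (hp : 0 < p) (hx : x < 0) (hl : l < 1)
    {e : Ω → ℝ} (he : Measurable[M.F t] e) {u : ℕ → ℝ≥0} (hu : ∀ k, t < u k)
    (huT : ∀ k, u k ≤ M.T) (huA : Antitone u) (hlim : Tendsto u atTop (𝓝 t)) :
    ∀ᵐ ω ∂M.prob, 0 ≤ e ω → 0 ≤ x + p * M.proceeds (e ω) θ → ∃ᶠ k in atTop,
      l * (x + p * M.proceeds (e ω) θ) <
        x + M.gbm B t p (u k) ω * M.proceeds (e ω) (θ + (u k - t)) := by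
  obtain ⟨C, hC0, hC⟩ := hc.exists_lipschitz
  set c0 : Ω → ℝ := fun ω => x + p * M.proceeds (e ω) θ with hc0
  set c : ℕ → Ω → ℝ := fun k ω =>
    x + M.gbm B t p (u k) ω * M.proceeds (e ω) (θ + (u k - t)) with hcdef
  set D : Set Ω := {ω | 0 ≤ e ω ∧ 0 ≤ c0 ω ∧ ∀ᶠ k in atTop, c k ω ≤ l * c0 ω} with hD
  have hφ := measurable_proceeds hf
  have hmc0 : Measurable[M.F t] c0 :=
    ((hφ.comp (he.prodMk measurable_const)).const_mul p).const_add x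
  have hmc : ∀ k, Measurable[M.F (u k)] (c k) := fun k =>
    ((hB.measurable_gbm (hu k).le le_rfl p).mul
      (hφ.comp ((he.mono (M.F.mono (hu k).le) le_rfl).prodMk measurable_const))).const_add x
  -- The failure event `D` depends only on what happens at arbitrarily small times after `t`. It
  -- lies in `F s` for every `s > t`, hence in `F t` by right-continuity.
  have hDt : MeasurableSet[M.F t] D := by
    have hr := hF.rightCont
    refine Filtration.IsRightContinuous.measurableSet ?_
    rw [Filtration.rightCont_eq]
    simp only [MeasurableSpace.measurableSet_iInf]
    intro s hs
    obtain ⟨K, hK⟩ := (hlim.eventually_lt_const hs).exists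
    have hDeq : D = {ω | 0 ≤ e ω} ∩ ({ω | 0 ≤ c0 ω} ∩
        ⋃ N, ⋂ k, ⋂ (_ : max K N ≤ k), {ω | c k ω ≤ l * c0 ω}) := by
      ext ω
      simp only [hD, mem_ofPred_eq, mem_inter_iff, mem_iUnion, mem_iInter, eventually_atTop]
      refine and_congr_right fun _ => and_congr_right fun _ => ⟨fun ⟨N, hN⟩ => ⟨N, fun k hk =>
        hN k ((le_max_right _ _).trans hk)⟩, fun ⟨N, hN⟩ => ⟨max K N, hN⟩⟩
    rw [hDeq]
    have he' : Measurable[M.F s] e := he.mono (M.F.mono (le_of_lt hs)) le_rfl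
    have hmc0' : Measurable[M.F s] c0 := hmc0.mono (M.F.mono (le_of_lt hs)) le_rfl
    refine (measurableSet_le measurable_const he').inter
      ((measurableSet_le measurable_const hmc0').inter ?_)
    refine MeasurableSet.iUnion fun N => MeasurableSet.iInter fun k => MeasurableSet.iInter
      fun hk => ?_
    have hku : u k ≤ s := (huA ((le_max_left _ _).trans hk)).trans hK.le
    exact measurableSet_le ((hmc k).mono (M.F.mono hku) le_rfl) (hmc0'.const_mul l)
  have hδ : Tendsto (fun k => (u k : ℝ) - t) atTop (𝓝 0) := by
    have := (NNReal.tendsto_coe.2 hlim).sub_const (t : ℝ)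
    rwa [sub_self] at this
  have hcl : ∀ ω, 0 ≤ e ω → Tendsto (fun k => c k ω) atTop (𝓝 (c0 ω)) := by
    intro ω hω
    have h1 : Tendsto (fun k => M.gbm B t p (u k) ω) atTop (𝓝 p) := by
      have h := ((hB.continuous_gbm t p ω).tendsto t).comp hlim
      have h0 : M.gbm B t p t ω = p := by simp [gbm]
      rwa [h0] at h
    have h2 : Tendsto (fun k => M.proceeds (e ω) (θ + (u k - t))) atTop
        (𝓝 (M.proceeds (e ω) θ)) := by
      refine hc.tendsto_proceeds_lag hω ?_
      have := hδ.const_add θ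
      rwa [add_zero] at this
    exact (h1.mul h2).const_add x
  -- In the limit `c0 ≤ l c0`, so `c0 = 0` on `D`. If the increment of `B` exceeded `r = √(u k -
  -- t)`, the price would gain about `σ r`, against a drift and a loss from the lag of order `r ^
  -- 2`, and the cash would be positive.
  have hsmall : ∀ ω ∈ D, ∀ᶠ k in atTop, B (u k) ω - B t ω ≤ Real.sqrt ((u k : ℝ) - t) := by
    rintro ω ⟨h0, h00, hev⟩
    have hzero : c0 ω = 0 := by
      have := le_of_tendsto (hcl ω h0) hev
      nlinarith
    have hφ0 : 0 < M.proceeds (e ω) θ := by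
      have h1 : x + p * M.proceeds (e ω) θ = 0 := hzero
      by_contra! hneg
      nlinarith
    set φ0 := M.proceeds (e ω) θ with hφ0def
    set b' := M.b - M.σ ^ 2 / 2 with hb'
    have hr : Tendsto (fun k => Real.sqrt ((u k : ℝ) - t)) atTop (𝓝 0) := by
      have := (Real.continuous_sqrt.tendsto 0).comp hδ
      rwa [Real.sqrt_zero] at this
    -- This is `(1 + r (b' r + σ)) (φ0 - e C r ^ 2) - φ0` divided by `r`; at `r = 0` it equals `σ φ0
    -- > 0`.
    have g1 : ∀ᶠ k in atTop, 0 < (b' * Real.sqrt ((u k : ℝ) - t) + M.σ) * φ0 -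
        e ω * C * Real.sqrt ((u k : ℝ) - t) * (1 + Real.sqrt ((u k : ℝ) - t) *
          (b' * Real.sqrt ((u k : ℝ) - t) + M.σ)) := by
      have hct : Continuous fun r : ℝ => (b' * r + M.σ) * φ0 - e ω * C * r * (1 + r * (b' * r + M.σ)) := by
        fun_prop
      have := (hct.tendsto 0).comp hr
      refine this.eventually_const_lt ?_
      simp only [mul_zero, zero_add, zero_mul, sub_zero]
      positivity
    have g2 : ∀ᶠ k in atTop, 0 < φ0 - e ω * C * Real.sqrt ((u k : ℝ) - t) ^ 2 := by
      have hct : Continuous fun r : ℝ => φ0 - e ω * C * r ^ 2 := by fun_prop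
      refine ((hct.tendsto 0).comp hr).eventually_const_lt ?_
      simpa using hφ0
    have g3 : ∀ᶠ k in atTop, 0 < b' * Real.sqrt ((u k : ℝ) - t) + M.σ := by
      have hct : Continuous fun r : ℝ => b' * r + M.σ := by fun_prop
      refine ((hct.tendsto 0).comp hr).eventually_const_lt ?_
      simpa using hσ
    filter_upwards [hev, g1, g2, g3] with k hk k1 k2 k3
    by_contra! hlt
    rw [hzero, mul_zero] at hk
    have hδk : 0 < (u k : ℝ) - t := sub_pos.2 (by exact_mod_cast hu k)
    set r := Real.sqrt ((u k : ℝ) - t) with hrdef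
    have hr0 : 0 < r := Real.sqrt_pos.2 hδk
    have hr2 : (u k : ℝ) - t = r ^ 2 := (Real.sq_sqrt hδk.le).symm
    have hlip := hC (e ω) h0 (θ + (u k - t)) θ
    rw [add_sub_cancel_left, abs_of_pos hδk, hr2] at hlip
    have hlow := (abs_le.1 hlip).1
    have hexp : 1 + r * (b' * r + M.σ) ≤ Real.exp (b' * ((u k : ℝ) - t) + M.σ * (B (u k) ω - B t ω)) := by
      refine le_trans ?_ (Real.add_one_le_exp _)
      rw [hr2]
      nlinarith
    have hck : x + p * Real.exp (b' * ((u k : ℝ) - t) + M.σ * (B (u k) ω - B t ω)) *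
        M.proceeds (e ω) (θ + (u k - t)) ≤ 0 := hk
    rw [hr2] at hck hexp
    have hx' : x = -(p * φ0) := by
      have : x + p * φ0 = 0 := hzero
      linarith
    set E := Real.exp (b' * r ^ 2 + M.σ * (B (u k) ω - B t ω)) with hE
    set ψ := M.proceeds (e ω) (θ + r ^ 2) with hψ
    have h3 : p * (E * ψ) ≤ p * φ0 := by rw [hx'] at hck; linarith
    have h4 : E * ψ ≤ φ0 := le_of_mul_le_mul_left h3 hp
    have hψ1 : φ0 - e ω * C * r ^ 2 ≤ ψ := by linarith
    have hz : 0 < r * (b' * r + M.σ) := mul_pos hr0 k3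
    have h5 : (1 + r * (b' * r + M.σ)) * (φ0 - e ω * C * r ^ 2) ≤ φ0 := by
      refine le_trans ?_ h4
      exact mul_le_mul hexp hψ1 k2.le (Real.exp_pos _).le
    have h6 := mul_pos hr0 k1
    nlinarith
  obtain ⟨κ, hκ1, hκ⟩ := exists_gaussian_quantile
  -- On `D` the increments are eventually at most their standard deviation. Each of these events has
  -- probability `κ < 1` and is independent of `D`, which lies in `F t`; hence `P(D) ≤ κ P(D)`.
  have hD0 : M.prob D = 0 := by
    set A : ℕ → Set Ω := fun k => (fun ω => B (u k) ω - B t ω) ⁻¹' Iic (Real.sqrt ((u k : ℝ) - t))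
    have hA : ∀ k, M.prob (D ∩ A k) = M.prob D * κ := by
      intro k
      rw [hB.indep t (u k) (hu k).le (huT k) D hDt _ measurableSet_Iic]
      congr 1
      have := hκ (u k - t) (tsub_pos_of_lt (hu k)).ne'
      rwa [NNReal.coe_sub (hu k).le] at this
    have hle : M.prob D ≤ M.prob D * κ := by
      have hDU : D = ⋃ N, (D ∩ ⋂ k, ⋂ (_ : N ≤ k), A k) := by
        ext ω
        simp only [mem_iUnion, mem_inter_iff, mem_iInter]
        constructor
        · intro h
          obtain ⟨N, hN⟩ := eventually_atTop.1 (hsmall ω h)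
          exact ⟨N, h, fun k hk => hN k hk⟩
        · rintro ⟨N, h, -⟩; exact h
      conv_lhs => rw [hDU]
      rw [Monotone.measure_iUnion]
      · refine iSup_le fun N => ?_
        rw [← hA N]
        exact measure_mono (inter_subset_inter_right _ (iInter₂_subset N le_rfl))
      · intro N N' hNN'
        refine inter_subset_inter_right _ ?_
        exact iInter_mono fun k => iInter_mono' fun hk => ⟨hNN'.trans hk, le_rfl⟩
    by_contra hne
    have : M.prob D * κ < M.prob D * 1 :=
      ENNReal.mul_lt_mul_right hne (measure_ne_top _ _) hκ1
    rw [mul_one] at this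
    exact absurd hle (not_le.2 this)
  filter_upwards [measure_eq_zero_iff_ae_notMem.1 hD0] with ω hω h0 h00
  by_contra hno
  refine hω ⟨h0, h00, ?_⟩
  rw [not_frequently] at hno
  exact hno.mono fun k hk => not_lt.1 hk

end Market

end Liquidation

/-! ### The discretized model: orders, steps and abandoned states. -/

namespace Liquidation

open Filter Topology

/-- The order size coded by an action: multiples of `1 / N` of absolute value at most `N`. -/
def orderSize (N : ℕ) (a : Fin (2 * N ^ 2 + 1 + 1)) : ℝ := ((a : ℕ) - 1 - (N : ℝ) ^ 2) / N

open Classical in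
/-- The action trading `z / N` shares. -/
def orderCode (N : ℕ) (z : ℤ) : Fin (2 * N ^ 2 + 1 + 1) :=
  if h : |z| ≤ (N : ℤ) ^ 2 then ⟨(z + N ^ 2 + 1).toNat, by
    obtain ⟨h1, h2⟩ := abs_le.1 h
    have h3 : ((N ^ 2 : ℕ) : ℤ) = (N : ℤ) ^ 2 := by push_cast; rfl
    generalize (N : ℤ) ^ 2 = m at *
    generalize N ^ 2 = k at *
    omega⟩ else 0

/-- The action `0` means no order; the actions `1, ..., 2 N ^ 2 + 1` code the multiples of `1 / N`
from `-N` to `N`. -/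
theorem orderCode_spec {N : ℕ} {z : ℤ} (h : |z| ≤ (N : ℤ) ^ 2) :
    orderCode N z ≠ 0 ∧ orderSize N (orderCode N z) = z / N := by
  have h' := abs_le.1 h
  rw [orderCode, dif_pos h]
  constructor
  · intro h0
    have := congrArg Fin.val h0
    simp only [Fin.val_zero] at this
    omega
  · rw [orderSize]
    congr 1
    have : (((z + N ^ 2 + 1).toNat : ℤ) : ℝ) = ((z + N ^ 2 + 1 : ℤ) : ℝ) := by
      rw [Int.toNat_of_nonneg (by omega)]
    simp only [Int.cast_natCast] at this
    simp only [this]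
    push_cast
    ring

namespace Market

variable {Ω : Type*} [MeasurableSpace Ω] (M : Market Ω)

/-- The cost of an order of size `ξ` in the state `(cash, shares, price, lag)`. -/
def orderCost (ξ : ℝ) (s : ℝ × ℝ × ℝ × ℝ) : ℝ :=
  ξ * s.2.2.1 * (M.impactExt ξ s.2.2.2).toReal

/-- The possibility of an order of size `ξ` in the state `(cash, shares, price, lag)`. -/
def Feasible (ξ : ℝ) (s : ℝ × ℝ × ℝ × ℝ) : Prop :=
  s.2.2.2 ∈ Ioc (0 : ℝ) M.T ∧ M.impactExt ξ s.2.2.2 ≠ ∞ ∧ 0 ≤ s.1 - M.orderCost ξ s ∧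
    0 ≤ s.2.1 + ξ

open Classical in
/-- The state after the action `a`, which is ignored when it is not feasible. -/
def stepState (N : ℕ) (a : Fin (2 * N ^ 2 + 1 + 1)) (s : ℝ × ℝ × ℝ × ℝ) : ℝ × ℝ × ℝ × ℝ :=
  if a ≠ 0 ∧ M.Feasible (orderSize N a) s then
    (s.1 - M.orderCost (orderSize N a) s, s.2.1 + orderSize N a, s.2.2.1, 0) else s

open Classical in
/-- A state of negative cash is abandoned when its liquidation value is negative or its lag is
about to exceed `T`. -/
def killState (d : ℝ≥0) (s : ℝ × ℝ × ℝ × ℝ) : ℝ × ℝ × ℝ × ℝ :=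
  if s.1 < 0 ∧ (s.1 + s.2.2.1 * M.proceeds s.2.1 s.2.2.2 < 0 ∨ (M.T : ℝ) < s.2.2.2 + d) then
    (-1, 0, s.2.2) else s

/-- The evolution of the discretized model over a time step `d`. -/
def evolve (N : ℕ) (d : ℝ≥0) (a : Fin (2 * N ^ 2 + 1 + 1)) (s : ℝ × ℝ × ℝ × ℝ) (w : ℝ) :
    ℝ × ℝ × ℝ × ℝ :=
  ((M.killState d (M.stepState N a s)).1, (M.killState d (M.stepState N a s)).2.1,
    s.2.2.1 * Real.exp ((M.b - M.σ ^ 2 / 2) * d + M.σ * w),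
    (M.killState d (M.stepState N a s)).2.2.2 + d)

/-- The truncated utility of the final cash. -/
def reward (C : ℝ) (s : ℝ × ℝ × ℝ × ℝ) : ℝ≥0∞ := ENNReal.ofReal (min (M.U (max 0 s.1)) C)

variable {M}

theorem measurable_orderCost (hf : M.BorelImpact) (ξ : ℝ) : Measurable (M.orderCost ξ) := by
  have h1 : Measurable fun s : ℝ × ℝ × ℝ × ℝ => s.2.2.1 := by fun_prop
  have h2 : Measurable fun s : ℝ × ℝ × ℝ × ℝ => (ξ, s.2.2.2) := by fun_prop
  exact (h1.const_mul ξ).mul ((measurable_impactExt hf).comp h2).ennreal_toReal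

theorem measurableSet_feasible (hf : M.BorelImpact) (ξ : ℝ) :
    MeasurableSet {s | M.Feasible ξ s} := by
  have h2 : Measurable fun s : ℝ × ℝ × ℝ × ℝ => (ξ, s.2.2.2) := by fun_prop
  have h3 : Measurable fun s : ℝ × ℝ × ℝ × ℝ => s.2.2.2 := by fun_prop
  refine (h3 measurableSet_Ioc).inter (MeasurableSet.inter ?_ (MeasurableSet.inter ?_ ?_))
  · exact (((measurable_impactExt hf).comp h2) (measurableSet_singleton ∞)).compl
  · exact measurableSet_le measurable_const (measurable_fst.sub (measurable_orderCost hf ξ))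
  · have h4 : Measurable fun s : ℝ × ℝ × ℝ × ℝ => s.2.1 + ξ := by fun_prop
    exact measurableSet_le measurable_const h4

theorem measurable_stepState (hf : M.BorelImpact) (N : ℕ) (a : Fin (2 * N ^ 2 + 1 + 1)) :
    Measurable (M.stepState N a) := by
  unfold stepState
  refine Measurable.ite ((MeasurableSet.const (a ≠ 0)).inter (measurableSet_feasible hf _)) ?_
    measurable_id
  exact (measurable_fst.sub (measurable_orderCost hf _)).prodMk (by fun_prop)

theorem measurable_killState (hf : M.BorelImpact) (d : ℝ≥0) : Measurable (M.killState d) := by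
  unfold killState
  have h1 : Measurable fun s : ℝ × ℝ × ℝ × ℝ => (s.2.1, s.2.2.2) := by fun_prop
  have h3 : Measurable fun s : ℝ × ℝ × ℝ × ℝ => s.2.2.2 + (d : ℝ) := by fun_prop
  have h2 : Measurable fun s : ℝ × ℝ × ℝ × ℝ => s.2.2.1 := by fun_prop
  have h4 : Measurable fun s : ℝ × ℝ × ℝ × ℝ => s.1 + s.2.2.1 * M.proceeds s.2.1 s.2.2.2 :=
    measurable_fst.add (h2.mul ((measurable_proceeds hf).comp h1))
  exact Measurable.ite (MeasurableSet.inter (measurableSet_lt measurable_fst measurable_const)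
    (MeasurableSet.union (measurableSet_lt h4 measurable_const)
      (measurableSet_lt measurable_const h3))) (by fun_prop) measurable_id

theorem measurable_evolve (hf : M.BorelImpact) (N : ℕ) (d : ℝ≥0) (a : Fin (2 * N ^ 2 + 1 + 1)) :
    Measurable (Function.uncurry (M.evolve N d a)) := by
  have h1 : Measurable fun z : (ℝ × ℝ × ℝ × ℝ) × ℝ => M.killState d (M.stepState N a z.1) :=
    (measurable_killState hf d).comp ((measurable_stepState hf N a).comp measurable_fst)
  unfold evolve Function.uncurry
  refine h1.fst.prodMk (h1.snd.fst.prodMk (Measurable.prodMk ?_ (h1.snd.snd.snd.add_const _)))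
  fun_prop

theorem measurable_reward (hU : M.HU) (C : ℝ) : Measurable (M.reward C) :=
  ((hU.measurable.comp measurable_fst).min measurable_const).ennreal_ofReal

theorem reward_le (C : ℝ) (s : ℝ × ℝ × ℝ × ℝ) : M.reward C s ≤ ENNReal.ofReal C :=
  ENNReal.ofReal_le_ofReal (min_le_right _ _)

theorem reward_eq_zero (hU : M.HU) {C : ℝ} {s : ℝ × ℝ × ℝ × ℝ} (hs : s.1 < 0) :
    M.reward C s = 0 := by
  rw [reward, max_eq_left hs.le, hU.zero]
  exact ENNReal.ofReal_eq_zero.2 (min_le_left _ _)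

/-- The abandoned states. -/
def Dead (s : ℝ × ℝ × ℝ × ℝ) : Prop := s.1 = -1 ∧ s.2.1 = 0

/-- Without shares nothing can be sold, and a purchase only lowers the cash `-1`: an abandoned state
can never recover and earns no reward. -/
theorem Dead.not_feasible {s : ℝ × ℝ × ℝ × ℝ} (h : Dead s) (hp : 0 < s.2.2.1) (ξ : ℝ) :
    ¬ M.Feasible ξ s := by
  rintro ⟨-, -, h1, h2⟩
  rw [h.1] at h1
  rw [h.2, zero_add] at h2
  have : 0 ≤ M.orderCost ξ s := mul_nonneg (mul_nonneg h2 hp.le) ENNReal.toReal_nonneg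
  linarith

theorem dead_killState {d : ℝ≥0} {s : ℝ × ℝ × ℝ × ℝ} (h : Dead s) : Dead (M.killState d s) := by
  rw [killState]
  split_ifs
  · exact ⟨rfl, rfl⟩
  · exact h

theorem killState_cases (d : ℝ≥0) (s : ℝ × ℝ × ℝ × ℝ) :
    M.killState d s = s ∨ (Dead (M.killState d s) ∧ s.1 < 0) := by
  rw [killState]
  split_ifs with h
  · exact Or.inr ⟨⟨rfl, rfl⟩, h.1⟩
  · exact Or.inl rfl

theorem Dead.evolve {N : ℕ} {d : ℝ≥0} {a : Fin (2 * N ^ 2 + 1 + 1)} {s : ℝ × ℝ × ℝ × ℝ}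
    (h : Dead s) (hp : 0 < s.2.2.1) (w : ℝ) : Dead (M.evolve N d a s w) := by
  have h1 : M.stepState N a s = s := if_neg fun h' => h.not_feasible hp _ h'.2
  have h2 := dead_killState (M := M) (d := d) h
  rw [Market.evolve, h1]
  exact h2

theorem gbm_succ (B : ℝ≥0 → Ω → ℝ) (t : ℝ≥0) (p : ℝ) (s d : ℝ≥0) (ω : Ω) :
    M.gbm B t p (s + d) ω = M.gbm B t p s ω *
      Real.exp ((M.b - M.σ ^ 2 / 2) * d + M.σ * (B (s + d) ω - B s ω)) := by
  rw [gbm, gbm, mul_assoc, ← Real.exp_add]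
  congr 2
  push_cast
  ring

end Market

end Liquidation

/-! ### Comparing schedules path by path; gluing two of them along an event of `F t`. -/

namespace Liquidation

open Filter Topology

namespace Market

variable {Ω : Type*} [MeasurableSpace Ω] {M : Market Ω}

namespace Schedule

variable {t : ℝ≥0} {q : State} {S S' : M.Schedule t q}

theorem lastTime_congr {ω : Ω} {k : ℕ} (h : ∀ i < k, S.ρ i ω = S'.ρ i ω) :
    S.lastTime ω k = S'.lastTime ω k := by
  induction k with
  | zero => rfl
  | succ k ih => rw [lastTime, lastTime, h k k.lt_succ_self, ih fun i hi => h i (by omega)]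

theorem impact_congr {ω : Ω} {k : ℕ} (h : ∀ i ≤ k, S.ρ i ω = S'.ρ i ω) (hξ : S.ξ k ω = S'.ξ k ω) :
    S.impact k ω = S'.impact k ω := by
  rw [impact, impact, h k le_rfl, hξ, lastTime_congr fun i hi => h i hi.le]

theorem cashAt_congr {ω : Ω} {k : ℕ} (h : ∀ i < k, S.ρ i ω = S'.ρ i ω)
    (hξ : ∀ i < k, S.ξ i ω = S'.ξ i ω) : S.cashAt k ω = S'.cashAt k ω := by
  rw [cashAt, cashAt]
  congr 1
  refine Finset.sum_congr rfl fun i hi => ?_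
  have hi := Finset.mem_range.1 hi
  rw [cost, cost, impact_congr (fun j hj => h j (by omega)) (hξ i hi), h i hi, hξ i hi]

theorem sharesAt_congr {ω : Ω} {k : ℕ} (h : ∀ i < k, S.ρ i ω = S'.ρ i ω)
    (hξ : ∀ i < k, S.ξ i ω = S'.ξ i ω) : S.sharesAt k ω = S'.sharesAt k ω := by
  rw [sharesAt, sharesAt]
  congr 1
  refine Finset.sum_congr rfl fun i hi => ?_
  have hi := Finset.mem_range.1 hi
  rw [h i hi, hξ i hi]

theorem cashAt_of_le {ω : Ω} {k : ℕ} (h : S.n ≤ k) : S.cashAt k ω = S.cashAt S.n ω := by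
  induction k, h using Nat.le_induction with
  | base => rfl
  | succ k hk ih => rw [cashAt_succ_of_eq _ (S.bounded k ω hk), ih]

open Classical in
/-- The schedule equal to `S` on the event `A` and to `S'` off `A`. -/
def merge (S S' : M.Schedule t q) {A : Set Ω} (hA : MeasurableSet[M.F t] A) : M.Schedule t q where
  n := max S.n S'.n
  ρ k ω := if ω ∈ A then S.ρ k ω else S'.ρ k ω
  ξ k ω := if ω ∈ A then S.ξ k ω else S'.ξ k ω
  stopping k s := by
    by_cases hs : t ≤ s
    · have : {ω | (if ω ∈ A then S.ρ k ω else S'.ρ k ω) ≤ (s : WithTop ℝ≥0)} =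
          A ∩ {ω | S.ρ k ω ≤ (s : WithTop ℝ≥0)} ∪ Aᶜ ∩ {ω | S'.ρ k ω ≤ (s : WithTop ℝ≥0)} := by
        ext ω
        by_cases hω : ω ∈ A <;> simp [hω]
      rw [this]
      have hA' := M.F.mono hs _ hA
      exact (hA'.inter (S.stopping k s)).union (hA'.compl.inter (S'.stopping k s))
    -- At times `s < t` membership in `A` need not be known yet, but no trade has been made either.
    · have : {ω | (if ω ∈ A then S.ρ k ω else S'.ρ k ω) ≤ (s : WithTop ℝ≥0)} = ∅ := by
        refine eq_empty_of_forall_notMem fun ω hω => hs ?_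
        have hω : (if ω ∈ A then S.ρ k ω else S'.ρ k ω) ≤ (s : WithTop ℝ≥0) := hω
        split_ifs at hω
        · exact WithTop.coe_le_coe.1 ((S.start k ω).trans hω)
        · exact WithTop.coe_le_coe.1 ((S'.start k ω).trans hω)
      rw [this]
      exact @MeasurableSet.empty _ (M.F s)
  size_meas k V hV := by
    have h0 : (fun ω => if ω ∈ A then S.ξ k ω else S'.ξ k ω) ⁻¹' V =
        A ∩ S.ξ k ⁻¹' V ∪ Aᶜ ∩ S'.ξ k ⁻¹' V := by
      ext ω
      by_cases hω : ω ∈ A <;> simp [hω]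
    refine ⟨?_, fun s => ?_⟩
    · rw [h0]
      have hA' : MeasurableSet[⨆ s, M.F s] A := (le_iSup M.F t) _ hA
      exact (hA'.inter (S.size_meas k V hV).1).union (hA'.compl.inter (S'.size_meas k V hV).1)
    · by_cases hs : t ≤ s
      · have : (fun ω => if ω ∈ A then S.ξ k ω else S'.ξ k ω) ⁻¹' V ∩
            {ω | (if ω ∈ A then S.ρ k ω else S'.ρ k ω) ≤ (s : WithTop ℝ≥0)} =
            A ∩ (S.ξ k ⁻¹' V ∩ {ω | S.ρ k ω ≤ (s : WithTop ℝ≥0)}) ∪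
            Aᶜ ∩ (S'.ξ k ⁻¹' V ∩ {ω | S'.ρ k ω ≤ (s : WithTop ℝ≥0)}) := by
          ext ω
          by_cases hω : ω ∈ A <;> simp [hω]
        rw [this]
        have hA' := M.F.mono hs _ hA
        exact (hA'.inter ((S.size_meas k V hV).2 s)).union
          (hA'.compl.inter ((S'.size_meas k V hV).2 s))
      · have : (fun ω => if ω ∈ A then S.ξ k ω else S'.ξ k ω) ⁻¹' V ∩
            {ω | (if ω ∈ A then S.ρ k ω else S'.ρ k ω) ≤ (s : WithTop ℝ≥0)} = ∅ := by
          refine eq_empty_of_forall_notMem fun ω hω => hs ?_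
          have hω : (if ω ∈ A then S.ρ k ω else S'.ρ k ω) ≤ (s : WithTop ℝ≥0) := hω.2
          split_ifs at hω
          · exact WithTop.coe_le_coe.1 ((S.start k ω).trans hω)
          · exact WithTop.coe_le_coe.1 ((S'.start k ω).trans hω)
        rw [this]
        exact @MeasurableSet.empty _ (M.F s)
  start k ω := by
    split_ifs
    · exact S.start k ω
    · exact S'.start k ω
  horizon k ω := by
    split_ifs
    · exact S.horizon k ω
    · exact S'.horizon k ω
  bounded k ω hk := by
    split_ifs
    · exact S.bounded k ω ((le_max_left _ _).trans hk)
    · exact S'.bounded k ω ((le_max_right _ _).trans hk)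
  strict i k ω hik := by
    split_ifs
    · exact S.strict i k ω hik
    · exact S'.strict i k ω hik
  first k ω := by
    split_ifs
    · exact S.first k ω
    · exact S'.first k ω

section Merge

variable {A : Set Ω} {hA : MeasurableSet[M.F t] A}

theorem merge_ρ_of_mem {ω : Ω} (hω : ω ∈ A) (k : ℕ) : (S.merge S' hA).ρ k ω = S.ρ k ω := if_pos hω

theorem merge_ρ_of_notMem {ω : Ω} (hω : ω ∉ A) (k : ℕ) : (S.merge S' hA).ρ k ω = S'.ρ k ω :=
  if_neg hω

theorem merge_ξ_of_mem {ω : Ω} (hω : ω ∈ A) (k : ℕ) : (S.merge S' hA).ξ k ω = S.ξ k ω := if_pos hω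

theorem merge_ξ_of_notMem {ω : Ω} (hω : ω ∉ A) (k : ℕ) : (S.merge S' hA).ξ k ω = S'.ξ k ω :=
  if_neg hω

theorem Positive.merge (h : S.Positive) (h' : S'.Positive) : (S.merge S' hA).Positive := by
  refine ⟨⟨fun k ω => ?_, ?_, ?_⟩, ?_, ?_⟩
  · by_cases hω : ω ∈ A
    · rw [merge_ρ_of_mem hω]; exact h.lt_horizon k ω
    · rw [merge_ρ_of_notMem hω]; exact h'.lt_horizon k ω
  · filter_upwards [h.trade, h'.trade] with ω h1 h2 k
    by_cases hω : ω ∈ A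
    · rw [impact_congr (fun i _ => merge_ρ_of_mem hω i) (merge_ξ_of_mem hω k),
        cashAt_congr (fun i _ => merge_ρ_of_mem hω i) (fun i _ => merge_ξ_of_mem hω i),
        sharesAt_congr (fun i _ => merge_ρ_of_mem hω i) (fun i _ => merge_ξ_of_mem hω i),
        merge_ρ_of_mem hω]
      exact h1 k
    · rw [impact_congr (fun i _ => merge_ρ_of_notMem hω i) (merge_ξ_of_notMem hω k),
        cashAt_congr (fun i _ => merge_ρ_of_notMem hω i) (fun i _ => merge_ξ_of_notMem hω i),
        sharesAt_congr (fun i _ => merge_ρ_of_notMem hω i) (fun i _ => merge_ξ_of_notMem hω i),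
        merge_ρ_of_notMem hω]
      exact h2 k
  · filter_upwards [h.pre, h'.pre] with ω h1 h2 s hs hs' hk
    by_cases hω : ω ∈ A
    · exact h1 s hs hs' fun k => by rw [← merge_ρ_of_mem (S' := S') (hA := hA) hω]; exact hk k
    · exact h2 s hs hs' fun k => by rw [← merge_ρ_of_notMem (S := S) (hA := hA) hω]; exact hk k
  · filter_upwards [h.trade_pos, h'.trade_pos] with ω h1 h2 k
    by_cases hω : ω ∈ A
    · rw [cashAt_congr (fun i _ => merge_ρ_of_mem hω i) (fun i _ => merge_ξ_of_mem hω i),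
        merge_ρ_of_mem hω]
      exact h1 k
    · rw [cashAt_congr (fun i _ => merge_ρ_of_notMem hω i) (fun i _ => merge_ξ_of_notMem hω i),
        merge_ρ_of_notMem hω]
      exact h2 k
  · filter_upwards [h.pre_pos, h'.pre_pos] with ω h1 h2 s hs hs' hk
    by_cases hω : ω ∈ A
    · exact h1 s hs hs' fun k => by rw [← merge_ρ_of_mem (S' := S') (hA := hA) hω]; exact hk k
    · exact h2 s hs hs' fun k => by rw [← merge_ρ_of_notMem (S := S) (hA := hA) hω]; exact hk k

theorem payoff_merge : (S.merge S' hA).payoff =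
    (∫⁻ ω in A, ENNReal.ofReal (M.U (max 0 (S.cashAt S.n ω))) ∂M.prob) +
      ∫⁻ ω in Aᶜ, ENNReal.ofReal (M.U (max 0 (S'.cashAt S'.n ω))) ∂M.prob := by
  have hA' : MeasurableSet A := M.F.le t _ hA
  rw [payoff, ← lintegral_add_compl _ hA']
  congr 1
  · refine setLIntegral_congr_fun hA' fun ω hω => ?_
    rw [cashAt_congr (fun i _ => merge_ρ_of_mem hω i) (fun i _ => merge_ξ_of_mem hω i),
      cashAt_of_le (show S.n ≤ (S.merge S' hA).n from le_max_left _ _)]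
  · refine setLIntegral_congr_fun hA'.compl fun ω hω => ?_
    rw [cashAt_congr (fun i _ => merge_ρ_of_notMem hω i) (fun i _ => merge_ξ_of_notMem hω i),
      cashAt_of_le (show S'.n ≤ (S.merge S' hA).n from le_max_right _ _)]

end Merge

end Schedule

end Market

end Liquidation

/-! ### Guarded schedules, which stop before the first impossible trade. -/

namespace Liquidation

open Filter Topology

namespace Market

variable {Ω : Type*} [MeasurableSpace Ω] {M : Market Ω}

namespace Schedule

variable {t : ℝ≥0} {q : State} {S S' : M.Schedule t q} {B : ℝ≥0 → Ω → ℝ}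

open Classical in
/-- The part of a schedule before the time `r`. -/
def before (S : M.Schedule t q) (r : ℝ≥0) : M.Schedule t q where
  n := S.n
  ρ k ω := if S.ρ k ω ≤ (r : WithTop ℝ≥0) then S.ρ k ω else ⊤
  ξ := S.ξ
  stopping k := by
    refine isStoppingTime_restrict (A := {ω | S.ρ k ω ≤ (r : WithTop ℝ≥0)}) (S.stopping k) ?_
    exact (S.stopping k).measurableSet_le' r
  size_meas k := by
    refine StopMeas.restrict (A := {ω | S.ρ k ω ≤ (r : WithTop ℝ≥0)}) (S.stopping k) ?_
      (S.size_meas k)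
    exact (S.stopping k).measurableSet_le' r
  start k ω := by
    split_ifs
    · exact S.start k ω
    · exact le_top
  horizon k ω := by
    split_ifs
    · exact S.horizon k ω
    · exact Or.inr rfl
  bounded k ω hk := by
    split_ifs
    · exact S.bounded k ω hk
    · rfl
  strict i k ω hik := by
    split_ifs
    · exact S.strict i k ω hik
    · exact fun _ h => absurd rfl h
    · exact fun h => absurd rfl h
    · exact fun h => absurd rfl h
  first k ω := by
    split_ifs
    · exact S.first k ω
    · exact fun h => absurd rfl h

theorem before_le (r : ℝ≥0) (k : ℕ) (ω : Ω) (h : (S.before r).ρ k ω ≠ ⊤) :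
    (S.before r).ρ k ω ≤ (r : WithTop ℝ≥0) := by
  classical
  change (if S.ρ k ω ≤ (r : WithTop ℝ≥0) then S.ρ k ω else ⊤) ≠ ⊤ at h
  change (if S.ρ k ω ≤ (r : WithTop ℝ≥0) then S.ρ k ω else ⊤) ≤ _
  split_ifs at h ⊢ with h'
  · exact h'
  · exact absurd rfl h

/-- If the trade `k` is made by `r`, cutting the schedule at `r` changes nothing up to `k`. The
quantities of the cut schedule are `F r`-measurable, so whether the trade is good can be decided at
`r`. -/
theorem before_ρ {r : ℝ≥0} {k : ℕ} {ω : Ω} (h : S.ρ k ω ≤ (r : WithTop ℝ≥0)) {i : ℕ}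
    (hi : i ≤ k) : (S.before r).ρ i ω = S.ρ i ω := by
  classical
  change (if S.ρ i ω ≤ (r : WithTop ℝ≥0) then S.ρ i ω else ⊤) = _
  split_ifs with h'
  · rfl
  · by_contra hne
    have h1 : S.ρ i ω ≠ ⊤ := fun h => hne h.symm
    rcases hi.eq_or_lt with rfl | hi
    · exact h' h
    · exact h' ((S.strict i k ω hi h1 (ne_top_of_le_ne_top WithTop.coe_ne_top h)).le.trans h)

open Classical in
/-- The cash before the trade number `k`, in terms of the continuous version of the price. -/
def cashExt (S : M.Schedule t q) (B : ℝ≥0 → Ω → ℝ) (k : ℕ) (ω : Ω) : ℝ :=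
  q.cash - ∑ i ∈ Finset.range k, if S.ρ i ω ≠ ⊤ then
    S.ξ i ω * M.gbm B t q.price (clock (S.ρ i ω)) ω *
      (M.impactExt (S.ξ i ω) (clock (S.ρ i ω) - S.lastTime ω i)).toReal else 0

theorem cashExt_succ_of_ne {k : ℕ} {ω : Ω} (h : S.ρ k ω ≠ ⊤) :
    S.cashExt B (k + 1) ω = S.cashExt B k ω - S.ξ k ω * M.gbm B t q.price (clock (S.ρ k ω)) ω *
      (M.impactExt (S.ξ k ω) (clock (S.ρ k ω) - S.lastTime ω k)).toReal := by
  rw [cashExt, Finset.sum_range_succ, if_pos h, cashExt]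
  ring

theorem cashExt_succ_of_eq {k : ℕ} {ω : Ω} (h : S.ρ k ω = ⊤) :
    S.cashExt B (k + 1) ω = S.cashExt B k ω := by
  rw [cashExt, Finset.sum_range_succ, if_neg (not_not.2 h), cashExt, add_zero]

theorem cashExt_congr {ω : Ω} {k : ℕ} (h : ∀ i < k, S.ρ i ω = S'.ρ i ω)
    (hξ : ∀ i < k, S.ξ i ω = S'.ξ i ω) : S.cashExt B k ω = S'.cashExt B k ω := by
  rw [cashExt, cashExt]
  congr 1
  refine Finset.sum_congr rfl fun i hi => ?_
  have hi := Finset.mem_range.1 hi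
  rw [h i hi, hξ i hi, lastTime_congr fun j hj => h j (by omega)]

theorem cashAt_eq_cashExt {ω : Ω} (hB : ∀ s ≤ M.T, M.gbm B t q.price s ω = M.price t q.price s ω)
    {k : ℕ} (h : ∀ i < k, S.ρ i ω ≠ ⊤ → clock (S.ρ i ω) - S.lastTime ω i ∈ Ioc (0 : ℝ) M.T) :
    S.cashAt k ω = S.cashExt B k ω := by
  rw [cashAt, cashExt]
  congr 1
  refine Finset.sum_congr rfl fun i hi => ?_
  by_cases hk : S.ρ i ω = ⊤
  · rw [if_neg (not_not.2 hk), if_neg (not_not.2 hk)]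
  · have h2 := h i (Finset.mem_range.1 hi) hk
    rw [if_pos hk, if_pos hk, cost, impact, hB _ (clock_le_horizon hk),
      impactExt_of_mem ⟨h2.1.le, h2.2⟩]

open Classical in
theorem measurable_term (hB : ContVersion M B) (hf : M.BorelImpact) {r : ℝ≥0}
    (h : ∀ k ω, S.ρ k ω ≠ ⊤ → S.ρ k ω ≤ (r : WithTop ℝ≥0)) (k : ℕ) :
    Measurable[M.F r] (fun ω => if S.ρ k ω ≠ ⊤ then S.ξ k ω else 0) ∧
    Measurable[M.F r] (fun ω => if S.ρ k ω ≠ ⊤ then M.gbm B t q.price (clock (S.ρ k ω)) ω else 0) ∧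
    Measurable[M.F r] (fun ω => if S.ρ k ω ≠ ⊤ then
      M.impactExt (S.ξ k ω) (clock (S.ρ k ω) - S.lastTime ω k) else 1) ∧
    Measurable[M.F r] (fun ω => if S.ρ k ω ≠ ⊤ then
      clock (S.ρ k ω) - S.lastTime ω k else (1 : ℝ)) := by
  have hs : MeasurableSet[M.F r] {ω | S.ρ k ω ≠ ⊤} := by
    have : {ω | S.ρ k ω ≠ ⊤} = {ω | S.ρ k ω ≤ (r : WithTop ℝ≥0)} := by
      ext ω
      exact ⟨h k ω, fun h' => ne_top_of_le_ne_top WithTop.coe_ne_top h'⟩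
    rw [this]
    exact S.stopping k r
  have h1 := measurable_ite_ne_top (S.stopping k) (S.size_meas k) (h k)
  have h2 := measurable_ite_ne_top (S.stopping k) (stopMeas_of_measurable (S.stopping k)
    (hB.measurable_gbm_stopped (S.stopping k) q.price (S.start k))) (h k)
  have h3 := measurable_ite_ne_top (S.stopping k) (stopMeas_of_measurable (S.stopping k)
    (measurable_coe_nnreal_real.comp (measurable_clock (S.stopping k)))) (h k)
  have h4 := S.measurable_lastTime_of_le h k
  refine ⟨by convert! h1, by convert! h2, ?_, ?_⟩
  · have := @Measurable.ite _ _ _ _ (M.F r) _ _ (fun _ => Classical.propDecidable _) hs ((measurable_impactExt hf).comp (h1.prodMk (h3.sub h4)))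
      (@measurable_const _ _ _ (M.F r) 1)
    refine Eq.mp (congrArg (fun g => Measurable[M.F r] g) (funext fun ω => ?_)) this
    by_cases hω : S.ρ k ω ≠ ⊤
    · simp only [if_pos hω, Function.comp, Pi.sub_apply]
    · simp only [if_neg hω]
  · have := @Measurable.ite _ _ _ _ (M.F r) _ _ (fun _ => Classical.propDecidable _) hs (h3.sub h4) (@measurable_const _ _ _ (M.F r) 1)
    refine Eq.mp (congrArg (fun g => Measurable[M.F r] g) (funext fun ω => ?_)) this
    by_cases hω : S.ρ k ω ≠ ⊤
    · simp only [if_pos hω, Function.comp, Pi.sub_apply]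
    · simp only [if_neg hω]

theorem measurable_cashExt (hB : ContVersion M B) (hf : M.BorelImpact) {r : ℝ≥0}
    (h : ∀ k ω, S.ρ k ω ≠ ⊤ → S.ρ k ω ≤ (r : WithTop ℝ≥0)) (k : ℕ) :
    Measurable[M.F r] (S.cashExt B k) := by
  classical
  refine Measurable.const_sub ?_ _
  refine @Finset.measurable_fun_sum _ _ _ _ _ _ (M.F r) _ _ fun i _ => ?_
  obtain ⟨h1, h2, h3, -⟩ := S.measurable_term hB hf h i
  convert! (h1.mul h2).mul h3.ennreal_toReal using 2 with ω
  by_cases hω : S.ρ i ω ≠ ⊤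
  · simp only [if_pos hω, Pi.mul_apply]
  · simp only [if_neg hω, Pi.mul_apply, zero_mul]

/-- The event that the trade number `k` is possible and leaves positive cash. -/
def good (S : M.Schedule t q) (B : ℝ≥0 → Ω → ℝ) (k : ℕ) : Set Ω :=
  {ω | clock (S.ρ k ω) - S.lastTime ω k ∈ Ioc (0 : ℝ) M.T ∧
    M.impactExt (S.ξ k ω) (clock (S.ρ k ω) - S.lastTime ω k) ≠ ∞ ∧
    0 < S.cashExt B (k + 1) ω ∧ 0 ≤ S.sharesAt (k + 1) ω}

theorem measurableSet_good (hB : ContVersion M B) (hf : M.BorelImpact) (k : ℕ) (r : ℝ≥0) :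
    MeasurableSet[M.F r] (S.good B k ∩ {ω | S.ρ k ω ≤ (r : WithTop ℝ≥0)}) := by
  classical
  have hle := S.before_le r
  obtain ⟨-, -, h3, h4⟩ := (S.before r).measurable_term hB hf hle k
  have h5 := (S.before r).measurable_cashExt hB hf hle (k + 1)
  have h6 : Measurable[M.F r] ((S.before r).sharesAt (k + 1)) :=
    (S.before r).measurable_sharesAt fun i _ => hle i
  have h0 : MeasurableSet[M.F r] ({ω | S.ρ k ω ≤ (r : WithTop ℝ≥0)} ∩
      ((fun ω => if (S.before r).ρ k ω ≠ ⊤ then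
        clock ((S.before r).ρ k ω) - (S.before r).lastTime ω k else (1 : ℝ)) ⁻¹' (Ioc (0 : ℝ) M.T) ∩
      ((fun ω => if (S.before r).ρ k ω ≠ ⊤ then M.impactExt ((S.before r).ξ k ω)
        (clock ((S.before r).ρ k ω) - (S.before r).lastTime ω k) else 1) ⁻¹' {∞}ᶜ ∩
      ((S.before r).cashExt B (k + 1) ⁻¹' (Ioi 0) ∩
        (S.before r).sharesAt (k + 1) ⁻¹' (Ici 0))))) :=
    (S.stopping k r).inter ((h4 measurableSet_Ioc).inter
      ((h3 (measurableSet_singleton ∞).compl).inter ((h5 measurableSet_Ioi).inter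
        (h6 measurableSet_Ici))))
  convert! h0 using 1
  ext ω
  simp only [mem_inter_iff, mem_preimage, mem_ofPred_eq]
  rw [and_comm]
  refine and_congr_right fun hω => ?_
  have hρ : ∀ i ≤ k, (S.before r).ρ i ω = S.ρ i ω := fun i hi => before_ρ hω hi
  have hne : S.ρ k ω ≠ ⊤ := ne_top_of_le_ne_top WithTop.coe_ne_top hω
  rw [hρ k le_rfl, if_pos hne, if_pos hne, lastTime_congr fun i hi => hρ i hi.le,
    cashExt_congr (S' := S) (fun i hi => hρ i (by omega)) (fun i _ => rfl),
    sharesAt_congr (S' := S) (fun i hi => hρ i (by omega)) (fun i _ => rfl)]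
  rfl

-- If the trade `k` is made by time `s`, so are all the earlier ones, and whether each of them is
-- good is known at `s`.
open Classical in
theorem isStoppingTime_guard (S : M.Schedule t q) (hB : ContVersion M B) (hf : M.BorelImpact)
    (k : ℕ) : IsStoppingTime M.F
      fun ω => if ∀ i ≤ k, S.ρ i ω ≠ ⊤ → ω ∈ S.good B i then S.ρ k ω else ⊤ := by
  intro s
  have : {ω | (if ∀ i ≤ k, S.ρ i ω ≠ ⊤ → ω ∈ S.good B i then S.ρ k ω else ⊤) ≤
      (s : WithTop ℝ≥0)} = {ω | S.ρ k ω ≤ (s : WithTop ℝ≥0)} ∩ ⋂ i, ⋂ (_ : i ≤ k),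
        ({ω | S.ρ i ω ≤ (s : WithTop ℝ≥0)}ᶜ ∪
          (S.good B i ∩ {ω | S.ρ i ω ≤ (s : WithTop ℝ≥0)})) := by
    ext ω
    simp only [mem_ofPred_eq, mem_inter_iff, mem_iInter, mem_union, mem_compl_iff]
    constructor
    · intro h
      split_ifs at h with h'
      · refine ⟨h, fun i hi => ?_⟩
        by_cases hs : S.ρ i ω ≤ (s : WithTop ℝ≥0)
        · exact Or.inr ⟨h' i hi (ne_top_of_le_ne_top WithTop.coe_ne_top hs), hs⟩
        · exact Or.inl hs
      · exact absurd h (WithTop.not_top_le_coe s)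
    · rintro ⟨h1, h2⟩
      rw [if_pos]
      · exact h1
      · intro i hi hne
        rcases h2 i hi with h | h
        · exfalso
          refine h ?_
          rcases hi.eq_or_lt with rfl | hi
          · exact h1
          · exact (S.strict i k ω hi hne (ne_top_of_le_ne_top WithTop.coe_ne_top h1)).le.trans h1
        · exact h.1
  rw [this]
  exact (S.stopping k s).inter (MeasurableSet.iInter fun i => MeasurableSet.iInter fun _ =>
    (S.stopping i s).compl.union (measurableSet_good hB hf i s))

open Classical in
/-- The schedule `S` stopped just before the first trade that is not possible. -/
def guard (S : M.Schedule t q) (hB : ContVersion M B) (hf : M.BorelImpact) : M.Schedule t q where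
  n := S.n
  ρ k ω := if ∀ i ≤ k, S.ρ i ω ≠ ⊤ → ω ∈ S.good B i then S.ρ k ω else ⊤
  ξ := S.ξ
  stopping k := isStoppingTime_guard S hB hf k
  size_meas k V hV := by
    refine ⟨(S.size_meas k V hV).1, fun s => ?_⟩
    have : S.ξ k ⁻¹' V ∩ {ω | (if ∀ i ≤ k, S.ρ i ω ≠ ⊤ → ω ∈ S.good B i then S.ρ k ω else ⊤) ≤
        (s : WithTop ℝ≥0)} = (S.ξ k ⁻¹' V ∩ {ω | S.ρ k ω ≤ (s : WithTop ℝ≥0)}) ∩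
        {ω | (if ∀ i ≤ k, S.ρ i ω ≠ ⊤ → ω ∈ S.good B i then S.ρ k ω else ⊤) ≤
          (s : WithTop ℝ≥0)} := by
      ext ω
      simp only [mem_inter_iff, mem_ofPred_eq]
      split_ifs with h
      · tauto
      · exact ⟨fun h => absurd h.2 (WithTop.not_top_le_coe s),
          fun h => absurd h.2 (WithTop.not_top_le_coe s)⟩
    rw [this]
    exact ((S.size_meas k V hV).2 s).inter (isStoppingTime_guard S hB hf k s)
  start k ω := by
    split_ifs
    · exact S.start k ω
    · exact le_top
  horizon k ω := by
    split_ifs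
    · exact S.horizon k ω
    · exact Or.inr rfl
  bounded k ω hk := by
    split_ifs
    · exact S.bounded k ω hk
    · rfl
  strict i k ω hik := by
    split_ifs
    · exact S.strict i k ω hik
    · exact fun _ h => absurd rfl h
    · exact fun h => absurd rfl h
    · exact fun h => absurd rfl h
  first k ω := by
    split_ifs
    · exact S.first k ω
    · exact fun h => absurd rfl h

section Guard

variable {hB : ContVersion M B} {hf : M.BorelImpact}

theorem guard_ne_top {k : ℕ} {ω : Ω} (h : (S.guard hB hf).ρ k ω ≠ ⊤) :
    (∀ i ≤ k, S.ρ i ω ≠ ⊤ → ω ∈ S.good B i) ∧ ∀ i ≤ k, (S.guard hB hf).ρ i ω = S.ρ i ω := by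
  classical
  have h1 : ∀ i ≤ k, S.ρ i ω ≠ ⊤ → ω ∈ S.good B i := by
    by_contra hne
    exact h (if_neg hne)
  exact ⟨h1, fun i hi => if_pos fun j hj => h1 j (hj.trans hi)⟩

theorem guard_ρ {ω : Ω} (h : ∀ k, S.ρ k ω ≠ ⊤ → ω ∈ S.good B k) (k : ℕ) :
    (S.guard hB hf).ρ k ω = S.ρ k ω := if_pos fun i _ => h i

/-- Trades that pass the guard leave positive cash by construction. The first trade is assumed to
pass it, since otherwise the waiting period, during which solvency is only known up to that trade,
would be prolonged. -/
theorem guard_positive (htT : t ≤ M.T) (hlt : ∀ k ω, S.ρ k ω ≠ ⊤ → S.ρ k ω < (M.T : WithTop ℝ≥0))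
    (hfirst : ∀ᵐ ω ∂M.prob, ∀ k, S.ρ k ω ≠ ⊤ → (∀ i < k, S.ρ i ω = ⊤) → ω ∈ S.good B k)
    (hpre : ∀ᵐ ω ∂M.prob, ∀ s : ℝ≥0, t ≤ s → s ≤ M.T → (∀ k, ¬ S.ρ k ω ≤ (s : WithTop ℝ≥0)) →
      (⟨q.cash, q.shares, M.price t q.price s ω, s - (t - q.lag)⟩ : State) ∈ M.domain ∧
      0 < M.liq ⟨q.cash, q.shares, M.price t q.price s ω, s - (t - q.lag)⟩) :
    (S.guard hB hf).Positive := by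
  classical
  have hno : ∀ ω, (∀ k, S.ρ k ω ≠ ⊤ → (∀ i < k, S.ρ i ω = ⊤) → ω ∈ S.good B k) → ∀ s : ℝ≥0,
      (∀ k, ¬ (S.guard hB hf).ρ k ω ≤ (s : WithTop ℝ≥0)) →
      ∀ k, ¬ S.ρ k ω ≤ (s : WithTop ℝ≥0) := by
    intro ω h1 s h2 k hk
    have hex : ∃ k, S.ρ k ω ≠ ⊤ := ⟨k, ne_top_of_le_ne_top WithTop.coe_ne_top hk⟩
    have hm := Nat.find_spec hex
    have hmin : ∀ i < Nat.find hex, S.ρ i ω = ⊤ := fun i hi => not_not.1 (Nat.find_min hex hi)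
    refine h2 (Nat.find hex) ?_
    have : (S.guard hB hf).ρ (Nat.find hex) ω = S.ρ (Nat.find hex) ω := if_pos fun i hi hne => by
      rcases hi.eq_or_lt with rfl | hi
      · exact h1 _ hm hmin
      · exact absurd (hmin i hi) hne
    rw [this]
    rcases (Nat.find_min' hex (ne_top_of_le_ne_top WithTop.coe_ne_top hk)).eq_or_lt with h | h
    · rw [h]; exact hk
    · exact (S.strict _ _ _ h hm (ne_top_of_le_ne_top WithTop.coe_ne_top hk)).le.trans hk
  have htr : ∀ᵐ ω ∂M.prob, ∀ k, (S.guard hB hf).ρ k ω ≠ ⊤ → (S.guard hB hf).impact k ω ≠ ∞ ∧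
      0 < (S.guard hB hf).cashAt (k + 1) ω ∧ 0 ≤ (S.guard hB hf).sharesAt (k + 1) ω := by
    filter_upwards [hB.gbm_ae_eq htT q.price] with ω hg k hk
    obtain ⟨h1, h2⟩ := guard_ne_top hk
    have hk' : S.ρ k ω ≠ ⊤ := by rwa [← h2 k le_rfl]
    have h3 := h1 k le_rfl hk'
    rw [impact_congr (S' := S) h2 rfl,
      cashAt_congr (S' := S) (fun i hi => h2 i (by omega)) (fun i _ => rfl),
      sharesAt_congr (S' := S) (fun i hi => h2 i (by omega)) (fun i _ => rfl),
      cashAt_eq_cashExt hg fun i hi hne => (h1 i (by omega) hne).1]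
    refine ⟨?_, h3.2.2.1, h3.2.2.2⟩
    rw [impact, ← impactExt_of_mem ⟨h3.1.1.le, h3.1.2⟩]
    exact h3.2.1
  refine ⟨⟨fun k ω h => ?_, ?_, ?_⟩, ?_, ?_⟩
  · have h2 := (guard_ne_top h).2 k le_rfl
    rw [h2] at h ⊢
    exact hlt k ω h
  · filter_upwards [htr] with ω h k hk
    exact ⟨(h k hk).1, (h k hk).2.1.le, (h k hk).2.2⟩
  · filter_upwards [hfirst, hpre] with ω h1 h2 s hs hs' hk
    have := h2 s hs hs' (hno ω h1 s hk)
    exact (M.mem_closedRegion_iff _).2 ⟨this.1, this.2.le⟩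
  · filter_upwards [htr] with ω h k hk
    exact (h k hk).2.1
  · filter_upwards [hfirst, hpre] with ω h1 h2 s hs hs' hk
    exact (h2 s hs hs'.le (hno ω h1 s hk)).2

theorem guard_cashAt {ω : Ω} (h : ∀ k, S.ρ k ω ≠ ⊤ → ω ∈ S.good B k) (k : ℕ) :
    (S.guard hB hf).cashAt k ω = S.cashAt k ω :=
  cashAt_congr (fun i _ => guard_ρ h i) fun _ _ => rfl

end Guard

end Schedule

end Market

end Liquidation

/-! ### Hitting times; the liquidation value along a path without trades. -/

namespace Liquidation

open Filter Topology

namespace Market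

variable {Ω : Type*} [MeasurableSpace Ω] {M : Market Ω}

/-- The first time after `t` at which a continuous adapted process is at most `δ`, capped by `H`,
is a stopping time. -/
theorem exists_hitting {X : ℝ≥0 → Ω → ℝ} (hX : ∀ ω, Continuous fun s => X s ω) {t H : ℝ≥0}
    (hadp : ∀ s, t ≤ s → Measurable[M.F s] (X s)) (htH : t ≤ H) (δ : ℝ) :
    ∃ κ : Ω → ℝ≥0, IsStoppingTime M.F (fun ω => (κ ω : WithTop ℝ≥0)) ∧ ∀ ω, t ≤ κ ω ∧ κ ω ≤ H ∧
      (∀ s, t ≤ s → s < κ ω → δ < X s ω) ∧ (κ ω < H → X (κ ω) ω ≤ δ) := by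
  set Z : Ω → Set ℝ≥0 := fun ω => {s | t ≤ s ∧ s ≤ H ∧ X s ω ≤ δ} ∪ {H} with hZ
  have hne : ∀ ω, (Z ω).Nonempty := fun ω => ⟨H, Or.inr rfl⟩
  have hcl : ∀ ω, IsClosed (Z ω) := fun ω =>
    ((isClosed_le continuous_const continuous_id).inter
      ((isClosed_le continuous_id continuous_const).inter
        (isClosed_le (hX ω) continuous_const))).union isClosed_singleton
  have hbdd : ∀ ω, BddBelow (Z ω) := fun ω => OrderBot.bddBelow _
  have hmem : ∀ ω, sInf (Z ω) ∈ Z ω := fun ω => (hcl ω).csInf_mem (hne ω) (hbdd ω)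
  have hH : ∀ ω, sInf (Z ω) ≤ H := fun ω => csInf_le (hbdd ω) (Or.inr rfl)
  have hprop : ∀ ω, t ≤ sInf (Z ω) ∧ sInf (Z ω) ≤ H ∧
      (∀ s, t ≤ s → s < sInf (Z ω) → δ < X s ω) ∧ (sInf (Z ω) < H → X (sInf (Z ω)) ω ≤ δ) := by
    refine fun ω => ⟨?_, hH ω, fun s hs hlt => ?_, fun hlt => ?_⟩
    · rcases hmem ω with h | h
      · exact h.1
      · exact htH.trans_eq (Eq.symm h)
    · by_contra! hle
      exact notMem_of_lt_csInf hlt (hbdd ω) (Or.inl ⟨hs, hlt.le.trans (hH ω), hle⟩)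
    · rcases hmem ω with h | h
      · exact h.2.2
      · exact absurd h hlt.ne
  refine ⟨fun ω => sInf (Z ω), fun s => ?_, hprop⟩
  have hset : {ω | ((sInf (Z ω) : ℝ≥0) : WithTop ℝ≥0) ≤ (s : WithTop ℝ≥0)} =
      {ω | sInf (Z ω) ≤ s} := by
    ext ω
    exact WithTop.coe_le_coe
  rw [hset]
  rcases le_or_gt H s with hs | hs
  · have : {ω | sInf (Z ω) ≤ s} = univ := eq_univ_of_forall fun ω => (hH ω).trans hs
    rw [this]
    exact @MeasurableSet.univ _ (M.F s)
  rcases lt_or_ge s t with hst | hst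
  · have : {ω | sInf (Z ω) ≤ s} = ∅ :=
      eq_empty_of_forall_notMem fun ω hω => absurd ((hprop ω).1.trans hω) (not_le.2 hst)
    rw [this]
    exact @MeasurableSet.empty _ (M.F s)
  set g : ℝ≥0 → ℝ≥0 := fun r => max t (min s r) with hg
  have hgc : Continuous g := by fun_prop
  have hgm : ∀ r, t ≤ g r ∧ g r ≤ s := fun r => ⟨le_max_left _ _, max_le hst (min_le_left _ _)⟩
  -- By compactness, the level is reached by `s` exactly when the infimum over `[t,s]` is at most
  -- `δ`, which a dense sequence detects; `g` projects that sequence into `[t,s]`.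
  have : {ω | sInf (Z ω) ≤ s} = ⋂ m : ℕ, ⋃ i : ℕ,
      {ω | X (g (TopologicalSpace.denseSeq ℝ≥0 i)) ω < δ + 1 / (m + 1)} := by
    ext ω
    simp only [mem_ofPred_eq, mem_iInter, mem_iUnion]
    constructor
    · intro h m
      have h1 : X (g (sInf (Z ω))) ω < δ + 1 / (m + 1) := by
        have h2 : g (sInf (Z ω)) = sInf (Z ω) := by
          rw [hg]
          simp only [min_eq_right h, max_eq_right (hprop ω).1]
        rw [h2]
        have := (hprop ω).2.2.2 (lt_of_le_of_lt h hs)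
        have h3 : (0 : ℝ) < 1 / (m + 1) := by positivity
        linarith
      obtain ⟨i, hi⟩ := (TopologicalSpace.denseRange_denseSeq ℝ≥0).exists_mem_open
        (isOpen_lt ((hX ω).comp hgc) continuous_const) ⟨_, h1⟩
      exact ⟨i, hi⟩
    · intro h
      obtain ⟨r, hr, hmin⟩ := (isCompact_Icc (a := t) (b := s)).exists_isMinOn ⟨t, le_rfl, hst⟩
        (hX ω).continuousOn
      refine (csInf_le (hbdd ω) (Or.inl ⟨hr.1, hr.2.trans hs.le, ?_⟩)).trans hr.2
      refine le_of_forall_pos_lt_add fun ε hε => ?_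
      obtain ⟨m, hm⟩ := exists_nat_one_div_lt hε
      obtain ⟨i, hi⟩ := h m
      have := hmin (hgm (TopologicalSpace.denseSeq ℝ≥0 i))
      have h4 : X r ω ≤ X (g (TopologicalSpace.denseSeq ℝ≥0 i)) ω := this
      linarith
  rw [this]
  refine MeasurableSet.iInter fun m => MeasurableSet.iUnion fun i => ?_
  exact (((hadp _ (hgm _).1).mono (M.F.mono (hgm _).2) le_rfl) measurableSet_Iio)

/-- The liquidation value along a path without any trade. -/
def liqPath (M : Market Ω) (B : ℝ≥0 → Ω → ℝ) (t : ℝ≥0) (q : State) (s : ℝ≥0) (ω : Ω) : ℝ :=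
  q.cash + M.gbm B t q.price s ω * M.proceeds q.shares (q.lag + (s - t))

variable {B : ℝ≥0 → Ω → ℝ} {t : ℝ≥0} {q : State}

theorem ContVersion.continuous_liqPath (hB : ContVersion M B) (hc : M.Hcf) (hq : 0 ≤ q.shares)
    (ω : Ω) : Continuous fun s => M.liqPath B t q s ω := by
  refine continuous_const.add ((hB.continuous_gbm t q.price ω).mul ?_)
  refine continuous_iff_continuousAt.2 fun s => hc.tendsto_proceeds_lag hq ?_
  exact (Continuous.tendsto (by fun_prop : Continuous fun s : ℝ≥0 => q.lag + ((s : ℝ) - t)) s)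

theorem ContVersion.measurable_liqPath (hB : ContVersion M B) {s r : ℝ≥0} (hts : t ≤ r)
    (hsr : s ≤ r) : Measurable[M.F r] (M.liqPath B t q s) :=
  ((hB.measurable_gbm hts hsr q.price).mul_const _).const_add _

theorem liqPath_start (hq : q ∈ M.domain) (ω : Ω) : M.liqPath B t q t ω = M.liq q := by
  rw [liqPath, gbm, liq_eq_proceeds hq.2.2]
  simp

theorem liqPath_eq_liq {s : ℝ≥0} {ω : Ω} (hg : M.gbm B t q.price s ω = M.price t q.price s ω)
    (hl : q.lag + (s - t) ∈ Icc (0 : ℝ) M.T) :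
    M.liqPath B t q s ω =
      M.liq ⟨q.cash, q.shares, M.price t q.price s ω, s - (t - q.lag)⟩ := by
  rw [show (s : ℝ) - (t - q.lag) = q.lag + (s - t) by ring, liq_eq_proceeds hl, liqPath, hg]

end Market

end Liquidation

/-! ### Following the discretized model with a true schedule. -/

namespace Liquidation

open Filter Topology

namespace Market

variable {Ω : Type*} [MeasurableSpace Ω] {M : Market Ω}

/-- The times of the grid of origin `u` and mesh `d`. -/
def gridTime (u d : ℝ≥0) (j : ℕ) : ℝ≥0 := u + j * d

theorem gridTime_zero (u d : ℝ≥0) : gridTime u d 0 = u := by simp [gridTime]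

theorem gridTime_succ (u d : ℝ≥0) (j : ℕ) : gridTime u d (j + 1) = gridTime u d j + d := by
  simp only [gridTime]
  push_cast
  ring

theorem gridTime_strictMono {u d : ℝ≥0} (hd : 0 < d) : StrictMono (gridTime u d) :=
  strictMono_nat_of_lt_succ fun j => by
    rw [gridTime_succ]
    exact lt_add_of_pos_right _ hd

theorem gridTime_mono (u d : ℝ≥0) : Monotone (gridTime u d) :=
  monotone_nat_of_le_succ fun j => by
    rw [gridTime_succ]
    exact le_self_add

/-- A controlled discretized model, to be followed by a schedule that sells everything at the
stopping time `κ` when no trade took place up to that time. -/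
structure Follow (M : Market Ω) (B : ℝ≥0 → Ω → ℝ) (t : ℝ≥0) (q : State) (u d : ℝ≥0) (n N : ℕ)
    (Δ : ℝ) (H : ℝ≥0) (κ : Ω → ℝ≥0) (a : ℕ → Ω → Fin (2 * N ^ 2 + 1 + 1))
    (s : ℕ → Ω → ℝ × ℝ × ℝ × ℝ) : Prop where
  cont : ContVersion M B
  borel : M.BorelImpact
  dom : q ∈ M.domain
  lag_pos : 0 < q.lag
  start : t ≤ u
  mesh : 0 < d
  horizon : gridTime u d n < M.T
  slack : 0 < Δ
  cap : H < M.T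
  cap_lag : q.lag + (H - t) ≤ M.T
  watch : IsStoppingTime M.F (fun ω => (κ ω : WithTop ℝ≥0))
  watch_ge : ∀ ω, t ≤ κ ω
  watch_le : ∀ ω, κ ω ≤ H
  watch_pos : ∀ ω r, t ≤ r → r ≤ κ ω → 0 < M.liqPath B t q r ω
  ctrl : Controlled M.prob (gaussianReal 0 d) (M.evolve N d) n (fun j => M.F (gridTime u d j))
    (fun j ω => B (gridTime u d (j + 1)) ω - B (gridTime u d j) ω) a s
  init : ∀ ω, s 0 ω = (q.cash - Δ, q.shares, M.gbm B t q.price u ω, q.lag + (u - t))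

namespace Follow

variable {B : ℝ≥0 → Ω → ℝ} {t : ℝ≥0} {q : State} {u d : ℝ≥0} {n N : ℕ} {Δ : ℝ} {H : ℝ≥0}
  {κ : Ω → ℝ≥0} {a : ℕ → Ω → Fin (2 * N ^ 2 + 1 + 1)} {s : ℕ → Ω → ℝ × ℝ × ℝ × ℝ}

/-- The event that a trade takes place in the model at the step `j`. -/
def exec (M : Market Ω) {N : ℕ} (a : ℕ → Ω → Fin (2 * N ^ 2 + 1 + 1))
    (s : ℕ → Ω → ℝ × ℝ × ℝ × ℝ) (j : ℕ) : Set Ω :=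
  {ω | a j ω ≠ 0 ∧ M.Feasible (orderSize N (a j ω)) (s j ω)}

/-- The event that the schedule did not stop before the step `j`. -/
def active (M : Market Ω) {N : ℕ} (u d : ℝ≥0) (κ : Ω → ℝ≥0)
    (a : ℕ → Ω → Fin (2 * N ^ 2 + 1 + 1))
    (s : ℕ → Ω → ℝ × ℝ × ℝ × ℝ) (j : ℕ) : Set Ω :=
  {ω | gridTime u d j ≤ κ ω} ∪ ⋃ i, ⋃ (_ : i < j), exec M a s i ∩ {ω | gridTime u d i ≤ κ ω}

/-- The event that no trade takes place in the model up to `κ`. -/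
def idle (M : Market Ω) {N : ℕ} (u d : ℝ≥0) (n : ℕ) (κ : Ω → ℝ≥0)
    (a : ℕ → Ω → Fin (2 * N ^ 2 + 1 + 1))
    (s : ℕ → Ω → ℝ × ℝ × ℝ × ℝ) : Set Ω :=
  ⋂ j, ⋂ (_ : j < n), {ω | κ ω < gridTime u d j} ∪ (exec M a s j)ᶜ

theorem measurableSet_exec (h : Follow M B t q u d n N Δ H κ a s)
    {j : ℕ} (hj : j < n) : MeasurableSet[M.F (gridTime u d j)] (exec M a s j) := by
  have h1 := h.ctrl.measurable_state (fun a => measurable_evolve h.borel N d a) hj.le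
  have h2 := h.ctrl.action j hj
  have : exec M a s j = ⋃ c, ⋃ (_ : c ≠ 0), a j ⁻¹' {c} ∩ s j ⁻¹' {z | M.Feasible (orderSize N c) z} := by
    ext ω
    simp only [exec, mem_ofPred_eq, mem_iUnion, mem_inter_iff, mem_preimage, mem_singleton_iff]
    constructor
    · rintro ⟨h1, h2⟩
      exact ⟨_, h1, rfl, h2⟩
    · rintro ⟨c, h1, rfl, h2⟩
      exact ⟨h1, h2⟩
  rw [this]
  exact MeasurableSet.iUnion fun c => MeasurableSet.iUnion fun _ =>
    (h2 (measurableSet_singleton c)).inter (h1 (measurableSet_feasible h.borel _))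

theorem measurableSet_watch_lt (h : Follow M B t q u d n N Δ H κ a s)
    (r : ℝ≥0) : MeasurableSet[M.F r] {ω | κ ω < r} := by
  have := h.watch.measurableSet_lt r
  convert! this using 1
  ext ω
  exact (WithTop.coe_lt_coe (a := r) (b := κ ω)).symm

theorem measurableSet_active (h : Follow M B t q u d n N Δ H κ a s)
    {j : ℕ} (hj : j < n) :
    MeasurableSet[M.F (gridTime u d j)] (active M u d κ a s j) := by
  have hw : ∀ r, {ω | r ≤ κ ω} = {ω | κ ω < r}ᶜ := fun r => by
    ext ω
    exact (not_lt (a := κ ω) (b := r)).symm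
  refine MeasurableSet.union ?_ (MeasurableSet.iUnion fun i => MeasurableSet.iUnion fun hi => ?_)
  · rw [hw]
    exact (h.measurableSet_watch_lt _).compl
  · rw [hw]
    exact M.F.mono (gridTime_mono u d hi.le) _
      ((h.measurableSet_exec (hi.trans hj)).inter (h.measurableSet_watch_lt _).compl)

/-- The condition at step `j` is automatic when `κ` comes before the grid time, and otherwise it is
known at that time, hence at `κ`. -/
theorem measurableSet_idle (h : Follow M B t q u d n N Δ H κ a s)
    : MeasurableSet[h.watch.measurableSpace] (idle M u d n κ a s) := by
  have hsup : ∀ r (A : Set Ω), MeasurableSet[M.F r] A → MeasurableSet[⨆ s, M.F s] A :=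
    fun r A hA => (le_iSup M.F r) _ hA
  refine MeasurableSet.iInter fun j => MeasurableSet.iInter fun hj => ⟨?_, fun r => ?_⟩
  · exact hsup _ _ ((h.measurableSet_watch_lt _).union (h.measurableSet_exec hj).compl)
  · rcases le_total (gridTime u d j) r with hr | hr
    · exact (M.F.mono hr _ ((h.measurableSet_watch_lt _).union
        (h.measurableSet_exec hj).compl)).inter (h.watch r)
    · rcases hr.eq_or_lt with hr | hr
      · rw [hr]
        exact ((h.measurableSet_watch_lt _).union (h.measurableSet_exec hj).compl).inter
          (h.watch _)
      · convert! h.watch r using 1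
        ext ω
        simp only [mem_inter_iff, mem_union, mem_ofPred_eq]
        exact ⟨fun h => h.2, fun h => ⟨Or.inl (lt_of_le_of_lt (WithTop.coe_le_coe.1 h) hr), h⟩⟩

theorem active_of_notMem_idle {ω : Ω} (hω : ω ∉ idle M u d n κ a s) (j : ℕ) :
    ω ∈ active M u d κ a s j := by
  simp only [idle, mem_iInter, mem_union, mem_ofPred_eq, mem_compl_iff, not_forall, not_or,
    not_not, not_lt] at hω
  obtain ⟨i, hi, h1, h2⟩ := hω
  rcases lt_or_ge i j with hij | hij
  · exact Or.inr (mem_iUnion₂.2 ⟨i, hij, h2, h1⟩)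
  · exact Or.inl ((gridTime_mono u d hij).trans h1)

/-- With `active_of_notMem_idle`: either everything is sold at `κ`, or all the trades of the model
are performed, never both. The times of the schedule are therefore strictly increasing. -/
theorem notMem_idle {ω : Ω} {j : ℕ} (hjn : j < n) (hj : ω ∈ exec M a s j)
    (hj' : ω ∈ active M u d κ a s j) : ω ∉ idle M u d n κ a s := by
  intro hω
  simp only [idle, mem_iInter, mem_union, mem_ofPred_eq, mem_compl_iff] at hω
  rcases hj' with h1 | h1
  · rcases hω j hjn with h2 | h2
    · exact absurd h1 (not_le.2 h2)
    · exact h2 hj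
  · obtain ⟨i, hi, h3, h4⟩ := mem_iUnion₂.1 h1
    rcases hω i (hi.trans hjn) with h2 | h2
    · exact absurd h4 (not_le.2 h2)
    · exact h2 h3

theorem le_horizon (h : Follow M B t q u d n N Δ H κ a s)
    {j : ℕ} (hj : j < n) : gridTime u d j < M.T :=
  (gridTime_mono u d hj.le).trans_lt h.horizon

theorem measurableSet_trade (h : Follow M B t q u d n N Δ H κ a s) (j : ℕ) :
    MeasurableSet[M.F (gridTime u d j)]
      {ω | j < n ∧ ω ∈ exec M a s j ∧ ω ∈ active M u d κ a s j} := by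
  by_cases hj : j < n
  · simp only [hj, true_and]
    exact (h.measurableSet_exec hj).inter (h.measurableSet_active hj)
  · simp only [hj, false_and]
    exact @MeasurableSet.empty _ (M.F (gridTime u d j))

open Classical in
/-- The trading times of the schedule. -/
def tradeTime (M : Market Ω) {N : ℕ} (u d : ℝ≥0) (n : ℕ) (κ : Ω → ℝ≥0)
    (a : ℕ → Ω → Fin (2 * N ^ 2 + 1 + 1)) (s : ℕ → Ω → ℝ × ℝ × ℝ × ℝ) : ℕ → Ω → WithTop ℝ≥0
  | 0, ω => if ω ∈ idle M u d n κ a s then ((κ ω : ℝ≥0) : WithTop ℝ≥0) else ⊤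
  | j + 1, ω => if ω ∈ {ω | j < n ∧ ω ∈ exec M a s j ∧ ω ∈ active M u d κ a s j} then
      ((gridTime u d j : ℝ≥0) : WithTop ℝ≥0) else ⊤

/-- The trade sizes of the schedule. -/
def tradeSize {N : ℕ} (y : ℝ) (n : ℕ) (a : ℕ → Ω → Fin (2 * N ^ 2 + 1 + 1)) : ℕ → Ω → ℝ
  | 0, _ => -y
  | j + 1, ω => if j < n then orderSize N (a j ω) else 0

theorem tradeTime_zero {ω : Ω} (hω : tradeTime M u d n κ a s 0 ω ≠ ⊤) :
    ω ∈ idle M u d n κ a s ∧ tradeTime M u d n κ a s 0 ω = κ ω := by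
  rw [tradeTime] at hω ⊢
  split_ifs at hω ⊢ with h
  · exact ⟨h, rfl⟩
  · exact absurd rfl hω

theorem tradeTime_succ {j : ℕ} {ω : Ω} (hω : tradeTime M u d n κ a s (j + 1) ω ≠ ⊤) :
    j < n ∧ ω ∈ exec M a s j ∧ ω ∈ active M u d κ a s j ∧
      tradeTime M u d n κ a s (j + 1) ω = gridTime u d j := by
  rw [tradeTime] at hω ⊢
  split_ifs at hω ⊢ with h
  · exact ⟨h.1, h.2.1, h.2.2, rfl⟩
  · exact absurd rfl hω

theorem tradeTime_succ_of_exec {j : ℕ} {ω : Ω} (hj : j < n) (h1 : ω ∈ exec M a s j)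
    (h2 : ω ∈ active M u d κ a s j) : tradeTime M u d n κ a s (j + 1) ω = gridTime u d j :=
  if_pos ⟨hj, h1, h2⟩

theorem tradeTime_succ_of_not_exec {j : ℕ} {ω : Ω} (h1 : ω ∉ exec M a s j) :
    tradeTime M u d n κ a s (j + 1) ω = ⊤ :=
  if_neg fun h => h1 h.2.1

theorem tradeTime_bounds (h : Follow M B t q u d n N Δ H κ a s) {k : ℕ} {ω : Ω}
    (hk : tradeTime M u d n κ a s k ω ≠ ⊤) : (t : WithTop ℝ≥0) ≤ tradeTime M u d n κ a s k ω ∧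
      tradeTime M u d n κ a s k ω < (M.T : WithTop ℝ≥0) := by
  rcases k with _ | j
  · rw [(tradeTime_zero hk).2]
    exact ⟨WithTop.coe_le_coe.2 (h.watch_ge ω),
      WithTop.coe_lt_coe.2 ((h.watch_le ω).trans_lt h.cap)⟩
  · obtain ⟨hj, -, -, e⟩ := tradeTime_succ hk
    rw [e]
    exact ⟨WithTop.coe_le_coe.2 (h.start.trans le_self_add),
      WithTop.coe_lt_coe.2 (h.le_horizon hj)⟩

/-- The schedule performing the trades of the model. -/
def schedule (h : Follow M B t q u d n N Δ H κ a s) : M.Schedule t q where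
  n := n + 1
  ρ := tradeTime M u d n κ a s
  ξ := tradeSize q.shares n a
  stopping k := by
    classical
    rcases k with _ | j
    · exact isStoppingTime_restrict h.watch h.measurableSet_idle
    · refine isStoppingTime_restrict (isStoppingTime_const M.F (gridTime u d j)) ?_
      rw [IsStoppingTime.measurableSpace_const]
      exact h.measurableSet_trade j
  size_meas k := by
    classical
    rcases k with _ | j
    · exact StopMeas.restrict h.watch h.measurableSet_idle
        (stopMeas_of_measurable h.watch measurable_const)
    · refine StopMeas.restrict (isStoppingTime_const M.F (gridTime u d j)) ?_ (stopMeas_const ?_)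
      · rw [IsStoppingTime.measurableSpace_const]
        exact h.measurableSet_trade j
      · by_cases hj : j < n
        · have : tradeSize q.shares n a (j + 1) = fun ω => orderSize N (a j ω) :=
            funext fun ω => if_pos hj
          rw [this]
          exact (measurable_of_finite (orderSize N)).comp (h.ctrl.action j hj)
        · have : tradeSize q.shares n a (j + 1) = fun _ => 0 := funext fun ω => if_neg hj
          rw [this]
          exact measurable_const
  start k ω := by
    by_cases hk : tradeTime M u d n κ a s k ω = ⊤
    · rw [hk]; exact le_top
    · exact (h.tradeTime_bounds hk).1
  horizon k ω := by
    by_cases hk : tradeTime M u d n κ a s k ω = ⊤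
    · exact Or.inr hk
    · exact Or.inl (h.tradeTime_bounds hk).2.le
  bounded k ω hk := by
    by_contra hne
    rcases k with _ | j
    · omega
    · have := (tradeTime_succ hne).1
      omega
  strict i k ω hik hi hk := by
    rcases k with _ | k
    · omega
    obtain ⟨hk1, hk2, hk3, e⟩ := tradeTime_succ hk
    rcases i with _ | i
    · exact absurd (tradeTime_zero hi).1 (notMem_idle hk1 hk2 hk3)
    · rw [e, (tradeTime_succ hi).2.2.2]
      exact WithTop.coe_lt_coe.2 (gridTime_strictMono h.mesh (by omega))
  first k ω hk := by
    have := Strategy.le_clock hk (h.tradeTime_bounds hk).1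
    have h1 : (t : ℝ) ≤ clock (tradeTime M u d n κ a s k ω) := by exact_mod_cast this
    have := h.lag_pos
    linarith

theorem price_eq (h : Follow M B t q u d n N Δ H κ a s) (j : ℕ) (ω : Ω) :
    (s j ω).2.2.1 = M.gbm B t q.price (gridTime u d j) ω := by
  induction j with
  | zero => rw [h.init, gridTime_zero]
  | succ j ih =>
    rw [h.ctrl.next, gridTime_succ, gbm_succ, ← ih]
    rfl

theorem price_pos (h : Follow M B t q u d n N Δ H κ a s) (j : ℕ) (ω : Ω) : 0 < (s j ω).2.2.1 := by
  rw [h.price_eq]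
  exact gbm_pos h.dom.2.1 _ _ _

/-- While some trade takes place before `κ`, the schedule holds `Δ` more than the model. -/
theorem invariant (h : Follow M B t q u d n N Δ H κ a s) {ω : Ω}
    (hω : ω ∉ idle M u d n κ a s) {j : ℕ} (hj : j ≤ n) : Dead (s j ω) ∨
      (h.schedule.cashExt B (j + 1) ω = (s j ω).1 + Δ ∧
        h.schedule.sharesAt (j + 1) ω = (s j ω).2.1 ∧
        (s j ω).2.2.2 = gridTime u d j - h.schedule.lastTime ω (j + 1)) := by
  induction j with
  | zero =>
    have h0 : h.schedule.ρ 0 ω = ⊤ := if_neg hω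
    right
    rw [Schedule.cashExt_succ_of_eq h0, Schedule.sharesAt_succ_of_eq _ h0, Schedule.lastTime,
      if_neg (not_not.2 h0), h.init, gridTime_zero]
    simp only [Schedule.cashExt, Schedule.sharesAt, Schedule.lastTime, Finset.range_zero,
      Finset.sum_empty]
    refine ⟨by ring, by ring, by ring⟩
  | succ j ih =>
    rw [h.ctrl.next]
    rcases ih (by omega) with hdead | ⟨h1, h2, h3⟩
    · exact Or.inl (hdead.evolve (h.price_pos j ω) _)
    by_cases hex : ω ∈ exec M a s j
    · have hρ : h.schedule.ρ (j + 1) ω = gridTime u d j :=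
        tradeTime_succ_of_exec hj hex (active_of_notMem_idle hω j)
      have hne : h.schedule.ρ (j + 1) ω ≠ ⊤ := by rw [hρ]; exact WithTop.coe_ne_top
      have hξ : h.schedule.ξ (j + 1) ω = orderSize N (a j ω) := if_pos hj
      have hst : M.stepState N (a j ω) (s j ω) = _ := if_pos hex
      right
      -- A feasible order leaves nonnegative cash, and only states of negative cash are abandoned.
      have hk : M.killState d (M.stepState N (a j ω) (s j ω)) =
          M.stepState N (a j ω) (s j ω) := by
        rcases M.killState_cases d (M.stepState N (a j ω) (s j ω)) with h' | h'
        · exact h'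
        · rw [hst] at h'
          exact absurd hex.2.2.2.1 (not_le.2 h'.2)
      have hlt : h.schedule.lastTime ω (j + 1 + 1) = clock (h.schedule.ρ (j + 1) ω) := if_pos hne
      rw [Schedule.cashExt_succ_of_ne hne, Schedule.sharesAt_succ_of_ne _ hne, hlt, hρ, hξ, h1, h2, evolve, hk, hst]
      have hc : clock ((gridTime u d j : ℝ≥0) : WithTop ℝ≥0) = gridTime u d j := rfl
      rw [hc, ← h3, ← h.price_eq j ω, gridTime_succ, orderCost]
      refine ⟨by ring, rfl, ?_⟩
      push_cast
      ring
    · have hρ : h.schedule.ρ (j + 1) ω = ⊤ := tradeTime_succ_of_not_exec hex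
      have hst : M.stepState N (a j ω) (s j ω) = s j ω := if_neg hex
      rcases M.killState_cases d (s j ω) with h' | h'
      · right
        have hlt : h.schedule.lastTime ω (j + 1 + 1) = h.schedule.lastTime ω (j + 1) :=
          if_neg (not_not.2 hρ)
        rw [Schedule.cashExt_succ_of_eq hρ, Schedule.sharesAt_succ_of_eq _ hρ, hlt, h1, h2, evolve, hst, h', gridTime_succ]
        refine ⟨rfl, rfl, ?_⟩
        rw [h3]
        push_cast
        ring
      · left
        rw [evolve, hst]
        exact h'.1

/-- The sale at `κ` leaves the liquidation value, positive up to `κ`. A trade feasible in the model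
leaves nonnegative cash there, hence at least `Δ > 0` in the schedule. -/
theorem mem_good (h : Follow M B t q u d n N Δ H κ a s) (h1f : M.H1f) {k : ℕ} {ω : Ω}
    (hk : h.schedule.ρ k ω ≠ ⊤) : ω ∈ h.schedule.good B k := by
  rcases k with _ | j
  · obtain ⟨hω, hρ⟩ := tradeTime_zero hk
    have hρ' : clock (h.schedule.ρ 0 ω) = κ ω := by
      change clock (tradeTime M u d n κ a s 0 ω) = _
      rw [hρ]; rfl
    have hξ : h.schedule.ξ 0 ω = -q.shares := rfl
    have hlt : h.schedule.lastTime ω 0 = t - q.lag := rfl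
    have hge : (t : ℝ) ≤ κ ω := by exact_mod_cast h.watch_ge ω
    have hle : (κ ω : ℝ) ≤ H := by exact_mod_cast h.watch_le ω
    have hl := h.lag_pos
    have hcap := h.cap_lag
    have hlag : (κ ω : ℝ) - (t - q.lag) ∈ Ioc (0 : ℝ) M.T := ⟨by linarith, by linarith⟩
    have himp : M.impactExt (-q.shares) ((κ ω : ℝ) - (t - q.lag)) ≠ ∞ := by
      rw [impactExt_of_mem ⟨hlag.1.le, hlag.2⟩]
      have hs : 0 ≤ q.shares := h.dom.1
      exact ne_top_of_le_ne_top ENNReal.one_ne_top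
        (impact_le_one_of_nonpos h1f (by linarith) ⟨hlag.1.le, hlag.2⟩)
    refine ⟨?_, ?_, ?_, ?_⟩
    · rw [hρ', hlt]
      exact hlag
    · rw [hρ', hlt, hξ]
      exact himp
    · rw [Schedule.cashExt_succ_of_ne hk, hρ', hξ, hlt]
      have := h.watch_pos ω (κ ω) (h.watch_ge ω) le_rfl
      rw [liqPath, proceeds, show q.lag + ((κ ω : ℝ) - t) = (κ ω : ℝ) - (t - q.lag) by ring] at this
      simp only [Schedule.cashExt, Finset.range_zero, Finset.sum_empty]
      linarith
    · rw [Schedule.sharesAt_succ_of_ne _ hk, hξ]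
      simp [Schedule.sharesAt]
  · obtain ⟨hj, hex, hact, hρ⟩ := tradeTime_succ hk
    have hω := notMem_idle hj hex hact
    have hρ' : clock (h.schedule.ρ (j + 1) ω) = gridTime u d j := by
      change clock (tradeTime M u d n κ a s (j + 1) ω) = _
      rw [hρ]; rfl
    have hξ : h.schedule.ξ (j + 1) ω = orderSize N (a j ω) := if_pos hj
    rcases h.invariant hω hj.le with hdead | ⟨h1, h2, h3⟩
    · exact absurd hex.2 (hdead.not_feasible (h.price_pos j ω) _)
    obtain ⟨f1, f2, f3, f4⟩ := hex.2
    refine ⟨?_, ?_, ?_, ?_⟩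
    · rw [hρ', ← h3]
      exact f1
    · rw [hρ', hξ, ← h3]
      exact f2
    · rw [Schedule.cashExt_succ_of_ne hk, hρ', hξ, h1, ← h3, ← h.price_eq]
      have := h.slack
      rw [orderCost] at f3
      linarith
    · rw [Schedule.sharesAt_succ_of_ne _ hk, hξ, h2]
      exact f4

/-- The model is dominated by a positive schedule, off the idle event. -/
theorem exists_positive (h : Follow M B t q u d n N Δ H κ a s) (h1f : M.H1f) (hU : M.HU) :
    ∃ R : M.Schedule t q, R.Positive ∧ ∀ C : ℝ, ∀ᵐ ω ∂M.prob, ω ∉ idle M u d n κ a s →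
      M.reward C (s n ω) ≤ ENNReal.ofReal (M.U (max 0 (R.cashAt R.n ω))) := by
  have htT : t ≤ M.T := h.start.trans ((gridTime_zero u d).ge.trans
    ((gridTime_mono u d n.zero_le).trans h.horizon.le))
  refine ⟨h.schedule.guard h.cont h.borel, Schedule.guard_positive htT
    (fun k ω hk => (h.tradeTime_bounds hk).2)
    (Eventually.of_forall fun ω k hk _ => h.mem_good h1f hk) ?_, fun C => ?_⟩
  · filter_upwards [h.cont.gbm_ae_eq htT q.price] with ω hg r hr hrT hno
    -- A trade is made by `κ` in every case: the full sale on the idle event, a trade of the model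
    -- otherwise.
    have hrκ : r < κ ω := by
      by_contra! hle
      by_cases hω : ω ∈ idle M u d n κ a s
      · refine hno 0 ?_
        have : h.schedule.ρ 0 ω = κ ω := if_pos hω
        rw [this]
        exact WithTop.coe_le_coe.2 hle
      · have hω' := hω
        simp only [idle, mem_iInter, mem_union, mem_ofPred_eq, mem_compl_iff, not_forall, not_or,
          not_not, not_lt] at hω
        obtain ⟨i, hi, h1, h2⟩ := hω
        refine hno (i + 1) ?_
        have : h.schedule.ρ (i + 1) ω = gridTime u d i :=
          tradeTime_succ_of_exec hi h2 (active_of_notMem_idle hω' i)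
        rw [this]
        exact WithTop.coe_le_coe.2 (h1.trans hle)
    have hpos := h.watch_pos ω r hr hrκ.le
    have hle : (r : ℝ) ≤ H := by exact_mod_cast hrκ.le.trans (h.watch_le ω)
    have hge : (t : ℝ) ≤ r := by exact_mod_cast hr
    have hl := h.lag_pos
    have hcap := h.cap_lag
    have hlag : q.lag + ((r : ℝ) - t) ∈ Icc (0 : ℝ) M.T := ⟨by linarith, by linarith⟩
    refine ⟨⟨h.dom.1, Market.price_pos h.dom.2.1 t r ω, ?_⟩, ?_⟩
    · change (r : ℝ) - (t - q.lag) ∈ _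
      rwa [show (r : ℝ) - (t - q.lag) = q.lag + (r - t) by ring]
    · rwa [← liqPath_eq_liq (hg r hrT) hlag]
  · filter_upwards [h.cont.gbm_ae_eq htT q.price] with ω hg hω
    rw [Schedule.guard_cashAt (fun k hk => h.mem_good h1f hk)]
    change _ ≤ ENNReal.ofReal (M.U (max 0 (h.schedule.cashAt (n + 1) ω)))
    rw [Schedule.cashAt_eq_cashExt hg fun i _ hne => (h.mem_good h1f hne).1]
    rcases h.invariant hω le_rfl with hdead | ⟨h1, -, -⟩
    · rw [reward_eq_zero hU (by rw [hdead.1]; norm_num)]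
      exact zero_le
    · rw [h1, reward]
      refine ENNReal.ofReal_le_ofReal ((min_le_left _ _).trans (hU.mono (mem_Ici.2 (le_max_left _ _))
        (mem_Ici.2 (le_max_left _ _)) (max_le_max le_rfl ?_)))
      linarith [h.slack]

/-- When no trade takes place up to `κ` although one takes place in the model, the liquidation
value varies fast. -/
theorem idle_nonneg (h : Follow M B t q u d n N Δ H κ a s) (hx : q.cash < 0)
    (huH : u ≤ H) (hH : ∀ j < n, q.lag + (gridTime u d j - t) ≤ M.T → gridTime u d j ≤ H)
    {ω : Ω} (hω : ω ∈ idle M u d n κ a s) (hpos : 0 ≤ (s n ω).1) :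
    κ ω < H ∧ (κ ω < u ∨ ∃ i, gridTime u d i ≤ κ ω ∧ κ ω < gridTime u d (i + 1) ∧
      Δ ≤ M.liqPath B t q (gridTime u d i) ω) := by
  -- While nothing is traded and the state is not abandoned, the model, whose cash is lower by `Δ`,
  -- has nonnegative liquidation value at the grid times, that is `Δ ≤ liqPath`. A nonnegative final
  -- cash is then possible only through a trade.
  have key : ∀ j ≤ n, ((s j ω).1 = q.cash - Δ ∧ (s j ω).2.1 = q.shares ∧
      (s j ω).2.2.2 = q.lag + (gridTime u d j - t) ∧ ∀ i < j,
        Δ ≤ M.liqPath B t q (gridTime u d i) ω ∧ q.lag + (gridTime u d (i + 1) - t) ≤ M.T) ∨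
      Dead (s j ω) ∨ ∃ i < n, ω ∈ exec M a s i ∧ ∀ l < i,
        Δ ≤ M.liqPath B t q (gridTime u d l) ω ∧ q.lag + (gridTime u d (l + 1) - t) ≤ M.T := by
    intro j
    induction j with
    | zero =>
      intro _
      rw [h.init, gridTime_zero]
      exact Or.inl ⟨rfl, rfl, rfl, fun i hi => absurd hi (Nat.not_lt_zero i)⟩
    | succ j ih =>
      intro hj
      rcases ih (by omega) with ⟨h1, h2, h3, h4⟩ | hdead | h4
      · by_cases hex : ω ∈ exec M a s j
        · exact Or.inr (Or.inr ⟨j, hj, hex, h4⟩)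
        have hst : M.stepState N (a j ω) (s j ω) = s j ω := if_neg hex
        by_cases hk : (s j ω).1 < 0 ∧
            ((s j ω).1 + (s j ω).2.2.1 * M.proceeds (s j ω).2.1 (s j ω).2.2.2 < 0 ∨
              (M.T : ℝ) < (s j ω).2.2.2 + d)
        · right; left
          have hk' : M.killState d (s j ω) = _ := if_pos hk
          rw [h.ctrl.next, evolve, hst, hk']
          exact ⟨rfl, rfl⟩
        · left
          have hk' : M.killState d (s j ω) = s j ω := if_neg hk
          have hneg : (s j ω).1 < 0 := by rw [h1]; linarith [h.slack]
          rw [h.ctrl.next, evolve, hst, hk']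
          refine ⟨h1, h2, ?_, fun i hi => ?_⟩
          · simp only [h3, gridTime_succ]
            push_cast
            ring
          · rcases (Nat.lt_succ_iff.1 hi).lt_or_eq with hi | rfl
            · exact h4 i hi
            · have h5 : ¬ ((s i ω).1 + (s i ω).2.2.1 * M.proceeds (s i ω).2.1 (s i ω).2.2.2 < 0 ∨
                (M.T : ℝ) < (s i ω).2.2.2 + d) := fun h' => hk ⟨hneg, h'⟩
              rw [not_or, not_lt, not_lt] at h5
              rw [h1, h2, h3, h.price_eq] at h5
              refine ⟨?_, ?_⟩
              · rw [liqPath]; linarith [h5.1]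
              · rw [gridTime_succ]
                push_cast
                linarith [h5.2]
      · right; left
        rw [h.ctrl.next]
        exact hdead.evolve (h.price_pos j ω) _
      · exact Or.inr (Or.inr h4)
  rcases key n le_rfl with ⟨h1, -⟩ | hdead | ⟨i, hi, hex, hl⟩
  · exfalso
    rw [h1] at hpos
    linarith [h.slack]
  · rw [hdead.1] at hpos
    norm_num at hpos
  · have hlt : κ ω < gridTime u d i := by
      simp only [idle, mem_iInter, mem_union, mem_ofPred_eq, mem_compl_iff] at hω
      exact (hω i hi).resolve_right (not_not.2 hex)
    have hiH : gridTime u d i ≤ H := by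
      rcases i with _ | i
      · rwa [gridTime_zero]
      · exact hH _ hi (hl i i.lt_succ_self).2
    refine ⟨hlt.trans_le hiH, ?_⟩
    by_cases hu : κ ω < u
    · exact Or.inl hu
    · right
      -- The mesh interval containing `κ` ends no later than the step `i` of the first trade of the
      -- model.
      have hex' : ∃ m, κ ω < gridTime u d m := ⟨i, hlt⟩
      have hm := Nat.find_spec hex'
      have hm1 : Nat.find hex' ≤ i := Nat.find_min' hex' hlt
      obtain ⟨m, hm2⟩ : ∃ m, Nat.find hex' = m + 1 := by
        refine Nat.exists_eq_succ_of_ne_zero fun h0 => ?_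
        rw [h0, gridTime_zero] at hm
        exact hu hm
      rw [hm2] at hm
      have hm3 : ¬ κ ω < gridTime u d m := Nat.find_min hex' (by omega)
      exact ⟨m, not_lt.1 hm3, hm, (hl m (by omega)).1⟩

end Follow

end Market

end Liquidation

/-! ### The shadow of a schedule on a grid. -/

namespace Liquidation

open Filter Topology

namespace Market

variable {Ω : Type*} [MeasurableSpace Ω] {M : Market Ω}

namespace Schedule

variable {t : ℝ≥0} {q : State} (S : M.Schedule t q)

open Classical in
/-- The sizes of the trades of the shadow of a schedule: the first trade is kept, the next ones
are scaled down. -/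
def target (l : ℝ) (k : ℕ) (ω : Ω) : ℝ :=
  if ∀ i < k, S.ρ i ω = ⊤ then S.ξ k ω else l ^ (2 * k + 3) * S.ξ k ω

/-- The first trade repays the debt, so it is not scaled. For the others, the exponent `2 k + 3`
lies between those of the comparison factors `l ^ (2 k + 2)` and `l ^ (2 k + 4)` before and after
the trade, which leaves room for errors on the cost whatever its sign. -/
theorem stopMeas_target (l : ℝ) (k : ℕ) : StopMeas M (S.ρ k) (S.target l k) := by
  have h := (S.size_meas k).measurable (S.stopping k)
  exact stopMeas_of_measurable (S.stopping k)
    (Measurable.ite (S.measurableSet_isFirst k) h (h.const_mul _))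

open Classical in
/-- The action of the shadow at the step `j`, taking into account the first `k` trades. -/
def pick (l : ℝ) (u d : ℝ≥0) (N j : ℕ) : ℕ → Ω → Fin (2 * N ^ 2 + 1 + 1)
  | 0, _ => 0
  | k + 1, ω => if S.ρ k ω ≤ (gridTime u d j : WithTop ℝ≥0) ∧
      (j = 0 ∨ ¬ S.ρ k ω ≤ (gridTime u d (j - 1) : WithTop ℝ≥0)) then
      orderCode N ⌈N * S.target l k ω⌉ else pick l u d N j k ω

/-- A trade is replayed at the first grid time not before it, when its size is known; if several
trades fall in one mesh, the last is retained. -/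
theorem measurable_pick (l : ℝ) (u d : ℝ≥0) (N j k : ℕ) :
    Measurable[M.F (gridTime u d j)] (S.pick l u d N j k) := by
  classical
  induction k with
  | zero => exact measurable_const
  | succ k ih =>
    have h1 := (S.stopMeas_target l k).measurable_ite (S.stopping k) (gridTime u d j)
    have h2 : Measurable[M.F (gridTime u d j)] fun ω => orderCode N ⌈N *
        (if S.ρ k ω ≤ (gridTime u d j : WithTop ℝ≥0) then S.target l k ω else 0)⌉ :=
      (measurable_of_countable (orderCode N)).comp (Int.measurable_ceil.comp (h1.const_mul _))
    have h3 : MeasurableSet[M.F (gridTime u d j)] {ω | S.ρ k ω ≤ (gridTime u d j : WithTop ℝ≥0) ∧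
        (j = 0 ∨ ¬ S.ρ k ω ≤ (gridTime u d (j - 1) : WithTop ℝ≥0))} := by
      refine (S.stopping k _).inter (MeasurableSet.union ?_ ?_)
      · exact @MeasurableSet.const _ (M.F (gridTime u d j)) _
      · exact M.F.mono (gridTime_mono u d (Nat.sub_le j 1)) _ (S.stopping k _).compl
    have h4 := @Measurable.ite _ _ _ _ (M.F (gridTime u d j)) _ _
      (fun _ => Classical.propDecidable _) h3 h2 ih
    refine Eq.mp (congrArg (fun g => Measurable[M.F (gridTime u d j)] g) (funext fun ω => ?_)) h4
    rw [pick]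
    by_cases hω : S.ρ k ω ≤ (gridTime u d j : WithTop ℝ≥0)
    · simp only [hω, if_true]
    · simp only [hω, if_false, false_and]

/-- The shadow of a schedule in the discretized model, started with a price multiplied by
`1 + ε` and a cash diminished by `δ`. -/
def shadow (B : ℝ≥0 → Ω → ℝ) (l ε δ : ℝ) (u d : ℝ≥0) (N : ℕ) : ℕ → Ω → ℝ × ℝ × ℝ × ℝ
  | 0, ω => (q.cash - δ, q.shares, (1 + ε) * M.gbm B t q.price u ω, q.lag + (u - t))
  | j + 1, ω => M.evolve N d (S.pick l u d N j S.n ω) (shadow B l ε δ u d N j ω)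
      (B (gridTime u d (j + 1)) ω - B (gridTime u d j) ω)

/-- The first grid point after the trade number `k`. -/
def gridIndex (u d : ℝ≥0) (k : ℕ) (ω : Ω) : ℕ := ⌈((clock (S.ρ k ω) : ℝ) - u) / d⌉₊

variable {S} {B : ℝ≥0 → Ω → ℝ} {l ε δ : ℝ} {u d : ℝ≥0} {N : ℕ}

theorem shadow_price (j : ℕ) (ω : Ω) : (S.shadow B l ε δ u d N j ω).2.2.1 =
    (1 + ε) * M.gbm B t q.price (gridTime u d j) ω := by
  induction j with
  | zero => rw [gridTime_zero]; rfl
  | succ j ih =>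
    rw [shadow, evolve, gridTime_succ, gbm_succ, ih, mul_assoc]

theorem controlled_shadow (hB : ContVersion M B) (htu : t ≤ u) {n : ℕ}
    (hn : gridTime u d n ≤ M.T) :
    Controlled M.prob (gaussianReal 0 d) (M.evolve N d) n (fun j => M.F (gridTime u d j))
      (fun j ω => B (gridTime u d (j + 1)) ω - B (gridTime u d j) ω)
      (fun j => S.pick l u d N j S.n) (S.shadow B l ε δ u d N) where
  le j := M.F.le _
  mono := fun i j hij => M.F.mono (gridTime_mono u d hij)
  action j _ := S.measurable_pick l u d N j S.n
  init := by
    have h1 : Measurable[M.F (gridTime u d 0)] (M.gbm B t q.price u) :=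
      hB.measurable_gbm (by rwa [gridTime_zero]) (by rw [gridTime_zero]) _
    exact measurable_const.prodMk (measurable_const.prodMk ((h1.const_mul _).prodMk
      measurable_const))
  noise j _ := (hB.adapted _).sub
    ((hB.adapted _).mono (M.F.mono (gridTime_mono u d j.le_succ)) le_rfl)
  indep j hj E hE A hA := by
    rw [hB.indep _ _ (gridTime_mono u d j.le_succ) ((gridTime_mono u d hj).trans hn) E hE A hA]
    congr 3
    rw [gridTime_succ, add_tsub_cancel_left]
  next j ω := rfl

theorem le_gridTime_iff (hd : 0 < d) {k : ℕ} {ω : Ω} (hk : S.ρ k ω ≠ ⊤) (j : ℕ) :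
    S.ρ k ω ≤ (gridTime u d j : WithTop ℝ≥0) ↔ S.gridIndex u d k ω ≤ j := by
  have hd' : (0 : ℝ) < d := by exact_mod_cast hd
  rw [← Strategy.coe_clock hk, WithTop.coe_le_coe, gridIndex, Nat.ceil_le, div_le_iff₀ hd',
    sub_le_iff_le_add', ← NNReal.coe_le_coe, gridTime]
  push_cast
  rfl

theorem gridIndex_bounds (hd : 0 < d) {k : ℕ} {ω : Ω} (hu : u < clock (S.ρ k ω)) :
    0 < S.gridIndex u d k ω ∧ (clock (S.ρ k ω) : ℝ) ≤ gridTime u d (S.gridIndex u d k ω) ∧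
      (gridTime u d (S.gridIndex u d k ω) : ℝ) < clock (S.ρ k ω) + d := by
  have hd' : (0 : ℝ) < d := by exact_mod_cast hd
  have hu' : (u : ℝ) < clock (S.ρ k ω) := by exact_mod_cast hu
  have hpos : 0 < ((clock (S.ρ k ω) : ℝ) - u) / d := div_pos (by linarith) hd'
  have h1 := Nat.le_ceil (((clock (S.ρ k ω) : ℝ) - u) / d)
  have h2 := Nat.ceil_lt_add_one hpos.le
  rw [div_le_iff₀ hd'] at h1
  have h3 := mul_lt_mul_of_pos_right h2 hd'
  rw [add_mul, div_mul_cancel₀ _ hd'.ne', one_mul] at h3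
  refine ⟨Nat.ceil_pos.2 hpos, ?_, ?_⟩
  · rw [gridTime, gridIndex]; push_cast; linarith
  · rw [gridTime, gridIndex]; push_cast; linarith

theorem pick_eq_zero (hd : 0 < d) {ω : Ω} (hu : ∀ k, S.ρ k ω ≠ ⊤ → u < clock (S.ρ k ω)) {j : ℕ} {m : ℕ}
    (h : ∀ k < m, S.ρ k ω ≠ ⊤ → S.gridIndex u d k ω ≠ j) : S.pick l u d N j m ω = 0 := by
  induction m with
  | zero => rfl
  | succ m ih =>
    rw [pick, if_neg, ih fun k hk => h k (by omega)]
    rintro ⟨h1, h2⟩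
    have hne := ne_top_of_le_ne_top WithTop.coe_ne_top h1
    have h0 := (gridIndex_bounds hd (hu m hne)).1
    have h3 := h m m.lt_succ_self hne
    rw [le_gridTime_iff hd hne] at h1
    rcases h2 with rfl | h2
    · omega
    · rw [le_gridTime_iff hd hne] at h2
      omega

theorem pick_eq (hd : 0 < d) {ω : Ω} (hu : ∀ k, S.ρ k ω ≠ ⊤ → u < clock (S.ρ k ω)) {k : ℕ}
    (hk : S.ρ k ω ≠ ⊤) {m : ℕ} (hkm : k < m)
    (h : ∀ i < m, k < i → S.ρ i ω ≠ ⊤ → S.gridIndex u d i ω ≠ S.gridIndex u d k ω) :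
    S.pick l u d N (S.gridIndex u d k ω) m ω = orderCode N ⌈N * S.target l k ω⌉ := by
  induction m with
  | zero => omega
  | succ m ih =>
    rw [pick]
    rcases (Nat.lt_succ_iff.1 hkm).lt_or_eq with hlt | rfl
    · rw [if_neg, ih hlt fun i hi => h i (by omega)]
      rintro ⟨h1, h2⟩
      have hne := ne_top_of_le_ne_top WithTop.coe_ne_top h1
      have h0 := (gridIndex_bounds hd (hu m hne)).1
      have h0' := (gridIndex_bounds hd (hu k hk)).1
      have h3 := h m m.lt_succ_self hlt hne
      rw [le_gridTime_iff hd hne] at h1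
      rcases h2 with h2 | h2
      · omega
      · rw [le_gridTime_iff hd hne] at h2
        omega
    · rw [if_pos]
      have h0 := (gridIndex_bounds hd (hu k hk)).1
      rw [le_gridTime_iff hd hk, le_gridTime_iff hd hk]
      omega

end Schedule

/-- The rounding up of order sizes. -/
theorem tendsto_ceil_div (w : ℝ) :
    Tendsto (fun N : ℕ => (⌈(N : ℝ) * w⌉ : ℝ) / N) atTop (𝓝 w) ∧
    ∀ᶠ N : ℕ in atTop, w ≤ (⌈(N : ℝ) * w⌉ : ℝ) / N ∧ |⌈(N : ℝ) * w⌉| ≤ (N : ℤ) ^ 2 := by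
  -- The rounding is upwards, so that the number of shares held never falls below its target.
  have hb : ∀ᶠ N : ℕ in atTop, w ≤ (⌈(N : ℝ) * w⌉ : ℝ) / N ∧
      (⌈(N : ℝ) * w⌉ : ℝ) / N ≤ w + 1 / (N : ℝ) := by
    filter_upwards [eventually_gt_atTop 0] with N hN
    have hN' : (0 : ℝ) < N := by exact_mod_cast hN
    have h1 := Int.le_ceil ((N : ℝ) * w)
    have h2 := (Int.ceil_lt_add_one ((N : ℝ) * w)).le
    refine ⟨by rw [le_div_iff₀ hN']; linarith, ?_⟩
    rw [div_le_iff₀ hN', add_mul, div_mul_cancel₀ _ hN'.ne']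
    linarith
  have hlim : Tendsto (fun N : ℕ => (⌈(N : ℝ) * w⌉ : ℝ) / N) atTop (𝓝 w) := by
    refine tendsto_of_tendsto_of_tendsto_of_le_of_le' tendsto_const_nhds ?_ (hb.mono fun _ h => h.1)
      (hb.mono fun _ h => h.2)
    simpa using (tendsto_one_div_atTop_nhds_zero_nat (𝕜 := ℝ)).const_add w
  refine ⟨hlim, ?_⟩
  have h3 := hlim.abs.eventually_lt_const (lt_add_one |w|)
  filter_upwards [hb, h3, eventually_gt_atTop 0,
    (tendsto_natCast_atTop_atTop (R := ℝ)).eventually_ge_atTop (|w| + 1)] with N h1 h2 hN hNw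
  refine ⟨h1.1, ?_⟩
  have hN' : (0 : ℝ) < N := by exact_mod_cast hN
  rw [abs_div, abs_of_pos hN', div_lt_iff₀ hN'] at h2
  have : ((|⌈(N : ℝ) * w⌉| : ℤ) : ℝ) ≤ ((N : ℤ) ^ 2 : ℤ) := by
    push_cast
    nlinarith
  exact_mod_cast this

end Market

end Liquidation

/-! ### Cost of the replayed trades; tracking a schedule by its shadow. -/

namespace Liquidation

open Filter Topology

namespace Market

variable {Ω : Type*} [MeasurableSpace Ω] {M : Market Ω}

/-- Joint continuity of the cost of a trade. -/
theorem Hcf.tendsto_cost (hc : M.Hcf) {w θ P : ℝ} (hw : w ≠ 0) (hθ : θ ∈ Ioc (0 : ℝ) M.T)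
    (hfin : M.f w θ ≠ ∞) {m θs Ps : ℕ → ℝ} (hm : Tendsto m atTop (𝓝 w))
    (hθs : Tendsto θs atTop (𝓝 θ)) (hmem : ∀ᶠ N in atTop, θs N ∈ Ioc (0 : ℝ) M.T)
    (hP : Tendsto Ps atTop (𝓝 P)) :
    Tendsto (fun N => m N * Ps N * (M.impactExt (m N) (θs N)).toReal) atTop
      (𝓝 (w * P * (M.f w θ).toReal)) ∧ ∀ᶠ N in atTop, M.impactExt (m N) (θs N) ≠ ∞ := by
  have h : Tendsto (fun N => M.impactExt (m N) (θs N)) atTop (𝓝 (M.f w θ)) := by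
    refine (hc.tendsto hw hθ hm hθs hmem).congr' ?_
    filter_upwards [hmem] with N hN
    rw [impactExt_of_mem ⟨hN.1.le, hN.2⟩]
  exact ⟨(hm.mul hP).mul ((ENNReal.tendsto_toReal hfin).comp h), h.eventually_ne hfin⟩

/-- The first trade of the shadow of a schedule. -/
theorem Hcf.eventually_first (hc : M.Hcf) (h1 : M.H1f) {x ξ θ P ε δ : ℝ} (hx : x < 0)
    (hP : 0 < P) (hε : 0 < ε) (hδ : δ < ε * (-x)) (hθ : θ ∈ Ioc (0 : ℝ) M.T)
    (hcash : 0 ≤ x - ξ * P * (M.f ξ θ).toReal) {θs Ps : ℕ → ℝ}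
    (hθs : Tendsto θs atTop (𝓝 θ)) (hmem : ∀ᶠ N in atTop, θs N ∈ Ioc (0 : ℝ) M.T)
    (hPs : Tendsto Ps atTop (𝓝 P)) :
    ∀ᶠ N : ℕ in atTop, M.impactExt ((⌈(N : ℝ) * ξ⌉ : ℝ) / N) (θs N) ≠ ∞ ∧
      x - ξ * P * (M.f ξ θ).toReal ≤ x - δ - (⌈(N : ℝ) * ξ⌉ : ℝ) / N * ((1 + ε) * Ps N) *
        (M.impactExt ((⌈(N : ℝ) * ξ⌉ : ℝ) / N) (θs N)).toReal := by
  -- The trade takes a debt to a nonnegative cash, so it is a sale.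
  have hξ : ξ < 0 := by
    by_contra! h0
    have : 0 ≤ ξ * P * (M.f ξ θ).toReal := by positivity
    linarith
  have hfin : M.f ξ θ ≠ ∞ := ne_top_of_le_ne_top ENNReal.one_ne_top
    (impact_le_one_of_nonpos h1 hξ.le ⟨hθ.1.le, hθ.2⟩)
  obtain ⟨h2, h3⟩ := hc.tendsto_cost hξ.ne hθ hfin (tendsto_ceil_div ξ).1 hθs hmem
    (hPs.const_mul (1 + ε))
  -- The proceeds are at least the debt `-x`, so a price higher by the factor `1 + ε` brings at
  -- least `ε (-x) > δ` more.
  have h4 : ξ * ((1 + ε) * P) * (M.f ξ θ).toReal < ξ * P * (M.f ξ θ).toReal - δ := by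
    have : ε * (ξ * P * (M.f ξ θ).toReal) ≤ ε * x :=
      mul_le_mul_of_nonneg_left (by linarith) hε.le
    nlinarith
  filter_upwards [h3, h2.eventually_lt_const h4] with N h5 h6
  exact ⟨h5, by linarith⟩

/-- The next trades of the shadow of a schedule. -/
theorem Hcf.eventually_next (hc : M.Hcf) (h1 : M.H1f) {l ξ θ P ε : ℝ} (hl0 : 0 < l) (hl1 : l < 1)
    (hP : 0 < P) (hε : 0 < ε) (hεl : (1 + ε) * l < 1) (hθ : θ ∈ Ioc (0 : ℝ) M.T) (k : ℕ)
    (hfin : M.f ξ θ ≠ ∞) {θs Ps : ℕ → ℝ}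
    (hθs : Tendsto θs atTop (𝓝 θ)) (hmem : ∀ᶠ N in atTop, θs N ∈ Ioc (0 : ℝ) M.T)
    (hPs : Tendsto Ps atTop (𝓝 P)) (hPpos : ∀ N, 0 < Ps N) :
    ∀ᶠ N : ℕ in atTop, M.impactExt ((⌈(N : ℝ) * (l ^ (2 * k + 3) * ξ)⌉ : ℝ) / N) (θs N) ≠ ∞ ∧
      ((⌈(N : ℝ) * (l ^ (2 * k + 3) * ξ)⌉ : ℝ) / N * ((1 + ε) * Ps N) *
        (M.impactExt ((⌈(N : ℝ) * (l ^ (2 * k + 3) * ξ)⌉ : ℝ) / N) (θs N)).toReal ≤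
        l ^ (2 * k + 2) * (ξ * P * (M.f ξ θ).toReal) ∨
      (⌈(N : ℝ) * (l ^ (2 * k + 3) * ξ)⌉ : ℝ) / N * ((1 + ε) * Ps N) *
        (M.impactExt ((⌈(N : ℝ) * (l ^ (2 * k + 3) * ξ)⌉ : ℝ) / N) (θs N)).toReal ≤
        l ^ (2 * k + 4) * (ξ * P * (M.f ξ θ).toReal)) := by
  have hθ' : θ ∈ Icc (0 : ℝ) M.T := ⟨hθ.1.le, hθ.2⟩
  rcases eq_or_ne ξ 0 with rfl | hξ
  · filter_upwards [hmem] with N hN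
    rw [mul_zero, mul_zero, Int.ceil_zero, Int.cast_zero, zero_div,
      impactExt_of_mem ⟨hN.1.le, hN.2⟩, h1.zero _ ⟨hN.1.le, hN.2⟩]
    exact ⟨ENNReal.one_ne_top, Or.inl (by simp)⟩
  have hpow : 0 < l ^ (2 * k + 3) := pow_pos hl0 _
  obtain ⟨hfin', hle⟩ := scaled_cost h1 (l := l ^ (2 * k + 3)) ⟨hpow.le, pow_le_one₀ hl0.le hl1.le⟩
    hθ' hP hfin
  have hw : l ^ (2 * k + 3) * ξ ≠ 0 := mul_ne_zero hpow.ne' hξ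
  obtain ⟨h2, h3⟩ := hc.tendsto_cost hw hθ hfin' (tendsto_ceil_div _).1 hθs hmem
    (hPs.const_mul (1 + ε))
  have hlim : l ^ (2 * k + 3) * ξ * ((1 + ε) * P) * (M.f (l ^ (2 * k + 3) * ξ) θ).toReal ≤
      (1 + ε) * (l ^ (2 * k + 3) * (ξ * P * (M.f ξ θ).toReal)) := by
    have := mul_le_mul_of_nonneg_left hle (by linarith : (0 : ℝ) ≤ 1 + ε)
    linarith
  set c := ξ * P * (M.f ξ θ).toReal with hcdef
  have hp2 : 0 < l ^ (2 * k + 2) := pow_pos hl0 _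
  -- A gain is compared with `l ^ (2 k + 4) c` and a cost with `l ^ (2 k + 2) c`, strictly, because
  -- `l < 1 + ε` and `(1 + ε) l < 1`. A nonzero trade of zero cost is a worthless sale, whose
  -- rounding is still a sale.
  rcases lt_trichotomy c 0 with hneg | hzero | hpos
  · have h4 : (1 + ε) * (l ^ (2 * k + 3) * c) < l ^ (2 * k + 4) * c := by
      have e1 : l ^ (2 * k + 4) = l ^ (2 * k + 3) * l := pow_succ _ _
      rw [e1]
      have : l ^ (2 * k + 3) * c < 0 := mul_neg_of_pos_of_neg hpow hneg
      nlinarith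
    filter_upwards [h3, h2.eventually_lt_const (hlim.trans_lt h4)] with N h5 h6
    exact ⟨h5, Or.inr h6.le⟩
  · have hξ' : ξ < 0 := by
      rcases lt_or_gt_of_ne hξ with h | h
      · exact h
      · exfalso
        have h5 := one_le_impact_of_nonneg h1 h.le hθ'
        have h6 := ENNReal.toReal_mono hfin h5
        rw [ENNReal.toReal_one] at h6
        have : 0 < ξ * P * (M.f ξ θ).toReal := by positivity
        linarith
    have h7 := (tendsto_ceil_div (l ^ (2 * k + 3) * ξ)).1.eventually_lt_const
      (mul_neg_of_pos_of_neg hpow hξ')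
    filter_upwards [h3, h7] with N h5 h6
    refine ⟨h5, Or.inl ?_⟩
    rw [hzero, mul_zero]
    have : 0 < (1 + ε) * Ps N := mul_pos (by linarith) (hPpos N)
    exact mul_nonpos_of_nonpos_of_nonneg (mul_nonpos_of_nonpos_of_nonneg h6.le this.le)
      ENNReal.toReal_nonneg
  · have h4 : (1 + ε) * (l ^ (2 * k + 3) * c) < l ^ (2 * k + 2) * c := by
      have e1 : l ^ (2 * k + 3) = l ^ (2 * k + 2) * l := pow_succ _ _
      rw [e1]
      have : 0 < l ^ (2 * k + 2) * c := mul_pos hp2 hpos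
      nlinarith
    filter_upwards [h3, h2.eventually_lt_const (hlim.trans_lt h4)] with N h5 h6
    exact ⟨h5, Or.inl h6.le⟩

namespace Schedule

variable {t : ℝ≥0} {q : State} {S : M.Schedule t q} {B : ℝ≥0 → Ω → ℝ} {l ε δ : ℝ} {u : ℝ≥0}
  {ω : Ω}

open Classical in
/-- The time of the last trade of the shadow of a schedule, before the trade number `k`. -/
def gridLast (S : M.Schedule t q) (u d : ℝ≥0) (ω : Ω) : ℕ → ℝ
  | 0 => t - q.lag
  | k + 1 => if S.ρ k ω ≠ ⊤ then (gridTime u d (S.gridIndex u d k ω) : ℝ) else gridLast S u d ω k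

theorem tendsto_gridTime {d : ℕ → ℝ≥0} (hd : ∀ N, 0 < d N) (hd0 : Tendsto d atTop (𝓝 0)) {k : ℕ}
    (hu : u < clock (S.ρ k ω)) :
    Tendsto (fun N => gridTime u (d N) (S.gridIndex u (d N) k ω)) atTop (𝓝 (clock (S.ρ k ω))) := by
  rw [← NNReal.tendsto_coe]
  have hd1 : Tendsto (fun N => (clock (S.ρ k ω) : ℝ) + d N) atTop (𝓝 (clock (S.ρ k ω))) := by
    have := (NNReal.tendsto_coe.2 hd0).const_add (clock (S.ρ k ω) : ℝ)
    simpa using this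
  exact tendsto_of_tendsto_of_tendsto_of_le_of_le tendsto_const_nhds hd1
    (fun N => (gridIndex_bounds (hd N) hu).2.1) (fun N => (gridIndex_bounds (hd N) hu).2.2.le)

theorem tendsto_gridLast {d : ℕ → ℝ≥0} (hd : ∀ N, 0 < d N) (hd0 : Tendsto d atTop (𝓝 0))
    (hu : ∀ k, S.ρ k ω ≠ ⊤ → u < clock (S.ρ k ω)) (k : ℕ) :
    Tendsto (fun N => S.gridLast u (d N) ω k) atTop (𝓝 (S.lastTime ω k)) := by
  induction k with
  | zero => exact tendsto_const_nhds
  | succ k ih =>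
    simp only [gridLast, lastTime]
    by_cases hk : S.ρ k ω ≠ ⊤
    · simp only [if_pos hk]
      exact NNReal.tendsto_coe.2 (tendsto_gridTime hd hd0 (hu k hk))
    · simp only [if_neg hk]
      exact ih

theorem gridLast_first {d : ℝ≥0} {k : ℕ} (h : ∀ i < k, S.ρ i ω = ⊤) :
    S.gridLast u d ω k = t - q.lag := by
  induction k with
  | zero => rfl
  | succ k ih =>
    rw [gridLast, if_neg (not_not.2 (h k k.lt_succ_self)), ih fun i hi => h i (by omega)]

theorem gridLast_nonneg {d : ℝ≥0} {k : ℕ} (h : ∃ i < k, S.ρ i ω ≠ ⊤) :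
    0 ≤ S.gridLast u d ω k := by
  induction k with
  | zero => obtain ⟨i, hi, -⟩ := h; omega
  | succ k ih =>
    rw [gridLast]
    split_ifs with hk
    · exact NNReal.coe_nonneg _
    · obtain ⟨i, hi, hi'⟩ := h
      refine ih ⟨i, ?_, hi'⟩
      rcases (Nat.lt_succ_iff.1 hi).lt_or_eq with hi | rfl
      · exact hi
      · exact absurd hi' hk

/-- Trading times are strictly increasing, so a fine enough grid separates them. -/
theorem eventually_gridIndex_lt {d : ℕ → ℝ≥0} (hd : ∀ N, 0 < d N) (hd0 : Tendsto d atTop (𝓝 0))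
    (hu : ∀ k, S.ρ k ω ≠ ⊤ → u < clock (S.ρ k ω)) {i k : ℕ} (hik : i < k) (hi : S.ρ i ω ≠ ⊤)
    (hk : S.ρ k ω ≠ ⊤) :
    ∀ᶠ N in atTop, S.gridIndex u (d N) i ω < S.gridIndex u (d N) k ω := by
  have h1 : clock (S.ρ i ω) < clock (S.ρ k ω) := by
    have := S.strict i k ω hik hi hk
    rwa [← Strategy.coe_clock hi, ← Strategy.coe_clock hk, WithTop.coe_lt_coe] at this
  filter_upwards [(tendsto_gridTime hd hd0 (hu i hi)).eventually_lt_const h1] with N hN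
  by_contra! hle
  have h2 := (gridIndex_bounds (hd N) (hu k hk)).2.1
  have h3 := gridTime_mono u (d N) hle
  exact absurd hN (not_lt.2 ((NNReal.coe_le_coe.1 h2).trans h3))

theorem at_nonneg (ht : ∀ k, S.ρ k ω ≠ ⊤ →
      S.impact k ω ≠ ∞ ∧ 0 ≤ S.cashAt (k + 1) ω ∧ 0 ≤ S.sharesAt (k + 1) ω) {k : ℕ}
    (h : ∃ i < k, S.ρ i ω ≠ ⊤) : 0 ≤ S.cashAt k ω ∧ 0 ≤ S.sharesAt k ω := by
  rcases S.at_cases k ω with ⟨hno, -⟩ | ⟨i, -, hi', -, e2, e3⟩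
  · obtain ⟨i, hi, hi'⟩ := h
    exact absurd (hno i hi) hi'
  · rw [e2, e3]
    exact (ht i hi').2

/-- The state of the shadow between the trades number `k - 1` and `k`. -/
structure Tracks (S : M.Schedule t q) (l δ : ℝ) (u d : ℝ≥0) (ω : Ω) (j k : ℕ)
    (z : ℝ × ℝ × ℝ × ℝ) : Prop where
  first : (∀ i < k, S.ρ i ω = ⊤) → z.1 = q.cash - δ ∧ z.2.1 = q.shares
  next : (∃ i < k, S.ρ i ω ≠ ⊤) → l ^ (2 * k + 2) * S.cashAt k ω ≤ z.1 ∧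
    l ^ (2 * k + 2) * S.sharesAt k ω ≤ z.2.1
  lag : z.2.2.2 = gridTime u d j - S.gridLast u d ω k

/-- Doing nothing preserves the holdings as long as the state is not abandoned, which `halive`
ensures. -/
theorem Tracks.carry {d : ℝ≥0} {N j k : ℕ} {z : ℝ × ℝ × ℝ × ℝ} {w : ℝ}
    (h : S.Tracks l δ u d ω j k z)
    (halive : 0 ≤ z.1 ∨ (0 ≤ z.1 + z.2.2.1 * M.proceeds z.2.1 z.2.2.2 ∧ z.2.2.2 + d ≤ M.T)) :
    S.Tracks l δ u d ω (j + 1) k (M.evolve N d 0 z w) := by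
  have hst : M.stepState N 0 z = z := if_neg fun h => h.1 rfl
  have hk : M.killState d z = z := by
    refine if_neg fun h' => ?_
    rcases halive with h0 | ⟨h0, h1⟩
    · exact absurd h0 (not_le.2 h'.1)
    · rcases h'.2 with h2 | h2
      · exact absurd h0 (not_le.2 h2)
      · exact absurd h1 (not_le.2 h2)
  rw [evolve, hst, hk]
  refine ⟨h.first, h.next, ?_⟩
  simp only [h.lag, gridTime_succ]
  push_cast
  ring

end Schedule

end Market

end Liquidation

/-! ### The shadow holds almost as much cash as the schedule. -/

namespace Liquidation

open Filter Topology

namespace Market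

variable {Ω : Type*} [MeasurableSpace Ω] {M : Market Ω}

namespace Schedule

variable {t : ℝ≥0} {q : State} {S : M.Schedule t q} {B : ℝ≥0 → Ω → ℝ} {l ε δ : ℝ} {u : ℝ≥0}
  {ω : Ω}

/-- A feasible trade of the model. -/
theorem evolve_of_feasible {N : ℕ} {d : ℝ≥0} {m : ℤ} (hm : |m| ≤ (N : ℤ) ^ 2)
    {z : ℝ × ℝ × ℝ × ℝ} (hz : M.Feasible (m / N) z) (w : ℝ) :
    (M.evolve N d (orderCode N m) z w).1 = z.1 - M.orderCost (m / N) z ∧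
    (M.evolve N d (orderCode N m) z w).2.1 = z.2.1 + m / N ∧
    (M.evolve N d (orderCode N m) z w).2.2.2 = d := by
  obtain ⟨h1, h2⟩ := orderCode_spec hm
  have hst : M.stepState N (orderCode N m) z =
      (z.1 - M.orderCost (m / N) z, z.2.1 + m / N, z.2.2.1, 0) := by
    rw [stepState, h2, if_pos ⟨h1, hz⟩]
  have hk : ¬ ((z.1 - M.orderCost (m / N) z) < 0) := not_lt.2 hz.2.2.1
  rw [evolve, hst, killState, if_neg fun h => hk h.1]
  exact ⟨rfl, rfl, zero_add _⟩

/-- As `N` grows, the grid time, the lag, the price and the order size tend to those prescribed for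
the trade `k`; the strict margins of `Hcf.eventually_first` and `Hcf.eventually_next` absorb the
errors. -/
theorem eventually_trade (hB : ContVersion M B) (h1 : M.H1f) (hc : M.Hcf) (hq : q ∈ M.domain)
    (hx : q.cash < 0) (hl0 : 0 < l) (hl1 : l < 1) (hε : 0 < ε) (hεl : (1 + ε) * l < 1)
    (hδ : δ < ε * (-q.cash)) {d : ℕ → ℝ≥0} (hd : ∀ N, 0 < d N) (hd0 : Tendsto d atTop (𝓝 0))
    (hgrid : ∀ N j, q.lag + (gridTime u (d N) j - t) < M.T →
      q.lag + (gridTime u (d N) (j + 1) - t) ≤ M.T)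
    (hg : ∀ s ≤ M.T, M.gbm B t q.price s ω = M.price t q.price s ω)
    (ht : ∀ k, S.ρ k ω ≠ ⊤ →
      S.impact k ω ≠ ∞ ∧ 0 ≤ S.cashAt (k + 1) ω ∧ 0 ≤ S.sharesAt (k + 1) ω)
    (hlag : ∀ k, S.ρ k ω ≠ ⊤ → clock (S.ρ k ω) - S.lastTime ω k ∈ Ioc (0 : ℝ) M.T)
    (hlt : ∀ k, S.ρ k ω ≠ ⊤ → S.ρ k ω < (M.T : WithTop ℝ≥0))
    (hu : ∀ k, S.ρ k ω ≠ ⊤ → u < clock (S.ρ k ω)) {k : ℕ} (hk : S.ρ k ω ≠ ⊤) :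
    ∀ᶠ N in atTop, ∀ z, S.Tracks l δ u (d N) ω (S.gridIndex u (d N) k ω) k z →
      z.2.2.1 = (1 + ε) * M.gbm B t q.price (gridTime u (d N) (S.gridIndex u (d N) k ω)) ω →
      ∀ w, S.Tracks l δ u (d N) ω (S.gridIndex u (d N) k ω + 1) (k + 1)
        (M.evolve N (d N) (orderCode N ⌈N * S.target l k ω⌉) z w) := by
  have hcl : clock (S.ρ k ω) < M.T := by
    have := hlt k hk
    rwa [← Strategy.coe_clock hk, WithTop.coe_lt_coe] at this
  have htime := tendsto_gridTime hd hd0 (hu k hk)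
  set θ : ℝ := clock (S.ρ k ω) - S.lastTime ω k with hθdef
  set P : ℝ := M.price t q.price (clock (S.ρ k ω)) ω with hPdef
  have hP : 0 < P := Market.price_pos hq.2.1 _ _ _
  set θs : ℕ → ℝ := fun N => gridTime u (d N) (S.gridIndex u (d N) k ω) - S.gridLast u (d N) ω k
    with hθs
  have hθlim : Tendsto θs atTop (𝓝 θ) :=
    (NNReal.tendsto_coe.2 htime).sub (tendsto_gridLast hd hd0 hu k)
  set Ps : ℕ → ℝ := fun N => M.gbm B t q.price (gridTime u (d N) (S.gridIndex u (d N) k ω)) ω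
    with hPs
  have hPlim : Tendsto Ps atTop (𝓝 P) := by
    rw [hPdef, ← hg _ hcl.le]
    exact ((hB.continuous_gbm t q.price ω).tendsto _).comp htime
  have hPpos : ∀ N, 0 < Ps N := fun N => gbm_pos hq.2.1 _ _ _
  -- The first trade is replayed slightly late, and its lag could exceed `T`. This is excluded by
  -- `hgrid`: the grid does not jump over the time at which the lag equals `T`. After a first trade
  -- the lag is bounded by the grid time, below `T`.
  have hmem : ∀ᶠ N in atTop, θs N ∈ Ioc (0 : ℝ) M.T := by
    by_cases hfirst : ∀ i < k, S.ρ i ω = ⊤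
    · filter_upwards [hθlim.eventually_const_lt (hlag k hk).1] with N h3
      refine ⟨h3, ?_⟩
      have h4 := (hlag k hk).2
      rcases S.at_cases k ω with ⟨-, e, -, -⟩ | ⟨i, hi, hi', -⟩
      · rw [e] at h4
        have h0 := (gridIndex_bounds (hd N) (hu k hk)).1
        obtain ⟨j, hj⟩ := Nat.exists_eq_succ_of_ne_zero h0.ne'
        have h5 : ¬ S.ρ k ω ≤ (gridTime u (d N) j : WithTop ℝ≥0) := by
          rw [le_gridTime_iff (hd N) hk]; omega
        rw [← Strategy.coe_clock hk, WithTop.coe_le_coe, not_le] at h5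
        have h6 : (gridTime u (d N) j : ℝ) < clock (S.ρ k ω) := by exact_mod_cast h5
        have h7 := hgrid N j (by linarith)
        simp only [hθs, gridLast_first hfirst, hj]
        linarith
      · exact absurd (hfirst i hi) hi'
    · push Not at hfirst
      filter_upwards [hθlim.eventually_const_lt (hlag k hk).1,
        htime.eventually_lt_const hcl] with N h3 h4
      have h5 := gridLast_nonneg (u := u) (d := d N) hfirst
      have h6 : (gridTime u (d N) (S.gridIndex u (d N) k ω) : ℝ) < M.T := by exact_mod_cast h4
      exact ⟨h3, by simp only [hθs]; linarith⟩
  have hcost : S.cost k ω = S.ξ k ω * P * (M.f (S.ξ k ω) θ).toReal := rfl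
  have hnew := ht k hk
  have hcash := S.cashAt_succ_of_ne hk
  have hshares := S.sharesAt_succ_of_ne hk
  have hlast : ∀ N, S.gridLast u (d N) ω (k + 1) =
      gridTime u (d N) (S.gridIndex u (d N) k ω) := fun N => if_pos hk
  have hpow : l ^ (2 * (k + 1) + 2) = l ^ (2 * k + 2) * l * l := by ring
  have hp2 : 0 < l ^ (2 * k + 2) := pow_pos hl0 _
  have hp4 : 0 < l ^ (2 * (k + 1) + 2) := pow_pos hl0 _
  have hp2' : l ^ (2 * k + 2) ≤ 1 := pow_le_one₀ hl0.le hl1.le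
  have hp4' : l ^ (2 * (k + 1) + 2) ≤ 1 := pow_le_one₀ hl0.le hl1.le
  have hfin : ∀ (N : ℕ) (m : ℤ) (z : ℝ × ℝ × ℝ × ℝ) (w : ℝ), |m| ≤ (N : ℤ) ^ 2 →
      θs N ∈ Ioc (0 : ℝ) M.T → z.2.2.2 = θs N → z.2.2.1 = (1 + ε) * Ps N →
      M.impactExt (m / N) (θs N) ≠ ∞ →
      l ^ (2 * (k + 1) + 2) * S.cashAt (k + 1) ω ≤
        z.1 - m / N * ((1 + ε) * Ps N) * (M.impactExt (m / N) (θs N)).toReal →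
      l ^ (2 * (k + 1) + 2) * S.sharesAt (k + 1) ω ≤ z.2.1 + m / N →
      S.Tracks l δ u (d N) ω (S.gridIndex u (d N) k ω + 1) (k + 1)
        (M.evolve N (d N) (orderCode N m) z w) := by
    intro N m z w hm hθN hz1 hz2 hfinN hcN hsN
    have hfeas : M.Feasible (m / N) z := by
      refine ⟨by rwa [hz1], by rwa [hz1], ?_, ?_⟩
      · rw [orderCost, hz1, hz2]
        exact (mul_nonneg hp4.le hnew.2.1).trans hcN
      · exact (mul_nonneg hp4.le hnew.2.2).trans hsN
    obtain ⟨e1, e2, e3⟩ := evolve_of_feasible (d := d N) hm hfeas w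
    refine ⟨fun h => absurd (h k k.lt_succ_self) hk, fun _ => ?_, ?_⟩
    · rw [e1, e2, orderCost, hz1, hz2]
      exact ⟨hcN, hsN⟩
    · rw [e3, hlast, gridTime_succ]
      push_cast
      ring
  by_cases hfirst : ∀ i < k, S.ρ i ω = ⊤
  · have htarget : S.target l k ω = S.ξ k ω := if_pos hfirst
    obtain ⟨e2, e3⟩ : S.cashAt k ω = q.cash ∧ S.sharesAt k ω = q.shares := by
      rcases S.at_cases k ω with ⟨-, -, h⟩ | ⟨i, hi, hi', -⟩
      · exact h
      · exact absurd (hfirst i hi) hi'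
    rw [e2, hcost] at hcash
    filter_upwards [hmem, hc.eventually_first h1 hx hP hε hδ (hlag k hk)
      (by rw [← hcash]; exact hnew.2.1) hθlim hmem hPlim, (tendsto_ceil_div (S.ξ k ω)).2]
      with N g1 g2 g3 z hz hzp w
    rw [htarget]
    obtain ⟨f1, f2⟩ := hz.first hfirst
    refine hfin N _ z w g3.2 g1 hz.lag hzp g2.1 ?_ ?_
    · rw [f1]
      refine le_trans ?_ g2.2
      rw [← hcash]
      exact mul_le_of_le_one_left hnew.2.1 hp4'
    · rw [f2]
      refine (mul_le_of_le_one_left hnew.2.2 hp4').trans ?_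
      rw [hshares, e3]
      linarith [g3.1]
  · have htarget : S.target l k ω = l ^ (2 * k + 3) * S.ξ k ω := if_neg hfirst
    push Not at hfirst
    have hold := at_nonneg ht hfirst
    rw [hcost] at hcash
    filter_upwards [hmem, hc.eventually_next h1 hl0 hl1 hP hε hεl (hlag k hk) k hnew.1 hθlim hmem
      hPlim hPpos, (tendsto_ceil_div (l ^ (2 * k + 3) * S.ξ k ω)).2] with N g1 g2 g3 z hz hzp w
    rw [htarget]
    obtain ⟨f1, f2⟩ := hz.next hfirst
    refine hfin N _ z w g3.2 g1 hz.lag hzp g2.1 ?_ ?_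
    · have hll : l * l ≤ 1 := by nlinarith
      have hle : l ^ (2 * (k + 1) + 2) ≤ l ^ (2 * k + 2) := by
        rw [hpow, mul_assoc]; exact mul_le_of_le_one_right hp2.le hll
      rcases g2.2 with g | g
      · have : l ^ (2 * (k + 1) + 2) * S.cashAt (k + 1) ω ≤
            l ^ (2 * k + 2) * S.cashAt (k + 1) ω := mul_le_mul_of_nonneg_right hle hnew.2.1
        rw [hcash] at this ⊢
        linarith
      · have e4 : l ^ (2 * k + 4) = l ^ (2 * (k + 1) + 2) := by ring
        rw [e4] at g
        have : l ^ (2 * (k + 1) + 2) * S.cashAt k ω ≤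
            l ^ (2 * k + 2) * S.cashAt k ω := mul_le_mul_of_nonneg_right hle hold.1
        rw [hcash]
        linarith
    · refine le_trans ?_ (add_le_add f2 g3.1)
      have e3 : l ^ (2 * k + 3) = l ^ (2 * k + 2) * l := pow_succ _ _
      rw [e3, hpow]
      -- With `y`, `y + ξ` the shares before and after the trade, `l ^ (2 k + 2) y + l ^ (2 k + 3) ξ
      -- - l ^ (2 k + 4) (y + ξ)` is the sum of the terms `a1` and `a2`.
      have a1 : 0 ≤ l ^ (2 * k + 2) * (1 - l) * S.sharesAt k ω :=
        mul_nonneg (mul_nonneg hp2.le (by linarith)) hold.2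
      have a2 : 0 ≤ l ^ (2 * k + 2) * l * (1 - l) * S.sharesAt (k + 1) ω :=
        mul_nonneg (mul_nonneg (mul_nonneg hp2.le hl0.le) (by linarith)) hnew.2.2
      rw [hshares] at a2 ⊢
      nlinarith

/-- The shadow of a valid schedule holds almost as much cash as the schedule. -/
theorem eventually_shadow (hB : ContVersion M B) (h1 : M.H1f) (hc : M.Hcf) (hq : q ∈ M.domain)
    (hx : q.cash < 0) (hl0 : 0 < l) (hl1 : l < 1) (hε : 0 < ε) (hεl : (1 + ε) * l < 1)
    (hδ : δ < ε * (-q.cash)) {d : ℕ → ℝ≥0} (hd : ∀ N, 0 < d N) (hd0 : Tendsto d atTop (𝓝 0))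
    (hgrid : ∀ N j, q.lag + (gridTime u (d N) j - t) < M.T →
      q.lag + (gridTime u (d N) (j + 1) - t) ≤ M.T)
    (hg : ∀ s ≤ M.T, M.gbm B t q.price s ω = M.price t q.price s ω)
    (ht : ∀ k, S.ρ k ω ≠ ⊤ →
      S.impact k ω ≠ ∞ ∧ 0 ≤ S.cashAt (k + 1) ω ∧ 0 ≤ S.sharesAt (k + 1) ω)
    (hpre : ∀ s : ℝ≥0, t ≤ s → s ≤ M.T → (∀ k, ¬ S.ρ k ω ≤ (s : WithTop ℝ≥0)) →
      (⟨q.cash, q.shares, M.price t q.price s ω, s - (t - q.lag)⟩ : State) ∈ M.closedRegion)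
    (hlag : ∀ k, S.ρ k ω ≠ ⊤ → clock (S.ρ k ω) - S.lastTime ω k ∈ Ioc (0 : ℝ) M.T)
    (hlt : ∀ k, S.ρ k ω ≠ ⊤ → S.ρ k ω < (M.T : WithTop ℝ≥0)) (htu : t ≤ u)
    (hu : ∀ k, S.ρ k ω ≠ ⊤ → u < clock (S.ρ k ω)) (hex : ∃ k, S.ρ k ω ≠ ⊤)
    {n : ℕ → ℕ} (hn : ∀ N, ∀ k, S.ρ k ω ≠ ⊤ → S.gridIndex u (d N) k ω < n N) :
    ∀ᶠ N in atTop, l ^ (2 * S.n + 2) * S.cashAt S.n ω ≤ (S.shadow B l ε δ u (d N) N (n N) ω).1 := by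
  have hkn : ∀ k, S.ρ k ω ≠ ⊤ → k < S.n := fun k hk => by
    by_contra! h
    exact hk (S.bounded k ω h)
  -- Induction on the trades, then on the grid steps between two of them; the threshold on `N`
  -- depends on the trade but not on the step `j`.
  have key : ∀ k ≤ S.n, ∀ᶠ N in atTop, ∀ j,
      (∀ i < k, S.ρ i ω ≠ ⊤ → S.gridIndex u (d N) i ω < j) →
      (∀ i, k ≤ i → S.ρ i ω ≠ ⊤ → j ≤ S.gridIndex u (d N) i ω) →
      S.Tracks l δ u (d N) ω j k (S.shadow B l ε δ u (d N) N j ω) := by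
    intro k
    induction k with
    | zero =>
      intro _
      refine Eventually.of_forall fun N j => ?_
      induction j with
      | zero =>
        intro _ _
        refine ⟨fun _ => ⟨rfl, rfl⟩, fun ⟨i, hi, _⟩ => absurd hi (Nat.not_lt_zero i), ?_⟩
        rw [gridTime_zero]
        simp only [shadow, gridLast]
        ring
      | succ j ih =>
        intro h2 h3
        have hj := ih (fun i hi => absurd hi (Nat.not_lt_zero i))
          fun i hi hi' => (Nat.le_succ j).trans (h3 i hi hi')
        rw [shadow, pick_eq_zero (hd N) hu fun i _ hi' h => by
          have := h3 i i.zero_le hi'; omega]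
        have hno : ∀ i, ¬ S.ρ i ω ≤ (gridTime u (d N) j : WithTop ℝ≥0) := by
          intro i hi
          have hi' := ne_top_of_le_ne_top WithTop.coe_ne_top hi
          rw [le_gridTime_iff (hd N) hi'] at hi
          have := h3 i i.zero_le hi'
          omega
        obtain ⟨f1, f2⟩ := hj.first fun i hi => absurd hi (Nat.not_lt_zero i)
        have flag := hj.lag
        rw [gridLast] at flag
        refine hj.carry (Or.inr ?_)
        -- the first trade takes place before the lag reaches `T`
        have hm := Nat.find_spec hex
        set m := Nat.find hex with hmdef
        have hfirst : ∀ i < m, S.ρ i ω = ⊤ := fun i hi => not_not.1 (Nat.find_min hex hi)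
        have hlm := (hlag m hm).2
        have e1 : S.lastTime ω m = t - q.lag := by
          rcases S.at_cases m ω with ⟨-, e, -⟩ | ⟨i, hi, hi', -⟩
          · exact e
          · exact absurd (hfirst i hi) hi'
        rw [e1] at hlm
        have h5 := hno m
        rw [← Strategy.coe_clock hm, WithTop.coe_le_coe, not_le] at h5
        have h6 : (gridTime u (d N) j : ℝ) < clock (S.ρ m ω) := by exact_mod_cast h5
        have h7 := hgrid N j (by linarith)
        have hT : gridTime u (d N) j ≤ M.T := h5.le.trans (clock_le_horizon hm)
        have hst := (M.mem_closedRegion_iff _).1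
          (hpre (gridTime u (d N) j) (htu.trans le_self_add) hT hno)
        have hL := hst.2
        rw [liq_eq_proceeds hst.1.2.2] at hL
        rw [f1, f2, flag, shadow_price]
        have hl' : (gridTime u (d N) j : ℝ) - (t - q.lag) = q.lag + (gridTime u (d N) j - t) := by
          ring
        rw [hg _ hT]
        refine ⟨?_, ?_⟩
        · set pr := M.proceeds q.shares ((gridTime u (d N) j : ℝ) - (t - q.lag)) with hpr
          set Pr := M.price t q.price (gridTime u (d N) j) ω with hPr
          change 0 ≤ q.cash + Pr * pr at hL
          -- `x - δ + (1 + ε) P φ = (1 + ε) (x + P φ) + (ε (-x) - δ)`: the higher price more than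
          -- compensates for the lower cash, so the waiting shadow is not abandoned.
          have : 0 ≤ ε * (q.cash + Pr * pr) := mul_nonneg hε.le hL
          nlinarith
        · rw [gridTime_succ] at h7
          push_cast at h7
          linarith
    | succ k ih =>
      intro hk
      have hprev := ih (by omega)
      by_cases hρ : S.ρ k ω = ⊤
      · filter_upwards [hprev] with N hN j h2 h3
        have hj := hN j (fun i hi => h2 i (by omega)) fun i hi hi' => h3 i (by
          rcases hi.eq_or_lt with rfl | h
          · exact absurd hρ hi'
          · exact h) hi'
        refine ⟨fun h => hj.first fun i hi => h i (by omega), fun ⟨i, hi, hi'⟩ => ?_, ?_⟩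
        · have hex' : ∃ i < k, S.ρ i ω ≠ ⊤ := by
            refine ⟨i, ?_, hi'⟩
            rcases (Nat.lt_succ_iff.1 hi).lt_or_eq with h | rfl
            · exact h
            · exact absurd hρ hi'
          obtain ⟨g1, g2⟩ := hj.next hex'
          obtain ⟨g3, g4⟩ := at_nonneg ht hex'
          rw [S.cashAt_succ_of_eq hρ, S.sharesAt_succ_of_eq hρ]
          have hle : l ^ (2 * (k + 1) + 2) ≤ l ^ (2 * k + 2) :=
            pow_le_pow_of_le_one hl0.le hl1.le (by omega)
          exact ⟨(mul_le_mul_of_nonneg_right hle g3).trans g1,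
            (mul_le_mul_of_nonneg_right hle g4).trans g2⟩
        · rw [hj.lag, gridLast, if_neg (not_not.2 hρ)]
      · have hsep : ∀ᶠ N in atTop, ∀ i ∈ Finset.range S.n, S.ρ i ω ≠ ⊤ →
            (i < k → S.gridIndex u (d N) i ω < S.gridIndex u (d N) k ω) ∧
            (k < i → S.gridIndex u (d N) k ω < S.gridIndex u (d N) i ω) := by
          rw [Finset.eventually_all]
          intro i _
          by_cases hi : S.ρ i ω = ⊤
          · exact Eventually.of_forall fun N h => absurd hi h
          rcases lt_trichotomy i k with h | rfl | h
          · filter_upwards [eventually_gridIndex_lt hd hd0 hu h hi hρ] with N hN _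
            exact ⟨fun _ => hN, fun h' => absurd h' h.not_gt⟩
          · exact Eventually.of_forall fun N _ =>
              ⟨fun h => absurd h (lt_irrefl _), fun h => absurd h (lt_irrefl _)⟩
          · filter_upwards [eventually_gridIndex_lt hd hd0 hu h hρ hi] with N hN _
            exact ⟨fun h' => absurd h' h.not_gt, fun _ => hN⟩
        filter_upwards [hprev, hsep, eventually_trade hB h1 hc hq hx hl0 hl1 hε hεl hδ hd hd0 hgrid
          hg ht hlag hlt hu hρ] with N hN hs htr j
        have hsep' : ∀ i, S.ρ i ω ≠ ⊤ →
            (i < k → S.gridIndex u (d N) i ω < S.gridIndex u (d N) k ω) ∧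
            (k < i → S.gridIndex u (d N) k ω < S.gridIndex u (d N) i ω) :=
          fun i hi => hs i (Finset.mem_range.2 (hkn i hi)) hi
        have hbase := htr _ (hN (S.gridIndex u (d N) k ω) (fun i hi hi' => (hsep' i hi').1 hi)
          fun i hi hi' => by
            rcases hi.eq_or_lt with rfl | h
            · exact le_rfl
            · exact ((hsep' i hi').2 h).le) (shadow_price _ _)
        induction j with
        | zero => exact fun h2 _ => absurd (h2 k k.lt_succ_self hρ) (Nat.not_lt_zero _)
        | succ j ihj =>
          intro h2 h3
          have hkj := h2 k k.lt_succ_self hρ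
          rcases (Nat.lt_succ_iff.1 hkj).eq_or_lt with rfl | hlt'
          · rw [shadow, pick_eq (hd N) hu hρ (hkn k hρ)
              fun i _ hi hi' => ((hsep' i hi').2 hi).ne']
            exact hbase _
          · have hle : ∀ i < k + 1, S.ρ i ω ≠ ⊤ → S.gridIndex u (d N) i ω < j := by
              intro i hi hi'
              rcases (Nat.lt_succ_iff.1 hi).lt_or_eq with h | rfl
              · exact ((hsep' i hi').1 h).trans hlt'
              · exact hlt'
            have hj := ihj hle fun i hi hi' => (Nat.le_succ j).trans (h3 i hi hi')
            rw [shadow, pick_eq_zero (hd N) hu fun i _ hi' h => ?_]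
            · have hex' : ∃ i < k + 1, S.ρ i ω ≠ ⊤ := ⟨k, k.lt_succ_self, hρ⟩
              exact hj.carry (Or.inl ((mul_nonneg (pow_pos hl0 _).le
                (at_nonneg ht hex').1).trans (hj.next hex').1))
            · rcases lt_or_ge i (k + 1) with hi | hi
              · have := hle i hi hi'
                omega
              · have := h3 i hi hi'
                omega
  filter_upwards [key S.n le_rfl] with N hN
  obtain ⟨k, hk⟩ := hex
  exact ((hN (n N) (fun i _ hi => hn N i hi) fun i hi hi' => absurd (S.bounded i ω hi) hi').next
    ⟨k, hkn k hk, hk⟩).1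

end Schedule

end Market

end Liquidation

/-! ### Vanishing probabilities, stability under a price shift, controlled policies. -/

namespace Liquidation

open Filter Topology

/-- Events that almost every point eventually leaves have vanishing probability. -/
theorem tendsto_measure_zero {Ω : Type*} [MeasurableSpace Ω] {μ : Measure Ω} [IsFiniteMeasure μ]
    {E : ℕ → Set Ω} (hE : ∀ n, MeasurableSet (E n)) (h : ∀ᵐ ω ∂μ, ∀ᶠ n in atTop, ω ∉ E n) :
    Tendsto (fun n => μ (E n)) atTop (𝓝 0) := by
  have h1 : Tendsto (fun n => ∫⁻ ω, (E n).indicator 1 ω ∂μ) atTop (𝓝 (∫⁻ _, 0 ∂μ)) := by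
    refine tendsto_lintegral_of_dominated_convergence 1
      (fun n => measurable_one.indicator (hE n))
      (fun n => Eventually.of_forall fun ω => indicator_le_self' (fun _ _ => zero_le) ω)
      (by simp) ?_
    filter_upwards [h] with ω hω
    refine tendsto_const_nhds.congr' ?_
    filter_upwards [hω] with n hn
    rw [indicator_of_notMem hn]
  simpa [lintegral_indicator_one (hE _)] using h1

/-- A choice of time just after `t` at which events receding as the time decreases to `t` have a
small probability. -/
theorem exists_time_measure_le {Ω : Type*} [MeasurableSpace Ω] {μ : Measure Ω} [IsFiniteMeasure μ]
    {E : ℝ≥0 → Set Ω} (hE : ∀ u, MeasurableSet (E u)) {t b : ℝ≥0} (htb : t < b)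
    (h : ∀ᵐ ω ∂μ, ∀ᶠ u in 𝓝[>] t, ω ∉ E u) {η : ℝ≥0∞} (hη : 0 < η) :
    ∃ u, t < u ∧ u < b ∧ μ (E u) ≤ η := by
  obtain ⟨v, -, hv, hlim⟩ := exists_seq_strictAnti_tendsto' htb
  have hlim' : Tendsto v atTop (𝓝[>] t) :=
    tendsto_nhdsWithin_iff.2 ⟨hlim, Eventually.of_forall fun m => (hv m).1⟩
  have hz := tendsto_measure_zero (μ := μ) (E := fun m => E (v m)) (fun m => hE _)
    (h.mono fun ω hω => hlim'.eventually hω)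
  obtain ⟨m, hm⟩ := (hz.eventually_lt_const hη).exists
  exact ⟨v m, (hv m).1, (hv m).2, hm.le⟩

namespace Market

variable {Ω : Type*} [MeasurableSpace Ω] {M : Market Ω}

/-- The integral of a function of an increment over an event of the past. -/
theorem ContVersion.setLIntegral_increment [IsProbabilityMeasure M.prob] {B : ℝ≥0 → Ω → ℝ}
    (hB : ContVersion M B)
    {t u : ℝ≥0} (htu : t ≤ u) (hu : u ≤ M.T) {g : ℝ → ℝ≥0∞} (hg : Measurable g) {A : Set Ω}
    (hA : MeasurableSet[M.F t] A) :
    ∫⁻ ω in A, g (B u ω - B t ω) ∂M.prob = (∫⁻ w, g w ∂gaussianReal 0 (u - t)) * M.prob A := by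
  have hm : Measurable fun ω => B u ω - B t ω :=
    ((hB.adapted u).mono (M.F.le _) le_rfl).sub ((hB.adapted t).mono (M.F.le _) le_rfl)
  have := setLIntegral_freeze (μ := M.prob) (γ := gaussianReal 0 (u - t))
    (𝓕 := fun _ => M.F t) (j := 0) (M.F.le t) (Z := fun _ => (0 : ℝ))
    (@measurable_const _ _ _ (M.F t) 0) hm
    (fun E hE V hV => hB.indep t u htu hu E hE V hV) (F := fun z => g z.2) (hg.comp measurable_snd) hA
  rw [this, setLIntegral_const]

/-- The stability of functions of the price at `u` under a multiplication of the price by a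
constant close to `1`. -/
theorem ContVersion.exists_price_shift [IsProbabilityMeasure M.prob] {B : ℝ≥0 → Ω → ℝ}
    (hB : ContVersion M B) (hσ : 0 < M.σ)
    {t u : ℝ≥0} (htu : t < u) (hu : u ≤ M.T) {η : ℝ} (hη : 0 < η) (p : ℝ) :
    ∃ ε₀ > 0, ∀ ε, 0 < ε → ε < ε₀ → ∀ C : ℝ, 0 < C → ∀ V : ℝ → ℝ≥0∞, Measurable V →
      (∀ x, V x ≤ ENNReal.ofReal C) → ∀ A : Set Ω, MeasurableSet[M.F t] A →
      ∫⁻ ω in A, V ((1 + ε) * M.gbm B t p u ω) ∂M.prob ≤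
        (∫⁻ ω in A, V (M.gbm B t p u ω) ∂M.prob) + ENNReal.ofReal (C * η) := by
  have hv : u - t ≠ 0 := (tsub_pos_of_lt htu).ne'
  -- The threshold is uniform over `V`: the value function to be inserted depends on `ε` and on the
  -- mesh, which are chosen later.
  obtain ⟨a₀, ha₀, h⟩ := exists_gaussian_shift hv hη
  refine ⟨M.σ * a₀, mul_pos hσ ha₀, fun ε hε hε₀ C hC V hV hVC A hA => ?_⟩
  set G : ℝ → ℝ := fun w => p * Real.exp ((M.b - M.σ ^ 2 / 2) * ((u : ℝ) - t) + M.σ * w) with hG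
  have hGm : Measurable G := by fun_prop
  -- Multiplying the price by `1 + ε` is the same as translating the Brownian increment by `log (1 +
  -- ε) / σ ≤ ε / σ`.
  have ha : |Real.log (1 + ε) / M.σ| < a₀ := by
    have h1 : 0 ≤ Real.log (1 + ε) := Real.log_nonneg (by linarith)
    have h2 : Real.log (1 + ε) ≤ ε := by
      have := Real.log_le_sub_one_of_pos (show 0 < 1 + ε by linarith)
      linarith
    rw [abs_of_nonneg (div_nonneg h1 hσ.le), div_lt_iff₀ hσ]
    linarith
  have hshift : ∀ w, G (w + Real.log (1 + ε) / M.σ) = (1 + ε) * G w := by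
    intro w
    simp only [hG]
    rw [mul_add, mul_div_cancel₀ _ hσ.ne', ← add_assoc, Real.exp_add,
      Real.exp_log (by linarith)]
    ring
  have hC0 : ENNReal.ofReal C ≠ 0 := by simpa using hC
  have hCtop : ENNReal.ofReal C ≠ ∞ := ENNReal.ofReal_ne_top
  set g : ℝ → ℝ≥0∞ := fun w => V (G w) / ENNReal.ofReal C with hg
  have hgm : Measurable g := (hV.comp hGm).div_const _
  have hg1 : ∀ w, g w ≤ 1 := fun w => ENNReal.div_le_of_le_mul (by rw [one_mul]; exact hVC _)
  have hgV : ∀ w, V (G w) = ENNReal.ofReal C * g w := fun w =>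
    (ENNReal.mul_div_cancel hC0 hCtop).symm
  have key := h _ ha g hgm hg1
  have e1 : ∫⁻ ω in A, V ((1 + ε) * M.gbm B t p u ω) ∂M.prob =
      (∫⁻ w, ENNReal.ofReal C * g (w + Real.log (1 + ε) / M.σ) ∂gaussianReal 0 (u - t)) *
        M.prob A := by
    rw [← hB.setLIntegral_increment htu.le hu (by fun_prop) hA]
    refine lintegral_congr fun ω => ?_
    rw [← hgV, hshift]
    rfl
  have e2 : ∫⁻ ω in A, V (M.gbm B t p u ω) ∂M.prob =
      (∫⁻ w, ENNReal.ofReal C * g w ∂gaussianReal 0 (u - t)) * M.prob A := by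
    rw [← hB.setLIntegral_increment htu.le hu (by fun_prop) hA]
    refine lintegral_congr fun ω => ?_
    rw [← hgV]
    rfl
  rw [e1, e2, lintegral_const_mul _ (by fun_prop), lintegral_const_mul _ hgm]
  calc _ ≤ ENNReal.ofReal C * ((∫⁻ w, g w ∂gaussianReal 0 (u - t)) + ENNReal.ofReal η) *
        M.prob A := by gcongr
    _ = ENNReal.ofReal C * (∫⁻ w, g w ∂gaussianReal 0 (u - t)) * M.prob A +
        ENNReal.ofReal C * ENNReal.ofReal η * M.prob A := by ring
    _ ≤ ENNReal.ofReal C * (∫⁻ w, g w ∂gaussianReal 0 (u - t)) * M.prob A +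
        ENNReal.ofReal C * ENNReal.ofReal η * 1 := by gcongr; exact prob_le_one
    _ = _ := by rw [mul_one, ← ENNReal.ofReal_mul hC.le]

/-- The process controlled by a policy. -/
def policyState (M : Market Ω) (B : ℝ≥0 → Ω → ℝ) (u d : ℝ≥0) (n N : ℕ)
    (π : ℕ → ℝ × ℝ × ℝ × ℝ → Fin (2 * N ^ 2 + 1 + 1)) (s₀ : Ω → ℝ × ℝ × ℝ × ℝ) :
    ℕ → Ω → ℝ × ℝ × ℝ × ℝ
  | 0, ω => s₀ ω
  | j + 1, ω => M.evolve N d (π (n - (j + 1)) (policyState M B u d n N π s₀ j ω))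
      (policyState M B u d n N π s₀ j ω) (B (gridTime u d (j + 1)) ω - B (gridTime u d j) ω)

theorem ContVersion.controlled_policyState {B : ℝ≥0 → Ω → ℝ} (hB : ContVersion M B)
    (hf : M.BorelImpact) {u d : ℝ≥0} {n N : ℕ}
    {π : ℕ → ℝ × ℝ × ℝ × ℝ → Fin (2 * N ^ 2 + 1 + 1)} (hπ : ∀ k, Measurable (π k))
    {s₀ : Ω → ℝ × ℝ × ℝ × ℝ} (hs₀ : Measurable[M.F u] s₀) (hn : gridTime u d n ≤ M.T) :
    Controlled M.prob (gaussianReal 0 d) (M.evolve N d) n (fun j => M.F (gridTime u d j))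
      (fun j ω => B (gridTime u d (j + 1)) ω - B (gridTime u d j) ω)
      (fun j ω => π (n - (j + 1)) (M.policyState B u d n N π s₀ j ω))
      (M.policyState B u d n N π s₀) := by
  have hnoise : ∀ j, Measurable[M.F (gridTime u d (j + 1))]
      fun ω => B (gridTime u d (j + 1)) ω - B (gridTime u d j) ω := fun j =>
    (hB.adapted _).sub ((hB.adapted _).mono (M.F.mono (gridTime_mono u d j.le_succ)) le_rfl)
  have hmeas : ∀ j, Measurable[M.F (gridTime u d j)] (M.policyState B u d n N π s₀ j) := by
    intro j
    induction j with
    | zero => rw [gridTime_zero]; exact hs₀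
    | succ j ih =>
      have h1 : Measurable[M.F (gridTime u d (j + 1))] (M.policyState B u d n N π s₀ j) :=
        ih.mono (M.F.mono (gridTime_mono u d j.le_succ)) le_rfl
      have h2 : Measurable fun z : Fin (2 * N ^ 2 + 1 + 1) × ((ℝ × ℝ × ℝ × ℝ) × ℝ) =>
          M.evolve N d z.1 z.2.1 z.2.2 :=
        measurable_from_prod_countable_right fun a => measurable_evolve hf N d a
      exact h2.comp (((hπ _).comp h1).prodMk (h1.prodMk (hnoise j)))
  exact {
    le := fun j => M.F.le _
    mono := fun i j hij => M.F.mono (gridTime_mono u d hij)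
    action := fun j _ => (hπ _).comp (hmeas j)
    init := hmeas 0
    noise := fun j _ => hnoise j
    indep := fun j hj E hE A hA => by
      rw [hB.indep _ _ (gridTime_mono u d j.le_succ) ((gridTime_mono u d hj).trans hn) E hE A hA]
      congr 3
      rw [gridTime_succ, add_tsub_cancel_left]
    next := fun j ω => rfl }

end Market

end Liquidation

/-! ### Integral estimates, the watch and the meshes. -/

namespace Liquidation

open Filter Topology

theorem setLIntegral_le_add_measure {Ω : Type*} [MeasurableSpace Ω] {μ : Measure Ω}
    {f g : Ω → ℝ≥0∞} {c : ℝ≥0∞} {A E : Set Ω} (hA : MeasurableSet A) (hE : MeasurableSet E)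
    (hf : ∀ ω, f ω ≤ c) (h : ∀ᵐ ω ∂μ, ω ∈ A → ω ∉ E → f ω ≤ g ω) :
    ∫⁻ ω in A, f ω ∂μ ≤ (∫⁻ ω in A, g ω ∂μ) + c * μ E := by
  calc ∫⁻ ω in A, f ω ∂μ ≤ ∫⁻ ω in (A \ E) ∪ E, f ω ∂μ :=
        lintegral_mono_set (by rw [sdiff_union_self]; exact subset_union_left)
    _ ≤ (∫⁻ ω in A \ E, f ω ∂μ) + ∫⁻ ω in E, f ω ∂μ := lintegral_union_le _ _ _
    _ ≤ (∫⁻ ω in A, g ω ∂μ) + c * μ E := by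
      refine add_le_add ?_ ?_
      · refine le_trans ?_ (lintegral_mono_set (sdiff_subset : A \ E ⊆ A))
        refine lintegral_mono_ae ?_
        rw [ae_restrict_iff' (hA.diff hE)]
        filter_upwards [h] with ω hω hm
        exact hω hm.1 hm.2
      · rw [← setLIntegral_const]
        exact lintegral_mono hf

/-- Fatou's lemma, with an error term. -/
theorem eventually_setLIntegral_le {Ω : Type*} [MeasurableSpace Ω] {μ : Measure Ω}
    [IsFiniteMeasure μ] {f : Ω → ℝ≥0∞} {g : ℕ → Ω → ℝ≥0∞} {c η : ℝ≥0∞} {A : Set Ω}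
    (hA : MeasurableSet A) (hc : c ≠ ∞) (hf : ∀ ω, f ω ≤ c) (hg : ∀ n, AEMeasurable (g n) μ)
    (h : ∀ᵐ ω ∂μ, ω ∈ A → ∀ᶠ n in atTop, f ω ≤ g n ω) (hη : 0 < η) :
    ∀ᶠ n in atTop, ∫⁻ ω in A, f ω ∂μ ≤ (∫⁻ ω in A, g n ω ∂μ) + η := by
  have h1 : ∫⁻ ω in A, f ω ∂μ ≤ liminf (fun n => ∫⁻ ω in A, g n ω ∂μ) atTop := by
    refine le_trans ?_ (lintegral_liminf_le' fun n => (hg n).restrict)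
    refine lintegral_mono_ae ?_
    rw [ae_restrict_iff' hA]
    filter_upwards [h] with ω hω hm
    exact le_liminf_of_le (by isBoundedDefault) (hω hm)
  have h2 : ∫⁻ ω in A, f ω ∂μ ≠ ∞ := by
    refine ne_top_of_le_ne_top ?_ (lintegral_mono hf)
    rw [setLIntegral_const]
    exact ENNReal.mul_ne_top hc (measure_ne_top _ _)
  rcases eq_or_ne (∫⁻ ω in A, f ω ∂μ) 0 with h0 | h0
  · exact Eventually.of_forall fun n => by rw [h0]; exact zero_le
  · have h3 := (ENNReal.sub_lt_self h2 h0 hη.ne').trans_le h1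
    filter_upwards [eventually_lt_of_lt_liminf h3] with n hn
    exact tsub_le_iff_right.1 hn.le

/-- A continuous function cannot decrease much between close times. -/
theorem eventually_no_drop {f : ℝ≥0 → ℝ} (hf : Continuous f) (H : ℝ≥0) {a b : ℝ} (hab : a < b)
    {d : ℕ → ℝ≥0} (hd : Tendsto d atTop (𝓝 0)) :
    ∀ᶠ N in atTop, ∀ r s : ℝ≥0, r ≤ s → s < r + d N → s ≤ H → b ≤ f r → a < f s := by
  have hu := (isCompact_Icc (a := (0 : ℝ≥0)) (b := H)).uniformContinuousOn_of_continuous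
    hf.continuousOn
  obtain ⟨δ, hδ, h⟩ := Metric.uniformContinuousOn_iff.1 hu (b - a) (sub_pos.2 hab)
  have hd' : ∀ᶠ N in atTop, ((d N : ℝ≥0) : ℝ) < δ := by
    have := (NNReal.tendsto_coe.2 hd).eventually_lt_const (show ((0 : ℝ≥0) : ℝ) < δ by simpa using hδ)
    exact this
  filter_upwards [hd'] with N hN r s hrs hsd hsH hb
  have h1 : (r : ℝ) ≤ s := by exact_mod_cast hrs
  have h2 : (s : ℝ) < r + d N := by exact_mod_cast hsd
  have h3 := h s ⟨zero_le, hsH⟩ r ⟨zero_le, hrs.trans hsH⟩ (by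
    rw [NNReal.dist_eq, abs_of_nonneg (by linarith)]
    linarith)
  rw [Real.dist_eq] at h3
  linarith [(abs_lt.1 h3).1]

namespace Market

variable {Ω : Type*} [MeasurableSpace Ω] {M : Market Ω} {B : ℝ≥0 → Ω → ℝ} {t : ℝ≥0} {q : State}

/-- A stopping time up to which the liquidation value without trades stays positive. -/
theorem ContVersion.exists_watch (hB : ContVersion M B) (hc : M.Hcf) (hq : q ∈ M.domain) {δ : ℝ}
    (hδ : δ < M.liq q) {H : ℝ≥0} (htH : t < H) :
    ∃ κ : Ω → ℝ≥0, IsStoppingTime M.F (fun ω => (κ ω : WithTop ℝ≥0)) ∧ ∀ ω, t < κ ω ∧ κ ω ≤ H ∧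
      (∀ r, t ≤ r → r ≤ κ ω → δ ≤ M.liqPath B t q r ω) ∧
      (κ ω < H → M.liqPath B t q (κ ω) ω ≤ δ) := by
  have hcont := fun ω => hB.continuous_liqPath (t := t) hc hq.1 ω
  obtain ⟨κ, h1, h2⟩ := exists_hitting (M := M) (X := M.liqPath B t q) hcont
    (fun s hs => hB.measurable_liqPath hs le_rfl) htH.le δ
  have hlt : ∀ ω, t < κ ω := fun ω => by
    refine lt_of_le_of_ne (h2 ω).1 fun he => ?_
    have h3 := (h2 ω).2.2.2 (by rwa [← he])
    rw [← he, liqPath_start hq] at h3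
    linarith
  refine ⟨κ, h1, fun ω => ⟨hlt ω, (h2 ω).2.1, fun r htr hr => ?_, (h2 ω).2.2.2⟩⟩
  have hcl : IsClosed {r : ℝ≥0 | δ ≤ M.liqPath B t q r ω} := isClosed_le continuous_const (hcont ω)
  have hsub : Ico t (κ ω) ⊆ {r : ℝ≥0 | δ ≤ M.liqPath B t q r ω} := fun r hr =>
    ((h2 ω).2.2.1 r hr.1 hr.2).le
  have := closure_minimal hsub hcl
  rw [closure_Ico (hlt ω).ne] at this
  exact this ⟨htr, hr⟩

theorem watch_lt {κ : Ω → ℝ≥0} (hκ : IsStoppingTime M.F (fun ω => (κ ω : WithTop ℝ≥0))) (u : ℝ≥0) :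
    MeasurableSet {ω | κ ω < u} := by
  have := M.F.le u _ (hκ.measurableSet_lt u)
  convert! this using 1
  ext ω
  exact (WithTop.coe_lt_coe (a := u) (b := κ ω)).symm

theorem reward_mono (hU : M.HU) (C : ℝ) {s : ℝ × ℝ × ℝ × ℝ} {x : ℝ} (h : x ≤ s.1) :
    ENNReal.ofReal (min (M.U (max 0 x)) C) ≤ M.reward C s :=
  ENNReal.ofReal_le_ofReal (min_le_min (hU.mono (mem_Ici.2 (le_max_left _ _))
    (mem_Ici.2 (le_max_left _ _)) (max_le_max le_rfl h)) le_rfl)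

variable {S : M.Schedule t q}

theorem Schedule.cashAt_of_no_trade {ω : Ω} (h : ∀ k, S.ρ k ω = ⊤) (k : ℕ) :
    S.cashAt k ω = q.cash := by
  classical
  rw [Schedule.cashAt, Finset.sum_eq_zero fun i _ => if_neg (not_not.2 (h i)), sub_zero]

/-- A choice of meshes dividing an interval. -/
theorem exists_mesh {u b c r : ℝ≥0} (hub : u < b) (hur : u ≤ r) (hrc : r < c) :
    ∃ (d : ℕ → ℝ≥0) (n : ℕ → ℕ), (∀ N, 0 < d N) ∧ Tendsto d atTop (𝓝 0) ∧
      (∀ N j, gridTime u (d N) j < b → gridTime u (d N) (j + 1) ≤ b) ∧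
      ∀ N, gridTime u (d N) (n N) < c ∧ ∀ s : ℝ≥0, s ≤ r → ⌈((s : ℝ) - u) / d N⌉₊ < n N := by
  have hub' : (u : ℝ) < b := by exact_mod_cast hub
  have hrc' : (r : ℝ) < c := by exact_mod_cast hrc
  have hur' : (u : ℝ) ≤ r := by exact_mod_cast hur
  have hbu : (0 : ℝ) < b - u := by linarith
  -- The mesh `(b - u) / (N + m)` makes `b` the grid point number `N + m`; `m` is so large that two
  -- mesh steps fit between `r` and `c`.
  obtain ⟨m, hm⟩ := exists_nat_gt (2 * ((b : ℝ) - u) / (c - r))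
  have hm0 : (0 : ℝ) < m := lt_trans (by have : (0 : ℝ) < c - r := by linarith
                                         positivity) hm
  rw [div_lt_iff₀ (by linarith)] at hm
  set d : ℕ → ℝ≥0 := fun N => (b - u) / ((N + m : ℕ) : ℝ≥0) with hd
  have hdc : ∀ N, (d N : ℝ) = ((b : ℝ) - u) / (N + m) := fun N => by
    rw [hd]
    push_cast
    rw [NNReal.coe_sub hub.le]
  have hpos : ∀ N : ℕ, (0 : ℝ) < N + m := fun N => by positivity
  have hdp : ∀ N, (0 : ℝ) < d N := fun N => by rw [hdc]; exact div_pos hbu (hpos N)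
  have hgc : ∀ N j, (gridTime u (d N) j : ℝ) = u + j * d N := fun N j => by
    rw [gridTime]; push_cast; rfl
  refine ⟨d, fun N => ⌈((r : ℝ) - u) / d N⌉₊ + 1, fun N => by exact_mod_cast hdp N, ?_,
    fun N j hj => ?_, fun N => ⟨?_, fun s hs => ?_⟩⟩
  · rw [← NNReal.tendsto_coe]
    have h1 : Tendsto (fun N : ℕ => (N : ℝ) + m) atTop atTop :=
      tendsto_atTop_add_const_right _ _ tendsto_natCast_atTop_atTop
    have h2 : Tendsto (fun N : ℕ => ((b : ℝ) - u) / ((N : ℝ) + m)) atTop (𝓝 0) :=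
      tendsto_const_nhds.div_atTop h1
    refine h2.congr fun N => (hdc N).symm
  · have hj' : (gridTime u (d N) j : ℝ) < b := by exact_mod_cast hj
    have : (gridTime u (d N) (j + 1) : ℝ) ≤ b := by
      rw [hgc] at hj' ⊢
      rw [hdc] at hj' ⊢
      have h1 : (j : ℝ) * (((b : ℝ) - u) / (N + m)) < b - u := by linarith
      rw [mul_div_assoc', div_lt_iff₀ (hpos N), mul_comm, mul_lt_mul_iff_right₀ hbu] at h1
      have h2 : j < N + m := by exact_mod_cast h1
      have h3 : ((j + 1 : ℕ) : ℝ) ≤ N + m := by exact_mod_cast h2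
      have h4 : ((j + 1 : ℕ) : ℝ) * (((b : ℝ) - u) / (N + m)) ≤ b - u := by
        rw [mul_div_assoc', div_le_iff₀ (hpos N), mul_comm]
        exact mul_le_mul_of_nonneg_left h3 hbu.le
      linarith
    exact_mod_cast this
  · have h1 := Nat.ceil_lt_add_one (div_nonneg (sub_nonneg.2 hur') (hdp N).le)
    have h2 : (gridTime u (d N) (⌈((r : ℝ) - u) / d N⌉₊ + 1) : ℝ) < c := by
      rw [hgc]
      push_cast
      have h3 : ((⌈((r : ℝ) - u) / d N⌉₊ : ℝ) + 1) * d N < (((r : ℝ) - u) / d N + 1 + 1) * d N :=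
        mul_lt_mul_of_pos_right (by linarith) (hdp N)
      have h4 : (((r : ℝ) - u) / d N + 1 + 1) * d N = r - u + 2 * d N := by
        field_simp [(hdp N).ne']
        ring
      have h5 : 2 * (d N : ℝ) ≤ c - r := by
        rw [hdc, mul_div_assoc', div_le_iff₀ (hpos N)]
        have : (0 : ℝ) ≤ (c - r) * N := mul_nonneg (by linarith) N.cast_nonneg
        nlinarith
      linarith
    exact_mod_cast h2
  · refine Nat.lt_succ_of_le (Nat.ceil_mono ?_)
    have : (s : ℝ) ≤ r := by exact_mod_cast hs
    gcongr

end Market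

end Liquidation

/-! ### A debt, without trade at the initial time. -/

namespace Liquidation

open Filter Topology

namespace Market

variable {Ω : Type*} [MeasurableSpace Ω] {M : Market Ω} {B : ℝ≥0 → Ω → ℝ} {t : ℝ≥0} {q : State}
  {S : M.Schedule t q}

/-- On an event where no trade takes place at the initial time, a valid schedule started with a
debt is dominated by a positive one, up to scaling and truncation. -/
theorem Schedule.Valid.exists_positive_of_no_initial_trade [IsProbabilityMeasure M.prob]
    (h : S.Valid) (hB : ContVersion M B) (hσ : 0 < M.σ) (hf : M.BorelImpact) (h1 : M.H1f)
    (hc : M.Hcf) (hU : M.HU) (hq : q ∈ M.domain) (hL : 0 < M.liq q) (hx : q.cash < 0)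
    (hlag0 : 0 < q.lag) (hlagT : q.lag < M.T) (htT : t < M.T) {r : ℝ≥0} (hrT : r < M.T)
    (hr : ∀ k ω, S.ρ k ω ≠ ⊤ → S.ρ k ω ≤ (r : WithTop ℝ≥0)) {A : Set Ω}
    (hA : MeasurableSet[M.F t] A) (hlate : ∀ ω ∈ A, ∀ k, ¬ S.ρ k ω ≤ (t : WithTop ℝ≥0))
    {l C η : ℝ} (hl0 : 0 < l) (hl1 : l < 1) (hC : 0 < C) (hη : 0 < η) :
    ∃ R : M.Schedule t q, R.Positive ∧
      ∫⁻ ω in A, ENNReal.ofReal (min (M.U (max 0 (l ^ (2 * S.n + 2) * S.cashAt S.n ω))) C) ∂M.prob ≤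
        (∫⁻ ω in A, ENNReal.ofReal (M.U (max 0 (R.cashAt R.n ω))) ∂M.prob) +
          5 * ENNReal.ofReal (C * η) := by
  have hA' : MeasurableSet A := M.F.le t _ hA
  have hη' : 0 < ENNReal.ofReal η := ENNReal.ofReal_pos.2 hη
  have hCη : ENNReal.ofReal C * ENNReal.ofReal η = ENNReal.ofReal (C * η) :=
    (ENNReal.ofReal_mul hC.le).symm
  have hCη' : 0 < ENNReal.ofReal (C * η) := ENNReal.ofReal_pos.2 (mul_pos hC hη)
  -- The level `δ / 2` of the watch `κ` will depend on `u`, through `ε`. The time `κ₀`, of fixed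
  -- level, comes before `κ` whenever `κ < H`, and allows `u` to be chosen beforehand so that `κ <
  -- u` is unlikely.
  obtain ⟨κ₀, hκ₀, hκ₀'⟩ := hB.exists_watch hc hq (half_lt_self hL) htT
  -- the last time at which the lag is admissible
  obtain ⟨lag, hlag⟩ : ∃ lag : ℝ≥0, (lag : ℝ) = q.lag := ⟨⟨q.lag, hlag0.le⟩, rfl⟩
  have hlagT' : lag < M.T := by exact_mod_cast hlag.trans_lt hlagT
  set b : ℝ≥0 := t + (M.T - lag) with hb
  have htb : t < b := lt_add_of_pos_right _ (tsub_pos_of_lt hlagT')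
  have hbr : (b : ℝ) = t + (M.T - q.lag) := by
    rw [hb, NNReal.coe_add, NNReal.coe_sub hlagT'.le, hlag]
  -- the starting time of the grid
  set E : ℝ≥0 → Set Ω := fun u => {ω | κ₀ ω < u} ∪
    (A ∩ ⋃ k ∈ Finset.range S.n, {ω | S.ρ k ω ≤ (u : WithTop ℝ≥0)}) with hE
  have hEm : ∀ u, MeasurableSet (E u) := fun u => (watch_lt hκ₀ u).union
    (hA'.inter (Finset.measurableSet_biUnion _ fun k _ => M.F.le u _ (S.stopping k u)))
  obtain ⟨u, htu, hub, hEu⟩ := exists_time_measure_le (μ := M.prob) hEm (lt_min htb htT)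
    (Eventually.of_forall fun ω => by
      have e1 : ∀ᶠ u in 𝓝[>] t, u < κ₀ ω :=
        (eventually_lt_nhds (hκ₀' ω).1).filter_mono nhdsWithin_le_nhds
      have e2 : ∀ᶠ u : ℝ≥0 in 𝓝[>] t, ∀ k ∈ Finset.range S.n, ω ∈ A →
          ¬ S.ρ k ω ≤ (u : WithTop ℝ≥0) := by
        refine (Finset.eventually_all _).2 fun k _ => ?_
        by_cases hω : ω ∈ A
        · have h3 := hlate ω hω k
          by_cases hk : S.ρ k ω = ⊤
          · exact Eventually.of_forall fun u _ => by
              rw [hk]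
              exact WithTop.not_top_le_coe u
          · rw [← Strategy.coe_clock hk] at h3 ⊢
            have h4 : t < clock (S.ρ k ω) := not_le.1 fun h' => h3 (WithTop.coe_le_coe.2 h')
            filter_upwards [(eventually_lt_nhds h4).filter_mono nhdsWithin_le_nhds] with u hu _ h5
            exact absurd (WithTop.coe_le_coe.1 h5) (not_le.2 hu)
        · exact Eventually.of_forall fun u h' => absurd h' hω
      filter_upwards [e1, e2] with u h1 h2
      rintro (h' | ⟨h', h''⟩)
      · exact absurd h' (not_lt.2 h1.le)
      · obtain ⟨k, hk, hk'⟩ := mem_iUnion₂.1 h''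
        exact h2 k hk h' hk') hη'
  have hub' : u < b := hub.trans_le (min_le_left _ _)
  have huT : u < M.T := hub.trans_le (min_le_right _ _)
  -- the perturbation of the price
  obtain ⟨ε₀, hε₀, hshift⟩ := hB.exists_price_shift hσ htu huT.le hη q.price
  obtain ⟨ε, hε, hεlt⟩ := exists_between (lt_min hε₀ (show 0 < 1 / l - 1 by
    rw [sub_pos, lt_div_iff₀ hl0]; linarith))
  have hεl : (1 + ε) * l < 1 := by
    have := hεlt.trans_le (min_le_right _ _)
    rw [lt_sub_iff_add_lt, lt_div_iff₀ hl0] at this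
    linarith
  -- The first bound is what the higher price can pay for; the second puts the level `δ / 2` below
  -- the level `L / 2` of `κ₀`.
  set δ : ℝ := min (ε * (-q.cash) / 2) (M.liq q / 4) with hδ
  have hεx : 0 < ε * (-q.cash) := mul_pos hε (by linarith)
  have hδ0 : 0 < δ := lt_min (by linarith) (by linarith)
  have hδ1 : δ < ε * (-q.cash) := (min_le_left _ _).trans_lt (by linarith)
  have hδ2 : δ ≤ M.liq q / 4 := min_le_right _ _
  -- the grid
  obtain ⟨c, hrc, hcT⟩ := exists_between (max_lt hrT huT)
  obtain ⟨d, n, hd, hd0, hgrid, hn⟩ := exists_mesh hub' (le_max_right r u) hrc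
  set H : ℝ≥0 := min b c with hH
  have huH : u < H := lt_min hub' ((le_max_right r u).trans_lt hrc)
  have hHr : q.lag + ((H : ℝ) - t) ≤ M.T := by
    have : (H : ℝ) ≤ b := by exact_mod_cast min_le_left b c
    linarith
  obtain ⟨κ, hκ, hκ'⟩ := hB.exists_watch (δ := δ / 2) hc hq (by linarith) (htu.trans huH)
  have hκκ₀ : ∀ ω, κ ω < H → κ₀ ω ≤ κ ω := fun ω hω => by
    by_contra! hlt
    have e1 := (hκ' ω).2.2.2 hω
    have e2 := (hκ₀' ω).2.2.1 (κ ω) (hκ' ω).1.le hlt.le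
    linarith
  -- the policies
  have hev := fun N : ℕ => measurable_evolve (M := M) hf N (d N)
  choose π hπ hπ' using fun N => exists_policy (γ := gaussianReal 0 (d N)) (hev N)
    (measurable_reward hU C)
  set s₀ : Ω → ℝ × ℝ × ℝ × ℝ := fun ω =>
    (q.cash - δ, q.shares, M.gbm B t q.price u ω, q.lag + (u - t)) with hs₀
  have hs₀m : Measurable[M.F u] s₀ := measurable_const.prodMk (measurable_const.prodMk
    ((hB.measurable_gbm htu.le le_rfl q.price).prodMk measurable_const))
  set s : ∀ N : ℕ, ℕ → Ω → ℝ × ℝ × ℝ × ℝ := fun N => M.policyState B u (d N) (n N) N (π N) s₀ with hs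
  set a : ∀ N : ℕ, ℕ → Ω → Fin (2 * N ^ 2 + 1 + 1) := fun N j ω =>
    π N (n N - (j + 1)) (s N j ω) with ha
  have hctrl := fun N => hB.controlled_policyState hf (hπ N) hs₀m ((hn N).1.trans hcT).le
  have hfol : ∀ N, Follow M B t q u (d N) (n N) N δ H κ (a N) (s N) := fun N => {
    cont := hB
    borel := hf
    dom := hq
    lag_pos := hlag0
    start := htu.le
    mesh := hd N
    horizon := (hn N).1.trans hcT
    slack := hδ0
    cap := (min_le_right _ _).trans_lt hcT
    cap_lag := hHr
    watch := hκ
    watch_ge := fun ω => (hκ' ω).1.le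
    watch_le := fun ω => (hκ' ω).2.1
    watch_pos := fun ω r h1 h2 => lt_of_lt_of_le (by linarith) ((hκ' ω).2.2.1 r h1 h2)
    ctrl := hctrl N
    init := fun ω => rfl }
  choose R hR hRw using fun N => (hfol N).exists_positive h1 hU
  -- the exceptional events
  set bad : ℕ → Set Ω := fun N => Follow.idle M u (d N) (n N) κ (a N) (s N) ∩
    {ω | 0 ≤ (s N (n N) ω).1} with hbad
  have hbadm : ∀ N, MeasurableSet (bad N) := fun N => by
    refine MeasurableSet.inter (hκ.measurableSpace_le _ (hfol N).measurableSet_idle) ?_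
    have := ((hctrl N).measurable_state (hev N) le_rfl).mono (M.F.le _) le_rfl
    exact measurableSet_le measurable_const this.fst
  -- Outside `E u`, `Follow.idle_nonneg` makes the liquidation value fall from `δ` to `δ / 2` within
  -- one mesh, which a continuous path does not do once the mesh is small.
  have hbad0 : Tendsto (fun N => M.prob (bad N \ E u)) atTop (𝓝 0) := by
    refine tendsto_measure_zero (fun N => (hbadm N).diff (hEm u)) (Eventually.of_forall fun ω => ?_)
    filter_upwards [eventually_no_drop (hB.continuous_liqPath (t := t) hc hq.1 ω) H
      (half_lt_self hδ0) hd0] with N hN hω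
    obtain ⟨e1, e2⟩ := (hfol N).idle_nonneg hx huH.le (fun j hj hj' => le_min (by
      have : (gridTime u (d N) j : ℝ) ≤ b := by linarith
      exact_mod_cast this) ((gridTime_mono u (d N) hj.le).trans (hn N).1.le)) hω.1.1 hω.1.2
    rcases e2 with e2 | ⟨i, e2, e3, e4⟩
    · exact hω.2 (Or.inl ((hκκ₀ ω e1).trans_lt e2))
    · rw [gridTime_succ] at e3
      exact absurd ((hκ' ω).2.2.2 e1) (not_le.2 (hN _ _ e2 e3 e1.le e4))
  -- the comparison with the shadow of the schedule
  have hshadow : ∀ᶠ N in atTop, ∫⁻ ω in A \ E u,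
      ENNReal.ofReal (min (M.U (max 0 (l ^ (2 * S.n + 2) * S.cashAt S.n ω))) C) ∂M.prob ≤
      (∫⁻ ω in A \ E u, M.reward C (S.shadow B l ε δ u (d N) N (n N) ω) ∂M.prob) +
        ENNReal.ofReal (C * η) := by
    refine eventually_setLIntegral_le (hA'.diff (hEm u)) (c := ENNReal.ofReal C)
      ENNReal.ofReal_ne_top (fun ω => ENNReal.ofReal_le_ofReal (min_le_right _ _)) (fun N => ?_)
      ?_ hCη'
    · refine Measurable.aemeasurable ?_
      exact (measurable_reward hU C).comp (((Schedule.controlled_shadow hB htu.le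
        ((hn N).1.trans hcT).le).measurable_state (hev N) le_rfl).mono (M.F.le _) le_rfl)
    · filter_upwards [h.trade, h.pre, h.lag_mem hq, hB.gbm_ae_eq htT.le q.price] with ω w1 w2 w3 w4 hω
      have hlate' : ∀ k, S.ρ k ω ≠ ⊤ → u < clock (S.ρ k ω) := fun k hk => by
        by_contra! hle
        refine hω.2 (Or.inr ⟨hω.1, mem_iUnion₂.2 ⟨k, Finset.mem_range.2 ?_, ?_⟩⟩)
        · by_contra! hk'
          exact hk (S.bounded k ω hk')
        · change S.ρ k ω ≤ _
          rw [← Strategy.coe_clock hk]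
          exact WithTop.coe_le_coe.2 hle
      by_cases hex : ∃ k, S.ρ k ω ≠ ⊤
      · have := S.eventually_shadow hB h1 hc hq hx hl0 hl1 hε hεl hδ1 hd hd0 (fun N j hj => ?_)
          w4 w1 w2 w3 (fun k hk => h.lt_horizon k ω hk) htu.le hlate' hex
          (n := n) (fun N k hk => (hn N).2 _ (le_trans ?_ (le_max_left r u)))
        · filter_upwards [this] with N hN
          exact reward_mono hU C hN
        · have e1 : gridTime u (d N) j < b := by
            have : (gridTime u (d N) j : ℝ) < b := by linarith
            exact_mod_cast this
          have e2 : (gridTime u (d N) (j + 1) : ℝ) ≤ b := by exact_mod_cast hgrid N j e1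
          linarith
        · have := hr k ω hk
          rw [← Strategy.coe_clock hk] at this
          exact WithTop.coe_le_coe.1 this
      -- Without any trade the debt remains, and the utility on the left is `U 0 = 0`.
      · push Not at hex
        refine Eventually.of_forall fun N => ?_
        rw [Schedule.cashAt_of_no_trade hex, max_eq_left, hU.zero,
          ENNReal.ofReal_eq_zero.2 (min_le_left _ _)]
        · exact zero_le
        · exact mul_nonpos_of_nonneg_of_nonpos (pow_nonneg hl0.le _) hx.le
  -- The chain is: schedule, shadow, `V` at the shifted price, `V` at the true price, optimal
  -- policy, `R N`. The errors, in units of `C η`, are one for `E u`, one for the shadow, one for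
  -- the shift and two for `bad N`.
  obtain ⟨N, hN1, hN2⟩ := (hshadow.and (hbad0.eventually_lt_const hη')).exists
  refine ⟨R N, hR N, ?_⟩
  have hA0 : MeasurableSet[M.F (gridTime u (d N) 0)] A := by
    rw [gridTime_zero]
    exact M.F.mono htu.le _ hA
  set V : ℝ → ℝ≥0∞ := fun P => bellman (gaussianReal 0 (d N)) (M.evolve N (d N)) (M.reward C) (n N)
    (q.cash - δ, q.shares, P, q.lag + (u - t)) with hV
  have hVm : Measurable V := (measurable_bellman (hev N) (measurable_reward hU C) (n N)).comp
    (by fun_prop)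
  have c1 : ∫⁻ ω in A, ENNReal.ofReal (min (M.U (max 0 (l ^ (2 * S.n + 2) * S.cashAt S.n ω))) C)
      ∂M.prob ≤ (∫⁻ ω in A \ E u, ENNReal.ofReal
        (min (M.U (max 0 (l ^ (2 * S.n + 2) * S.cashAt S.n ω))) C) ∂M.prob) +
          ENNReal.ofReal (C * η) := by
    refine (lintegral_mono_set (t := (A \ E u) ∪ E u)
      (by rw [sdiff_union_self]; exact subset_union_left)).trans
      ((lintegral_union_le _ _ _).trans (add_le_add le_rfl ?_))
    refine (lintegral_mono fun ω => ENNReal.ofReal_le_ofReal (min_le_right _ _)).trans ?_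
    rw [setLIntegral_const, ← hCη]
    gcongr
  have c2 : ∫⁻ ω in A, M.reward C (S.shadow B l ε δ u (d N) N (n N) ω) ∂M.prob ≤
      ∫⁻ ω in A, V ((1 + ε) * M.gbm B t q.price u ω) ∂M.prob :=
    (Schedule.controlled_shadow hB htu.le ((hn N).1.trans hcT).le).setLIntegral_le (hev N)
      (measurable_reward hU C) hA0
  have c3 := hshift ε hε (hεlt.trans_le (min_le_left _ _)) C hC V hVm
    (fun P => bellman_le (fun s => reward_le C s) _ _) A hA
  have c4 : ∫⁻ ω in A, M.reward C (s N (n N) ω) ∂M.prob =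
      ∫⁻ ω in A, V (M.gbm B t q.price u ω) ∂M.prob :=
    (hctrl N).setLIntegral_eq (hev N) (measurable_reward hU C) (hπ' N) (fun j _ ω => rfl) hA0
  have c5 : ∫⁻ ω in A, M.reward C (s N (n N) ω) ∂M.prob ≤
      (∫⁻ ω in A, ENNReal.ofReal (M.U (max 0 ((R N).cashAt (R N).n ω))) ∂M.prob) +
        ENNReal.ofReal C * M.prob (bad N) := by
    refine setLIntegral_le_add_measure hA' (hbadm N) (fun ω => reward_le C _) ?_
    filter_upwards [hRw N C] with ω w1 _ w2
    by_cases hω : ω ∈ Follow.idle M u (d N) (n N) κ (a N) (s N)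
    · rw [reward_eq_zero hU (not_le.1 fun h' => w2 ⟨hω, h'⟩)]
      exact zero_le
    · exact w1 hω
  have c6 : M.prob (bad N) ≤ ENNReal.ofReal η + ENNReal.ofReal η :=
    (measure_le_inter_add_sdiff _ _ (E u)).trans
      (add_le_add ((measure_mono inter_subset_right).trans hEu) hN2.le)
  have c7 : ∫⁻ ω in A \ E u, M.reward C (S.shadow B l ε δ u (d N) N (n N) ω) ∂M.prob ≤
      ∫⁻ ω in A, M.reward C (S.shadow B l ε δ u (d N) N (n N) ω) ∂M.prob :=
    lintegral_mono_set sdiff_subset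
  set e := ENNReal.ofReal (C * η) with he
  set X := ∫⁻ ω in A, ENNReal.ofReal (M.U (max 0 ((R N).cashAt (R N).n ω))) ∂M.prob
  have c8 : ENNReal.ofReal C * M.prob (bad N) ≤ e + e := by
    refine (mul_le_mul_right c6 _).trans_eq ?_
    rw [mul_add, hCη]
  calc _ ≤ _ := c1
    _ ≤ (X + (e + e) + e) + e + e := by
      refine add_le_add (hN1.trans (add_le_add (c7.trans (c2.trans (c3.trans
        (add_le_add ?_ le_rfl)))) le_rfl)) le_rfl
      rw [← c4]
      exact c5.trans (add_le_add le_rfl c8)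
    _ = _ := by ring

end Market

end Liquidation

/-! ### Postponing the initial trade. -/

namespace Liquidation

open Filter Topology

namespace Market

variable {Ω : Type*} [MeasurableSpace Ω] {M : Market Ω} {B : ℝ≥0 → Ω → ℝ} {t : ℝ≥0} {q : State}
  {S : M.Schedule t q}

theorem stopMeas_of_le {σ : Ω → WithTop ℝ≥0} (hσ : IsStoppingTime M.F σ) {r : ℝ≥0}
    (h : ∀ ω, (r : WithTop ℝ≥0) ≤ σ ω) {e : Ω → ℝ} (he : Measurable[M.F r] e) : StopMeas M σ e := by
  refine fun A hA => ⟨(le_iSup M.F r) _ (he hA), fun s => ?_⟩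
  rcases le_or_gt r s with hrs | hrs
  · exact (M.F.mono hrs _ (he hA)).inter (hσ s)
  · have : e ⁻¹' A ∩ {ω | σ ω ≤ (s : WithTop ℝ≥0)} = ∅ :=
      eq_empty_of_forall_notMem fun ω hω => not_le.2 hrs (WithTop.coe_le_coe.1 ((h ω).trans hω.2))
    rw [this]
    exact @MeasurableSet.empty _ (M.F s)

/-- A sale leaving positive cash is possible as the first trade. -/
theorem Schedule.mem_good_of_first_sale (h1 : M.H1f) {k : ℕ} {ω : Ω} {w : ℝ≥0} {e : ℝ}
    (hfirst : ∀ i < k, S.ρ i ω = ⊤) (hk : S.ρ k ω = w) (hξ : S.ξ k ω = -e) (he : 0 ≤ e)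
    (hey : e ≤ q.shares) (hlag : q.lag + ((w : ℝ) - t) ∈ Ioc (0 : ℝ) M.T)
    (hpos : 0 < q.cash + M.gbm B t q.price w ω * M.proceeds e (q.lag + (w - t))) :
    S.cashExt B (k + 1) ω = q.cash + M.gbm B t q.price w ω * M.proceeds e (q.lag + (w - t)) ∧
      S.sharesAt (k + 1) ω = q.shares - e ∧ ω ∈ S.good B k := by
  have hne : S.ρ k ω ≠ ⊤ := by rw [hk]; exact WithTop.coe_ne_top
  obtain ⟨e1, e2⟩ : S.lastTime ω k = t - q.lag ∧ S.sharesAt k ω = q.shares := by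
    rcases S.at_cases k ω with ⟨-, h1, -, h2⟩ | ⟨i, hi, hi', -⟩
    · exact ⟨h1, h2⟩
    · exact absurd (hfirst i hi) hi'
  have e3 : S.cashExt B k ω = q.cash := by
    rw [Schedule.cashExt, Finset.sum_eq_zero, sub_zero]
    intro i hi
    rw [if_neg (not_not.2 (hfirst i (Finset.mem_range.1 hi)))]
  have hc : clock (S.ρ k ω) = w := by rw [hk]; rfl
  have hl : (clock (S.ρ k ω) : ℝ) - S.lastTime ω k = q.lag + (w - t) := by rw [hc, e1]; ring
  have e4 : S.cashExt B (k + 1) ω =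
      q.cash + M.gbm B t q.price w ω * M.proceeds e (q.lag + (w - t)) := by
    rw [Schedule.cashExt_succ_of_ne hne, hl, hc, e3, hξ, proceeds]
    ring
  have e5 : S.sharesAt (k + 1) ω = q.shares - e := by
    rw [S.sharesAt_succ_of_ne hne, e2, hξ]
    ring
  refine ⟨e4, e5, ?_, ?_, ?_, ?_⟩
  · rwa [hl]
  · rw [hl, hξ, impactExt_of_mem ⟨hlag.1.le, hlag.2⟩]
    exact ne_top_of_le_ne_top ENNReal.one_ne_top
      (impact_le_one_of_nonpos h1 (by linarith) ⟨hlag.1.le, hlag.2⟩)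
  · rwa [e4]
  · rw [e5]; linarith

/-- The data needed to postpone the first trade of a schedule from `t` to the stopping time `σ`,
everything being sold at the stopping time `κ` when `σ` is infinite. -/
structure Delay (M : Market Ω) (B : ℝ≥0 → Ω → ℝ) (t : ℝ≥0) (q : State) (H : ℝ≥0) (κ : Ω → ℝ≥0)
    (σ : Ω → WithTop ℝ≥0) (e : Ω → ℝ) : Prop where
  dom : q ∈ M.domain
  lag_pos : 0 < q.lag
  cap : H < M.T
  cap_lag : q.lag + (H - t) ≤ M.T
  watch : IsStoppingTime M.F (fun ω => (κ ω : WithTop ℝ≥0))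
  watch_ge : ∀ ω, t ≤ κ ω
  watch_le : ∀ ω, κ ω ≤ H
  watch_pos : ∀ ω r, t ≤ r → r ≤ κ ω → 0 < M.liqPath B t q r ω
  first_stopping : IsStoppingTime M.F σ
  first_gt : ∀ ω, (t : WithTop ℝ≥0) < σ ω
  first_lt : ∀ ω, σ ω ≠ ⊤ → σ ω < (κ ω : WithTop ℝ≥0)
  size : Measurable[M.F t] e
  sale : ∀ ω, σ ω ≠ ⊤ → 0 ≤ e ω ∧ e ω ≤ q.shares ∧
    0 < q.cash + M.gbm B t q.price (clock (σ ω)) ω * M.proceeds (e ω) (q.lag + (clock (σ ω) - t))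

namespace Delay

variable {H : ℝ≥0} {κ : Ω → ℝ≥0} {σ : Ω → WithTop ℝ≥0} {e : Ω → ℝ}

open Classical in
/-- The trading times of the postponed schedule. -/
def tradeTime (S : M.Schedule t q) (κ : Ω → ℝ≥0) (σ : Ω → WithTop ℝ≥0) : ℕ → Ω → WithTop ℝ≥0
  | 0, ω => σ ω
  | 1, ω => if ω ∈ {ω | σ ω ≤ (κ ω : WithTop ℝ≥0)}ᶜ then (κ ω : WithTop ℝ≥0) else ⊤
  | k + 2, ω => if ω ∈ {ω | S.ρ k ω ≤ σ ω}ᶜ then S.ρ k ω else ⊤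

/-- The sizes of the trades of the postponed schedule. -/
def tradeSize (S : M.Schedule t q) (e : Ω → ℝ) (l : ℝ) : ℕ → Ω → ℝ
  | 0, ω => -e ω
  | 1, _ => -q.shares
  | k + 2, ω => l ^ (2 * k + 3) * S.ξ k ω

/-- A finite `σ` is less than `κ`. The slot `1`, the full sale at `κ`, is thus used only when the
postponed sale never occurs, whereas the slots `k + 2`, which come after `σ`, are used only when it
does. -/
theorem tradeTime_one (h : Delay M B t q H κ σ e) {ω : Ω} (hω : tradeTime S κ σ 1 ω ≠ ⊤) :
    σ ω = ⊤ ∧ tradeTime S κ σ 1 ω = κ ω := by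
  rw [tradeTime] at hω ⊢
  split_ifs at hω ⊢ with h'
  · refine ⟨by_contra fun hne => h' (h.first_lt ω hne).le, rfl⟩
  · exact absurd rfl hω

theorem tradeTime_add_two {k : ℕ} {ω : Ω} (hω : tradeTime S κ σ (k + 2) ω ≠ ⊤) :
    σ ω < S.ρ k ω ∧ tradeTime S κ σ (k + 2) ω = S.ρ k ω := by
  rw [tradeTime] at hω ⊢
  split_ifs at hω ⊢ with h'
  · exact ⟨not_le.1 h', rfl⟩
  · exact absurd rfl hω

theorem tradeTime_bounds (h : Delay M B t q H κ σ e)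
    (hS : ∀ k ω, S.ρ k ω ≠ ⊤ → S.ρ k ω < (M.T : WithTop ℝ≥0)) {k : ℕ} {ω : Ω}
    (hk : tradeTime S κ σ k ω ≠ ⊤) : (t : WithTop ℝ≥0) ≤ tradeTime S κ σ k ω ∧
      tradeTime S κ σ k ω < (M.T : WithTop ℝ≥0) := by
  have hκ : (κ ω : WithTop ℝ≥0) < (M.T : WithTop ℝ≥0) :=
    WithTop.coe_lt_coe.2 ((h.watch_le ω).trans_lt h.cap)
  rcases k with _ | _ | k
  · exact ⟨(h.first_gt ω).le, (h.first_lt ω hk).trans hκ⟩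
  · rw [(h.tradeTime_one hk).2]
    exact ⟨WithTop.coe_le_coe.2 (h.watch_ge ω), hκ⟩
  · have h1 := (tradeTime_add_two hk).2
    rw [h1] at hk ⊢
    exact ⟨S.start k ω, hS k ω hk⟩

/-- The postponed schedule. -/
def schedule (h : Delay M B t q H κ σ e) (S : M.Schedule t q)
    (hS : ∀ k ω, S.ρ k ω ≠ ⊤ → S.ρ k ω < (M.T : WithTop ℝ≥0)) (l : ℝ) : M.Schedule t q where
  n := S.n + 2
  ρ := tradeTime S κ σ
  ξ := tradeSize S e l
  stopping k := by
    classical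
    rcases k with _ | _ | k
    · exact h.first_stopping
    · exact isStoppingTime_restrict h.watch
        (IsStoppingTime.measurableSet_stopping_time_le h.first_stopping h.watch).compl
    · exact isStoppingTime_restrict (S.stopping k)
        (IsStoppingTime.measurableSet_le_stopping_time (S.stopping k) h.first_stopping).compl
  size_meas k := by
    classical
    rcases k with _ | _ | k
    · exact stopMeas_of_le h.first_stopping (fun ω => (h.first_gt ω).le) h.size.neg
    · exact StopMeas.restrict h.watch
        (IsStoppingTime.measurableSet_stopping_time_le h.first_stopping h.watch).compl
        (stopMeas_of_measurable h.watch measurable_const)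
    · exact StopMeas.restrict (S.stopping k)
        (IsStoppingTime.measurableSet_le_stopping_time (S.stopping k) h.first_stopping).compl
        (stopMeas_of_measurable (S.stopping k)
          (((S.size_meas k).measurable (S.stopping k)).const_mul _))
  start k ω := by
    by_cases hk : tradeTime S κ σ k ω = ⊤
    · rw [hk]; exact le_top
    · exact (h.tradeTime_bounds hS hk).1
  horizon k ω := by
    by_cases hk : tradeTime S κ σ k ω = ⊤
    · exact Or.inr hk
    · exact Or.inl (h.tradeTime_bounds hS hk).2.le
  bounded k ω hk := by
    by_contra hne
    rcases k with _ | _ | k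
    · omega
    · omega
    · obtain ⟨-, e1⟩ := tradeTime_add_two hne
      rw [e1] at hne
      exact hne (S.bounded k ω (by omega))
  strict i k ω hik hi hk := by
    rcases k with _ | _ | k
    · omega
    · obtain rfl : i = 0 := by omega
      exact absurd (h.tradeTime_one hk).1 hi
    · obtain ⟨f1, f2⟩ := tradeTime_add_two hk
      rw [f2]
      rcases i with _ | _ | i
      · exact f1
      · have := (h.tradeTime_one hi).1
        rw [this] at f1
        exact absurd f1 not_top_lt
      · obtain ⟨f3, f4⟩ := tradeTime_add_two hi
        rw [f4] at hi ⊢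
        rw [f2] at hk
        exact S.strict i k ω (by omega) hi hk
  first k ω hk := by
    have := Strategy.le_clock hk (h.tradeTime_bounds hS hk).1
    have h1 : (t : ℝ) ≤ clock (tradeTime S κ σ k ω) := by exact_mod_cast this
    have := h.lag_pos
    linarith

variable {hS : ∀ k ω, S.ρ k ω ≠ ⊤ → S.ρ k ω < (M.T : WithTop ℝ≥0)} {l : ℝ}

theorem lag_mem (h : Delay M B t q H κ σ e) {w : ℝ≥0} {ω : Ω} (htw : t ≤ w) (hw : w ≤ κ ω) :
    q.lag + ((w : ℝ) - t) ∈ Ioc (0 : ℝ) M.T := by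
  have h1 : (t : ℝ) ≤ w := by exact_mod_cast htw
  have h2 : (w : ℝ) ≤ H := by exact_mod_cast hw.trans (h.watch_le ω)
  have h3 := h.lag_pos
  have h4 := h.cap_lag
  exact ⟨by linarith, by linarith⟩

theorem clock_bounds (h : Delay M B t q H κ σ e) {ω : Ω} (hω : σ ω ≠ ⊤) :
    t < clock (σ ω) ∧ clock (σ ω) < κ ω := by
  have h1 := h.first_gt ω
  have h2 := h.first_lt ω hω
  rw [← Strategy.coe_clock hω] at h1 h2
  exact ⟨WithTop.coe_lt_coe.1 h1, WithTop.coe_lt_coe.1 h2⟩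

theorem first_sale (h : Delay M B t q H κ σ e) (h1 : M.H1f) {ω : Ω} (hω : σ ω ≠ ⊤) :
    (h.schedule S hS l).cashExt B 1 ω = q.cash + M.gbm B t q.price (clock (σ ω)) ω *
        M.proceeds (e ω) (q.lag + (clock (σ ω) - t)) ∧
      (h.schedule S hS l).sharesAt 1 ω = q.shares - e ω ∧ ω ∈ (h.schedule S hS l).good B 0 := by
  obtain ⟨h2, h3, h4⟩ := h.sale ω hω
  obtain ⟨h5, h6⟩ := h.clock_bounds hω
  exact Schedule.mem_good_of_first_sale (k := 0) h1 (fun i hi => absurd hi (Nat.not_lt_zero i))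
    (Strategy.coe_clock hω).symm rfl h2 h3 (h.lag_mem h5.le h6.le) h4

theorem mem_good_of_first (h : Delay M B t q H κ σ e) (h1 : M.H1f) {k : ℕ} {ω : Ω}
    (hk : (h.schedule S hS l).ρ k ω ≠ ⊤) (hfirst : ∀ i < k, (h.schedule S hS l).ρ i ω = ⊤) :
    ω ∈ (h.schedule S hS l).good B k := by
  rcases k with _ | _ | k
  · exact (h.first_sale h1 hk).2.2
  · exact (Schedule.mem_good_of_first_sale (k := 1) h1 hfirst (h.tradeTime_one (S := S) hk).2 rfl h.dom.1
      le_rfl (h.lag_mem (h.watch_ge ω) le_rfl) (h.watch_pos ω _ (h.watch_ge ω) le_rfl)).2.2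
  · have h2 : σ ω = ⊤ := hfirst 0 (by omega)
    have h3 := (tradeTime_add_two (S := S) (κ := κ) hk).1
    rw [h2] at h3
    exact absurd h3 not_top_lt

theorem guard_positive (h : Delay M B t q H κ σ e) (h1 : M.H1f) (htT : t ≤ M.T)
    (hB : ContVersion M B) (hf : M.BorelImpact) :
    ((h.schedule S hS l).guard hB hf).Positive := by
  refine Schedule.guard_positive htT (fun k ω hk => (h.tradeTime_bounds hS hk).2)
    (Eventually.of_forall fun ω k hk hfirst => h.mem_good_of_first h1 hk hfirst) ?_
  filter_upwards [hB.gbm_ae_eq htT q.price] with ω hg r hr hrT hno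
  have hrκ : r < κ ω := by
    by_contra! hle
    by_cases hω : σ ω = ⊤
    · refine hno 1 ?_
      have : (h.schedule S hS l).ρ 1 ω = κ ω := if_pos fun h' : σ ω ≤ (κ ω : WithTop ℝ≥0) => by
        rw [hω] at h'
        exact WithTop.not_top_le_coe _ h'
      rw [this]
      exact WithTop.coe_le_coe.2 hle
    · exact hno 0 ((h.first_lt ω hω).le.trans (WithTop.coe_le_coe.2 hle))
  have hlag := h.lag_mem hr hrκ.le
  refine ⟨⟨h.dom.1, Market.price_pos h.dom.2.1 t r ω, ?_⟩, ?_⟩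
  · change (r : ℝ) - (t - q.lag) ∈ _
    rw [show (r : ℝ) - (t - q.lag) = q.lag + (r - t) by ring]
    exact ⟨hlag.1.le, hlag.2⟩
  · rw [← liqPath_eq_liq (hg r hrT) ⟨hlag.1.le, hlag.2⟩]
    exact h.watch_pos ω r hr hrκ.le

/-- The comparison of a schedule with the postponed one. -/
theorem compare (h : Delay M B t q H κ σ e) (h1 : M.H1f) (hl0 : 0 < l) (hl1 : l < 1) {ω : Ω}
    (hg : ∀ s ≤ M.T, M.gbm B t q.price s ω = M.price t q.price s ω)
    (ht : ∀ k, S.ρ k ω ≠ ⊤ →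
      S.impact k ω ≠ ∞ ∧ 0 ≤ S.cashAt (k + 1) ω ∧ 0 ≤ S.sharesAt (k + 1) ω)
    {m : ℕ} (hm : S.ρ m ω = t) (hω : σ ω ≠ ⊤) (hshares : S.sharesAt (m + 1) ω = q.shares - e ω)
    (hcash : l * S.cashAt (m + 1) ω < q.cash + M.gbm B t q.price (clock (σ ω)) ω *
        M.proceeds (e ω) (q.lag + (clock (σ ω) - t)))
    (hnext : ∀ k, m < k → S.ρ k ω ≠ ⊤ → σ ω < S.ρ k ω ∧
      clock (S.ρ k ω) - max (clock (σ ω) : ℝ) (S.lastTime ω k) ∈ Ioc (0 : ℝ) M.T ∧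
      M.f (l ^ (2 * k + 3) * S.ξ k ω)
        (clock (S.ρ k ω) - max (clock (σ ω) : ℝ) (S.lastTime ω k)) ≠ ∞ ∧
      (l ^ (2 * k + 3) * S.ξ k ω * M.price t q.price (clock (S.ρ k ω)) ω *
        (M.f (l ^ (2 * k + 3) * S.ξ k ω)
          (clock (S.ρ k ω) - max (clock (σ ω) : ℝ) (S.lastTime ω k))).toReal ≤
            l ^ (2 * k + 2) * S.cost k ω ∨
      l ^ (2 * k + 3) * S.ξ k ω * M.price t q.price (clock (S.ρ k ω)) ω *
        (M.f (l ^ (2 * k + 3) * S.ξ k ω)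
          (clock (S.ρ k ω) - max (clock (σ ω) : ℝ) (S.lastTime ω k))).toReal ≤
            l ^ (2 * k + 4) * S.cost k ω)) :
    (∀ k, (h.schedule S hS l).ρ k ω ≠ ⊤ → ω ∈ (h.schedule S hS l).good B k) ∧
      l ^ (2 * S.n + 2) * S.cashAt S.n ω ≤ (h.schedule S hS l).cashAt (S.n + 2) ω := by
  have hmt : S.ρ m ω ≠ ⊤ := by rw [hm]; exact WithTop.coe_ne_top
  have hmn : m < S.n := by
    by_contra! hle
    exact hmt (S.bounded m ω hle)
  obtain ⟨f1, f2, f3⟩ := h.first_sale (S := S) (hS := hS) (l := l) h1 hω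
  obtain ⟨b1, b2⟩ := h.clock_bounds hω
  have b1' : (t : ℝ) < clock (σ ω) := by exact_mod_cast b1
  set D := h.schedule S hS l with hD
  have hρ1 : D.ρ 1 ω = ⊤ := if_neg fun h' => h' (h.first_lt ω hω).le
  have hl1' : D.lastTime ω 1 = clock (σ ω) := if_pos hω
  -- the state at the beginning of the common trades
  have hbegin : ∀ k ≤ m + 1, D.cashExt B (k + 2) ω = D.cashExt B 1 ω ∧
      D.sharesAt (k + 2) ω = D.sharesAt 1 ω ∧ D.lastTime ω (k + 2) = clock (σ ω) := by
    intro k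
    induction k with
    | zero =>
      intro _
      refine ⟨Schedule.cashExt_succ_of_eq hρ1, D.sharesAt_succ_of_eq hρ1, ?_⟩
      rw [← hl1']
      exact if_neg (not_not.2 hρ1)
    | succ k ih =>
      intro hk
      have hle : S.ρ k ω ≤ σ ω ∨ S.ρ k ω = ⊤ := by
        by_cases hk' : S.ρ k ω = ⊤
        · exact Or.inr hk'
        · left
          rcases (Nat.le_of_succ_le_succ hk).eq_or_lt with rfl | hlt
          · rw [hm]; exact (h.first_gt ω).le
          · refine ((S.strict k m ω hlt hk' hmt).trans_le ?_).le
            rw [hm]; exact (h.first_gt ω).le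
      have hρ : D.ρ (k + 2) ω = ⊤ := by
        by_contra hne
        have h2 := tradeTime_add_two (S := S) (κ := κ) hne
        rcases hle with hle | hle
        · exact absurd h2.1 (not_lt.2 hle)
        · have h3 : D.ρ (k + 2) ω = S.ρ k ω := h2.2
          rw [h3] at hne
          exact hne hle
      obtain ⟨g1, g2, g3⟩ := ih (by omega)
      refine ⟨(Schedule.cashExt_succ_of_eq hρ).trans g1, (D.sharesAt_succ_of_eq hρ).trans g2, ?_⟩
      rw [← g3]
      exact if_neg (not_not.2 hρ)
  have hlastm : ∀ k, m + 1 ≤ k → (t : ℝ) ≤ S.lastTime ω k := by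
    intro k hk
    rcases S.at_cases k ω with ⟨h2, -⟩ | ⟨i, -, hi, h2, -⟩
    · exact absurd (h2 m (by omega)) hmt
    · rw [h2]
      exact Schedule.start_le_clock hi
  have hall : ∀ k, m + 1 ≤ k → 0 ≤ S.cashAt k ω ∧ 0 ≤ S.sharesAt k ω := fun k hk =>
    Schedule.at_nonneg ht ⟨m, by omega, hmt⟩
  -- The same geometric invariant as for the shadow, from the trade following the initial one on.
  -- The time of the last trade differs from the original one only as long as that is the initial
  -- trade, hence the maximum with `σ`.
  have key : ∀ k, m + 1 ≤ k → l ^ (2 * k + 2) * S.cashAt k ω < D.cashExt B (k + 2) ω ∧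
      l ^ (2 * k + 2) * S.sharesAt k ω ≤ D.sharesAt (k + 2) ω ∧
      D.lastTime ω (k + 2) = max (clock (σ ω) : ℝ) (S.lastTime ω k) ∧
      ∀ i < k, D.ρ (i + 2) ω ≠ ⊤ → ω ∈ D.good B (i + 2) := by
    intro k hk
    induction k, hk using Nat.le_induction with
    | base =>
      obtain ⟨g1, g2, g3⟩ := hbegin (m + 1) le_rfl
      obtain ⟨a1, a2⟩ := hall (m + 1) le_rfl
      have hpl : l ^ (2 * (m + 1) + 2) ≤ l := pow_le_of_le_one hl0.le hl1.le (by omega)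
      refine ⟨?_, ?_, ?_, fun i hi hne => ?_⟩
      · rw [g1, f1]
        exact (mul_le_mul_of_nonneg_right hpl a1).trans_lt hcash
      · rw [g2, f2, ← hshares]
        exact mul_le_of_le_one_left a2 (hpl.trans hl1.le)
      · have hlm : S.lastTime ω (m + 1) = clock (S.ρ m ω) := if_pos hmt
        have hcm : clock (S.ρ m ω) = t := by rw [hm]; rfl
        rw [g3, hlm, hcm, max_eq_left b1'.le]
      · exfalso
        have h2 := tradeTime_add_two (S := S) (κ := κ) hne
        have h3 : S.ρ i ω ≤ t := by
          rcases (Nat.le_of_lt_succ hi).eq_or_lt with rfl | hlt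
          · exact hm.le
          · have h4 : S.ρ i ω ≠ ⊤ := by
              have : D.ρ (i + 2) ω = S.ρ i ω := h2.2
              rwa [this] at hne
            exact (S.strict i m ω hlt h4 hmt).le.trans hm.le
        exact absurd h2.1 (not_lt.2 (h3.trans (h.first_gt ω).le))
    | succ k hk ih =>
      obtain ⟨i1, i2, i3, i4⟩ := ih
      obtain ⟨a1, a2⟩ := hall k hk
      obtain ⟨a3, a4⟩ := hall (k + 1) (by omega)
      have hp2 : 0 < l ^ (2 * k + 2) := pow_pos hl0 _
      have hpow : l ^ (2 * (k + 1) + 2) = l ^ (2 * k + 4) := by ring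
      have hpow3 : l ^ (2 * k + 3) = l ^ (2 * k + 2) * l := pow_succ _ _
      have hpow4 : l ^ (2 * k + 4) = l ^ (2 * k + 2) * l * l := by rw [pow_succ, hpow3]
      have hle4 : l ^ (2 * k + 4) ≤ l ^ (2 * k + 2) :=
        pow_le_pow_of_le_one hl0.le hl1.le (by omega)
      by_cases hρ : S.ρ k ω = ⊤
      · have hρ' : D.ρ (k + 2) ω = ⊤ := by
          by_contra hne
          have h3 : D.ρ (k + 2) ω = S.ρ k ω := (tradeTime_add_two (S := S) (κ := κ) hne).2
          rw [h3] at hne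
          exact hne hρ
        rw [Schedule.cashExt_succ_of_eq hρ', D.sharesAt_succ_of_eq hρ', S.cashAt_succ_of_eq hρ,
          S.sharesAt_succ_of_eq hρ, hpow]
        refine ⟨(mul_le_mul_of_nonneg_right hle4 a1).trans_lt i1,
          (mul_le_mul_of_nonneg_right hle4 a2).trans i2, ?_, fun i hi hne => ?_⟩
        · have e1 : D.lastTime ω (k + 1 + 2) = D.lastTime ω (k + 2) := if_neg (not_not.2 hρ')
          have e2 : S.lastTime ω (k + 1) = S.lastTime ω k := if_neg (not_not.2 hρ)
          rw [e1, e2, i3]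
        · rcases (Nat.le_of_lt_succ hi).eq_or_lt with rfl | hlt
          · exact absurd hρ' hne
          · exact i4 i hlt hne
      · obtain ⟨n1, n2, n3, n4⟩ := hnext k (by omega) hρ
        have hρ' : D.ρ (k + 2) ω = S.ρ k ω := if_pos (not_le.2 n1)
        have hne : D.ρ (k + 2) ω ≠ ⊤ := by rwa [hρ']
        have hξ : D.ξ (k + 2) ω = l ^ (2 * k + 3) * S.ξ k ω := rfl
        have hcl : clock (S.ρ k ω) ≤ M.T := Schedule.clock_le_horizon hρ
        have e1 : D.cashExt B (k + 1 + 2) ω = D.cashExt B (k + 2) ω -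
            l ^ (2 * k + 3) * S.ξ k ω * M.price t q.price (clock (S.ρ k ω)) ω *
              (M.f (l ^ (2 * k + 3) * S.ξ k ω)
                (clock (S.ρ k ω) - max (clock (σ ω) : ℝ) (S.lastTime ω k))).toReal := by
          rw [show k + 1 + 2 = k + 2 + 1 by ring, Schedule.cashExt_succ_of_ne hne, hρ', hξ, i3,
            hg _ hcl, impactExt_of_mem ⟨n2.1.le, n2.2⟩]
        have e2 : D.sharesAt (k + 1 + 2) ω = D.sharesAt (k + 2) ω + l ^ (2 * k + 3) * S.ξ k ω :=
          D.sharesAt_succ_of_ne hne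
        have e3 := S.cashAt_succ_of_ne hρ
        have e4 := S.sharesAt_succ_of_ne hρ
        have j1 : l ^ (2 * k + 4) * S.cashAt (k + 1) ω < D.cashExt B (k + 1 + 2) ω := by
          rw [e1]
          rcases n4 with n4 | n4
          · have := mul_le_mul_of_nonneg_right hle4 a3
            rw [e3] at this ⊢
            linarith
          · have := mul_le_mul_of_nonneg_right hle4 a1
            rw [e3]
            linarith
        have j2 : l ^ (2 * k + 4) * S.sharesAt (k + 1) ω ≤ D.sharesAt (k + 1 + 2) ω := by
          rw [e2]
          have c1 : 0 ≤ l ^ (2 * k + 2) * (1 - l) * S.sharesAt k ω :=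
            mul_nonneg (mul_nonneg hp2.le (by linarith)) a2
          have c2 : 0 ≤ l ^ (2 * k + 2) * l * (1 - l) * S.sharesAt (k + 1) ω :=
            mul_nonneg (mul_nonneg (mul_nonneg hp2.le hl0.le) (by linarith)) a4
          rw [hpow3, hpow4]
          rw [e4] at c2 ⊢
          nlinarith
        refine ⟨by rwa [hpow], by rwa [hpow], ?_, fun i hi hne' => ?_⟩
        · have e5 : D.lastTime ω (k + 1 + 2) = clock (D.ρ (k + 2) ω) := if_pos hne
          have e6 : S.lastTime ω (k + 1) = clock (S.ρ k ω) := if_pos hρ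
          rw [e5, e6, hρ', max_eq_right]
          rw [← Strategy.coe_clock hω, ← Strategy.coe_clock hρ] at n1
          exact_mod_cast (WithTop.coe_lt_coe.1 n1).le
        · rcases (Nat.le_of_lt_succ hi).eq_or_lt with rfl | hlt
          · have hp4 : 0 < l ^ (2 * i + 4) := pow_pos hl0 _
            refine ⟨by rwa [hρ', i3], ?_, ?_, ?_⟩
            · rw [hρ', i3, hξ, impactExt_of_mem ⟨n2.1.le, n2.2⟩]
              exact n3
            · exact (mul_nonneg hp4.le a3).trans_lt j1
            · exact (mul_nonneg hp4.le a4).trans j2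
          · exact i4 i hlt hne'
  have hgood : ∀ k, D.ρ k ω ≠ ⊤ → ω ∈ D.good B k := by
    intro k hk
    rcases k with _ | _ | k
    · exact f3
    · exact absurd hρ1 hk
    · exact (key (max (m + 1) (k + 1)) (le_max_left _ _)).2.2.2 k
        (lt_of_lt_of_le k.lt_succ_self (le_max_right _ _)) hk
  refine ⟨hgood, ?_⟩
  rw [Schedule.cashAt_eq_cashExt hg fun i _ hne => (hgood i hne).1]
  exact (key S.n hmn).1.le

end Delay

end Market

end Liquidation

/-! ### Effect of the postponement on the later trades. -/

namespace Liquidation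

open Filter Topology

namespace Market

variable {Ω : Type*} [MeasurableSpace Ω] {M : Market Ω} {B : ℝ≥0 → Ω → ℝ} {t : ℝ≥0} {q : State}
  {S : M.Schedule t q}

/-- The cost of a scaled down trade, for a lag close to the original one. -/
theorem Hcf.eventually_scaled (hc : M.Hcf) (h1 : M.H1f) {l ξ θ P : ℝ} (hl0 : 0 < l) (hl1 : l < 1)
    (hP : 0 < P) (hθ : θ ∈ Ioc (0 : ℝ) M.T) (k : ℕ) (hfin : M.f ξ θ ≠ ∞) {ι : Type*}
    {F : Filter ι} {θs : ι → ℝ} (hθs : Tendsto θs F (𝓝 θ))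
    (hmem : ∀ᶠ i in F, θs i ∈ Ioc (0 : ℝ) M.T) :
    ∀ᶠ i in F, M.f (l ^ (2 * k + 3) * ξ) (θs i) ≠ ∞ ∧
      (l ^ (2 * k + 3) * ξ * P * (M.f (l ^ (2 * k + 3) * ξ) (θs i)).toReal ≤
        l ^ (2 * k + 2) * (ξ * P * (M.f ξ θ).toReal) ∨
      l ^ (2 * k + 3) * ξ * P * (M.f (l ^ (2 * k + 3) * ξ) (θs i)).toReal ≤
        l ^ (2 * k + 4) * (ξ * P * (M.f ξ θ).toReal)) := by
  have hθ' : θ ∈ Icc (0 : ℝ) M.T := ⟨hθ.1.le, hθ.2⟩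
  rcases eq_or_ne ξ 0 with rfl | hξ
  · filter_upwards [hmem] with i hi
    rw [mul_zero, h1.zero _ ⟨hi.1.le, hi.2⟩]
    exact ⟨ENNReal.one_ne_top, Or.inl (by simp)⟩
  have hpow : 0 < l ^ (2 * k + 3) := pow_pos hl0 _
  obtain ⟨hfin', hle⟩ := scaled_cost h1 (l := l ^ (2 * k + 3)) ⟨hpow.le, pow_le_one₀ hl0.le hl1.le⟩
    hθ' hP hfin
  have h3 := hc.tendsto (mul_ne_zero hpow.ne' hξ) hθ tendsto_const_nhds hθs hmem
  have h2 := ((ENNReal.tendsto_toReal hfin').comp h3).const_mul (l ^ (2 * k + 3) * ξ * P)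
  set c := ξ * P * (M.f ξ θ).toReal with hcdef
  have e1 : l ^ (2 * k + 4) = l ^ (2 * k + 3) * l := pow_succ _ _
  have e2 : l ^ (2 * k + 3) = l ^ (2 * k + 2) * l := pow_succ _ _
  have hp2 : 0 < l ^ (2 * k + 2) := pow_pos hl0 _
  rcases lt_trichotomy c 0 with hneg | hzero | hpos
  · have h4 : l ^ (2 * k + 3) * c < l ^ (2 * k + 4) * c := by
      rw [e1]
      have : l ^ (2 * k + 3) * c < 0 := mul_neg_of_pos_of_neg hpow hneg
      nlinarith
    filter_upwards [h3.eventually_ne hfin', h2.eventually_lt_const (hle.trans_lt h4)] with i h5 h6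
    exact ⟨h5, Or.inr h6.le⟩
  · have hξ' : ξ < 0 := by
      rcases lt_or_gt_of_ne hξ with h | h
      · exact h
      · exfalso
        have h5 := one_le_impact_of_nonneg h1 h.le hθ'
        have h6 := ENNReal.toReal_mono hfin h5
        rw [ENNReal.toReal_one] at h6
        have : 0 < ξ * P * (M.f ξ θ).toReal := by positivity
        linarith
    filter_upwards [h3.eventually_ne hfin'] with i h5
    refine ⟨h5, Or.inl ?_⟩
    rw [hzero, mul_zero]
    exact mul_nonpos_of_nonpos_of_nonneg (mul_nonpos_of_nonpos_of_nonneg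
      (mul_neg_of_pos_of_neg hpow hξ').le hP.le) ENNReal.toReal_nonneg
  · have h4 : l ^ (2 * k + 3) * c < l ^ (2 * k + 2) * c := by
      rw [e2]
      have : 0 < l ^ (2 * k + 2) * c := mul_pos hp2 hpos
      nlinarith
    filter_upwards [h3.eventually_ne hfin', h2.eventually_lt_const (hle.trans_lt h4)] with i h5 h6
    exact ⟨h5, Or.inl h6.le⟩

namespace Schedule

open Classical in
/-- The number of shares sold at the initial time. -/
def initialSale (S : M.Schedule t q) (ω : Ω) : ℝ :=
  -∑ k ∈ Finset.range S.n, if S.ρ k ω ≤ (t : WithTop ℝ≥0) then S.ξ k ω else 0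

theorem measurable_initialSale : Measurable[M.F t] S.initialSale := by
  classical
  refine Measurable.neg ?_
  refine @Finset.measurable_fun_sum _ _ _ _ _ _ (M.F t) _ _ fun k _ => ?_
  exact (S.size_meas k).measurable_ite (S.stopping k) t

theorem eq_of_le_start {ω : Ω} {m : ℕ} (hm : S.ρ m ω ≤ (t : WithTop ℝ≥0)) : S.ρ m ω = t :=
  le_antisymm hm (S.start m ω)

theorem no_trade_before_start {ω : Ω} {m : ℕ} (hm : S.ρ m ω = t) {i : ℕ} (hi : i < m) :
    S.ρ i ω = ⊤ := by
  by_contra hne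
  have h1 := S.strict i m ω hi hne (by rw [hm]; exact WithTop.coe_ne_top)
  rw [hm] at h1
  exact absurd (S.start i ω) (not_le.2 h1)

/-- Strictly increasing times allow at most one trade at `t`, so the sum has a single term. The sum
form avoids an index depending on `ω`, and shows that the sale is known at `t`. -/
theorem initialSale_eq {ω : Ω} {m : ℕ} (hm : S.ρ m ω = t) : S.initialSale ω = -S.ξ m ω := by
  classical
  have hmt : S.ρ m ω ≠ ⊤ := by rw [hm]; exact WithTop.coe_ne_top
  rw [initialSale, Finset.sum_eq_single m, if_pos hm.le]
  · intro i _ hi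
    refine if_neg fun h => ?_
    have h1 := S.eq_of_le_start h
    rcases lt_or_gt_of_ne hi with h2 | h2
    · have := no_trade_before_start hm h2
      rw [this] at h1
      exact WithTop.top_ne_coe h1
    · have := no_trade_before_start h1 h2
      exact hmt this
  · intro h
    exact absurd (S.bounded m ω (by simpa using h)) hmt

/-- The state after a trade at the initial time. -/
theorem initial_trade {ω : Ω} {m : ℕ} (hm : S.ρ m ω = t) (hq : q ∈ M.domain) (hx : q.cash < 0)
    (ht : 0 ≤ S.cashAt (m + 1) ω) :
    S.cashAt (m + 1) ω = q.cash + q.price * M.proceeds (S.initialSale ω) q.lag ∧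
      S.sharesAt (m + 1) ω = q.shares - S.initialSale ω ∧ 0 ≤ S.initialSale ω := by
  have hmt : S.ρ m ω ≠ ⊤ := by rw [hm]; exact WithTop.coe_ne_top
  obtain ⟨e1, e2, e3⟩ : S.lastTime ω m = t - q.lag ∧ S.cashAt m ω = q.cash ∧
      S.sharesAt m ω = q.shares := by
    rcases S.at_cases m ω with ⟨-, h⟩ | ⟨i, hi, hi', -⟩
    · exact h
    · exact absurd (no_trade_before_start hm hi) hi'
  have hc : clock (S.ρ m ω) = t := by rw [hm]; rfl
  have e4 := S.cashAt_succ_of_ne hmt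
  have e5 : S.cost m ω = -(q.price * M.proceeds (S.initialSale ω) q.lag) := by
    rw [cost, impact, e1, hc, initialSale_eq hm, proceeds, neg_neg,
      impactExt_of_mem hq.2.2, sub_sub_cancel]
    have : M.price t q.price t ω = q.price := by simp [price]
    rw [this]
    ring
  rw [e2, e5, sub_neg_eq_add] at e4
  refine ⟨e4, ?_, ?_⟩
  · rw [S.sharesAt_succ_of_ne hmt, e3, initialSale_eq hm]; ring
  · by_contra! hneg
    have h1 : M.proceeds (S.initialSale ω) q.lag ≤ 0 :=
      mul_nonpos_of_nonpos_of_nonneg hneg.le ENNReal.toReal_nonneg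
    have := mul_nonpos_of_nonneg_of_nonpos hq.2.1.le h1
    linarith

/-- The next trades of a schedule postponing its initial trade to `w`. -/
theorem eventually_next (hc : M.Hcf) (h1 : M.H1f) {l : ℝ} (hl0 : 0 < l) (hl1 : l < 1)
    (hq : q ∈ M.domain) {ω : Ω} {m : ℕ} (hm : S.ρ m ω = t)
    (ht : ∀ k, S.ρ k ω ≠ ⊤ →
      S.impact k ω ≠ ∞ ∧ 0 ≤ S.cashAt (k + 1) ω ∧ 0 ≤ S.sharesAt (k + 1) ω)
    (hlag : ∀ k, S.ρ k ω ≠ ⊤ → clock (S.ρ k ω) - S.lastTime ω k ∈ Ioc (0 : ℝ) M.T) :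
    ∀ᶠ w : ℝ≥0 in 𝓝[>] t, ∀ k, m < k → S.ρ k ω ≠ ⊤ → w < clock (S.ρ k ω) ∧
      clock (S.ρ k ω) - max (w : ℝ) (S.lastTime ω k) ∈ Ioc (0 : ℝ) M.T ∧
      M.f (l ^ (2 * k + 3) * S.ξ k ω)
        (clock (S.ρ k ω) - max (w : ℝ) (S.lastTime ω k)) ≠ ∞ ∧
      (l ^ (2 * k + 3) * S.ξ k ω * M.price t q.price (clock (S.ρ k ω)) ω *
        (M.f (l ^ (2 * k + 3) * S.ξ k ω)
          (clock (S.ρ k ω) - max (w : ℝ) (S.lastTime ω k))).toReal ≤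
            l ^ (2 * k + 2) * S.cost k ω ∨
      l ^ (2 * k + 3) * S.ξ k ω * M.price t q.price (clock (S.ρ k ω)) ω *
        (M.f (l ^ (2 * k + 3) * S.ξ k ω)
          (clock (S.ρ k ω) - max (w : ℝ) (S.lastTime ω k))).toReal ≤
            l ^ (2 * k + 4) * S.cost k ω) := by
  have hmt : S.ρ m ω ≠ ⊤ := by rw [hm]; exact WithTop.coe_ne_top
  suffices ∀ᶠ w : ℝ≥0 in 𝓝[>] t, ∀ k ∈ Finset.range S.n, m < k → S.ρ k ω ≠ ⊤ → _ by
    filter_upwards [this] with w hw k hmk hk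
    refine hw k (Finset.mem_range.2 ?_) hmk hk
    by_contra! hle
    exact hk (S.bounded k ω hle)
  refine (Finset.eventually_all _).2 fun k _ => ?_
  by_cases hmk : m < k
  swap
  · exact Eventually.of_forall fun w h => absurd h hmk
  by_cases hk : S.ρ k ω = ⊤
  · exact Eventually.of_forall fun w _ h => absurd hk h
  have hlast : (t : ℝ) ≤ S.lastTime ω k := by
    rcases S.at_cases k ω with ⟨h2, -⟩ | ⟨i, -, hi, h2, -⟩
    · exact absurd (h2 m hmk) hmt
    · rw [h2]
      exact start_le_clock hi
  have hlt : t < clock (S.ρ k ω) := by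
    have := S.strict m k ω hmk hmt hk
    rw [hm, ← Strategy.coe_clock hk] at this
    exact WithTop.coe_lt_coe.1 this
  have hθ := hlag k hk
  -- As `t ≤ lastTime`, the maximum tends to `lastTime` when `w` decreases to `t`: a short delay
  -- alters the later lags by little.
  have hlim : Tendsto (fun w : ℝ≥0 => (clock (S.ρ k ω) : ℝ) - max (w : ℝ) (S.lastTime ω k))
      (𝓝[>] t) (𝓝 (clock (S.ρ k ω) - S.lastTime ω k)) := by
    have h2 : Continuous fun w : ℝ≥0 =>
        (clock (S.ρ k ω) : ℝ) - max (w : ℝ) (S.lastTime ω k) := by fun_prop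
    have h3 := (h2.tendsto t).mono_left (nhdsWithin_le_nhds (s := Ioi t))
    rwa [max_eq_right hlast] at h3
  have hlt' : ∀ᶠ w in 𝓝[>] t, w < clock (S.ρ k ω) :=
    (eventually_lt_nhds hlt).filter_mono nhdsWithin_le_nhds
  have hmem : ∀ᶠ w : ℝ≥0 in 𝓝[>] t,
      clock (S.ρ k ω) - max (w : ℝ) (S.lastTime ω k) ∈ Ioc (0 : ℝ) M.T := by
    filter_upwards [hlt'] with w hw
    have h2 : (w : ℝ) < clock (S.ρ k ω) := by exact_mod_cast hw
    refine ⟨sub_pos.2 (max_lt h2 (by linarith [hθ.1])), ?_⟩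
    linarith [le_max_right (w : ℝ) (S.lastTime ω k), hθ.2]
  filter_upwards [hlt', hmem, hc.eventually_scaled h1 hl0 hl1
    (Market.price_pos hq.2.1 t (clock (S.ρ k ω)) ω) hθ k (ht k hk).1 hlim hmem] with w h2 h3 h4 _ _
  exact ⟨h2, h3, h4⟩

end Schedule

end Market

end Liquidation

/-! ### A debt, with a trade at the initial time. -/

namespace Liquidation

open Filter Topology

namespace Market

section FirstTime

variable {Ω : Type*} {v : ℕ → ℝ≥0} {A : ℕ → Set Ω} {I : Finset ℕ}

open Classical in
/-- The first of the times `v i`, `i ∈ I`, at which the event `A i` is realized. -/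
def firstTime (v : ℕ → ℝ≥0) (A : ℕ → Set Ω) (I : Finset ℕ) (ω : Ω) : WithTop ℝ≥0 :=
  I.inf fun i => if ω ∈ A i then (v i : WithTop ℝ≥0) else ⊤

theorem firstTime_spec {ω : Ω}
    (h : firstTime v A I ω ≠ ⊤) : ∃ i ∈ I, ω ∈ A i ∧ firstTime v A I ω = v i := by
  classical
  rcases I.eq_empty_or_nonempty with rfl | hI
  · exact absurd Finset.inf_empty h
  obtain ⟨i, hi, e⟩ := Finset.exists_mem_eq_inf I hI
    fun i => if ω ∈ A i then (v i : WithTop ℝ≥0) else ⊤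
  have e' : firstTime v A I ω = if ω ∈ A i then (v i : WithTop ℝ≥0) else ⊤ := e
  rw [e'] at h ⊢
  split_ifs at h ⊢ with hω
  · exact ⟨i, hi, hω, rfl⟩
  · exact absurd rfl h

theorem firstTime_le {ω : Ω} {i : ℕ} (hi : i ∈ I)
    (hω : ω ∈ A i) : firstTime v A I ω ≤ v i := by
  classical
  exact (Finset.inf_le hi).trans_eq (if_pos hω)

end FirstTime

variable {Ω : Type*} [MeasurableSpace Ω] {M : Market Ω} {B : ℝ≥0 → Ω → ℝ} {t : ℝ≥0} {q : State}
  {S : M.Schedule t q}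

theorem isStoppingTime_firstTime {v : ℕ → ℝ≥0} {A : ℕ → Set Ω} {I : Finset ℕ}
    (hA : ∀ i, MeasurableSet[M.F (v i)] (A i)) : IsStoppingTime M.F (firstTime v A I) := by
  intro s
  have : {ω | firstTime v A I ω ≤ (s : WithTop ℝ≥0)} =
      ⋃ i ∈ I, {ω | v i ≤ s ∧ ω ∈ A i} := by
    ext ω
    simp only [mem_iUnion, exists_prop]
    constructor
    · intro h
      have h' : firstTime v A I ω ≤ (s : WithTop ℝ≥0) := h
      obtain ⟨i, hi, h1, h2⟩ := firstTime_spec (ne_top_of_le_ne_top WithTop.coe_ne_top h')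
      rw [h2] at h'
      exact ⟨i, hi, WithTop.coe_le_coe.1 h', h1⟩
    · rintro ⟨i, hi, h1, h2⟩
      exact (firstTime_le hi h2).trans (WithTop.coe_le_coe.2 h1)
  rw [this]
  refine Finset.measurableSet_biUnion _ fun i _ => ?_
  by_cases h : v i ≤ s
  · simp only [h, true_and]
    exact M.F.mono h _ (hA i)
  · simp only [h, false_and]
    exact @MeasurableSet.empty _ (M.F s)

/-- On the event where a trade takes place at the initial time, a valid schedule started with a
debt is dominated by a positive one, up to scaling and truncation. -/
theorem Schedule.Valid.exists_positive_of_initial_trade [IsProbabilityMeasure M.prob]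
    (h : S.Valid) (hF : M.UsualConditions) (hB : ContVersion M B) (hσ : 0 < M.σ)
    (hf : M.BorelImpact) (h1 : M.H1f)
    (hc : M.Hcf) (hU : M.HU) (hq : q ∈ M.domain) (hL : 0 < M.liq q) (hx : q.cash < 0)
    (hlag0 : 0 < q.lag) (hlagT : q.lag < M.T) (htT : t < M.T) {A : Set Ω} (hA : MeasurableSet A)
    (hinit : ∀ ω ∈ A, ∃ k, S.ρ k ω ≤ (t : WithTop ℝ≥0))
    {l C η : ℝ} (hl0 : 0 < l) (hl1 : l < 1) (hC : 0 < C) (hη : 0 < η) :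
    ∃ R : M.Schedule t q, R.Positive ∧
      ∫⁻ ω in A, ENNReal.ofReal (min (M.U (max 0 (l ^ (2 * S.n + 2) * S.cashAt S.n ω))) C) ∂M.prob ≤
        (∫⁻ ω in A, ENNReal.ofReal (M.U (max 0 (R.cashAt R.n ω))) ∂M.prob) +
          2 * ENNReal.ofReal (C * η) := by
  have hη' : 0 < ENNReal.ofReal η := ENNReal.ofReal_pos.2 hη
  have hCη : ENNReal.ofReal C * ENNReal.ofReal η = ENNReal.ofReal (C * η) :=
    (ENNReal.ofReal_mul hC.le).symm
  have hCη' : 0 < ENNReal.ofReal (C * η) := ENNReal.ofReal_pos.2 (mul_pos hC hη)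
  -- the stopping time at which everything is sold
  obtain ⟨lag, hlag⟩ : ∃ lag : ℝ≥0, (lag : ℝ) = q.lag := ⟨⟨q.lag, hlag0.le⟩, rfl⟩
  have hlagT' : lag < M.T := by exact_mod_cast hlag.trans_lt hlagT
  obtain ⟨H, htH, hHlt⟩ := exists_between (lt_min (lt_add_of_pos_right t (tsub_pos_of_lt hlagT')) htT)
  have hHT : H < M.T := hHlt.trans_le (min_le_right _ _)
  have hHlag : q.lag + ((H : ℝ) - t) ≤ M.T := by
    have h2 : H ≤ t + (M.T - lag) := hHlt.le.trans (min_le_left _ _)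
    have h3 : (H : ℝ) ≤ t + (M.T - q.lag) := by
      rw [← hlag, ← NNReal.coe_sub hlagT'.le]
      exact_mod_cast h2
    linarith
  obtain ⟨κ, hκ, hκ'⟩ := hB.exists_watch hc hq (half_lt_self hL) htH
  -- the times at which the initial trade may be performed
  obtain ⟨v, hvanti, hv, hvlim⟩ := exists_seq_strictAnti_tendsto' htH
  have hvT : ∀ i, v i ≤ M.T := fun i => (hv i).2.le.trans hHT.le
  have hem := S.measurable_initialSale
  set e := S.initialSale with he
  set D : Set Ω := {ω | 0 ≤ e ω ∧ e ω ≤ q.shares ∧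
    0 ≤ q.cash + q.price * M.proceeds (e ω) q.lag} with hD
  -- At the time `v i`, before the watch, the initial sale leaves more than `l` times the cash that
  -- it leaves at `t`; in particular a positive amount.
  set hit : ℕ → Set Ω := fun i => D ∩ ({ω | l * (q.cash + q.price * M.proceeds (e ω) q.lag) <
    q.cash + M.gbm B t q.price (v i) ω * M.proceeds (e ω) (q.lag + (v i - t))} ∩
      {ω | v i < κ ω}) with hhit
  have hφ := measurable_proceeds hf
  have hcm : Measurable[M.F t] fun ω => q.cash + q.price * M.proceeds (e ω) q.lag :=
    ((hφ.comp (hem.prodMk measurable_const)).const_mul q.price).const_add q.cash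
  have hDm : MeasurableSet[M.F t] D :=
    (hem measurableSet_Ici).inter ((hem measurableSet_Iic).inter (hcm measurableSet_Ici))
  have hhitm : ∀ i, MeasurableSet[M.F (v i)] (hit i) := fun i => by
    have hmono := M.F.mono (hv i).1.le
    have hm : Measurable[M.F (v i)] fun ω => q.cash + M.gbm B t q.price (v i) ω *
        M.proceeds (e ω) (q.lag + (v i - t)) :=
      ((hB.measurable_gbm (hv i).1.le le_rfl q.price).mul
        (hφ.comp ((hem.mono hmono le_rfl).prodMk measurable_const))).const_add q.cash
    refine (hmono _ hDm).inter (MeasurableSet.inter ?_ ?_)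
    · have := (hm.sub ((hcm.mono hmono le_rfl).const_mul l)) (measurableSet_Ioi (a := (0 : ℝ)))
      convert! this using 1
      ext ω
      exact (sub_pos (α := ℝ)).symm
    · convert! (hκ (v i)).compl using 1
      ext ω
      exact (not_le (a := κ ω) (b := v i)).symm.trans
        (not_congr (WithTop.coe_le_coe (a := v i) (b := κ ω)).symm)
  have hfreq : ∀ᵐ ω ∂M.prob, ω ∈ D → ∃ᶠ i in atTop, ω ∈ hit i := by
    filter_upwards [hB.frequently_cash_gt hF hσ hf hc hq.2.1 hx hl1 hem (fun k => (hv k).1) hvT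
      hvanti.antitone hvlim (θ := q.lag)] with ω hω hωD
    refine ((hω hωD.1 hωD.2.2).and_eventually
      (hvlim.eventually_lt_const (hκ' ω).1)).mono fun i hi => ⟨hωD, hi.1, hi.2⟩
  -- the range of indices used
  set miss : ℕ → ℕ → Set Ω := fun N I => D \ ⋃ i ∈ Finset.Ico N (N + I), hit i with hmiss
  have hmissm : ∀ N I, MeasurableSet (miss N I) := fun N I =>
    (M.F.le t _ hDm).diff (Finset.measurableSet_biUnion _ fun i _ => M.F.le _ _ (hhitm i))
  -- Hits occur infinitely often almost surely on `D`, so beyond any `N` finitely many candidate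
  -- times miss them all with probability less than `η` only.
  have hI : ∀ N, ∃ I, M.prob (miss N I) < ENNReal.ofReal η := fun N => by
    refine ((tendsto_measure_zero (hmissm N) ?_).eventually_lt_const hη').exists
    filter_upwards [hfreq] with ω hω
    by_cases hωD : ω ∈ D
    · obtain ⟨i, hi, hi'⟩ := (hω hωD).forall_exists_of_atTop N
      filter_upwards [eventually_gt_atTop (i - N)] with I hI h'
      exact h'.2 (mem_iUnion₂.2 ⟨i, Finset.mem_Ico.2 ⟨hi, by omega⟩, hi'⟩)
    · exact Eventually.of_forall fun I h' => hωD h'.1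
  choose I hIN using hI
  set σ : ℕ → Ω → WithTop ℝ≥0 := fun N => firstTime v hit (Finset.Ico N (N + I N)) with hσdef
  have hσspec : ∀ N ω, σ N ω ≠ ⊤ → ∃ i, N ≤ i ∧ ω ∈ hit i ∧ σ N ω = v i := fun N ω hω => by
    obtain ⟨i, hi, h2, h3⟩ := firstTime_spec hω
    exact ⟨i, (Finset.mem_Ico.1 hi).1, h2, h3⟩
  have hdelay : ∀ N, Delay M B t q H κ (σ N) e := fun N => {
    dom := hq
    lag_pos := hlag0
    cap := hHT
    cap_lag := hHlag
    watch := hκ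
    watch_ge := fun ω => (hκ' ω).1.le
    watch_le := fun ω => (hκ' ω).2.1
    watch_pos := fun ω r h2 h3 => lt_of_lt_of_le (by linarith) ((hκ' ω).2.2.1 r h2 h3)
    first_stopping := isStoppingTime_firstTime hhitm
    first_gt := fun ω => by
      by_cases hω : σ N ω = ⊤
      · rw [hω]; exact WithTop.coe_lt_top t
      · obtain ⟨i, -, -, h2⟩ := hσspec N ω hω
        rw [h2]
        exact WithTop.coe_lt_coe.2 (hv i).1
    first_lt := fun ω hω => by
      obtain ⟨i, -, h2, h3⟩ := hσspec N ω hω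
      rw [h3]
      exact WithTop.coe_lt_coe.2 h2.2.2
    size := hem
    sale := fun ω hω => by
      obtain ⟨i, -, h2, h3⟩ := hσspec N ω hω
      have hcl : clock (σ N ω) = v i := by rw [h3]; rfl
      rw [hcl]
      exact ⟨h2.1.1, h2.1.2.1, (mul_nonneg hl0.le h2.1.2.2).trans_lt h2.2.1⟩ }
  set P : ℕ → M.Schedule t q := fun N => (hdelay N).schedule S h.lt_horizon l with hP
  set R : ℕ → M.Schedule t q := fun N => (P N).guard hB hf with hR
  have hRpos : ∀ N, (R N).Positive := fun N => (hdelay N).guard_positive h1 htT.le hB hf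
  -- the comparison
  have hcmp := eventually_setLIntegral_le (μ := M.prob) (c := ENNReal.ofReal C)
    (η := ENNReal.ofReal (C * η)) (A := A)
    (f := fun ω => ENNReal.ofReal (min (M.U (max 0 (l ^ (2 * S.n + 2) * S.cashAt S.n ω))) C))
    (g := fun N ω => ENNReal.ofReal (M.U (max 0 ((R N).cashAt (R N).n ω))) +
      (miss N (I N)).indicator (fun _ => ENNReal.ofReal C) ω)
    hA ENNReal.ofReal_ne_top
    (fun ω => ENNReal.ofReal_le_ofReal (min_le_right _ _))
    (fun N => AEMeasurable.add (hU.measurable.comp_aemeasurable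
      ((hRpos N).toValid.aemeasurable_cashAt hq hf htT.le hB _)).ennreal_ofReal
        (measurable_const.indicator (hmissm N _)).aemeasurable) (by
    filter_upwards [h.trade, h.lag_mem hq, hB.gbm_ae_eq htT.le q.price] with ω w1 w2 w3 hω
    obtain ⟨m, hm⟩ := hinit ω hω
    replace hm := S.eq_of_le_start hm
    have hmt : S.ρ m ω ≠ ⊤ := by rw [hm]; exact WithTop.coe_ne_top
    obtain ⟨-, c1, c2⟩ := w1 m hmt
    obtain ⟨d1, d2, d3⟩ := S.initial_trade hm hq hx c1
    rw [d2] at c2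
    have hωD : ω ∈ D := ⟨d3, by linarith, by rwa [← d1]⟩
    obtain ⟨b, hb, hsub⟩ := (mem_nhdsGT_iff_exists_Ioo_subset (a := t)).1
      (S.eventually_next hc h1 hl0 hl1 hq hm w1 w2)
    -- For `N` large the postponed sale is made so early that all the later trades compare with the
    -- original ones.
    filter_upwards [hvlim.eventually_lt_const hb] with N hN
    by_cases hmN : ω ∈ miss N (I N)
    · rw [indicator_of_mem hmN]
      exact (ENNReal.ofReal_le_ofReal (min_le_right _ _)).trans le_add_self
    rw [indicator_of_notMem hmN, add_zero]
    have hne : σ N ω ≠ ⊤ := by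
      intro htop
      refine hmN ⟨hωD, fun h' => ?_⟩
      obtain ⟨i, hi, hi'⟩ := mem_iUnion₂.1 h'
      have := firstTime_le (v := v) hi hi'
      have e1 : firstTime v hit (Finset.Ico N (N + I N)) ω = ⊤ := htop
      rw [e1] at this
      exact WithTop.not_top_le_coe _ this
    obtain ⟨i, hi, h2, h3⟩ := hσspec N ω hne
    have hcl : clock (σ N ω) = v i := by rw [h3]; rfl
    have hmem := hsub ⟨(hv i).1, (hvanti.antitone hi).trans_lt hN⟩
    obtain ⟨g1, g2⟩ := (hdelay N).compare (S := S) (hS := h.lt_horizon) h1 hl0 hl1 w3 w1 hm hne d2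
      (by rw [hcl, d1]; exact h2.2.1) (fun k hmk hk => by
        obtain ⟨a1, a2⟩ := hmem k hmk hk
        rw [hcl]
        refine ⟨?_, a2⟩
        rw [h3, ← Strategy.coe_clock hk]
        exact WithTop.coe_lt_coe.2 a1)
    refine ENNReal.ofReal_le_ofReal ((min_le_left _ _).trans (hU.mono (mem_Ici.2 (le_max_left _ _))
      (mem_Ici.2 (le_max_left _ _)) (max_le_max le_rfl ?_)))
    refine g2.trans_eq ?_
    exact (Schedule.guard_cashAt g1 _).symm) hCη'
  obtain ⟨N, hN⟩ := hcmp.exists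
  refine ⟨R N, hRpos N, hN.trans ?_⟩
  rw [lintegral_add_right _ (measurable_const.indicator (hmissm N _)), two_mul, ← add_assoc]
  refine add_le_add (add_le_add le_rfl ?_) le_rfl
  refine (setLIntegral_le_lintegral _ _).trans ?_
  rw [lintegral_indicator_const (hmissm N _), ← hCη]
  exact mul_le_mul_right (hIN N).le _

end Market

end Liquidation

/-! ### Removing the scaling and the truncation; the second assertion. -/

namespace Liquidation

open Filter Topology

namespace Market

variable {Ω : Type*} [MeasurableSpace Ω] {M : Market Ω} {t : ℝ≥0} {q : State}
  {S : M.Schedule t q}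

/-- The removal of a truncation and of a scaling of the final cash. -/
theorem Schedule.payoff_le_of_scaled (hU : M.HU) (hm : AEMeasurable (S.cashAt S.n) M.prob)
    {m : ℕ} (hm0 : m ≠ 0) {V : ℝ≥0∞} (h : ∀ l : ℝ, 0 < l → l < 1 → ∀ C : ℝ, 0 < C →
      ∫⁻ ω, ENNReal.ofReal (min (M.U (max 0 (l ^ m * S.cashAt S.n ω))) C) ∂M.prob ≤ V) :
    S.payoff ≤ V := by
  have h' : ∀ l : ℝ, 0 < l → l < 1 →
      ∫⁻ ω, ENNReal.ofReal (M.U (max 0 (l ^ m * S.cashAt S.n ω))) ∂M.prob ≤ V := by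
    intro l hl0 hl1
    have hF := lintegral_liminf_le' (μ := M.prob) (u := atTop) (f := fun (C : ℕ) ω => ENNReal.ofReal
      (min (M.U (max 0 (l ^ m * S.cashAt S.n ω))) ((C : ℝ) + 1)))
      (fun C => ((hU.measurable.comp_aemeasurable (hm.const_mul (l ^ m))).min
        aemeasurable_const).ennreal_ofReal)
    refine le_trans (lintegral_mono fun ω => ?_) (hF.trans ?_)
    · refine le_liminf_of_le (by isBoundedDefault) ?_
      filter_upwards [(tendsto_natCast_atTop_atTop (R := ℝ)).eventually_ge_atTop
        (M.U (max 0 (l ^ m * S.cashAt S.n ω)))] with C hC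
      rw [min_eq_left (by linarith)]
    · exact liminf_le_of_le (by isBoundedDefault) fun b hb => by
        obtain ⟨C, hC⟩ := hb.exists
        exact hC.trans (h l hl0 hl1 _ (by positivity))
  refine ENNReal.le_of_forall_lt_one_mul_le fun a ha => ?_
  obtain ⟨a, rfl⟩ : ∃ a' : ℝ≥0, a = a' := ⟨a.toNNReal, (ENNReal.coe_toNNReal ha.ne_top).symm⟩
  have ha1 : (a : ℝ) < 1 := by exact_mod_cast ha
  rcases eq_or_ne a 0 with rfl | ha0
  · simp
  have ha0' : (0 : ℝ) < a := by exact_mod_cast pos_iff_ne_zero.2 ha0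
  have hinv : (0 : ℝ) < (m : ℝ)⁻¹ := inv_pos.2 (by exact_mod_cast Nat.pos_of_ne_zero hm0)
  -- The choice `l = a ^ (1 / m)` makes the factor `l ^ m` equal to `a`, and by concavity the
  -- utility loses at most this factor.
  refine le_trans ?_ (h' ((a : ℝ) ^ (m : ℝ)⁻¹) (Real.rpow_pos_of_pos ha0' _)
    (Real.rpow_lt_one ha0'.le ha1 hinv))
  rw [Real.rpow_inv_natCast_pow ha0'.le hm0, Schedule.payoff, ← lintegral_const_mul' _ _ ENNReal.coe_ne_top]
  refine lintegral_mono fun ω => ?_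
  have hmax : max 0 ((a : ℝ) * S.cashAt S.n ω) = a * max 0 (S.cashAt S.n ω) := by
    rw [mul_max_of_nonneg _ _ ha0'.le, mul_zero]
  rw [hmax, ← ENNReal.ofReal_coe_nnreal, ← ENNReal.ofReal_mul ha0'.le]
  exact ENNReal.ofReal_le_ofReal (hU.mul_le ⟨ha0'.le, ha1.le⟩ (le_max_left _ _))

/-- Whether a trade is made at `t` is known at `t`, so the positive schedules built on this event
and on its complement can be glued into one. -/
theorem Schedule.Valid.payoff_le_valuePositive_of_cash_neg [IsProbabilityMeasure M.prob]
    (h : S.Valid) (hσ : 0 < M.σ) (hF : M.UsualConditions) (hW : M.IsBrownianMotion)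
    (hf : M.BorelImpact) (h1 : M.H1f) (h2 : M.H2f) (hc : M.Hcf) (hU : M.HU) (htT : t < M.T)
    (hq : q ∈ M.domain) (hL : 0 < M.liq q) (hx : q.cash < 0) (hlagT : q.lag < M.T) {r : ℝ≥0}
    (hrT : r < M.T) (hr : ∀ k ω, S.ρ k ω ≠ ⊤ → S.ρ k ω ≤ (r : WithTop ℝ≥0)) :
    S.payoff ≤ M.valuePositive t q := by
  obtain ⟨B, hB⟩ := exists_contVersion hF hW
  have hlag0 : 0 < q.lag := by
    refine hq.2.2.1.lt_of_ne fun h0 => ?_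
    rw [liq_of_lag_zero h2 hq.1 h0.symm] at hL
    linarith
  have hcash := h.aemeasurable_cashAt hq hf htT.le hB S.n
  refine Schedule.payoff_le_of_scaled hU hcash (m := 2 * S.n + 2) (by omega)
    fun l hl0 hl1 C hC => ?_
  set A : Set Ω := ⋃ k, {ω | S.ρ k ω ≤ (t : WithTop ℝ≥0)} with hA
  have hAm : MeasurableSet[M.F t] A := MeasurableSet.iUnion fun k => S.stopping k t
  have hAm' : MeasurableSet A := M.F.le t _ hAm
  refine ENNReal.le_of_forall_pos_le_add fun η hη _ => ?_
  have hη' : (0 : ℝ) < η := by exact_mod_cast hη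
  -- Two error terms come from the first construction and five from the second, each equal to `C`
  -- times this number.
  have hη₁ : (0 : ℝ) < η / (7 * C) := by positivity
  obtain ⟨R, hR, hR'⟩ := h.exists_positive_of_initial_trade hF hB hσ hf h1 hc hU hq hL hx hlag0
    hlagT htT hAm' (fun ω hω => mem_iUnion.1 hω) hl0 hl1 hC hη₁
  obtain ⟨R₂, hR₂, hR₂'⟩ := h.exists_positive_of_no_initial_trade hB hσ hf h1 hc hU hq hL hx hlag0
    hlagT htT hrT hr hAm.compl (fun ω hω k hk => hω (mem_iUnion.2 ⟨k, hk⟩)) hl0 hl1 hC hη₁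
  have hmerge := (hR.merge hR₂ (hA := hAm)).payoff_le_valuePositive h1 hU hq htT
  rw [Schedule.payoff_merge] at hmerge
  rw [← lintegral_add_compl _ hAm']
  have hfin : 2 * ENNReal.ofReal (C * (η / (7 * C))) + 5 * ENNReal.ofReal (C * (η / (7 * C))) =
      (η : ℝ≥0∞) := by
    rw [← add_mul, show (2 : ℝ≥0∞) + 5 = ENNReal.ofReal 7 by norm_num,
      ← ENNReal.ofReal_mul (by norm_num), ← ENNReal.ofReal_coe_nnreal]
    congr 1
    field_simp
  calc _ ≤ _ := add_le_add hR' hR₂'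
    _ = _ := add_add_add_comm _ _ _ _
    _ ≤ _ := add_le_add hmerge hfin.le

/-- The truncations used for the first assertion are valid schedules that stop trading before some
`r < T`; it is enough to dominate these, according to the sign of the initial cash. -/
theorem value_eq_valuePositive [IsProbabilityMeasure M.prob] (hσ : 0 < M.σ)
    (hF : M.UsualConditions) (hW : M.IsBrownianMotion) (hf : M.BorelImpact)
    (h1 : M.H1f) (h2 : M.H2f) (h3 : M.H3f) (hc : M.Hcf) (hU : M.HU)
    (hfpos : ∀ e < 0, ∀ θ ∈ Ioc (0 : ℝ) M.T, 0 < M.f e θ) (htT : t < M.T) (hlagT : q.lag < M.T)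
    (hq : q ∈ M.closedRegion \ M.boundaryL) : M.value t q = M.valuePositive t q := by
  obtain ⟨hq1, hq2⟩ := (M.mem_closedRegion_iff q).1 hq.1
  have hL : 0 < M.liq q := hq2.lt_of_ne fun h0 => hq.2 ⟨hq1, h0.symm⟩
  refine le_antisymm (iSup₂_le fun α hα => ?_)
    (iSup₂_le fun α hα => le_iSup₂_of_le α hα.1.1 le_rfl)
  refine (hα.expectedUtility_le hF hW hf h1 h2 h3 hc hU htT hq.1).trans (iSup₂_le fun S hS => ?_)
  obtain ⟨hS1, r, hrT, hr⟩ := hS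
  rcases le_or_gt 0 q.cash with hx | hx
  · exact hS1.payoff_le_valuePositive_of_cash_nonneg h1 h2 hU hq1 htT hL hx hfpos
  · exact hS1.payoff_le_valuePositive_of_cash_neg hσ hF hW hf h1 h2 hc hU htT hq1 hL hx hlagT hrT hr

end Market

end Liquidation

end

/-! ### The theorem. -/

theorem theorem3p1 {Ω : Type*} [MeasurableSpace Ω] (M : Liquidation.Market Ω)
    [IsProbabilityMeasure M.prob] (hσ : 0 < M.σ)
    (hF : M.UsualConditions) (hW : M.IsBrownianMotion) (hf : M.BorelImpact)
    (h1 : M.H1f) (h2 : M.H2f) (h3 : M.H3f) (hc : M.Hcf) (hU : M.HU) :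
    (∀ (t : ℝ≥0) (q : Liquidation.State), t < M.T → q ∈ M.closedRegion →
      M.value t q = M.valueFinite t q) ∧
    ((∀ e < 0, ∀ θ ∈ Ioc (0 : ℝ) M.T, 0 < M.f e θ) →
      ∀ (t : ℝ≥0) (q : Liquidation.State), t < M.T → q.lag < M.T →
        q ∈ M.closedRegion \ M.boundaryL →
        M.value t q = M.valuePositive t q) :=
  ⟨fun _ _ htT hq => Liquidation.Market.value_eq_valueFinite hF hW hf h1 h2 h3 hc hU htT hq,
    fun hfpos _ _ htT hlagT hq =>
      Liquidation.Market.value_eq_valuePositive hσ hF hW hf h1 h2 h3 hc hU hfpos htT hlagT hq⟩
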